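/- **Setting.** Let $E,F$ be finite-dimensional real normed spaces and let $E\otimes E$ carry a norm with $|x\otimes y|=|x||y|$. For $A$ defined on $\{0\le s\le t\le T\}$ with values in a normed space, $\alpha>0$ and $0<p,q\le\infty$, put $$\|A\|_{B^\alpha_{p,q}}=\Big(\int_0^T\Big(\frac{1}{t^{\alpha}}\sup_{0<h\le t}\Big(\int_0^{T-h}|A_{s,s+h}|^p\,ds\Big)^{1/p}\Big)^q\frac{dt}{t}\Big)^{1/q}$$ (usual modifications if $p=\infty$ or $q=\infty$); for a path $f$ use $A_{s,t}=f_t-f_s$. A *Besov rough path* on $[0,T]$ with parameters $\alpha,p,q$ is a pair $\mathbf X=(X,\mathbb X)$ of continuous maps $(s,t)\mapsto X_{s,t}\in E$, $\mathbb X_{s,t}\in E\otimes E$ on $\{0\le s\le t\le T\}$ with $X_{s,t}=X_{s,u}+X_{u,t}$, $\mathbb X_{s,t}=\mathbb X_{s,u}+\mathbb X_{u,t}+X_{s,u}\otimes X_{u,t}$ for $s\le u\le t$, and $\|X\|_{B^\alpha_{p,q}}<\infty$, $\|\mathbb X\|_{B^{2\alpha}_{p/2,q/2}}<\infty$. Put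 $|||\mathbf X|||_{B^\alpha_{p,q}}=\|X\|_{B^\alpha_{p,q}}+\|\mathbb X\|_{B^{2\alpha}_{p/2,q/2}}^{1/2}$. For $Y:[0,T]\to F$, $Y':[0,T]\to L(E,F)$ let $R^{Y,X}_{s,t}=Y_t-Y_s-Y'_sX_{s,t}$. The pair $(Y,Y')$ is an *$X$-controlled $r$-rough path* if $Y'$ has finite $r$-variation and $R^{Y,X}$ has finite $r/2$-variation; it is *Besov-controlled* if $Y,Y'$ are continuous and $\|Y\|_{B^\alpha_{p,q}},\|Y'\|_{B^\alpha_{p,q}},\|R^{Y,X}\|_{B^{2\alpha}_{p/2,q/2}}$ are finite. It *solves the RDE* $Y_t=y_0+\int_0^t\phi(\mathbf Y)\,d\mathbf X$ on $[0,T]$ if for all $t\in[0,T]$ one has $Y'_t=\phi(Y_t)$ and $Y_t-y_0$ is the limit, along the partitions of $[0,t]$ directed by refinement, of $\sum_i \big(\phi(Y_{u_i})X_{u_i,u_{i+1}}+D\phi(Y_{u_i})Y'_{u_i}\,\mathbb X_{u_i,u_{i+1}}\big)$. **Theorem.** Let $\alpha>\frac13$, $\frac1\alpha<p$, $2\le p\le\infty$,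 $\frac12\le q\le\infty$, and let $\Phi_0,\Phi_{0,1},\Phi_1,\Phi_{1,1},\Phi_2,\Phi_{2,1},\Phi_{DD}\ge0$. There is a constant $C$, depending only on these data and on the normed spaces $E$, $F$, $E\otimes E$, such that for all $T>0$ and $M\ge0$ there is $T_0\in(0,T]$ with the following properties for every $\tau\in(0,T_0]$ and every $\phi\in C^{2,1}_b(F;L(E,F))$ with $\|\phi\|_{\sup}\le\Phi_0$, $\|\phi\|_{\mathrm{Lip}}\le\Phi_{0,1}$, $\|D\phi\|_{\sup}\le\Phi_1$, $\|D\phi\|_{\mathrm{Lip}}\le\Phi_{1,1}$, $\|D^2\phi\|_{\sup}\le\Phi_2$, $\|D^2\phi\|_{\mathrm{Lip}}\le\Phi_{2,1}$, $\|D\phi\cdot\phi\|_{\sup}\le\Phi_{DD}$. 1. For every Besov rough path $\mathbf X$ on $[0,T]$ with parameters $\alpha,p,q$ and $|||\mathbf X|||_{B^\alpha_{p,q}}\le M$ on $[0,T]$, and every $y_0\in F$, the RDE has on $[0,\tau]$ a solution $\mathbf Y=(Y,Y')$ that is Besov-controlled with parameters $\alpha,p,q$ and is an $X$-controlled $r$-rough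 path for every $r\in[2,3)$ with $\frac1\alpha<r\le p$. It is the only solution on $[0,\tau]$ among the Besov-controlled rough paths with parameters $\alpha,p,q$, and the only one among the $X$-controlled $r$-rough paths for any such $r$. 2. If $\mathbf X,\tilde{\mathbf X}$ are two such rough paths, and $\mathbf Y,\tilde{\mathbf Y}$ are the Besov-controlled solutions on $[0,\tau]$ of the RDEs driven by $\mathbf X,\tilde{\mathbf X}$ with initial values $y_0,\tilde y_0$, then, with $\Delta Y=Y-\tilde Y$, $\Delta R^{Y,X}=R^{Y,X}-R^{\tilde Y,\tilde X}$, $\Delta X=X-\tilde X$, $\Delta\mathbb X=\mathbb X-\tilde{\mathbb X}$, $\Delta y_0=y_0-\tilde y_0$ and all norms taken on $[0,\tau]$, $$\|\Delta Y\|_{B^\alpha_{p,q}}\le C\Big((|||\mathbf X|||_{B^\alpha_{p,q}}+|||\tilde{\mathbf X}|||_{B^\alpha_{p,q}})|\Delta y_0|+(1+\|X\|_{B^\alpha_{p,q}}+\|\tilde X\|_{B^\alpha_{p,q}})\|\Delta X\|_{B^\alpha_{p,q}}+\|\Delta\mathbb X\|_{B^{2\alpha}_{p/2,q/2}}\Big),$$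 $$\|\Delta R^{Y,X}\|_{B^{2\alpha}_{p/2,q/2}}\le C\Big((|||\mathbf X|||^2_{B^\alpha_{p,q}}+|||\tilde{\mathbf X}|||^2_{B^\alpha_{p,q}}+\|X\|_{B^\alpha_{p,q}}\|\tilde X\|_{B^\alpha_{p,q}})|\Delta y_0|+(|||\mathbf X|||_{B^\alpha_{p,q}}+|||\tilde{\mathbf X}|||_{B^\alpha_{p,q}})\|\Delta X\|_{B^\alpha_{p,q}}+\|\Delta\mathbb X\|_{B^{2\alpha}_{p/2,q/2}}\Big).$$ -/

import Mathlib

open MeasureTheory Set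
open scoped ENNReal NNReal TensorProduct

noncomputable section

/-- `omegaMod T p A t` is `sup_{0 < h ≤ t} (∫_0^{T-h} |A(s, s+h)|^p ds)^{1/p}`
(essential supremum in `s` if `p = ∞`). -/
def omegaMod {G : Type*} [NormedAddCommGroup G] (T : ℝ) (p : ℝ≥0∞) (A : ℝ → ℝ → G)
    (t : ℝ) : ℝ≥0∞ :=
  ⨆ h ∈ Ioc (0 : ℝ) t, eLpNorm (fun s => A s (s + h)) p (volume.restrict (Ioc 0 (T - h)))

/-- The Besov norm on `[0, T]` of a two-parameter function: the `L^q((0, T], dt / t)`-norm of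
`t ↦ t^{-α} Ω_p(t)`. -/
def besovNorm {G : Type*} [NormedAddCommGroup G] (T α : ℝ) (p q : ℝ≥0∞) (A : ℝ → ℝ → G) :
    ℝ≥0∞ :=
  eLpNorm (fun t => omegaMod T p A t / ENNReal.ofReal (t ^ α)) q
    ((volume.restrict (Ioc 0 T)).withDensity fun t => ENNReal.ofReal t⁻¹)

/-- The increments of a one-parameter path. -/
def incr {G : Type*} [NormedAddCommGroup G] (f : ℝ → G) (s t : ℝ) : G := f t - f s

/-- The `r`-variation on `[0, T]` of a two-parameter function. -/
def rVariation {G : Type*} [NormedAddCommGroup G] (T r : ℝ) (A : ℝ → ℝ → G) : ℝ≥0∞ :=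
  (⨆ (n : ℕ) (u : Fin (n + 1) → ℝ) (_ : StrictMono u) (_ : ∀ i, u i ∈ Icc 0 T),
    ∑ i : Fin n, ‖A (u i.castSucc) (u i.succ)‖ₑ ^ r) ^ (1 / r)

/-- The simplex `{(s, t) : 0 ≤ s ≤ t ≤ T}`. -/
def simplex (T : ℝ) : Set (ℝ × ℝ) := {z | 0 ≤ z.1 ∧ z.1 ≤ z.2 ∧ z.2 ≤ T}

section RoughPaths

variable {E F V : Type*} [NormedAddCommGroup E] [NormedSpace ℝ E]
  [NormedAddCommGroup F] [NormedSpace ℝ F] [NormedAddCommGroup V] [NormedSpace ℝ V]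

/-- The homogeneous norm `‖X‖_{B^α_{p,q}} + ‖𝕏‖_{B^{2α}_{p/2,q/2}}^{1/2}` on `[0, T]`. -/
def roughBesovNorm (T α : ℝ) (p q : ℝ≥0∞) (X : ℝ → ℝ → E) (XX : ℝ → ℝ → V) : ℝ≥0∞ :=
  besovNorm T α p q X + besovNorm T (2 * α) (p / 2) (q / 2) XX ^ (1 / 2 : ℝ)

/-- `(X, XX)` is a (continuous) level-2 Besov rough path on `[0, T]` with parameters `α, p, q`.
The normed space `V` is `E ⊗ E` with the norm that is transported along `ι`. -/
structure IsBesovRoughPath (ι : E ⊗[ℝ] E ≃ₗ[ℝ] V) (T α : ℝ) (p q : ℝ≥0∞)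
    (X : ℝ → ℝ → E) (XX : ℝ → ℝ → V) : Prop where
  additive : ∀ s u t, 0 ≤ s → s ≤ u → u ≤ t → t ≤ T → X s t = X s u + X u t
  chen : ∀ s u t, 0 ≤ s → s ≤ u → u ≤ t → t ≤ T →
    XX s t = XX s u + XX u t + ι (X s u ⊗ₜ[ℝ] X u t)
  continuousOn_fst : ContinuousOn (fun z : ℝ × ℝ => X z.1 z.2) (simplex T)
  continuousOn_snd : ContinuousOn (fun z : ℝ × ℝ => XX z.1 z.2) (simplex T)
  besov_fst : besovNorm T α p q X < ∞
  besov_snd : besovNorm T (2 * α) (p / 2) (q / 2) XX < ∞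

/-- The remainder `R_{s,t} = Y_t - Y_s - Y'_s X_{s,t}`. -/
def remainder (X : ℝ → ℝ → E) (Y : ℝ → F) (Y' : ℝ → E →L[ℝ] F) (s t : ℝ) : F :=
  Y t - Y s - Y' s (X s t)

/-- `(Y, Y')` is an `X`-controlled `r`-rough path on `[0, T]`. -/
def IsControlled (T r : ℝ) (X : ℝ → ℝ → E) (Y : ℝ → F) (Y' : ℝ → E →L[ℝ] F) : Prop :=
  rVariation T r (incr Y') < ∞ ∧ rVariation T (r / 2) (remainder X Y Y') < ∞

/-- `(Y, Y')` is a (continuous) Besov-controlled rough path on `[0, T]` with parameters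
`α, p, q`. -/
structure IsBesovControlled (T α : ℝ) (p q : ℝ≥0∞) (X : ℝ → ℝ → E)
    (Y : ℝ → F) (Y' : ℝ → E →L[ℝ] F) : Prop where
  continuousOn : ContinuousOn Y (Icc 0 T)
  continuousOn_deriv : ContinuousOn Y' (Icc 0 T)
  besov : besovNorm T α p q (incr Y) < ∞
  besov_deriv : besovNorm T α p q (incr Y') < ∞
  besov_remainder : besovNorm T (2 * α) (p / 2) (q / 2) (remainder X Y Y') < ∞

/-- The action on `V = E ⊗ E` of a bilinear map `B`, so that `x ⊗ y` is sent to `B x y`. -/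
def tensorApply (ι : E ⊗[ℝ] E ≃ₗ[ℝ] V) (B : E →L[ℝ] E →L[ℝ] F) (v : V) : F :=
  TensorProduct.lift B.toLinearMap₁₂ (ι.symm v)

/-- `z` is the limit of the Riemann sums `∑ A(u_i, u_{i+1})` along the net of all partitions of
`[s, t]`, directed by refinement. -/
def IsPartitionLimit (A : ℝ → ℝ → F) (s t : ℝ) (z : F) : Prop :=
  ∀ ε > 0, ∃ P₀ : Finset ℝ, (P₀ : Set ℝ) ⊆ Icc s t ∧
    ∀ (n : ℕ) (u : Fin (n + 1) → ℝ), StrictMono u → u 0 = s → u (Fin.last n) = t →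
      (P₀ : Set ℝ) ⊆ range u →
      ‖∑ i : Fin n, A (u i.castSucc) (u i.succ) - z‖ < ε

/-- `z = ∫_s^t (A, A') d(X, XX)`: the rough integral of a controlled path `(A, A')`, that is, the
sewing of `A_u X_{u,v} + A'_u XX_{u,v}`. -/
def IsRoughIntegral (ι : E ⊗[ℝ] E ≃ₗ[ℝ] V) (X : ℝ → ℝ → E) (XX : ℝ → ℝ → V)
    (A : ℝ → E →L[ℝ] F) (A' : ℝ → E →L[ℝ] E →L[ℝ] F) (s t : ℝ) (z : F) : Prop :=
  IsPartitionLimit (fun u v => A u (X u v) + tensorApply ι (A' u) (XX u v)) s t z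

/-- `(Y, Y')` satisfies `Y_t = y₀ + ∫_0^t φ(Y, Y') d(X, XX)` and `Y'_t = φ(Y_t)` for all
`t ∈ [0, T]`, where `φ(Y, Y') = (φ(Y), Dφ(Y) Y')`. -/
def SolvesRDE (ι : E ⊗[ℝ] E ≃ₗ[ℝ] V) (φ : F → E →L[ℝ] F) (T : ℝ) (X : ℝ → ℝ → E)
    (XX : ℝ → ℝ → V) (y₀ : F) (Y : ℝ → F) (Y' : ℝ → E →L[ℝ] F) : Prop :=
  ∀ t ∈ Icc 0 T, Y' t = φ (Y t) ∧
    IsRoughIntegral ι X XX (fun s => φ (Y s)) (fun s => (fderiv ℝ φ (Y s)).comp (Y' s)) 0 t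
      (Y t - y₀)

/-- `φ ∈ C^{2,1}_b` with explicit bounds on `φ`, its derivatives, their Lipschitz constants, and
on `Dφ · φ`. -/
structure BoundedC21 (φ : F → E →L[ℝ] F) (Φ₀ Φ₀₁ Φ₁ Φ₁₁ Φ₂ Φ₂₁ ΦDD : ℝ≥0) : Prop where
  contDiff : ContDiff ℝ 2 φ
  bound : ∀ y, ‖φ y‖ ≤ Φ₀
  lipschitz : LipschitzWith Φ₀₁ φ
  bound_deriv : ∀ y, ‖fderiv ℝ φ y‖ ≤ Φ₁
  lipschitz_deriv : LipschitzWith Φ₁₁ (fderiv ℝ φ)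
  bound_deriv2 : ∀ y, ‖iteratedFDeriv ℝ 2 φ y‖ ≤ Φ₂
  lipschitz_deriv2 : LipschitzWith Φ₂₁ (iteratedFDeriv ℝ 2 φ)
  bound_deriv_mul : ∀ y, ‖(fderiv ℝ φ y).comp (φ y)‖ ≤ ΦDD

end RoughPaths

end

/-! The argument separates pathwise estimates from function space estimates. Fix `r < 3` with `1 / α
< r < p`.

Function spaces. A function `A` of finite Besov norm that is additive up to a controlled defect is
bounded pointwise by `ω ^ (1 / r)`, up to constants and the defect, where `ω` is superadditive and
`ω ^ (1 / r)` again has Besov norm at most a multiple of that of `A`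
(`exists_control_of_besovNorm`). For finite `p` one takes `ω(s,t) = (t - s)^(1 - r/p) I(s,t)^(r/p)`,
where `I(s,t)` integrates `|A(u,v)|^p (v - u)^(-1 - p/r)` over `s < u < v ≤ t` with `v - u ≤ τ/2`.
This is an embedding of Garsia-Rodemich-Rumsey type. The pointwise bound comes from chaining
averages of `|A|` over dyadic intervals (`ChainBound.le`). The Besov size comes from comparison with
a regularity `γ` strictly between `1/r` and `α` and a Hardy type inequality over dyadic scales
(`exists_eLpNorm_scaleSup_le`). The total mass obeys `ω(0,τ)^(1/r) ≤ C τ^(α - 1/p) ‖A‖`, so a short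
time makes everything small.

Pathwise estimates. For a rough path controlled by `ω`, a solution is characterised by Davie's
estimate: the error `J(s,t)` of one second order Euler step is at most a multiple of `ω(s,t)^(3/r)`.
By Chen's relation the defect of `J` is at most a multiple of `ω^(3/r) + ω^(1/r) |J|`; since `3/r >
1`, sewing applies, and the last term is absorbed when `ω` is small. This gives the estimate for
Euler schemes, hence existence by compactness (`IsRoughOn.exists_pathRem_le`), and for every
solution whose remainder has finite variation (`IsRoughOn.norm_pathRem_le_of_limit`). The same
sewing applied to the difference of two local errors gives stability
(`IsRoughOn.norm_pathRem_sub_le`, `IsRoughOn.norm_sub_le_of_pathRem`), and uniqueness is stability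
with equal data, iterated over short intervals.

Transfer. Every pathwise bound is a sum of products of powers of controls. Taking Besov norms, with
Cauchy-Schwarz in both integrations for products (`besovNorm_mul_le`), shows that the solution is
Besov-controlled and yields the two Lipschitz estimates (`exists_besovNorm_sub_le`). Terms that
carry superfluous factors are removed with `τ^(α - 1/p) N ≤ 1`, where `N` is the size of the rough
paths. Hence `C` does not depend on the bound `M`; only `T₀` does. -/

/-! ### Controls and operations that preserve superadditivity. -/

/-- A superadditive nonnegative function of the subintervals of `[a, b]`. -/
structure IsControl (a b : ℝ) (ω : ℝ → ℝ → ℝ) : Prop where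
  nonneg : ∀ s t, a ≤ s → s ≤ t → t ≤ b → 0 ≤ ω s t
  add_le : ∀ s u t, a ≤ s → s ≤ u → u ≤ t → t ≤ b → ω s u + ω u t ≤ ω s t

namespace IsControl

variable {a b : ℝ} {ω ω₁ ω₂ : ℝ → ℝ → ℝ}

lemma diag (h : IsControl a b ω) {s : ℝ} (h1 : a ≤ s) (h2 : s ≤ b) : ω s s = 0 := by
  have := h.add_le s s s h1 le_rfl le_rfl h2
  have := h.nonneg s s h1 le_rfl h2
  linarith

lemma mono (h : IsControl a b ω) {s s' t' t : ℝ} (h1 : a ≤ s) (h2 : s ≤ s') (h3 : s' ≤ t')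
    (h4 : t' ≤ t) (h5 : t ≤ b) : ω s' t' ≤ ω s t := by
  have e1 := h.add_le s s' t h1 h2 (h3.trans h4) h5
  have e2 := h.add_le s' t' t (h1.trans h2) h3 h4 h5
  have e3 := h.nonneg s s' h1 h2 ((h3.trans h4).trans h5)
  have e4 := h.nonneg t' t (h1.trans (h2.trans h3)) h4 h5
  linarith

lemma restrict (h : IsControl a b ω) {a' b' : ℝ} (ha : a ≤ a') (hb : b' ≤ b) :
    IsControl a' b' ω :=
  ⟨fun s t h1 h2 h3 => h.nonneg s t (ha.trans h1) h2 (h3.trans hb),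
    fun s u t h1 h2 h3 h4 => h.add_le s u t (ha.trans h1) h2 h3 (h4.trans hb)⟩

lemma add (h₁ : IsControl a b ω₁) (h₂ : IsControl a b ω₂) :
    IsControl a b (fun s t => ω₁ s t + ω₂ s t) :=
  ⟨fun s t h1 h2 h3 => add_nonneg (h₁.nonneg s t h1 h2 h3) (h₂.nonneg s t h1 h2 h3),
    fun s u t h1 h2 h3 h4 => by
      have := h₁.add_le s u t h1 h2 h3 h4
      have := h₂.add_le s u t h1 h2 h3 h4
      linarith⟩

lemma const_mul (h : IsControl a b ω) {c : ℝ} (hc : 0 ≤ c) :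
    IsControl a b (fun s t => c * ω s t) :=
  ⟨fun s t h1 h2 h3 => mul_nonneg hc (h.nonneg s t h1 h2 h3),
    fun s u t h1 h2 h3 h4 => by
      have := mul_le_mul_of_nonneg_left (h.add_le s u t h1 h2 h3 h4) hc
      linarith⟩

lemma rpow (h : IsControl a b ω) {θ : ℝ} (hθ : 1 ≤ θ) :
    IsControl a b (fun s t => ω s t ^ θ) :=
  ⟨fun s t h1 h2 h3 => Real.rpow_nonneg (h.nonneg s t h1 h2 h3) _,
    fun s u t h1 h2 h3 h4 => by
      have e1 := h.nonneg s u h1 h2 (h3.trans h4)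
      have e2 := h.nonneg u t (h1.trans h2) h3 h4
      exact (Real.add_rpow_le_rpow_add e1 e2 hθ).trans
        (Real.rpow_le_rpow (add_nonneg e1 e2) (h.add_le s u t h1 h2 h3 h4) (by linarith))⟩

end IsControl

/-- Hölder's inequality for sums of two terms: after division by the totals, each term is estimated
by the weighted inequality of arithmetic and geometric means. It makes weighted geometric means of
controls superadditive. -/
lemma rpow_mul_rpow_add_le {x₁ x₂ y₁ y₂ : ℝ} (hx₁ : 0 ≤ x₁) (hx₂ : 0 ≤ x₂) (hy₁ : 0 ≤ y₁)
    (hy₂ : 0 ≤ y₂) {μ ν : ℝ} (hμ : 0 ≤ μ) (hν : 0 ≤ ν) (h : μ + ν = 1) :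
    x₁ ^ μ * y₁ ^ ν + x₂ ^ μ * y₂ ^ ν ≤ (x₁ + x₂) ^ μ * (y₁ + y₂) ^ ν := by
  rcases hμ.eq_or_lt with rfl | hμ
  · have : ν = 1 := by linarith
    subst this; simp
  rcases hν.eq_or_lt with rfl | hν
  · have : μ = 1 := by linarith
    subst this; simp
  rcases (add_nonneg hx₁ hx₂).eq_or_lt with hx | hx
  · have h1 : x₁ = 0 := by linarith
    have h2 : x₂ = 0 := by linarith
    simp [h1, h2, Real.zero_rpow hμ.ne']
  rcases (add_nonneg hy₁ hy₂).eq_or_lt with hy | hy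
  · have h1 : y₁ = 0 := by linarith
    have h2 : y₂ = 0 := by linarith
    simp [h1, h2, Real.zero_rpow hν.ne']
  have key : ∀ x y : ℝ, 0 ≤ x → 0 ≤ y → x ^ μ * y ^ ν ≤
      (x₁ + x₂) ^ μ * (y₁ + y₂) ^ ν * (μ * (x / (x₁ + x₂)) + ν * (y / (y₁ + y₂))) := by
    intro x y h1 h2
    have := Real.geom_mean_le_arith_mean2_weighted hμ.le hν.le (div_nonneg h1 hx.le)
      (div_nonneg h2 hy.le) h
    rw [Real.div_rpow h1 hx.le, Real.div_rpow h2 hy.le] at this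
    have p1 : 0 < (x₁ + x₂) ^ μ := Real.rpow_pos_of_pos hx _
    have p2 : 0 < (y₁ + y₂) ^ ν := Real.rpow_pos_of_pos hy _
    calc x ^ μ * y ^ ν = (x₁ + x₂) ^ μ * (y₁ + y₂) ^ ν *
          (x ^ μ / (x₁ + x₂) ^ μ * (y ^ ν / (y₁ + y₂) ^ ν)) := by field_simp
      _ ≤ _ := by gcongr
  have k1 := key x₁ y₁ hx₁ hy₁
  have k2 := key x₂ y₂ hx₂ hy₂
  refine (add_le_add k1 k2).trans (le_of_eq ?_)
  rw [← mul_add]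
  have : μ * (x₁ / (x₁ + x₂)) + ν * (y₁ / (y₁ + y₂)) +
      (μ * (x₂ / (x₁ + x₂)) + ν * (y₂ / (y₁ + y₂))) = μ + ν := by field_simp; ring
  rw [this, h, mul_one]

lemma IsControl.rpow_mul_rpow {a b : ℝ} {ω₁ ω₂ : ℝ → ℝ → ℝ} (h₁ : IsControl a b ω₁)
    (h₂ : IsControl a b ω₂) {μ ν : ℝ} (hμ : 0 ≤ μ) (hν : 0 ≤ ν) (h : μ + ν = 1) :
    IsControl a b (fun s t => ω₁ s t ^ μ * ω₂ s t ^ ν) :=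
  ⟨fun s t h1 h2 h3 => mul_nonneg (Real.rpow_nonneg (h₁.nonneg s t h1 h2 h3) _)
      (Real.rpow_nonneg (h₂.nonneg s t h1 h2 h3) _),
    fun s u t h1 h2 h3 h4 => by
      have e1 := h₁.nonneg s u h1 h2 (h3.trans h4)
      have e2 := h₁.nonneg u t (h1.trans h2) h3 h4
      have e3 := h₂.nonneg s u h1 h2 (h3.trans h4)
      have e4 := h₂.nonneg u t (h1.trans h2) h3 h4
      refine (rpow_mul_rpow_add_le e1 e2 e3 e4 hμ hν h).trans ?_
      exact mul_le_mul (Real.rpow_le_rpow (add_nonneg e1 e2) (h₁.add_le s u t h1 h2 h3 h4) hμ)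
        (Real.rpow_le_rpow (add_nonneg e3 e4) (h₂.add_le s u t h1 h2 h3 h4) hν)
        (Real.rpow_nonneg (add_nonneg e3 e4) _)
        (Real.rpow_nonneg (h₁.nonneg s t h1 (h2.trans h3) h4) _)⟩

/-! ### Sewing: discrete, along partitions, and with absorption. -/

/-- The constant in the sewing lemma with exponent `θ > 1`. -/
noncomputable def sewConst (θ : ℝ) : ℝ := 2 / (1 - 2 ^ (1 - θ))

lemma two_rpow_lt_one {θ : ℝ} (hθ : 1 < θ) : (2 : ℝ) ^ (1 - θ) < 1 :=
  Real.rpow_lt_one_of_one_lt_of_neg one_lt_two (by linarith)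

lemma sewConst_pos {θ : ℝ} (hθ : 1 < θ) : 0 < sewConst θ :=
  div_pos two_pos (sub_pos.2 (two_rpow_lt_one hθ))

/-- A discrete sewing lemma, in which the bound on the defect may use the bound on `I i j` that
is to be proved. -/
theorem discrete_sewing {G : Type*} [SeminormedAddCommGroup G] (I : ℕ → ℕ → G) (w : ℕ → ℕ → ℝ)
    {θ L B : ℝ} (hθ : 1 < θ) (hL : 0 ≤ L) (hw : ∀ i j, i ≤ j → 0 ≤ w i j)
    (hadd : ∀ i j k, i ≤ j → j ≤ k → w i j + w j k ≤ w i k)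
    (h0 : ∀ i, ‖I i i‖ = 0) (h1 : ∀ i, ‖I i (i + 1)‖ = 0)
    (h : ∀ i j k, i ≤ j → j ≤ k → ‖I i j‖ ≤ L * w i j ^ θ →
      ‖I i k - I i j - I j k‖ ≤ B * w i k ^ θ)
    (hB : sewConst θ * B ≤ L) (i k : ℕ) (hik : i ≤ k) : ‖I i k‖ ≤ L * w i k ^ θ := by
  have hd : ∀ i, w i i = 0 := fun i => by
    have e1 := hadd i i i le_rfl le_rfl
    have e2 := hw i i le_rfl
    linarith
  have hmono : ∀ i j k l, i ≤ j → j ≤ k → k ≤ l → w j k ≤ w i l := fun i j k l h1 h2 h3 => by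
    have e1 := hadd i j l h1 (h2.trans h3)
    have e2 := hadd j k l h2 h3
    have e3 := hw i j h1
    have e4 := hw k l h3
    linarith
  have hq : 0 < 1 - (2 : ℝ) ^ (1 - θ) := sub_pos.2 (two_rpow_lt_one hθ)
  -- The recursion closes exactly here: two defects cost `2 * B`, and the two halves return the
  -- fraction `2 ^ (1 - θ)` of `L`.
  have hB' : 2 * B ≤ L * (1 - 2 ^ (1 - θ)) := by
    have : sewConst θ * B * (1 - 2 ^ (1 - θ)) = 2 * B := by
      unfold sewConst; field_simp
    rw [← this]
    exact mul_le_mul_of_nonneg_right hB hq.le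
  induction hn : k - i using Nat.strong_induction_on generalizing i k with
  | _ n ih =>
  rcases hik.eq_or_lt with rfl | hlt
  · rw [h0]; exact mul_nonneg hL (Real.rpow_nonneg (hw _ _ le_rfl) _)
  -- Take the largest `j` for which the left part carries at most half of the weight. By
  -- superadditivity the part after `j + 1` then carries at most half as well, and the step from `j`
  -- to `j + 1` in between costs nothing by `h1`.
  have hex : ∃ j, i ≤ j ∧ j < k ∧ w i j ≤ w i k / 2 ∧ w (j + 1) k ≤ w i k / 2 := by
    have hne : ((Finset.Ico i k).filter fun j => w i j ≤ w i k / 2).Nonempty :=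
      ⟨i, by simp [hlt, hd]; linarith [hw i k hik]⟩
    obtain ⟨j, hj, hmax⟩ := Finset.exists_max_image _ id hne
    simp only [Finset.mem_filter, Finset.mem_Ico, id] at hj hmax
    refine ⟨j, hj.1.1, hj.1.2, hj.2, ?_⟩
    rcases (Nat.succ_le_of_lt hj.1.2).eq_or_lt with hjk | hjk
    · rw [Nat.succ_eq_add_one] at hjk
      rw [hjk, hd]; linarith [hw i k hik]
    · by_contra hcon
      push Not at hcon
      have e1 := hadd i (j + 1) k (by omega) (by omega)
      have := hmax (j + 1) ⟨⟨by omega, hjk⟩, by linarith⟩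
      omega
  obtain ⟨j, hij, hjk, hw1, hw2⟩ := hex
  have b1 : ‖I i j‖ ≤ L * w i j ^ θ := ih (j - i) (by omega) i j hij rfl
  have b2 : ‖I (j + 1) k‖ ≤ L * w (j + 1) k ^ θ := ih (k - (j + 1)) (by omega) _ _ (by omega) rfl
  have d1 := h i j k hij hjk.le b1
  have d2 := h j (j + 1) k (by omega) (by omega)
    (by rw [h1]; exact mul_nonneg hL (Real.rpow_nonneg (hw _ _ (by omega)) _))
  have hwik := hw i k hik
  have d2' : B * w j k ^ θ ≤ B * w i k ^ θ := by
    have hB0 : 0 ≤ B ∨ B < 0 := le_or_gt 0 B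
    rcases hB0 with hB0 | hB0
    · exact mul_le_mul_of_nonneg_left (Real.rpow_le_rpow (hw _ _ hjk.le)
        (hmono i j k k hij hjk.le le_rfl) (by linarith)) hB0
    · have p1 : 0 ≤ B * w i k ^ θ := (norm_nonneg _).trans d1
      exact (mul_nonpos_of_nonpos_of_nonneg hB0.le (Real.rpow_nonneg (hw _ _ hjk.le) _)).trans p1
  have e1 : w i j ^ θ ≤ (w i k / 2) ^ θ := Real.rpow_le_rpow (hw _ _ hij) hw1 (by linarith)
  have e2 : w (j + 1) k ^ θ ≤ (w i k / 2) ^ θ :=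
    Real.rpow_le_rpow (hw _ _ (by omega)) hw2 (by linarith)
  have e3 : 2 * (w i k / 2) ^ θ = 2 ^ (1 - θ) * w i k ^ θ := by
    rw [Real.div_rpow hwik two_pos.le, Real.rpow_sub two_pos, Real.rpow_one]; ring
  have eqn : I i k = (I i k - I i j - I j k) + (I j k - I j (j + 1) - I (j + 1) k) + I i j
      + I j (j + 1) + I (j + 1) k := by abel
  calc ‖I i k‖ = ‖(I i k - I i j - I j k) + (I j k - I j (j + 1) - I (j + 1) k) + I i j
      + I j (j + 1) + I (j + 1) k‖ := by rw [← eqn]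
    _ ≤ ‖I i k - I i j - I j k‖ + ‖I j k - I j (j + 1) - I (j + 1) k‖ + ‖I i j‖
      + ‖I j (j + 1)‖ + ‖I (j + 1) k‖ := by
        refine (norm_add_le _ _).trans (add_le_add_left ((norm_add_le _ _).trans (add_le_add_left
          ((norm_add_le _ _).trans (add_le_add_left (norm_add_le _ _) _)) _)) _)
    _ ≤ B * w i k ^ θ + B * w i k ^ θ + L * (w i k / 2) ^ θ + 0 + L * (w i k / 2) ^ θ := by
        have := mul_le_mul_of_nonneg_left e1 hL
        have := mul_le_mul_of_nonneg_left e2 hL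
        rw [h1]; linarith
    _ = (2 * B) * w i k ^ θ + L * (2 * (w i k / 2) ^ θ) := by ring
    _ ≤ (L * (1 - 2 ^ (1 - θ))) * w i k ^ θ + L * (2 * (w i k / 2) ^ θ) := by
        gcongr
    _ = L * w i k ^ θ := by rw [e3]; ring

/-- `u` runs monotonically from `s` to `t` in `n` steps, and stays at `t`. -/
structure IsPart (s t : ℝ) (n : ℕ) (u : ℕ → ℝ) : Prop where
  mono : Monotone u
  zero : u 0 = s
  eq_of_le : ∀ k, n ≤ k → u k = t

lemma IsPart.mem {s t : ℝ} {n : ℕ} {u : ℕ → ℝ} (h : IsPart s t n u) (k : ℕ) : u k ∈ Icc s t := by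
  constructor
  · rw [← h.zero]; exact h.mono (Nat.zero_le k)
  · rw [← h.eq_of_le (max n k) (le_max_left _ _)]; exact h.mono (le_max_right _ _)

/-- Subtracting the Riemann sum between two partition points from `A` does not change the defect and
gives a function that vanishes on consecutive points, so `discrete_sewing` applies to the indices of
the partition. -/
theorem young_sewing {G : Type*} [SeminormedAddCommGroup G] {a b : ℝ} (A : ℝ → ℝ → G)
    {ω : ℝ → ℝ → ℝ} (hω : IsControl a b ω) {θ B : ℝ} (hθ : 1 < θ) (hB : 0 ≤ B)
    (hA : ∀ s u t, a ≤ s → s ≤ u → u ≤ t → t ≤ b → ‖A s t - A s u - A u t‖ ≤ B * ω s t ^ θ)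
    {s t : ℝ} (has : a ≤ s) (htb : t ≤ b) {n : ℕ} {u : ℕ → ℝ} (hu : IsPart s t n u) :
    ‖A s t - ∑ k ∈ Finset.range n, A (u k) (u (k + 1))‖ ≤ sewConst θ * B * ω s t ^ θ := by
  have hmem : ∀ k, a ≤ u k ∧ u k ≤ b := fun k =>
    ⟨has.trans (hu.mem k).1, (hu.mem k).2.trans htb⟩
  -- At three equal points the defect of `A` is `-A`, so the bound on it forces `A` to vanish on the
  -- diagonal.
  have hdiag : ∀ k, ‖A (u k) (u k)‖ = 0 := fun k => by
    have := hA (u k) (u k) (u k) (hmem k).1 le_rfl le_rfl (hmem k).2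
    rw [hω.diag (hmem k).1 (hmem k).2, Real.zero_rpow (by linarith), mul_zero] at this
    simp only [sub_self, zero_sub, norm_neg] at this
    exact le_antisymm this (norm_nonneg _)
  have := discrete_sewing (fun i j => A (u i) (u j) - ∑ k ∈ Finset.Ico i j, A (u k) (u (k + 1)))
    (fun i j => ω (u i) (u j)) (θ := θ) (L := sewConst θ * B) (B := B) hθ
    (mul_nonneg (sewConst_pos hθ).le hB)
    (fun i j hij => hω.nonneg _ _ (hmem i).1 (hu.mono hij) (hmem j).2)
    (fun i j k hij hjk => hω.add_le _ _ _ (hmem i).1 (hu.mono hij) (hu.mono hjk) (hmem k).2)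
    (fun i => by simpa using hdiag i) (fun i => by simp)
    (fun i j k hij hjk _ => by
      have e : ∑ l ∈ Finset.Ico i k, A (u l) (u (l + 1)) =
          ∑ l ∈ Finset.Ico i j, A (u l) (u (l + 1)) + ∑ l ∈ Finset.Ico j k, A (u l) (u (l + 1)) :=
        (Finset.sum_Ico_consecutive _ hij hjk).symm
      have := hA (u i) (u j) (u k) (hmem i).1 (hu.mono hij) (hu.mono hjk) (hmem k).2
      rw [e]
      convert this using 2
      abel) le_rfl 0 n (Nat.zero_le n)
  rw [Finset.range_eq_Ico]
  simpa only [hu.zero, hu.eq_of_le n le_rfl] using this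

/-- If a bound `f ≤ K g` always improves to `f ≤ (c + K / 2) g`, then `f ≤ 2 c g`. -/
lemma le_two_mul_of_forall_improve {ι : Type*} (f g : ι → ℝ) {c K₀ : ℝ} (hc : 0 ≤ c)
    (hK₀ : 0 ≤ K₀) (hg : ∀ i, 0 ≤ g i) (h₀ : ∀ i, f i ≤ K₀ * g i)
    (h : ∀ K, 0 ≤ K → (∀ i, f i ≤ K * g i) → ∀ i, f i ≤ (c + K / 2) * g i) (i : ι) :
    f i ≤ 2 * c * g i := by
  have key : ∀ n : ℕ, ∀ i, f i ≤ (2 * c + K₀ * (1 / 2) ^ n) * g i := by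
    intro n
    induction n with
    | zero =>
      intro i
      refine (h₀ i).trans (mul_le_mul_of_nonneg_right ?_ (hg i))
      linarith [pow_zero (1 / 2 : ℝ)]
    | succ n ih =>
      intro i
      refine (h _ (by positivity) ih i).trans (le_of_eq ?_)
      rw [pow_succ]; ring
  have lim : Filter.Tendsto (fun n : ℕ => (2 * c + K₀ * (1 / 2) ^ n) * g i) Filter.atTop
      (nhds ((2 * c + K₀ * 0) * g i)) :=
    ((tendsto_pow_atTop_nhds_zero_of_lt_one (by norm_num) (by norm_num)).const_mul K₀
      |>.const_add _ |>.mul_const _)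
  have := ge_of_tendsto' lim fun n => key n i
  simpa using this

/-- Sewing with absorption: the defect of `I` may be bounded by a small multiple of `I`. -/
theorem sewing_absorb {G : Type*} [SeminormedAddCommGroup G] {a b : ℝ} (I : ℝ → ℝ → G)
    {c c' : ℝ → ℝ → ℝ} (hc : IsControl a b c) (hc' : IsControl a b c') {θ B b₀ K₀ : ℝ}
    (hθ : 1 < θ) (hB : 0 ≤ B) (hb₀ : 0 ≤ b₀) (hK₀ : 0 ≤ K₀)
    (crude : ∀ s t, a ≤ s → s ≤ t → t ≤ b → ‖I s t‖ ≤ K₀ * c' s t ^ θ)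
    (hI : ∀ s u t, a ≤ s → s ≤ u → u ≤ t → t ≤ b →
      ‖I s t - I s u - I u t‖ ≤ B * c s t ^ θ + b₀ * ‖I s u‖)
    (hb : sewConst θ * b₀ ≤ 1 / 2)
    (vanish : ∀ s t, a ≤ s → s ≤ t → t ≤ b → ∀ ε > 0, ∃ n u, IsPart s t n u ∧
      ‖∑ k ∈ Finset.range n, I (u k) (u (k + 1))‖ ≤ ε)
    {s t : ℝ} (has : a ≤ s) (hst : s ≤ t) (htb : t ≤ b) :
    ‖I s t‖ ≤ 2 * (sewConst θ * B) * c s t ^ θ := by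
  have hθ0 : 0 < θ := by linarith
  -- The crude control `c'` is added to `c` with a small weight `η`. This provides some finite
  -- constant with which the iteration can start; the bound it converges to does not remember that
  -- constant, and `η → 0` then removes `c'`.
  have main : ∀ η : ℝ, 0 < η → ‖I s t‖ ≤ 2 * (sewConst θ * B) * (c s t + η * c' s t) ^ θ := by
    intro η hη
    have hcη := hc.add (hc'.const_mul hη.le)
    set ι := {z : ℝ × ℝ // a ≤ z.1 ∧ z.1 ≤ z.2 ∧ z.2 ≤ b}
    refine le_two_mul_of_forall_improve (ι := ι) (fun z => ‖I z.1.1 z.1.2‖)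
      (fun z => (c z.1.1 z.1.2 + η * c' z.1.1 z.1.2) ^ θ) (c := sewConst θ * B)
      (K₀ := K₀ * (η⁻¹) ^ θ) (mul_nonneg (sewConst_pos hθ).le hB) (by positivity)
      (fun z => Real.rpow_nonneg (hcη.nonneg _ _ z.2.1 z.2.2.1 z.2.2.2) _) ?_ ?_
      ⟨(s, t), has, hst, htb⟩
    · rintro ⟨⟨s, t⟩, h1, h2, h3⟩
      dsimp only at h1 h2 h3 ⊢
      refine (crude s t h1 h2 h3).trans ?_
      have p1 := hc.nonneg s t h1 h2 h3
      have p2 := hc'.nonneg s t h1 h2 h3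
      rw [mul_assoc, ← Real.mul_rpow (by positivity) (by positivity)]
      refine mul_le_mul_of_nonneg_left (Real.rpow_le_rpow p2 ?_ hθ0.le) hK₀
      rw [mul_add, ← mul_assoc, inv_mul_cancel₀ hη.ne', one_mul]
      have : 0 ≤ η⁻¹ * c s t := by positivity
      linarith
    · rintro K hK hKI ⟨⟨s, t⟩, h1, h2, h3⟩
      dsimp only at h1 h2 h3 ⊢
      have hδ : ∀ x u y, a ≤ x → x ≤ u → u ≤ y → y ≤ b →
          ‖I x y - I x u - I u y‖ ≤ (B + b₀ * K) * (c x y + η * c' x y) ^ θ := by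
        intro x u y hx hxu huy hy
        have p1 := hc.nonneg x y hx (hxu.trans huy) hy
        have p2 := hc'.nonneg x y hx (hxu.trans huy) hy
        have e1 := hKI ⟨(x, u), hx, hxu, huy.trans hy⟩
        dsimp only at e1
        have e2 : (c x u + η * c' x u) ^ θ ≤ (c x y + η * c' x y) ^ θ :=
          Real.rpow_le_rpow (hcη.nonneg x u hx hxu (huy.trans hy))
            (hcη.mono hx le_rfl hxu huy hy) hθ0.le
        have e3 : c x y ^ θ ≤ (c x y + η * c' x y) ^ θ :=
          Real.rpow_le_rpow p1 (by linarith [mul_nonneg hη.le p2]) hθ0.le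
        calc _ ≤ _ := hI x u y hx hxu huy hy
          _ ≤ B * (c x y + η * c' x y) ^ θ + b₀ * (K * (c x y + η * c' x y) ^ θ) := by
            gcongr
            exact e1.trans (by gcongr)
          _ = _ := by ring
      have hfin : ‖I s t‖ ≤ sewConst θ * (B + b₀ * K) * (c s t + η * c' s t) ^ θ := by
        refine le_of_forall_pos_le_add fun ε hε => ?_
        obtain ⟨n, u, hu, hε'⟩ := vanish s t h1 h2 h3 ε hε
        have := young_sewing I hcη hθ (by positivity) hδ h1 h3 hu
        have e := norm_le_insert' (I s t) (∑ k ∈ Finset.range n, I (u k) (u (k + 1)))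
        linarith
      -- By `hb` the contribution of `b₀ * K` is at most `K / 2`, which is the required improvement.
      refine hfin.trans (mul_le_mul_of_nonneg_right ?_
        (Real.rpow_nonneg (hcη.nonneg s t h1 h2 h3) _))
      nlinarith
  have lim : Filter.Tendsto (fun η : ℝ => 2 * (sewConst θ * B) * (c s t + η * c' s t) ^ θ)
      (nhdsWithin 0 (Ioi 0)) (nhds (2 * (sewConst θ * B) * (c s t + 0 * c' s t) ^ θ)) := by
    refine Filter.Tendsto.mono_left (Continuous.tendsto ?_ 0) nhdsWithin_le_nhds
    exact continuous_const.mul ((by fun_prop : Continuous fun η : ℝ => c s t + η * c' s t).rpow_const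
      fun _ => Or.inr hθ0.le)
  have := ge_of_tendsto lim (Filter.eventually_of_mem self_mem_nhdsWithin main)
  simpa using this

/-! ### Limits along partitions. -/

lemma exists_strictMono_fin_of_finset {s t : ℝ} (hst : s ≤ t) (P : Finset ℝ)
    (hP : (P : Set ℝ) ⊆ Icc s t) :
    ∃ (n : ℕ) (u : Fin (n + 1) → ℝ), StrictMono u ∧ u 0 = s ∧ u (Fin.last n) = t ∧
      (P : Set ℝ) ⊆ range u := by
  classical
  set Q : Finset ℝ := insert s (insert t P) with hQ
  have hs : s ∈ Q := by simp [hQ]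
  have ht : t ∈ Q := by simp [hQ]
  have hmem : ∀ x ∈ Q, s ≤ x ∧ x ≤ t := by
    intro x hx
    simp only [hQ, Finset.mem_insert] at hx
    rcases hx with rfl | rfl | hx
    · exact ⟨le_rfl, hst⟩
    · exact ⟨hst, le_rfl⟩
    · exact hP hx
  obtain ⟨n, hn⟩ : ∃ n, Q.card = n + 1 := Nat.exists_eq_succ_of_ne_zero
    (Finset.card_ne_zero_of_mem hs)
  have hrange : range (Q.orderEmbOfFin hn) = (Q : Set ℝ) := Q.range_orderEmbOfFin hn
  have hin : ∀ i, s ≤ Q.orderEmbOfFin hn i ∧ Q.orderEmbOfFin hn i ≤ t := fun i =>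
    hmem _ (Q.orderEmbOfFin_mem hn i)
  refine ⟨n, Q.orderEmbOfFin hn, (Q.orderEmbOfFin hn).strictMono, ?_, ?_, ?_⟩
  · obtain ⟨i, hi⟩ : s ∈ range (Q.orderEmbOfFin hn) := by rw [hrange]; exact hs
    refine le_antisymm ?_ (hin 0).1
    rw [← hi]
    exact (Q.orderEmbOfFin hn).monotone (Fin.zero_le i)
  · obtain ⟨i, hi⟩ : t ∈ range (Q.orderEmbOfFin hn) := by rw [hrange]; exact ht
    refine le_antisymm (hin _).2 ?_
    rw [← hi]
    exact (Q.orderEmbOfFin hn).monotone (Fin.le_last i)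
  · rw [hrange]
    intro x hx
    simp only [hQ, Finset.coe_insert]
    exact Or.inr (Or.inr hx)

/-- The sequence that runs through `u` and then stays at the last point. -/
def finExtend {n : ℕ} (u : Fin (n + 1) → ℝ) (k : ℕ) : ℝ :=
  u ⟨min k n, Nat.lt_succ_of_le (min_le_right k n)⟩

lemma finExtend_isPart {n : ℕ} {u : Fin (n + 1) → ℝ} (hu : StrictMono u) :
    IsPart (u 0) (u (Fin.last n)) n (finExtend u) where
  mono i j hij := hu.monotone (by simp only [Fin.mk_le_mk]; omega)
  zero := by simp only [finExtend, Nat.zero_min]; rfl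
  eq_of_le k hk := by simp only [finExtend, min_eq_right hk]; rfl

lemma sum_finExtend {G : Type*} [AddCommMonoid G] (A : ℝ → ℝ → G) {n : ℕ}
    (u : Fin (n + 1) → ℝ) :
    ∑ k ∈ Finset.range n, A (finExtend u k) (finExtend u (k + 1)) =
      ∑ i : Fin n, A (u i.castSucc) (u i.succ) := by
  rw [Finset.sum_range]
  refine Finset.sum_congr rfl fun i _ => ?_
  have h1 : min (i : ℕ) n = i := min_eq_left i.2.le
  have h2 : min ((i : ℕ) + 1) n = i + 1 := min_eq_left i.2
  simp only [finExtend, h1, h2]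
  rfl

/-- A partition of `[o, s]` and one of `[s, t]`, each containing the relevant points of the two
reference partitions, concatenate to a partition of `[o, t]` that is fine enough. The sum over `[s,
t]` is the difference of two sums that are close to their limits. Only the existence of the limits
from the common origin `o` enters. -/
lemma IsPartitionLimit.exists_isPart {F : Type*} [NormedAddCommGroup F]
    {A : ℝ → ℝ → F} {o s t : ℝ} {z₁ z₂ : F} (hos : o ≤ s) (hst : s ≤ t)
    (h₁ : IsPartitionLimit A o s z₁) (h₂ : IsPartitionLimit A o t z₂) {ε : ℝ} (hε : 0 < ε) :
    ∃ n u, IsPart s t n u ∧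
      ‖∑ k ∈ Finset.range n, A (u k) (u (k + 1)) - (z₂ - z₁)‖ ≤ ε := by
  classical
  obtain ⟨P₁, hP₁, H₁⟩ := h₁ (ε / 2) (half_pos hε)
  obtain ⟨P₂, hP₂, H₂⟩ := h₂ (ε / 2) (half_pos hε)
  obtain ⟨n, u, hu, hu0, hun, hPu⟩ := exists_strictMono_fin_of_finset hos
    (P₁ ∪ P₂.filter (· ≤ s)) (by
      intro x hx
      simp only [Finset.coe_union, Finset.coe_filter, mem_union, Finset.mem_coe, mem_ofPred_eq] at hx
      rcases hx with hx | hx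
      · exact hP₁ hx
      · exact ⟨(hP₂ hx.1).1, hx.2⟩)
  obtain ⟨m, v, hv, hv0, hvm, hPv⟩ := exists_strictMono_fin_of_finset hst
    (P₂.filter (s ≤ ·)) (by
      intro x hx
      simp only [Finset.coe_filter, mem_ofPred_eq] at hx
      exact ⟨hx.2, (hP₂ hx.1).2⟩)
  have hU := finExtend_isPart hu
  have hV := finExtend_isPart hv
  rw [hu0, hun] at hU
  rw [hv0, hvm] at hV
  have e1 := H₁ n u hu hu0 hun (fun x hx => hPu (by simp [Finset.mem_coe.1 hx]))
  refine ⟨m, finExtend v, hV, ?_⟩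
  -- At the index `n` the partition `u` has reached `s`, where `v` starts; the branch `≤ n` counts
  -- this point once.
  set W : Fin (n + m + 1) → ℝ := fun i =>
    if (i : ℕ) ≤ n then finExtend u i else finExtend v (i - n) with hW
  have hvs : ∀ k, 0 < k → k ≤ m → s < finExtend v k := by
    intro k hk hkm
    rw [← hv0]
    refine hv ?_
    rw [Fin.lt_def]
    simp only [Fin.val_zero]
    omega
  have hWmono : StrictMono W := by
    intro i j hij
    have hij' : (i : ℕ) < j := hij
    have hj := j.2
    simp only [hW]
    by_cases hjn : (j : ℕ) ≤ n
    · rw [if_pos (by omega), if_pos hjn]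
      refine hu ?_
      rw [Fin.mk_lt_mk]; omega
    · rw [if_neg hjn]
      by_cases hin : (i : ℕ) ≤ n
      · rw [if_pos hin]
        exact (hU.mem i).2.trans_lt (hvs _ (by omega) (by omega))
      · rw [if_neg hin]
        refine hv ?_
        rw [Fin.mk_lt_mk]; omega
  have hW0 : W 0 = o := by simp [hW, hU.zero]
  have hWl : W (Fin.last (n + m)) = t := by
    simp only [hW, Fin.val_last]
    split_ifs with hc
    · have hm : m = 0 := by omega
      subst hm
      rw [hU.eq_of_le _ (by omega)]
      have := hV.eq_of_le 0 le_rfl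
      rw [hV.zero] at this
      exact this
    · exact hV.eq_of_le _ (by omega)
  have hWr : (P₂ : Set ℝ) ⊆ range W := by
    intro x hx
    by_cases hxs : x ≤ s
    · obtain ⟨i, hi⟩ := hPu (show x ∈ _ by simp [Finset.mem_coe.1 hx, hxs])
      have hi2 := i.2
      refine ⟨⟨i, by omega⟩, ?_⟩
      simp only [hW]
      rw [if_pos (by omega), ← hi]
      simp only [finExtend]
      congr 1
      ext
      simp only
      omega
    · push Not at hxs
      obtain ⟨i, hi⟩ := hPv (show x ∈ _ by simp [Finset.mem_coe.1 hx, hxs.le])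
      have hi0 : (i : ℕ) ≠ 0 := by
        intro h0
        have : i = 0 := Fin.ext h0
        rw [this, hv0] at hi
        exact hxs.ne hi
      have hi2 := i.2
      refine ⟨⟨n + i, by omega⟩, ?_⟩
      simp only [hW]
      rw [if_neg (by omega), ← hi]
      simp only [finExtend]
      congr 1
      ext
      simp only
      omega
  have e2 := H₂ (n + m) W hWmono hW0 hWl hWr
  have hsplit : ∑ i : Fin (n + m), A (W i.castSucc) (W i.succ) =
      ∑ i : Fin n, A (u i.castSucc) (u i.succ) +
        ∑ k ∈ Finset.range m, A (finExtend v k) (finExtend v (k + 1)) := by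
    rw [← sum_finExtend A W, Finset.sum_range_add, ← sum_finExtend A u]
    congr 1
    · refine Finset.sum_congr rfl fun k hk => ?_
      rw [Finset.mem_range] at hk
      congr 1
      · simp only [finExtend, hW]
        rw [if_pos (by omega)]
        congr 1; ext; simp only; omega
      · simp only [finExtend, hW]
        rw [if_pos (by omega)]
        congr 1; ext; simp only; omega
    · refine Finset.sum_congr rfl fun k hk => ?_
      rw [Finset.mem_range] at hk
      congr 1
      · simp only [finExtend, hW]
        split_ifs with hc
        · have hk0 : k = 0 := by omega
          subst hk0
          have a1 : u ⟨min (min (n + 0) (n + m)) n, by omega⟩ = s := by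
            rw [← hun]; congr 1; ext; simp
          have a2 : v ⟨min 0 m, by omega⟩ = s := by
            rw [← hv0]; congr 1
          rw [a1, a2]
        · congr 1; ext; simp only; omega
      · simp only [finExtend, hW]
        rw [if_neg (by omega)]
        congr 1; ext; simp only; omega
  rw [hsplit] at e2
  set S₁ := ∑ i : Fin n, A (u i.castSucc) (u i.succ)
  set S₂ := ∑ k ∈ Finset.range m, A (finExtend v k) (finExtend v (k + 1))
  have : S₂ - (z₂ - z₁) = (S₁ + S₂ - z₂) - (S₁ - z₁) := by abel
  rw [this]
  exact (norm_sub_le _ _).trans (by linarith)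

/-- The control is small on short intervals. -/
def IsUnifSmall (a b : ℝ) (ω : ℝ → ℝ → ℝ) : Prop :=
  ∀ ε > 0, ∃ η > 0, ∀ s t, a ≤ s → s ≤ t → t ≤ b → t - s ≤ η → ω s t ≤ ε

lemma IsControl.sum_le {a b : ℝ} {ω : ℝ → ℝ → ℝ} (hω : IsControl a b ω) {s t : ℝ}
    (has : a ≤ s) (htb : t ≤ b) {n : ℕ} {u : ℕ → ℝ} (hu : IsPart s t n u) :
    ∑ k ∈ Finset.range n, ω (u k) (u (k + 1)) ≤ ω s t := by
  have hmem : ∀ k, a ≤ u k ∧ u k ≤ b := fun k =>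
    ⟨has.trans (hu.mem k).1, (hu.mem k).2.trans htb⟩
  have : ∀ m : ℕ, ∑ k ∈ Finset.range m, ω (u k) (u (k + 1)) ≤ ω (u 0) (u m) := by
    intro m
    induction m with
    | zero => simp [hω.diag (hmem 0).1 (hmem 0).2]
    | succ m ih =>
      rw [Finset.sum_range_succ]
      have := hω.add_le (u 0) (u m) (u (m + 1)) (hmem 0).1 (hu.mono (Nat.zero_le _))
        (hu.mono (Nat.le_succ _)) (hmem _).2
      linarith
  have := this n
  rwa [hu.zero, hu.eq_of_le n le_rfl] at this

/-- A path is the limit of the sums of `A` if its increments differ from `A` by little. -/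
theorem isPartitionLimit_of_le {F : Type*} [NormedAddCommGroup F]
    {A : ℝ → ℝ → F} {s t : ℝ} (hst : s ≤ t) {ω : ℝ → ℝ → ℝ} (hω : IsControl s t ω)
    (hsmall : IsUnifSmall s t ω) {θ L : ℝ} (hθ : 1 < θ) (hL : 0 ≤ L) {Y : ℝ → F}
    (h : ∀ x y, s ≤ x → x ≤ y → y ≤ t → ‖Y y - Y x - A x y‖ ≤ L * ω x y ^ θ) :
    IsPartitionLimit A s t (Y t - Y s) := by
  intro ε hε
  have hw0 : 0 ≤ ω s t := hω.nonneg s t le_rfl hst le_rfl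
  -- Where `ω ≤ c`, one has `ω ^ θ ≤ c ^ (θ - 1) * ω`; summing the last factor by superadditivity
  -- makes the total error at most `L * c ^ (θ - 1) * ω s t`.
  obtain ⟨c, hc, hc'⟩ : ∃ c : ℝ, 0 < c ∧ L * c ^ (θ - 1) * ω s t < ε := by
    have lim : Filter.Tendsto (fun c : ℝ => L * c ^ (θ - 1) * ω s t) (nhdsWithin 0 (Ioi 0))
        (nhds (L * (0 : ℝ) ^ (θ - 1) * ω s t)) := by
      refine Filter.Tendsto.mono_left (Continuous.tendsto ?_ 0) nhdsWithin_le_nhds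
      exact (continuous_const.mul (continuous_id.rpow_const fun _ => Or.inr (by linarith))).mul
        continuous_const
    rw [Real.zero_rpow (by linarith), mul_zero, zero_mul] at lim
    obtain ⟨c, hc1, hc2⟩ := ((lim.eventually (gt_mem_nhds hε)).and self_mem_nhdsWithin).exists
    exact ⟨c, hc2, hc1⟩
  obtain ⟨η, hη, hηs⟩ := hsmall c hc
  obtain ⟨N, hN⟩ := exists_nat_gt ((t - s) / η)
  have hNη : t - s < N * η := by rwa [div_lt_iff₀ hη] at hN
  -- A uniform grid of step `η`, cut off at `t`: a partition that contains it must have mesh at most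
  -- `η`, because the first grid point beyond `v k` is itself a partition point.
  set P : Finset ℝ := (Finset.range (N + 1)).image fun k : ℕ => min (s + k * η) t with hP
  refine ⟨P, ?_, ?_⟩
  · intro x hx
    simp only [hP, Finset.coe_image, mem_image] at hx
    obtain ⟨k, -, rfl⟩ := hx
    exact ⟨le_min (by have : (0 : ℝ) ≤ k * η := by positivity
                      linarith) hst, min_le_right _ _⟩
  · intro n u hu hu0 hun hPu
    have hU := finExtend_isPart hu
    rw [hu0, hun] at hU
    rw [← sum_finExtend A u]
    set v := finExtend u
    have hmesh : ∀ k, k < n → v (k + 1) - v k ≤ η := by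
      intro k hk
      set l : ℕ := ⌊(v k - s) / η⌋₊ with hl
      have hvk := hU.mem k
      have h1 : (l : ℝ) * η ≤ v k - s := by
        have := Nat.floor_le (div_nonneg (sub_nonneg.2 hvk.1) hη.le)
        rwa [le_div_iff₀ hη] at this
      have h2 : v k - s < (l + 1) * η := by
        have := Nat.lt_floor_add_one ((v k - s) / η)
        rwa [div_lt_iff₀ hη] at this
      have hlt : v k < t := by
        have : v k < v n := by
          refine hu ?_
          rw [Fin.mk_lt_mk]; omega
        rwa [hU.eq_of_le n le_rfl] at this
      have hlN : l < N := by
        have : (l : ℝ) * η < N * η := by linarith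
        exact_mod_cast (mul_lt_mul_iff_left₀ hη).1 this
      obtain ⟨j, hj⟩ := hPu (show min (s + ((l + 1 : ℕ) : ℝ) * η) t ∈ (P : Set ℝ) by
        simp only [hP, Finset.coe_image, mem_image]
        exact ⟨l + 1, by simpa using hlN, rfl⟩)
      have hgt : v k < u j := by
        rw [hj]; push_cast; exact lt_min (by linarith) hlt
      have hkj : k + 1 ≤ j := by
        have : (⟨min k n, by omega⟩ : Fin (n + 1)) < j := hu.lt_iff_lt.1 hgt
        have h3 : min k n < (j : ℕ) := this
        omega
      have hle : v (k + 1) ≤ u j := by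
        refine hu.monotone ?_
        rw [Fin.le_def]
        simp only
        omega
      have : u j ≤ s + (l + 1) * η := by
        rw [hj]; push_cast; exact min_le_left _ _
      linarith
    have hsum : ∑ k ∈ Finset.range n, A (v k) (v (k + 1)) - (Y t - Y s) =
        -∑ k ∈ Finset.range n, (Y (v (k + 1)) - Y (v k) - A (v k) (v (k + 1))) := by
      have := Finset.sum_range_sub (fun k => Y (v k)) n
      rw [Finset.sum_sub_distrib, this, hU.zero, hU.eq_of_le n le_rfl]
      abel
    rw [hsum, norm_neg]
    refine lt_of_le_of_lt ?_ hc'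
    calc _ ≤ ∑ k ∈ Finset.range n, ‖Y (v (k + 1)) - Y (v k) - A (v k) (v (k + 1))‖ :=
          norm_sum_le _ _
      _ ≤ ∑ k ∈ Finset.range n, L * c ^ (θ - 1) * ω (v k) (v (k + 1)) := by
          refine Finset.sum_le_sum fun k hk => ?_
          rw [Finset.mem_range] at hk
          have m1 := hU.mem k
          have m2 := hU.mem (k + 1)
          have hvv := hU.mono (Nat.le_succ k)
          refine (h _ _ m1.1 hvv m2.2).trans ?_
          have p0 := hω.nonneg _ _ m1.1 hvv m2.2
          have p1 := hηs _ _ m1.1 hvv m2.2 (hmesh k hk)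
          rw [mul_assoc]
          refine mul_le_mul_of_nonneg_left ?_ hL
          rcases p0.eq_or_lt with p0 | p0
          · rw [← p0, Real.zero_rpow (by linarith), mul_zero]
          · have : ω (v k) (v (k + 1)) ^ θ =
                ω (v k) (v (k + 1)) ^ (θ - 1) * ω (v k) (v (k + 1)) := by
              rw [Real.rpow_sub_one p0.ne']; field_simp
            rw [this]
            exact mul_le_mul_of_nonneg_right (Real.rpow_le_rpow p0.le p1 (by linarith)) p0.le
      _ ≤ L * c ^ (θ - 1) * ω s t := by
          rw [← Finset.mul_sum]
          exact mul_le_mul_of_nonneg_left (hω.sum_le le_rfl le_rfl hU) (by positivity)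

/-! ### The pairing of bilinear maps with second level increments. -/

section tensorApply

variable {E F V : Type*} [NormedAddCommGroup E] [NormedSpace ℝ E]
  [NormedAddCommGroup F] [NormedSpace ℝ F] [NormedAddCommGroup V] [NormedSpace ℝ V]
  (ι : E ⊗[ℝ] E ≃ₗ[ℝ] V)

lemma tensorApply_tmul (B : E →L[ℝ] E →L[ℝ] F) (x y : E) :
    tensorApply ι B (ι (x ⊗ₜ[ℝ] y)) = B x y := by
  simp [tensorApply]

lemma tensorApply_add (B : E →L[ℝ] E →L[ℝ] F) (v w : V) :
    tensorApply ι B (v + w) = tensorApply ι B v + tensorApply ι B w := by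
  simp [tensorApply]

lemma tensorApply_sub (B : E →L[ℝ] E →L[ℝ] F) (v w : V) :
    tensorApply ι B (v - w) = tensorApply ι B v - tensorApply ι B w := by
  simp [tensorApply]

lemma sub_tensorApply (B B' : E →L[ℝ] E →L[ℝ] F) (v : V) :
    tensorApply ι (B - B') v = tensorApply ι B v - tensorApply ι B' v := by
  unfold tensorApply
  induction ι.symm v using TensorProduct.induction_on with
  | zero => simp
  | tmul x y => simp
  | add x y hx hy => simp only [map_add, hx, hy]; abel

/-- In a basis of `E` the pairing is a finite sum of coordinates of `v` times values of `B` on basis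
vectors. The coordinates are continuous because `V` is finite-dimensional, whatever its norm is. -/
lemma exists_norm_tensorApply_le [FiniteDimensional ℝ E] (F : Type*) [NormedAddCommGroup F]
    [NormedSpace ℝ F] : ∃ κ : ℝ, 0 ≤ κ ∧
    ∀ (B : E →L[ℝ] E →L[ℝ] F) (v : V), ‖tensorApply ι B v‖ ≤ κ * ‖B‖ * ‖v‖ := by
  let b := Module.finBasis ℝ E
  let bb := (b.tensorProduct b).map ι
  have : FiniteDimensional ℝ V := bb.finiteDimensional_of_finite
  let c : _ → (V →L[ℝ] ℝ) := fun i => LinearMap.toContinuousLinearMap (bb.coord i)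
  refine ⟨∑ i, ‖c i‖ * (‖b i.1‖ * ‖b i.2‖), by positivity, fun B v => ?_⟩
  have hv : tensorApply ι B v = ∑ i, c i v • B (b i.1) (b i.2) := by
    have h1 : v = ∑ i, c i v • bb i := (bb.sum_repr v).symm
    have h2 : ∀ i, tensorApply ι B (bb i) = B (b i.1) (b i.2) := by
      intro i
      have : bb i = ι (b i.1 ⊗ₜ[ℝ] b i.2) := by
        rw [Module.Basis.map_apply, Module.Basis.tensorProduct_apply']
      rw [this, tensorApply_tmul]
    conv_lhs => rw [h1]
    simp only [← h2, tensorApply, map_sum, map_smul]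
  rw [hv, Finset.sum_mul, Finset.sum_mul]
  refine (norm_sum_le _ _).trans (Finset.sum_le_sum fun i _ => ?_)
  rw [norm_smul]
  calc ‖c i v‖ * ‖B (b i.1) (b i.2)‖ ≤ (‖c i‖ * ‖v‖) * (‖B‖ * ‖b i.1‖ * ‖b i.2‖) := by
        gcongr
        · exact (c i).le_opNorm v
        · exact B.le_opNorm₂ _ _
    _ = _ := by ring

end tensorApply

/-! ### Taylor and four-point estimates for the vector field. -/

section SmoothField

variable {G H : Type*} [NormedAddCommGroup G] [NormedSpace ℝ G] [NormedAddCommGroup H]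
  [NormedSpace ℝ H]

lemma norm_sub_le_of_norm_fderiv_le {g : G → H} (hg : Differentiable ℝ g) {C : ℝ} {s : Set G}
    (hs : Convex ℝ s) (h : ∀ x ∈ s, ‖fderiv ℝ g x‖ ≤ C) {x y : G} (hx : x ∈ s) (hy : y ∈ s) :
    ‖g y - g x‖ ≤ C * ‖y - x‖ :=
  hs.norm_image_sub_le_of_norm_fderiv_le (fun x _ => hg x) h hx hy

/-- After replacing `h` by `k` in the first increment, at the cost of the Lipschitz bound, both
increments have the same step. The mean value inequality for `x ↦ g (x + k) - g x` in the base point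
does the rest. -/
lemma norm_four_point_le {g : G → H} (hg : Differentiable ℝ g) {Λ₁ Λ₂ : ℝ}
    (h₁ : ∀ x y, ‖g x - g y‖ ≤ Λ₁ * ‖x - y‖)
    (h₂ : ∀ x y, ‖fderiv ℝ g x - fderiv ℝ g y‖ ≤ Λ₂ * ‖x - y‖) (a b h k : G) :
    ‖g (a + h) - g a - (g (b + k) - g b)‖ ≤ Λ₁ * ‖h - k‖ + Λ₂ * (‖a - b‖ * ‖k‖) := by
  have e1 : ‖g (a + h) - g (a + k)‖ ≤ Λ₁ * ‖h - k‖ := by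
    have := h₁ (a + h) (a + k)
    rwa [add_sub_add_left_eq_sub] at this
  have hdk : Differentiable ℝ fun x => g (x + k) := hg.comp (differentiable_id.add_const k)
  have e2 : ‖(g (a + k) - g a) - (g (b + k) - g b)‖ ≤ (Λ₂ * ‖k‖) * ‖a - b‖ := by
    refine norm_sub_le_of_norm_fderiv_le (g := fun x => g (x + k) - g x) (hdk.sub hg)
      convex_univ (fun x _ => ?_) (mem_univ b) (mem_univ a)
    rw [fderiv_fun_sub (hdk x) (hg x), fderiv_comp_add_right]
    have := h₂ (x + k) x
    rwa [add_sub_cancel_left] at this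
  have : g (a + h) - g a - (g (b + k) - g b) =
      (g (a + h) - g (a + k)) + ((g (a + k) - g a) - (g (b + k) - g b)) := by abel
  rw [this]
  refine (norm_add_le _ _).trans ?_
  linarith

/-- Mean value inequality for the Taylor remainder as a function of the step, on the ball of radius
`‖h‖ + ‖k‖`, where its derivative is at most `Λ₂ * (‖h‖ + ‖k‖)`. -/
lemma norm_taylor_sub_le {g : G → H} (hg : Differentiable ℝ g) {Λ₂ : ℝ} (hΛ₂ : 0 ≤ Λ₂)
    (h₂ : ∀ x y, ‖fderiv ℝ g x - fderiv ℝ g y‖ ≤ Λ₂ * ‖x - y‖) (a h k : G) :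
    ‖(g (a + h) - g a - fderiv ℝ g a h) - (g (a + k) - g a - fderiv ℝ g a k)‖ ≤
      Λ₂ * ((‖h‖ + ‖k‖) * ‖h - k‖) := by
  have hd1 : Differentiable ℝ fun x => g (a + x) := hg.comp (differentiable_id.const_add a)
  have hd2 : Differentiable ℝ fun x => g (a + x) - fderiv ℝ g a x :=
    hd1.sub (fderiv ℝ g a).differentiable
  have := norm_sub_le_of_norm_fderiv_le (g := fun x => g (a + x) - fderiv ℝ g a x)
    (C := Λ₂ * (‖h‖ + ‖k‖)) hd2 (convex_closedBall (0 : G) (‖h‖ + ‖k‖))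
    (fun x hx => by
      rw [fderiv_fun_sub (hd1 x) (fderiv ℝ g a).differentiableAt, fderiv_comp_add_left,
        ContinuousLinearMap.fderiv]
      refine (h₂ (a + x) a).trans ?_
      rw [add_sub_cancel_left]
      exact mul_le_mul_of_nonneg_left (by simpa using hx) hΛ₂) (x := k) (y := h)
    (by simp) (by simp)
  rw [mul_assoc] at this
  convert this using 2
  abel

/-- The derivative of the Taylor remainder in the base point is the Taylor remainder of the
derivative, of second order in `k` by the previous estimate. The identification uses the symmetry of
the second derivative. -/
lemma norm_taylor_sub_le' {g : G → H} (hg : ContDiff ℝ 2 g) {Λ₃ : ℝ} (hΛ₃ : 0 ≤ Λ₃)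
    (h₃ : ∀ x y, ‖fderiv ℝ (fderiv ℝ g) x - fderiv ℝ (fderiv ℝ g) y‖ ≤ Λ₃ * ‖x - y‖)
    (a b k : G) :
    ‖(g (a + k) - g a - fderiv ℝ g a k) - (g (b + k) - g b - fderiv ℝ g b k)‖ ≤
      Λ₃ * (‖k‖ ^ 2 * ‖a - b‖) := by
  have hgd : Differentiable ℝ g := hg.differentiable (by norm_num)
  have hg' : Differentiable ℝ (fderiv ℝ g) :=
    (hg.fderiv_right (m := 1) (by norm_num)).differentiable (by norm_num)
  have hd1 : Differentiable ℝ fun x => g (x + k) := hgd.comp (differentiable_id.add_const k)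
  have hd2 : Differentiable ℝ fun x => fderiv ℝ g x k := fun x =>
    (hg' x).clm_apply (differentiableAt_const k)
  have key : ∀ x, ‖fderiv ℝ g (x + k) - fderiv ℝ g x - fderiv ℝ (fderiv ℝ g) x k‖ ≤
      Λ₃ * ‖k‖ ^ 2 := by
    intro x
    have := norm_taylor_sub_le hg' hΛ₃ h₃ x k 0
    simpa [sq] using this
  have := norm_sub_le_of_norm_fderiv_le (g := fun x => g (x + k) - g x - fderiv ℝ g x k)
    (C := Λ₃ * ‖k‖ ^ 2) ((hd1.fun_sub hgd).fun_sub hd2) convex_univ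
    (fun x _ => by
      rw [fderiv_fun_sub ((hd1 x).fun_sub (hgd x)) (hd2 x), fderiv_fun_sub (hd1 x) (hgd x),
        fderiv_comp_add_right]
      refine le_trans (le_of_eq ?_) (key x)
      congr 1
      congr 1
      ext v
      rw [fderiv_clm_apply (hg' x) (differentiableAt_const k)]
      simp
      have hsymm : IsSymmSndFDerivAt ℝ g x := (hg.contDiffAt).isSymmSndFDerivAt (by simp)
      exact hsymm.eq v k) (mem_univ b) (mem_univ a)
  rwa [mul_assoc] at this

lemma norm_fderiv_fderiv_sub_le {g : G → H} {Λ : ℝ≥0}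
    (h : LipschitzWith Λ (iteratedFDeriv ℝ 2 g)) (x y : G) :
    ‖fderiv ℝ (fderiv ℝ g) x - fderiv ℝ (fderiv ℝ g) y‖ ≤ Λ * ‖x - y‖ := by
  have h1 : ‖iteratedFDeriv ℝ 2 g x - iteratedFDeriv ℝ 2 g y‖ ≤ Λ * ‖x - y‖ := by
    simpa [dist_eq_norm] using h.dist_le_mul x y
  refine ContinuousLinearMap.opNorm_le_bound₂ _ (by positivity) fun v w => ?_
  have h2 := (iteratedFDeriv ℝ 2 g x - iteratedFDeriv ℝ 2 g y).le_opNorm ![v, w]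
  simp only [_root_.sub_apply, iteratedFDeriv_two_apply, Fin.prod_univ_two,
    Matrix.cons_val_zero, Matrix.cons_val_one] at h2
  simp only [_root_.sub_apply]
  refine h2.trans ?_
  rw [mul_assoc _ ‖v‖]
  exact mul_le_mul_of_nonneg_right h1 (by positivity)

variable {E F : Type*} [NormedAddCommGroup E] [NormedSpace ℝ E]
  [NormedAddCommGroup F] [NormedSpace ℝ F]

/-- The field `Dφ · φ`. -/
noncomputable def derivMul (φ : F → E →L[ℝ] F) (y : F) : E →L[ℝ] E →L[ℝ] F :=
  (fderiv ℝ φ y).comp (φ y)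

/-- The consequences of `φ ∈ C^{2,1}_b` that matter for rough differential equations, with a
single constant `Λ`. -/
structure IsNiceField (φ : F → E →L[ℝ] F) (Λ : ℝ) : Prop where
  one_le : 1 ≤ Λ
  bound : ∀ y, ‖φ y‖ ≤ Λ
  lip : ∀ x y, ‖φ x - φ y‖ ≤ Λ * ‖x - y‖
  deriv_bound : ∀ y, ‖fderiv ℝ φ y‖ ≤ Λ
  deriv_lip : ∀ x y, ‖fderiv ℝ φ x - fderiv ℝ φ y‖ ≤ Λ * ‖x - y‖
  derivMul_bound : ∀ y, ‖derivMul φ y‖ ≤ Λ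
  derivMul_lip : ∀ x y, ‖derivMul φ x - derivMul φ y‖ ≤ Λ * ‖x - y‖
  derivMul_four : ∀ a b h k, ‖derivMul φ (a + h) - derivMul φ a -
    (derivMul φ (b + k) - derivMul φ b)‖ ≤ Λ * (‖h - k‖ + ‖a - b‖ * ‖k‖)
  taylor : ∀ a h, ‖φ (a + h) - φ a - fderiv ℝ φ a h‖ ≤ Λ * ‖h‖ ^ 2
  taylor_sub : ∀ a b h k, ‖(φ (a + h) - φ a - fderiv ℝ φ a h) -
    (φ (b + k) - φ b - fderiv ℝ φ b k)‖ ≤ Λ * ((‖h‖ + ‖k‖) * ‖h - k‖ + ‖k‖ ^ 2 * ‖a - b‖)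

lemma BoundedC21.isNiceField {φ : F → E →L[ℝ] F}
    {Φ₀ Φ₀₁ Φ₁ Φ₁₁ Φ₂ Φ₂₁ ΦDD : ℝ≥0} (h : BoundedC21 φ Φ₀ Φ₀₁ Φ₁ Φ₁₁ Φ₂ Φ₂₁ ΦDD) :
    IsNiceField φ (1 + Φ₀ + Φ₀₁ + Φ₁ + Φ₁₁ + Φ₂₁ + ΦDD + 2 * (Φ₁₁ * Φ₀ + Φ₁ * Φ₀₁)
      + Φ₂₁ * Φ₀ + 2 * Φ₁₁ * Φ₀₁ + Φ₁ * Φ₁₁) := by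
  have n0 : (0 : ℝ) ≤ Φ₀ := NNReal.coe_nonneg _
  have n1 : (0 : ℝ) ≤ Φ₀₁ := NNReal.coe_nonneg _
  have n2 : (0 : ℝ) ≤ Φ₁ := NNReal.coe_nonneg _
  have n3 : (0 : ℝ) ≤ Φ₁₁ := NNReal.coe_nonneg _
  have n4 : (0 : ℝ) ≤ Φ₂₁ := NNReal.coe_nonneg _
  have n5 : (0 : ℝ) ≤ ΦDD := NNReal.coe_nonneg _
  have hd : Differentiable ℝ φ := h.contDiff.differentiable (by norm_num)
  have hd' : Differentiable ℝ (fderiv ℝ φ) :=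
    (h.contDiff.fderiv_right (m := 1) (by norm_num)).differentiable (by norm_num)
  have hlip : ∀ x y, ‖φ x - φ y‖ ≤ Φ₀₁ * ‖x - y‖ := fun x y => by
    simpa [dist_eq_norm] using h.lipschitz.dist_le_mul x y
  have hlip' : ∀ x y, ‖fderiv ℝ φ x - fderiv ℝ φ y‖ ≤ Φ₁₁ * ‖x - y‖ := fun x y => by
    simpa [dist_eq_norm] using h.lipschitz_deriv.dist_le_mul x y
  have hlip'' := norm_fderiv_fderiv_sub_le h.lipschitz_deriv2
  set Λ : ℝ := 1 + (Φ₀ : ℝ) + Φ₀₁ + Φ₁ + Φ₁₁ + Φ₂₁ + ΦDD + 2 * (Φ₁₁ * Φ₀ + Φ₁ * Φ₀₁) + Φ₂₁ * Φ₀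
    + 2 * Φ₁₁ * Φ₀₁ + Φ₁ * Φ₁₁ with hΛ
  have m1 : (0 : ℝ) ≤ Φ₁₁ * Φ₀ := mul_nonneg n3 n0
  have m2 : (0 : ℝ) ≤ Φ₁ * Φ₀₁ := mul_nonneg n2 n1
  have m3 : (0 : ℝ) ≤ Φ₂₁ * Φ₀ := mul_nonneg n4 n0
  have m4 : (0 : ℝ) ≤ Φ₁₁ * Φ₀₁ := mul_nonneg n3 n1
  have m5 : (0 : ℝ) ≤ Φ₁ * Φ₁₁ := mul_nonneg n2 n3
  have hmul : ∀ x y, ‖derivMul φ x - derivMul φ y‖ ≤ (Φ₁₁ * Φ₀ + Φ₁ * Φ₀₁) * ‖x - y‖ := by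
    intro x y
    have : derivMul φ x - derivMul φ y = (fderiv ℝ φ x - fderiv ℝ φ y).comp (φ x) +
        (fderiv ℝ φ y).comp (φ x - φ y) := by
      simp only [derivMul, ContinuousLinearMap.sub_comp, ContinuousLinearMap.comp_sub]; abel
    rw [this]
    refine le_trans (ContinuousLinearMap.opNorm_add_le _ _) ?_
    have e1 := ContinuousLinearMap.opNorm_comp_le (fderiv ℝ φ x - fderiv ℝ φ y) (φ x)
    have e2 := ContinuousLinearMap.opNorm_comp_le (fderiv ℝ φ y) (φ x - φ y)
    have e3 : ‖fderiv ℝ φ x - fderiv ℝ φ y‖ * ‖φ x‖ ≤ (Φ₁₁ * ‖x - y‖) * Φ₀ :=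
      mul_le_mul (hlip' x y) (h.bound x) (norm_nonneg _) (by positivity)
    have e4 : ‖fderiv ℝ φ y‖ * ‖φ x - φ y‖ ≤ Φ₁ * (Φ₀₁ * ‖x - y‖) :=
      mul_le_mul (h.bound_deriv y) (hlip x y) (norm_nonneg _) (by positivity)
    linarith
  refine ⟨by linarith, fun y => (h.bound y).trans (by linarith),
    fun x y => (hlip x y).trans (mul_le_mul_of_nonneg_right (by linarith) (norm_nonneg _)),
    fun y => (h.bound_deriv y).trans (by linarith),
    fun x y => (hlip' x y).trans (mul_le_mul_of_nonneg_right (by linarith) (norm_nonneg _)),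
    fun y => (h.bound_deriv_mul y).trans (by linarith),
    fun x y => (hmul x y).trans (mul_le_mul_of_nonneg_right (by linarith) (norm_nonneg _)),
    ?_, ?_, ?_⟩
  · intro a b u k
    have q1 := norm_four_point_le hd hlip hlip' a b u k
    have q2 := norm_four_point_le hd' hlip' hlip'' a b u k
    have r1 := hlip (a + u) (a + k)
    rw [add_sub_add_left_eq_sub] at r1
    have r2 : ‖fderiv ℝ φ (b + k) - fderiv ℝ φ b‖ ≤ Φ₁₁ * ‖k‖ := by
      simpa using hlip' (b + k) b
    have r3 : ‖φ (a + k) - φ (b + k)‖ ≤ Φ₀₁ * ‖a - b‖ := by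
      simpa using hlip (a + k) (b + k)
    have r4 : ‖φ (b + k) - φ b‖ ≤ Φ₀₁ * ‖k‖ := by simpa using hlip (b + k) b
    have r5 := hlip' a b
    have r6 := hmul (a + u) (a + k)
    rw [add_sub_add_left_eq_sub] at r6
    have q1' := norm_four_point_le hd hlip hlip' a b k k
    have q2' := norm_four_point_le hd' hlip' hlip'' a b k k
    rw [sub_self, norm_zero, mul_zero, zero_add] at q1' q2'
    -- The step `u` is first changed to `k`; afterwards the product rule leaves only four-point
    -- differences with equal steps, for which `q1'` and `q2'` contain no term of first order.
    have eqn : derivMul φ (a + u) - derivMul φ a - (derivMul φ (b + k) - derivMul φ b) =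
        (derivMul φ (a + u) - derivMul φ (a + k)) +
        ((fderiv ℝ φ (a + k) - fderiv ℝ φ a - (fderiv ℝ φ (b + k) - fderiv ℝ φ b)).comp (φ (a + k))
        + (fderiv ℝ φ (b + k) - fderiv ℝ φ b).comp (φ (a + k) - φ (b + k))
        + (fderiv ℝ φ a).comp (φ (a + k) - φ a - (φ (b + k) - φ b))
        + (fderiv ℝ φ a - fderiv ℝ φ b).comp (φ (b + k) - φ b)) := by
      simp only [derivMul, ContinuousLinearMap.sub_comp, ContinuousLinearMap.comp_sub]; abel
    rw [eqn]
    have s1 := ContinuousLinearMap.opNorm_comp_le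
      (fderiv ℝ φ (a + k) - fderiv ℝ φ a - (fderiv ℝ φ (b + k) - fderiv ℝ φ b)) (φ (a + k))
    have s2 := ContinuousLinearMap.opNorm_comp_le
      (fderiv ℝ φ (b + k) - fderiv ℝ φ b) (φ (a + k) - φ (b + k))
    have s3 := ContinuousLinearMap.opNorm_comp_le (fderiv ℝ φ a)
      (φ (a + k) - φ a - (φ (b + k) - φ b))
    have s4 := ContinuousLinearMap.opNorm_comp_le (fderiv ℝ φ a - fderiv ℝ φ b) (φ (b + k) - φ b)
    have t1 := mul_le_mul q2' (h.bound (a + k)) (norm_nonneg _) (by positivity)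
    have t2 := mul_le_mul r2 r3 (norm_nonneg _) (by positivity)
    have t3 := mul_le_mul (h.bound_deriv a) q1' (norm_nonneg _) (by positivity)
    have t4 := mul_le_mul r5 r4 (norm_nonneg _) (by positivity)
    refine le_trans (ContinuousLinearMap.opNorm_add_le _ _) ?_
    refine le_trans (add_le_add r6 (le_trans (ContinuousLinearMap.opNorm_add_le _ _) (add_le_add
      (le_trans (ContinuousLinearMap.opNorm_add_le _ _) (add_le_add
        (le_trans (ContinuousLinearMap.opNorm_add_le _ _) (add_le_add (s1.trans t1) (s2.trans t2)))
        (s3.trans t3))) (s4.trans t4)))) ?_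
    have P : 0 ≤ ‖a - b‖ * ‖k‖ := by positivity
    have Q : 0 ≤ ‖u - k‖ := norm_nonneg _
    have l1 : (Φ₁₁ * Φ₀ + Φ₁ * Φ₀₁) * ‖u - k‖ ≤ Λ * ‖u - k‖ :=
      mul_le_mul_of_nonneg_right (by linarith) Q
    have l2 : (Φ₂₁ * Φ₀ + 2 * Φ₁₁ * Φ₀₁ + Φ₁ * Φ₁₁) * (‖a - b‖ * ‖k‖) ≤ Λ * (‖a - b‖ * ‖k‖) :=
      mul_le_mul_of_nonneg_right (by linarith) P
    linarith
  · intro a u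
    have := norm_taylor_sub_le hd n3 hlip' a u 0
    simp only [add_zero, sub_self, map_zero, sub_zero, norm_zero] at this
    rw [← sq] at this
    exact this.trans (mul_le_mul_of_nonneg_right (by linarith) (by positivity))
  · intro a b u k
    have e1 := norm_taylor_sub_le hd n3 hlip' a u k
    have e2 := norm_taylor_sub_le' h.contDiff n4 hlip'' a b k
    refine (norm_sub_le_norm_sub_add_norm_sub _ (φ (a + k) - φ a - fderiv ℝ φ a k) _).trans ?_
    have P : 0 ≤ (‖u‖ + ‖k‖) * ‖u - k‖ := by positivity
    have Q : 0 ≤ ‖k‖ ^ 2 * ‖a - b‖ := by positivity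
    have l1 : Φ₁₁ * ((‖u‖ + ‖k‖) * ‖u - k‖) ≤ Λ * ((‖u‖ + ‖k‖) * ‖u - k‖) :=
      mul_le_mul_of_nonneg_right (by linarith) P
    have l2 : Φ₂₁ * (‖k‖ ^ 2 * ‖a - b‖) ≤ Λ * (‖k‖ ^ 2 * ‖a - b‖) :=
      mul_le_mul_of_nonneg_right (by linarith) Q
    linarith

end SmoothField

/-! ### One step of the second order Euler scheme. -/

section Euler

variable {E F V : Type*} [NormedAddCommGroup E] [NormedSpace ℝ E]
  [NormedAddCommGroup F] [NormedSpace ℝ F] [NormedAddCommGroup V] [NormedSpace ℝ V]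

/-- The error of one step of the second order Euler scheme from `ys` to `yt`. -/
noncomputable def eulerRem (ι : E ⊗[ℝ] E ≃ₗ[ℝ] V) (φ : F → E →L[ℝ] F) (ys yt : F) (x : E)
    (v : V) : F :=
  yt - ys - φ ys x - tensorApply ι (derivMul φ ys) v

variable (ι : E ⊗[ℝ] E ≃ₗ[ℝ] V)

/-- The product term in Chen's relation is what supplies `derivMul φ ys x x'`. It completes the
first difference to a Taylor remainder along `x`, so both surviving terms are of third order when
the local error is. -/
lemma eulerRem_defect (φ : F → E →L[ℝ] F) (ys yu yt : F) (x x' : E) (v v' : V) :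
    eulerRem ι φ ys yt (x + x') (v + v' + ι (x ⊗ₜ[ℝ] x')) - eulerRem ι φ ys yu x v
      - eulerRem ι φ yu yt x' v' =
    (φ yu - φ ys - derivMul φ ys x) x' +
      tensorApply ι (derivMul φ yu - derivMul φ ys) v' := by
  simp only [eulerRem, map_add, tensorApply_add, tensorApply_tmul, sub_tensorApply,
    _root_.sub_apply]
  abel

/-- `μ ≥ 1` dominates the constants of the field `φ` and the norm of the pairing `tensorApply`. -/
structure EulerBound (φ : F → E →L[ℝ] F) (μ : ℝ) : Prop where
  nice : IsNiceField φ μ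
  tensor : ∀ (B : E →L[ℝ] E →L[ℝ] F) (v : V), ‖tensorApply ι B v‖ ≤ μ * ‖B‖ * ‖v‖

variable {ι}

lemma EulerBound.norm_incr_le {φ : F → E →L[ℝ] F} {μ : ℝ} (h : EulerBound ι φ μ) (y : F) {x : E}
    {v : V} {w : ℝ} (hw1 : w ≤ 1) (hx : ‖x‖ ≤ w) (hv : ‖v‖ ≤ w ^ 2) :
    ‖φ y x + tensorApply ι (derivMul φ y) v‖ ≤ 2 * μ ^ 2 * w := by
  have hμ := h.nice.one_le
  have hw : 0 ≤ w := (norm_nonneg _).trans hx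
  have e1 : ‖φ y x‖ ≤ μ * w :=
    ((φ y).le_opNorm x).trans (mul_le_mul (h.nice.bound y) hx (norm_nonneg _) (by linarith))
  have e2 : ‖tensorApply ι (derivMul φ y) v‖ ≤ μ * μ * w ^ 2 := by
    refine (h.tensor _ _).trans ?_
    gcongr
    exact h.nice.derivMul_bound y
  have e3 : μ ≤ μ ^ 2 := by nlinarith
  have e4 : w ^ 2 ≤ w := by nlinarith
  have : μ * μ * w ^ 2 ≤ μ ^ 2 * w := by rw [← sq]; gcongr
  have : μ * w ≤ μ ^ 2 * w := by gcongr
  refine (norm_add_le _ _).trans ?_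
  linarith

/-- Write `yu = ys + z + J` with the Euler increment `z` and its error `J`. The first factor is then
a Lipschitz term in `J`, a Taylor remainder in `z`, and the derivative of `φ` applied to the second
level term. No bound on `J` is assumed: it enters linearly with the small factor `w`, which permits
absorption. -/
lemma EulerBound.norm_defect_le {φ : F → E →L[ℝ] F} {μ : ℝ} (h : EulerBound ι φ μ) (ys yu : F)
    {x x' : E} {v v' : V} {w : ℝ} (hw1 : w ≤ 1) (hx : ‖x‖ ≤ w) (hv : ‖v‖ ≤ w ^ 2)
    (hx' : ‖x'‖ ≤ w) (hv' : ‖v'‖ ≤ w ^ 2) :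
    ‖(φ yu - φ ys - derivMul φ ys x) x' + tensorApply ι (derivMul φ yu - derivMul φ ys) v'‖ ≤
      8 * μ ^ 5 * (w ^ 3 + w * ‖eulerRem ι φ ys yu x v‖) := by
  have hμ := h.nice.one_le
  have hμ0 : 0 ≤ μ := by linarith
  have hw : 0 ≤ w := (norm_nonneg _).trans hx
  set J := eulerRem ι φ ys yu x v with hJ
  set z := φ ys x + tensorApply ι (derivMul φ ys) v with hz
  have hyu : yu = ys + (z + J) := by rw [hz, hJ, eulerRem]; abel
  have hzn : ‖z‖ ≤ 2 * μ ^ 2 * w := h.norm_incr_le ys hw1 hx hv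
  have e1 : ‖φ yu - φ (ys + z)‖ ≤ μ * ‖J‖ := by
    have := h.nice.lip yu (ys + z)
    have e : yu - (ys + z) = J := by rw [hyu]; abel
    rwa [e] at this
  have e2 : ‖φ (ys + z) - φ ys - fderiv ℝ φ ys z‖ ≤ μ * (2 * μ ^ 2 * w) ^ 2 :=
    (h.nice.taylor ys z).trans (by gcongr)
  have e3 : ‖fderiv ℝ φ ys (tensorApply ι (derivMul φ ys) v)‖ ≤ μ * (μ * μ * w ^ 2) := by
    refine ((fderiv ℝ φ ys).le_opNorm _).trans ?_
    refine mul_le_mul (h.nice.deriv_bound ys) ?_ (norm_nonneg _) hμ0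
    refine (h.tensor _ _).trans ?_
    gcongr
    exact h.nice.derivMul_bound ys
  have eP : φ yu - φ ys - derivMul φ ys x = (φ yu - φ (ys + z)) +
      (φ (ys + z) - φ ys - fderiv ℝ φ ys z) +
      fderiv ℝ φ ys (tensorApply ι (derivMul φ ys) v) := by
    rw [hz, map_add]
    simp only [derivMul, ContinuousLinearMap.comp_apply]
    abel
  have hP : ‖φ yu - φ ys - derivMul φ ys x‖ ≤
      μ * ‖J‖ + μ * (2 * μ ^ 2 * w) ^ 2 + μ * (μ * μ * w ^ 2) := by
    rw [eP]
    exact norm_add₃_le.trans (add_le_add (add_le_add e1 e2) e3)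
  have hQ : ‖derivMul φ yu - derivMul φ ys‖ ≤ μ * (2 * μ ^ 2 * w + ‖J‖) := by
    refine (h.nice.derivMul_lip yu ys).trans ?_
    have e : yu - ys = z + J := by rw [hyu]; abel
    rw [e]
    gcongr
    exact (norm_add_le _ _).trans (by gcongr)
  have t1 : ‖(φ yu - φ ys - derivMul φ ys x) x'‖ ≤
      (μ * ‖J‖ + μ * (2 * μ ^ 2 * w) ^ 2 + μ * (μ * μ * w ^ 2)) * w :=
    (ContinuousLinearMap.le_opNorm _ _).trans
      (mul_le_mul hP hx' (norm_nonneg _) ((norm_nonneg _).trans hP))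
  have t2 : ‖tensorApply ι (derivMul φ yu - derivMul φ ys) v'‖ ≤
      μ * (μ * (2 * μ ^ 2 * w + ‖J‖)) * w ^ 2 := by
    refine (h.tensor _ _).trans ?_
    gcongr
  refine (norm_add_le _ _).trans ((add_le_add t1 t2).trans ?_)
  have m1 : μ ≤ μ ^ 5 := by simpa using pow_le_pow_right₀ hμ (show 1 ≤ 5 by norm_num)
  have m2 : μ ^ 2 ≤ μ ^ 5 := pow_le_pow_right₀ hμ (by norm_num)
  have m3 : μ ^ 3 ≤ μ ^ 5 := pow_le_pow_right₀ hμ (by norm_num)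
  have m4 : μ ^ 4 ≤ μ ^ 5 := pow_le_pow_right₀ hμ (by norm_num)
  have hJ0 := norm_nonneg J
  have hw3 : 0 ≤ w ^ 3 := by positivity
  have hwJ : 0 ≤ w * ‖J‖ := by positivity
  have k1 := mul_le_mul_of_nonneg_right m1 hwJ
  have k2 := mul_le_mul_of_nonneg_right m3 hw3
  have k3 := mul_le_mul_of_nonneg_right m4 hw3
  have k4 : μ ^ 2 * (w ^ 2 * ‖J‖) ≤ μ ^ 5 * (w * ‖J‖) := by
    refine mul_le_mul m2 ?_ (by positivity) (by positivity)
    gcongr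
    nlinarith
  have k5 : 0 ≤ μ ^ 5 * w ^ 3 := by positivity
  have k6 : 0 ≤ μ ^ 5 * (w * ‖J‖) := by positivity
  linarith

-- The difference of two defects is expanded by the product rule. Each of the four kinds of
-- discrepancy (base points `d`, first level `ξ`, second level `ζ`, local errors) retains the powers
-- of `w` that complete it to total order three, the local errors again with one factor `w`. Unlike
-- in the estimate of a single defect, the local errors themselves are assumed to be of order three.
set_option maxHeartbeats 800000 in
lemma EulerBound.norm_defect_sub_le {φ : F → E →L[ℝ] F} {μ : ℝ} (h : EulerBound ι φ μ)
    (ys yu zs zu : F) {x x' x₁ x₁' : E} {v v' v₁ v₁' : V} {w ξ ζ d : ℝ} (hw1 : w ≤ 1)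
    (hx : ‖x‖ ≤ w) (hv : ‖v‖ ≤ w ^ 2) (hx' : ‖x'‖ ≤ w) (hv' : ‖v'‖ ≤ w ^ 2)
    (hx₁ : ‖x₁‖ ≤ w) (hv₁ : ‖v₁‖ ≤ w ^ 2)
    (hξ : ‖x - x₁‖ ≤ ξ) (hξ' : ‖x' - x₁'‖ ≤ ξ) (hζ : ‖v - v₁‖ ≤ ζ) (hζ' : ‖v' - v₁'‖ ≤ ζ)
    (hd : ‖ys - zs‖ ≤ d) (hJ : ‖eulerRem ι φ ys yu x v‖ ≤ μ * w ^ 3)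
    (hJ₁ : ‖eulerRem ι φ zs zu x₁ v₁‖ ≤ μ * w ^ 3) :
    ‖((φ yu - φ ys - derivMul φ ys x) x' + tensorApply ι (derivMul φ yu - derivMul φ ys) v') -
      ((φ zu - φ zs - derivMul φ zs x₁) x₁' + tensorApply ι (derivMul φ zu - derivMul φ zs) v₁')‖ ≤
      43 * μ ^ 5 * (d * w ^ 3 + ξ * w ^ 2 + ζ * w +
        w * ‖eulerRem ι φ ys yu x v - eulerRem ι φ zs zu x₁ v₁‖) := by
  have hμ := h.nice.one_le
  have hμ0 : 0 ≤ μ := by linarith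
  have hw : 0 ≤ w := (norm_nonneg _).trans hx
  have hd0 : 0 ≤ d := (norm_nonneg _).trans hd
  have hξ0 : 0 ≤ ξ := (norm_nonneg _).trans hξ
  have hζ0 : 0 ≤ ζ := (norm_nonneg _).trans hζ
  set J := eulerRem ι φ ys yu x v with hJdef
  set J₁ := eulerRem ι φ zs zu x₁ v₁ with hJ₁def
  set j := ‖J - J₁‖ with hj
  have hj0 : 0 ≤ j := norm_nonneg _
  have m1 : 1 ≤ μ ^ 2 := one_le_pow₀ hμ
  have m2 : μ ≤ μ ^ 2 := by nlinarith
  have w2 : w ^ 2 ≤ w := by nlinarith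
  have w3 : w ^ 3 ≤ w ^ 2 := by nlinarith [sq_nonneg w]
  -- the increments
  set a := yu - ys with ha
  set a₁ := zu - zs with ha₁
  -- `R` is the part of the increment beyond the first level; by the assumed bound on the local
  -- error it is of order `w ^ 2`.
  set R := tensorApply ι (derivMul φ ys) v + J with hR
  set R₁ := tensorApply ι (derivMul φ zs) v₁ + J₁ with hR₁
  have eaR : a = φ ys x + R := by rw [hR, hJdef, eulerRem, ha]; abel
  have eaR₁ : a₁ = φ zs x₁ + R₁ := by rw [hR₁, hJ₁def, eulerRem, ha₁]; abel
  have hyu : yu = ys + a := by rw [ha]; abel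
  have hzu : zu = zs + a₁ := by rw [ha₁]; abel
  have nR : ∀ (y : F) (v : V) (J : F), ‖v‖ ≤ w ^ 2 → ‖J‖ ≤ μ * w ^ 3 →
      ‖tensorApply ι (derivMul φ y) v + J‖ ≤ 2 * μ ^ 2 * w ^ 2 := by
    intro y v J hv hJ
    have e2 : ‖tensorApply ι (derivMul φ y) v‖ ≤ μ * μ * w ^ 2 := by
      refine (h.tensor _ _).trans ?_
      gcongr
      exact h.nice.derivMul_bound y
    have : μ * w ^ 3 ≤ μ ^ 2 * w ^ 2 := by gcongr
    refine (norm_add_le _ _).trans ?_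
    linarith
  have nR0 := nR ys v J hv hJ
  have nR1 := nR zs v₁ J₁ hv₁ hJ₁
  have na : ∀ (y : F) (x : E) (R : F), ‖x‖ ≤ w → ‖R‖ ≤ 2 * μ ^ 2 * w ^ 2 →
      ‖φ y x + R‖ ≤ 3 * μ ^ 2 * w := by
    intro y x R hx hR
    have e1 : ‖φ y x‖ ≤ μ * w :=
      ((φ y).le_opNorm x).trans (mul_le_mul (h.nice.bound y) hx (norm_nonneg _) (by linarith))
    have : μ * w ≤ μ ^ 2 * w := by gcongr
    have : μ ^ 2 * w ^ 2 ≤ μ ^ 2 * w := by gcongr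
    refine (norm_add_le _ _).trans ?_
    linarith
  have na0 : ‖a‖ ≤ 3 * μ ^ 2 * w := by rw [eaR]; exact na ys x R hx nR0
  have na1 : ‖a₁‖ ≤ 3 * μ ^ 2 * w := by rw [eaR₁]; exact na zs x₁ R₁ hx₁ nR1
  -- differences
  have dR : ‖R - R₁‖ ≤ μ ^ 2 * (d * w ^ 2 + ζ + j) := by
    have e : R - R₁ = tensorApply ι (derivMul φ ys - derivMul φ zs) v +
        tensorApply ι (derivMul φ zs) (v - v₁) + (J - J₁) := by
      rw [hR, hR₁, sub_tensorApply, tensorApply_sub]; abel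
    have b1 : ‖tensorApply ι (derivMul φ ys - derivMul φ zs) v‖ ≤ μ * (μ * d) * w ^ 2 := by
      refine (h.tensor _ _).trans ?_
      gcongr
      exact (h.nice.derivMul_lip ys zs).trans (by gcongr)
    have b2 : ‖tensorApply ι (derivMul φ zs) (v - v₁)‖ ≤ μ * μ * ζ := by
      refine (h.tensor _ _).trans ?_
      gcongr
      exact h.nice.derivMul_bound zs
    have b3 : j ≤ μ ^ 2 * j := le_mul_of_one_le_left hj0 m1
    rw [e]
    refine norm_add₃_le.trans ?_
    linarith
  have da : ‖a - a₁‖ ≤ 2 * μ ^ 2 * (d * w + ξ + ζ + j) := by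
    have e : a - a₁ = (φ ys - φ zs) x + φ zs (x - x₁) + (R - R₁) := by
      rw [eaR, eaR₁, _root_.sub_apply, map_sub]; abel
    have b1 : ‖(φ ys - φ zs) x‖ ≤ (μ * d) * w :=
      (ContinuousLinearMap.le_opNorm _ _).trans (mul_le_mul
        ((h.nice.lip ys zs).trans (by gcongr)) hx (norm_nonneg _) (by positivity))
    have b2 : ‖φ zs (x - x₁)‖ ≤ μ * ξ :=
      (ContinuousLinearMap.le_opNorm _ _).trans (mul_le_mul
        (h.nice.bound zs) hξ (norm_nonneg _) (by positivity))
    have c1 : μ * d * w ≤ μ ^ 2 * d * w := by gcongr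
    have c2 : μ * ξ ≤ μ ^ 2 * ξ := by gcongr
    have c3 : μ ^ 2 * (d * w ^ 2) ≤ μ ^ 2 * (d * w) := by gcongr
    have p1 : 0 ≤ μ ^ 2 * ξ := by positivity
    have p2 : 0 ≤ μ ^ 2 * ζ := by positivity
    have p3 : 0 ≤ μ ^ 2 * j := by positivity
    rw [e]
    refine norm_add₃_le.trans ?_
    linarith
  -- the first factor
  set S := d * w ^ 2 + ξ * w + ζ + j with hS
  have hS0 : 0 ≤ S := by positivity
  set T := φ yu - φ ys - fderiv ℝ φ ys a with hT
  set T₁ := φ zu - φ zs - fderiv ℝ φ zs a₁ with hT₁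
  have eP : φ yu - φ ys - derivMul φ ys x = T + fderiv ℝ φ ys R := by
    rw [hT, eaR, map_add]; simp only [derivMul, ContinuousLinearMap.comp_apply]; abel
  have eP₁ : φ zu - φ zs - derivMul φ zs x₁ = T₁ + fderiv ℝ φ zs R₁ := by
    rw [hT₁, eaR₁, map_add]; simp only [derivMul, ContinuousLinearMap.comp_apply]; abel
  have m5 : μ ^ 3 ≤ μ ^ 5 := pow_le_pow_right₀ hμ (by norm_num)
  have nP₁ : ‖T₁ + fderiv ℝ φ zs R₁‖ ≤ 11 * μ ^ 5 * w ^ 2 := by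
    have b1 : ‖T₁‖ ≤ μ * (3 * μ ^ 2 * w) ^ 2 := by
      have := h.nice.taylor zs a₁
      rw [← hzu] at this
      exact this.trans (by gcongr)
    have b2 : ‖fderiv ℝ φ zs R₁‖ ≤ μ * (2 * μ ^ 2 * w ^ 2) :=
      (ContinuousLinearMap.le_opNorm _ _).trans (mul_le_mul (h.nice.deriv_bound zs) nR1
        (norm_nonneg _) hμ0)
    have c : μ ^ 3 * w ^ 2 ≤ μ ^ 5 * w ^ 2 := by gcongr
    refine (norm_add_le _ _).trans ?_
    linarith
  have dP : ‖(T + fderiv ℝ φ ys R) - (T₁ + fderiv ℝ φ zs R₁)‖ ≤ 24 * μ ^ 5 * S := by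
    have b1 : ‖T - T₁‖ ≤ 21 * μ ^ 5 * S := by
      have := h.nice.taylor_sub ys zs a a₁
      rw [← hyu, ← hzu] at this
      refine this.trans ?_
      have c1 : (‖a‖ + ‖a₁‖) * ‖a - a₁‖ ≤
          (3 * μ ^ 2 * w + 3 * μ ^ 2 * w) * (2 * μ ^ 2 * (d * w + ξ + ζ + j)) := by gcongr
      have c2 : ‖a₁‖ ^ 2 * ‖ys - zs‖ ≤ (3 * μ ^ 2 * w) ^ 2 * d := by gcongr
      have c3 : w * (d * w + ξ + ζ + j) ≤ S := by
        have : w * ζ ≤ ζ := mul_le_of_le_one_left hζ0 hw1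
        have : w * j ≤ j := mul_le_of_le_one_left hj0 hw1
        rw [hS]; linarith
      have c4 : w ^ 2 * d ≤ S := by
        rw [hS]; linarith [mul_nonneg hξ0 hw]
      calc μ * ((‖a‖ + ‖a₁‖) * ‖a - a₁‖ + ‖a₁‖ ^ 2 * ‖ys - zs‖)
          ≤ μ * ((3 * μ ^ 2 * w + 3 * μ ^ 2 * w) * (2 * μ ^ 2 * (d * w + ξ + ζ + j)) +
              (3 * μ ^ 2 * w) ^ 2 * d) := by gcongr
        _ = 12 * μ ^ 5 * (w * (d * w + ξ + ζ + j)) + 9 * μ ^ 5 * (w ^ 2 * d) := by ring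
        _ ≤ 12 * μ ^ 5 * S + 9 * μ ^ 5 * S := by gcongr
        _ = _ := by ring
    have b2 : ‖(fderiv ℝ φ ys - fderiv ℝ φ zs) R‖ ≤ (μ * d) * (2 * μ ^ 2 * w ^ 2) :=
      (ContinuousLinearMap.le_opNorm _ _).trans (mul_le_mul
        ((h.nice.deriv_lip ys zs).trans (by gcongr)) nR0 (norm_nonneg _) (by positivity))
    have b3 : ‖fderiv ℝ φ zs (R - R₁)‖ ≤ μ * (μ ^ 2 * (d * w ^ 2 + ζ + j)) :=
      (ContinuousLinearMap.le_opNorm _ _).trans (mul_le_mul (h.nice.deriv_bound zs) dR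
        (norm_nonneg _) hμ0)
    have b4 : (μ * d) * (2 * μ ^ 2 * w ^ 2) + μ * (μ ^ 2 * (d * w ^ 2 + ζ + j)) ≤
        3 * μ ^ 5 * S := by
      have c1 : d * w ^ 2 * 2 + (d * w ^ 2 + ζ + j) ≤ 3 * S := by
        rw [hS]; linarith [mul_nonneg hξ0 hw]
      calc _ = μ ^ 3 * (d * w ^ 2 * 2 + (d * w ^ 2 + ζ + j)) := by ring
        _ ≤ μ ^ 5 * (3 * S) := by gcongr
        _ = _ := by ring
    have e : (T + fderiv ℝ φ ys R) - (T₁ + fderiv ℝ φ zs R₁) =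
        (T - T₁) + (fderiv ℝ φ ys - fderiv ℝ φ zs) R + fderiv ℝ φ zs (R - R₁) := by
      rw [_root_.sub_apply, map_sub]; abel
    rw [e]
    refine norm_add₃_le.trans ?_
    linarith
  -- the second factor
  set Q := derivMul φ yu - derivMul φ ys with hQ
  set Q₁ := derivMul φ zu - derivMul φ zs with hQ₁
  have nQ₁ : ‖Q₁‖ ≤ 3 * μ ^ 3 * w := by
    refine (h.nice.derivMul_lip zu zs).trans ?_
    calc μ * ‖zu - zs‖ ≤ μ * (3 * μ ^ 2 * w) := by gcongr
      _ = _ := by ring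
  have dQ : ‖Q - Q₁‖ ≤ 5 * μ ^ 3 * (d * w + ξ + ζ + j) := by
    have := h.nice.derivMul_four ys zs a a₁
    rw [← hyu, ← hzu] at this
    refine this.trans ?_
    have c2 : ‖ys - zs‖ * ‖a₁‖ ≤ d * (3 * μ ^ 2 * w) := by gcongr
    calc μ * (‖a - a₁‖ + ‖ys - zs‖ * ‖a₁‖)
        ≤ μ * (2 * μ ^ 2 * (d * w + ξ + ζ + j) + d * (3 * μ ^ 2 * w)) := by gcongr
      _ = 5 * μ ^ 3 * (d * w + ξ + ζ + j) - 3 * μ ^ 3 * (ξ + ζ + j) := by ring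
      _ ≤ _ := by
        have : 0 ≤ 3 * μ ^ 3 * (ξ + ζ + j) := by positivity
        linarith
  rw [eP, eP₁]
  set P := T + fderiv ℝ φ ys R
  set P₁ := T₁ + fderiv ℝ φ zs R₁
  have e : P x' + tensorApply ι Q v' - (P₁ x₁' + tensorApply ι Q₁ v₁') =
      (P - P₁) x' + P₁ (x' - x₁') + tensorApply ι (Q - Q₁) v' + tensorApply ι Q₁ (v' - v₁') := by
    rw [_root_.sub_apply, map_sub, sub_tensorApply ι Q Q₁, tensorApply_sub]; abel
  have f1 : ‖(P - P₁) x'‖ ≤ 24 * μ ^ 5 * S * w :=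
    (ContinuousLinearMap.le_opNorm _ _).trans (mul_le_mul dP hx' (norm_nonneg _) (by positivity))
  have f2 : ‖P₁ (x' - x₁')‖ ≤ 11 * μ ^ 5 * w ^ 2 * ξ :=
    (ContinuousLinearMap.le_opNorm _ _).trans (mul_le_mul nP₁ hξ' (norm_nonneg _) (by positivity))
  have f3 : ‖tensorApply ι (Q - Q₁) v'‖ ≤ μ * (5 * μ ^ 3 * (d * w + ξ + ζ + j)) * w ^ 2 := by
    refine (h.tensor _ _).trans ?_
    gcongr
  have f4 : ‖tensorApply ι Q₁ (v' - v₁')‖ ≤ μ * (3 * μ ^ 3 * w) * ζ := by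
    refine (h.tensor _ _).trans ?_
    gcongr
  rw [e]
  have m4 : μ ^ 4 ≤ μ ^ 5 := pow_le_pow_right₀ hμ (by norm_num)
  have g1 : (d * w + ξ + ζ + j) * w ^ 2 ≤ d * w ^ 3 + ξ * w ^ 2 + ζ * w + w * j := by
    have : ζ * w ^ 2 ≤ ζ * w := by gcongr
    have : j * w ^ 2 ≤ j * w := by gcongr
    linarith
  have g2 : μ * (5 * μ ^ 3 * (d * w + ξ + ζ + j)) * w ^ 2 ≤
      5 * μ ^ 5 * (d * w ^ 3 + ξ * w ^ 2 + ζ * w + w * j) := by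
    calc _ = 5 * μ ^ 4 * ((d * w + ξ + ζ + j) * w ^ 2) := by ring
      _ ≤ _ := by gcongr
  have g3 : μ * (3 * μ ^ 3 * w) * ζ ≤ 3 * μ ^ 5 * (ζ * w) := by
    calc _ = 3 * μ ^ 4 * (ζ * w) := by ring
      _ ≤ _ := by gcongr
  have g4 : 24 * μ ^ 5 * S * w = 24 * μ ^ 5 * (d * w ^ 3 + ξ * w ^ 2 + ζ * w + w * j) := by
    rw [hS]; ring
  have p1 : 0 ≤ μ ^ 5 * (d * w ^ 3) := by positivity
  have p2 : 0 ≤ μ ^ 5 * (ξ * w ^ 2) := by positivity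
  have p3 : 0 ≤ μ ^ 5 * (ζ * w) := by positivity
  have p4 : 0 ≤ μ ^ 5 * (w * j) := by positivity
  refine (norm_add₄_le).trans ?_
  linarith

end Euler

/-! ### Davie's estimate and the stability of local errors. -/

lemma rpow_two_div {x r : ℝ} (hx : 0 ≤ x) : x ^ (2 / r) = (x ^ (1 / r)) ^ 2 := by
  rw [← Real.rpow_natCast, ← Real.rpow_mul hx]; congr 1; push_cast; ring

lemma rpow_three_div {x r : ℝ} (hx : 0 ≤ x) : x ^ (3 / r) = (x ^ (1 / r)) ^ 3 := by
  rw [← Real.rpow_natCast, ← Real.rpow_mul hx]; congr 1; push_cast; ring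

section Rough

variable {E F V : Type*} [NormedAddCommGroup E] [NormedSpace ℝ E]
  [NormedAddCommGroup F] [NormedSpace ℝ F] [NormedAddCommGroup V] [NormedSpace ℝ V]

/-- `(X, XX)` is a rough path on `[a, b]` that is controlled by `ω` with exponent `r`. -/
structure IsRoughOn (ι : E ⊗[ℝ] E ≃ₗ[ℝ] V) (a b r : ℝ) (ω : ℝ → ℝ → ℝ) (X : ℝ → ℝ → E)
    (XX : ℝ → ℝ → V) : Prop where
  ctrl : IsControl a b ω
  additive : ∀ s u t, a ≤ s → s ≤ u → u ≤ t → t ≤ b → X s t = X s u + X u t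
  chen : ∀ s u t, a ≤ s → s ≤ u → u ≤ t → t ≤ b →
    XX s t = XX s u + XX u t + ι (X s u ⊗ₜ[ℝ] X u t)
  fst : ∀ s t, a ≤ s → s ≤ t → t ≤ b → ‖X s t‖ ≤ ω s t ^ (1 / r)
  snd : ∀ s t, a ≤ s → s ≤ t → t ≤ b → ‖XX s t‖ ≤ ω s t ^ (2 / r)

variable {ι : E ⊗[ℝ] E ≃ₗ[ℝ] V} {a b r : ℝ} {ω ω₁ ω₃ : ℝ → ℝ → ℝ} {X X₁ : ℝ → ℝ → E}
  {XX XX₁ : ℝ → ℝ → V} {φ : F → E →L[ℝ] F} {μ : ℝ} {Y Y₁ : ℝ → F}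

lemma IsRoughOn.restrict (h : IsRoughOn ι a b r ω X XX) {a' b' : ℝ} (ha : a ≤ a')
    (hb : b' ≤ b) : IsRoughOn ι a' b' r ω X XX :=
  ⟨h.ctrl.restrict ha hb,
    fun s u t h1 h2 h3 h4 => h.additive s u t (ha.trans h1) h2 h3 (h4.trans hb),
    fun s u t h1 h2 h3 h4 => h.chen s u t (ha.trans h1) h2 h3 (h4.trans hb),
    fun s t h1 h2 h3 => h.fst s t (ha.trans h1) h2 (h3.trans hb),
    fun s t h1 h2 h3 => h.snd s t (ha.trans h1) h2 (h3.trans hb)⟩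

/-- The local error of the second order Euler expansion of `Y`. -/
noncomputable def pathRem (ι : E ⊗[ℝ] E ≃ₗ[ℝ] V) (φ : F → E →L[ℝ] F) (X : ℝ → ℝ → E)
    (XX : ℝ → ℝ → V) (Y : ℝ → F) (s t : ℝ) : F := eulerRem ι φ (Y s) (Y t) (X s t) (XX s t)

lemma IsRoughOn.bounds (h : IsRoughOn ι a b r ω X XX) (hr : 0 < r) {s u v t : ℝ} (has : a ≤ s)
    (hsu : s ≤ u) (huv : u ≤ v) (hvt : v ≤ t) (htb : t ≤ b) :
    ‖X u v‖ ≤ ω s t ^ (1 / r) ∧ ‖XX u v‖ ≤ (ω s t ^ (1 / r)) ^ 2 := by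
  have h0 := h.ctrl.nonneg u v (has.trans hsu) huv (hvt.trans htb)
  have hm := h.ctrl.mono has hsu huv hvt htb
  constructor
  · exact (h.fst u v (has.trans hsu) huv (hvt.trans htb)).trans
      (Real.rpow_le_rpow h0 hm (by positivity))
  · rw [← rpow_two_div (h0.trans hm)]
    exact (h.snd u v (has.trans hsu) huv (hvt.trans htb)).trans
      (Real.rpow_le_rpow h0 hm (by positivity))

lemma IsControl.rpow_le_one (h : IsControl a b ω) (hr : 0 < r) (h1 : ω a b ≤ 1) {s t : ℝ}
    (has : a ≤ s) (hst : s ≤ t) (htb : t ≤ b) : ω s t ^ (1 / r) ≤ 1 :=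
  Real.rpow_le_one (h.nonneg s t has hst htb)
    ((h.mono le_rfl has hst htb le_rfl).trans h1) (by positivity)

lemma IsControl.rpow_le (h : IsControl a b ω) {e : ℝ} (he : 0 ≤ e) {s t : ℝ}
    (has : a ≤ s) (hst : s ≤ t) (htb : t ≤ b) : ω s t ^ e ≤ ω a b ^ e :=
  Real.rpow_le_rpow (h.nonneg s t has hst htb) (h.mono le_rfl has hst htb le_rfl) he

lemma IsRoughOn.pathRem_defect (h : IsRoughOn ι a b r ω X XX) {s u t : ℝ} (has : a ≤ s)
    (hsu : s ≤ u) (hut : u ≤ t) (htb : t ≤ b) :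
    pathRem ι φ X XX Y s t - pathRem ι φ X XX Y s u - pathRem ι φ X XX Y u t =
      (φ (Y u) - φ (Y s) - derivMul φ (Y s) (X s u)) (X u t) +
        tensorApply ι (derivMul φ (Y u) - derivMul φ (Y s)) (XX u t) := by
  rw [← eulerRem_defect ι φ (Y s) (Y u) (Y t) (X s u) (X u t) (XX s u) (XX u t)]
  rw [← h.additive s u t has hsu hut htb, ← h.chen s u t has hsu hut htb]
  rfl

/-- The error over `[s, u]` reappears with the factor `ω s t ^ (1 / r)`, which is small on a short
interval. This is the form in which `sewing_absorb` can remove it. -/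
lemma IsRoughOn.norm_pathRem_defect_le (h : IsRoughOn ι a b r ω X XX) (hφ : EulerBound ι φ μ)
    (hr : 0 < r) (h1 : ω a b ≤ 1) {s u t : ℝ} (has : a ≤ s) (hsu : s ≤ u) (hut : u ≤ t)
    (htb : t ≤ b) :
    ‖pathRem ι φ X XX Y s t - pathRem ι φ X XX Y s u - pathRem ι φ X XX Y u t‖ ≤
      8 * μ ^ 5 * (ω s t ^ (3 / r) + ω s t ^ (1 / r) * ‖pathRem ι φ X XX Y s u‖) := by
  have hst := hsu.trans hut
  rw [h.pathRem_defect has hsu hut htb, rpow_three_div (h.ctrl.nonneg s t has hst htb)]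
  exact hφ.norm_defect_le (Y s) (Y u) (h.ctrl.rpow_le_one hr h1 has hst htb)
    (h.bounds hr has le_rfl hsu hut htb).1 (h.bounds hr has le_rfl hsu hut htb).2
    (h.bounds hr has hsu hut le_rfl htb).1 (h.bounds hr has hsu hut le_rfl htb).2

lemma sum_pathRem {s t : ℝ} {n : ℕ} {u : ℕ → ℝ} (hu : IsPart s t n u) :
    ∑ k ∈ Finset.range n, pathRem ι φ X XX Y (u k) (u (k + 1)) = (Y t - Y s) -
      ∑ k ∈ Finset.range n, (φ (Y (u k)) (X (u k) (u (k + 1))) +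
        tensorApply ι (derivMul φ (Y (u k))) (XX (u k) (u (k + 1)))) := by
  have := Finset.sum_range_sub (fun k => Y (u k)) n
  rw [hu.zero, hu.eq_of_le n le_rfl] at this
  rw [← this, ← Finset.sum_sub_distrib]
  refine Finset.sum_congr rfl fun k _ => ?_
  simp only [pathRem, eulerRem]
  abel

/-- A solution with a remainder of finite variation satisfies the Davie estimate. -/
theorem IsRoughOn.norm_pathRem_le_of_limit {o : ℝ} {y₀ : F} {ω' : ℝ → ℝ → ℝ}
    (h : IsRoughOn ι a b r ω X XX) (hφ : EulerBound ι φ μ) (hr : 0 < r) (hr3 : r < 3)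
    (hoa : o ≤ a) (hsol : ∀ t ∈ Icc a b, IsPartitionLimit
      (fun u v => φ (Y u) (X u v) + tensorApply ι (derivMul φ (Y u)) (XX u v)) o t (Y t - y₀))
    (hω' : IsControl a b ω')
    (hY : ∀ s t, a ≤ s → s ≤ t → t ≤ b → ‖Y t - Y s - φ (Y s) (X s t)‖ ≤ ω' s t ^ (2 / r))
    (h1 : ω a b ≤ 1) (hsm : sewConst (3 / r) * (8 * μ ^ 5 * ω a b ^ (1 / r)) ≤ 1 / 2)
    {s t : ℝ} (has : a ≤ s) (hst : s ≤ t) (htb : t ≤ b) :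
    ‖pathRem ι φ X XX Y s t‖ ≤ 2 * (sewConst (3 / r) * (8 * μ ^ 5)) * ω s t ^ (3 / r) := by
  have hθ : 1 < 3 / r := by rwa [lt_div_iff₀ hr, one_mul]
  have hμ := hφ.nice.one_le
  have hμ0 : 0 ≤ μ := by linarith
  set A : ℝ → ℝ → F := fun u v => φ (Y u) (X u v) + tensorApply ι (derivMul φ (Y u)) (XX u v)
    with hA
  have hpart : ∀ s t, a ≤ s → s ≤ t → t ≤ b → ∀ ε > 0, ∃ n u, IsPart s t n u ∧
      ‖∑ k ∈ Finset.range n, A (u k) (u (k + 1)) - (Y t - Y s)‖ ≤ ε := by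
    intro s t has hst htb ε hε
    have := (hsol s ⟨has, hst.trans htb⟩).exists_isPart (hoa.trans has) hst
      (hsol t ⟨has.trans hst, htb⟩) hε
    simpa using this
  have hω'' := h.ctrl.add hω'
  set B : ℝ := 8 * μ ^ 5 * (2 + μ ^ 2) with hB
  -- A crude bound, used to start the absorption: since the remainder of `Y` is of order `2 / r` in
  -- `ω'`, the local error is of order `W ^ 2` and the defect of order `W ^ 3`. The control `ω'`
  -- need not be small on short intervals.
  have hAdef : ∀ s u t, a ≤ s → s ≤ u → u ≤ t → t ≤ b →
      ‖A s t - A s u - A u t‖ ≤ B * (ω s t + ω' s t) ^ (3 / r) := by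
    intro s u t has hsu hut htb
    have hst := hsu.trans hut
    have e : A s t - A s u - A u t = -(pathRem ι φ X XX Y s t - pathRem ι φ X XX Y s u -
        pathRem ι φ X XX Y u t) := by
      simp only [hA, pathRem, eulerRem]; abel
    rw [e, norm_neg]
    refine (h.norm_pathRem_defect_le hφ hr h1 has hsu hut htb).trans ?_
    have p1 := h.ctrl.nonneg s t has hst htb
    have p2 := hω'.nonneg s t has hst htb
    set W := (ω s t + ω' s t) ^ (1 / r) with hW
    have hW0 : 0 ≤ W := Real.rpow_nonneg (add_nonneg p1 p2) _
    have hwW : ω s t ^ (1 / r) ≤ W := Real.rpow_le_rpow p1 (by linarith) (by positivity)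
    have hw'W : ω' s t ^ (1 / r) ≤ W := Real.rpow_le_rpow p2 (by linarith) (by positivity)
    have hrem : ‖pathRem ι φ X XX Y s u‖ ≤ (1 + μ ^ 2) * W ^ 2 := by
      have e : pathRem ι φ X XX Y s u = (Y u - Y s - φ (Y s) (X s u)) -
        tensorApply ι (derivMul φ (Y s)) (XX s u) := rfl
      rw [e]
      have b1 : ‖Y u - Y s - φ (Y s) (X s u)‖ ≤ W ^ 2 := by
        refine (hY s u has hsu (hut.trans htb)).trans ?_
        have := hω'.mono has le_rfl hsu hut htb
        rw [rpow_two_div (hω'.nonneg s u has hsu (hut.trans htb))]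
        have q := Real.rpow_nonneg (hω'.nonneg s u has hsu (hut.trans htb)) (1 / r)
        gcongr
        exact (Real.rpow_le_rpow (hω'.nonneg s u has hsu (hut.trans htb)) this
          (by positivity)).trans hw'W
      have b2 : ‖tensorApply ι (derivMul φ (Y s)) (XX s u)‖ ≤ μ * μ * W ^ 2 := by
        refine (hφ.tensor _ _).trans ?_
        have q := (h.bounds hr has le_rfl hsu hut htb).2
        have q' := Real.rpow_nonneg p1 (1 / r)
        have q'' : ‖XX s u‖ ≤ W ^ 2 := q.trans (by gcongr)
        gcongr
        exact hφ.nice.derivMul_bound _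
      refine (norm_sub_le _ _).trans ?_
      linarith
    rw [rpow_three_div p1, rpow_three_div (add_nonneg p1 p2), ← hW]
    have q' := Real.rpow_nonneg p1 (1 / r)
    calc 8 * μ ^ 5 * ((ω s t ^ (1 / r)) ^ 3 + ω s t ^ (1 / r) * ‖pathRem ι φ X XX Y s u‖)
        ≤ 8 * μ ^ 5 * (W ^ 3 + W * ((1 + μ ^ 2) * W ^ 2)) := by gcongr
      _ = B * W ^ 3 := by rw [hB]; ring
  -- The final bound involves `ω` alone; `ω + ω'` occurs only in the crude one. The sums of local
  -- errors become small because the Riemann sums of `A` approach the increments of `Y`.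
  refine sewing_absorb (pathRem ι φ X XX Y) h.ctrl hω'' hθ (B := 8 * μ ^ 5)
    (b₀ := 8 * μ ^ 5 * ω a b ^ (1 / r)) (K₀ := sewConst (3 / r) * B) (by positivity) ?_ ?_ ?_ ?_
    hsm ?_ has hst htb
  · have := h.ctrl.nonneg a b le_rfl (has.trans (hst.trans htb)) le_rfl
    positivity
  · have := sewConst_pos hθ
    positivity
  · intro s t has hst htb
    refine le_of_forall_pos_le_add fun ε hε => ?_
    obtain ⟨n, u, hu, hε'⟩ := hpart s t has hst htb ε hε
    have := young_sewing A hω'' hθ (by positivity) hAdef has htb hu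
    have e : pathRem ι φ X XX Y s t =
        -(A s t - ∑ k ∈ Finset.range n, A (u k) (u (k + 1))) -
        (∑ k ∈ Finset.range n, A (u k) (u (k + 1)) - (Y t - Y s)) := by
      simp only [hA, pathRem, eulerRem]; abel
    rw [e]
    refine (norm_sub_le _ _).trans ?_
    rw [norm_neg]
    linarith
  · intro s u t has hsu hut htb
    refine (h.norm_pathRem_defect_le hφ hr h1 has hsu hut htb).trans ?_
    have := h.ctrl.rpow_le (e := 1 / r) (by positivity) has (hsu.trans hut) htb
    rw [mul_add, ← mul_assoc (8 * μ ^ 5)]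
    gcongr
  · intro s t has hst htb ε hε
    obtain ⟨n, u, hu, hε'⟩ := hpart s t has hst htb ε hε
    refine ⟨n, u, hu, ?_⟩
    rw [sum_pathRem hu, norm_sub_rev]
    exact hε'

/-- A bound with exponent `θ > 1` says that `I` approximates the increments of the constant path, so
its Riemann sums tend to zero. This verifies the last hypothesis of `sewing_absorb`. -/
lemma IsControl.exists_isPart_sum_le {G : Type*} [NormedAddCommGroup G] {I : ℝ → ℝ → G}
    (hω : IsControl a b ω) (hsmall : IsUnifSmall a b ω)
    {θ L : ℝ} (hθ : 1 < θ) (hL : 0 ≤ L)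
    (hI : ∀ s t, a ≤ s → s ≤ t → t ≤ b → ‖I s t‖ ≤ L * ω s t ^ θ) {s t : ℝ} (has : a ≤ s)
    (hst : s ≤ t) (htb : t ≤ b) {ε : ℝ} (hε : 0 < ε) :
    ∃ n u, IsPart s t n u ∧ ‖∑ k ∈ Finset.range n, I (u k) (u (k + 1))‖ ≤ ε := by
  have key : ∀ t', s ≤ t' → t' ≤ b → IsPartitionLimit I s t' (0 : G) := by
    intro t' hst' ht'b
    have := isPartitionLimit_of_le (F := G) (A := I) (Y := fun _ => 0) hst'
      (hω.restrict has ht'b) (fun ε hε => by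
        obtain ⟨η, hη, h⟩ := hsmall ε hε
        exact ⟨η, hη, fun x y h1 h2 h3 => h x y (has.trans h1) h2 (h3.trans ht'b)⟩) hθ hL
      (fun x y h1 h2 h3 => by
        simpa using hI x y (has.trans h1) h2 (h3.trans ht'b))
    simpa using this
  have := (key s le_rfl (hst.trans htb)).exists_isPart le_rfl hst (key t hst htb) hε
  simpa using this

/-- The constant in the stability estimate for the local errors. -/
noncomputable def stabConst (r μ : ℝ) : ℝ :=
  2 * (sewConst (3 / r) * (3 * (43 * μ ^ 5))) * 3 ^ (3 / r)

lemma stabConst_nonneg {r μ : ℝ} (hr : 0 < r) (hr3 : r < 3) (hμ : 0 ≤ μ) :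
    0 ≤ stabConst r μ := by
  have := sewConst_pos (θ := 3 / r) (by rwa [lt_div_iff₀ hr, one_mul])
  unfold stabConst
  positivity

/-- Stability of the local errors of two paths that satisfy the Davie estimate. -/
theorem IsRoughOn.norm_pathRem_sub_le (h : IsRoughOn ι a b r ω X XX)
    (h₁ : IsRoughOn ι a b r ω X₁ XX₁) (hφ : EulerBound ι φ μ) (hr : 0 < r) (hr3 : r < 3)
    (hsmall : IsUnifSmall a b ω) (hω₁ : IsControl a b ω₁) (hω₃ : IsControl a b ω₃)
    (hX : ∀ s t, a ≤ s → s ≤ t → t ≤ b → ‖X s t - X₁ s t‖ ≤ ω₁ s t ^ (1 / r))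
    (hXX : ∀ s t, a ≤ s → s ≤ t → t ≤ b → ‖XX s t - XX₁ s t‖ ≤ ω₃ s t ^ (2 / r))
    (hY : ∀ s t, a ≤ s → s ≤ t → t ≤ b → ‖pathRem ι φ X XX Y s t‖ ≤ μ * ω s t ^ (3 / r))
    (hY₁ : ∀ s t, a ≤ s → s ≤ t → t ≤ b → ‖pathRem ι φ X₁ XX₁ Y₁ s t‖ ≤ μ * ω s t ^ (3 / r))
    (h1 : ω a b ≤ 1) (hsm : sewConst (3 / r) * (43 * μ ^ 5 * ω a b ^ (1 / r)) ≤ 1 / 2)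
    {D : ℝ} (hD : ∀ t, a ≤ t → t ≤ b → ‖Y t - Y₁ t‖ ≤ D)
    {s t : ℝ} (has : a ≤ s) (hst : s ≤ t) (htb : t ≤ b) :
    ‖pathRem ι φ X XX Y s t - pathRem ι φ X₁ XX₁ Y₁ s t‖ ≤ stabConst r μ *
      (D * (ω s t ^ (1 / r)) ^ 3 + ω₁ s t ^ (1 / r) * (ω s t ^ (1 / r)) ^ 2 +
        ω₃ s t ^ (2 / r) * ω s t ^ (1 / r)) := by
  have hθ : 1 < 3 / r := by rwa [lt_div_iff₀ hr, one_mul]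
  have hμ := hφ.nice.one_le
  have hμ0 : 0 ≤ μ := by linarith
  have hD0 : 0 ≤ D := (norm_nonneg _).trans (hD s has (hst.trans htb))
  have hS := sewConst_pos hθ
  -- The powers `3 / r` of these functions are the three terms of the estimate. The first is a
  -- multiple of `ω`, the other two are geometric means with exponents adding to one, so all are
  -- controls.
  set c₁ : ℝ → ℝ → ℝ := fun s t => D ^ (r / 3) * ω s t with hc₁
  set c₂ : ℝ → ℝ → ℝ := fun s t => ω₁ s t ^ (1 / 3 : ℝ) * ω s t ^ (2 / 3 : ℝ) with hc₂
  set c₃ : ℝ → ℝ → ℝ := fun s t => ω₃ s t ^ (2 / 3 : ℝ) * ω s t ^ (1 / 3 : ℝ) with hc₃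
  have C₁ : IsControl a b c₁ := h.ctrl.const_mul (Real.rpow_nonneg hD0 _)
  have C₂ : IsControl a b c₂ := hω₁.rpow_mul_rpow h.ctrl (by norm_num) (by norm_num) (by norm_num)
  have C₃ : IsControl a b c₃ := hω₃.rpow_mul_rpow h.ctrl (by norm_num) (by norm_num) (by norm_num)
  have C := (C₁.add C₂).add C₃
  have e₁ : ∀ s t, a ≤ s → s ≤ t → t ≤ b → c₁ s t ^ (3 / r) = D * (ω s t ^ (1 / r)) ^ 3 := by
    intro s t has hst htb
    have p := h.ctrl.nonneg s t has hst htb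
    rw [hc₁, Real.mul_rpow (Real.rpow_nonneg hD0 _) p, ← Real.rpow_mul hD0, rpow_three_div p]
    have : r / 3 * (3 / r) = 1 := by field_simp
    rw [this, Real.rpow_one]
  have e₂ : ∀ s t, a ≤ s → s ≤ t → t ≤ b → c₂ s t ^ (3 / r) =
      ω₁ s t ^ (1 / r) * (ω s t ^ (1 / r)) ^ 2 := by
    intro s t has hst htb
    have p := h.ctrl.nonneg s t has hst htb
    have p₁ := hω₁.nonneg s t has hst htb
    rw [hc₂, Real.mul_rpow (Real.rpow_nonneg p₁ _) (Real.rpow_nonneg p _), ← Real.rpow_mul p₁,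
      ← Real.rpow_mul p, ← rpow_two_div p]
    congr 2 <;> field_simp
  have e₃ : ∀ s t, a ≤ s → s ≤ t → t ≤ b → c₃ s t ^ (3 / r) =
      ω₃ s t ^ (2 / r) * ω s t ^ (1 / r) := by
    intro s t has hst htb
    have p := h.ctrl.nonneg s t has hst htb
    have p₁ := hω₃.nonneg s t has hst htb
    rw [hc₃, Real.mul_rpow (Real.rpow_nonneg p₁ _) (Real.rpow_nonneg p _), ← Real.rpow_mul p₁,
      ← Real.rpow_mul p]
    congr 2 <;> field_simp
  have main := sewing_absorb (fun s t => pathRem ι φ X XX Y s t - pathRem ι φ X₁ XX₁ Y₁ s t)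
    C h.ctrl hθ (B := 3 * (43 * μ ^ 5)) (b₀ := 43 * μ ^ 5 * ω a b ^ (1 / r)) (K₀ := 2 * μ)
    (by positivity) (by
      have := h.ctrl.nonneg a b le_rfl (has.trans (hst.trans htb)) le_rfl
      positivity) (by positivity)
    (fun s t h1 h2 h3 => by
      refine (norm_sub_le _ _).trans ?_
      have := hY s t h1 h2 h3
      have := hY₁ s t h1 h2 h3
      linarith)
    (fun s u t has hsu hut htb => by
      have hst := hsu.trans hut
      have p := h.ctrl.nonneg s t has hst htb
      have e : pathRem ι φ X XX Y s t - pathRem ι φ X₁ XX₁ Y₁ s t -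
          (pathRem ι φ X XX Y s u - pathRem ι φ X₁ XX₁ Y₁ s u) -
          (pathRem ι φ X XX Y u t - pathRem ι φ X₁ XX₁ Y₁ u t) =
          (pathRem ι φ X XX Y s t - pathRem ι φ X XX Y s u - pathRem ι φ X XX Y u t) -
          (pathRem ι φ X₁ XX₁ Y₁ s t - pathRem ι φ X₁ XX₁ Y₁ s u - pathRem ι φ X₁ XX₁ Y₁ u t) := by
        abel
      rw [e, h.pathRem_defect has hsu hut htb, h₁.pathRem_defect has hsu hut htb]
      have key := hφ.norm_defect_sub_le (Y s) (Y u) (Y₁ s) (Y₁ u)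
        (x := X s u) (x' := X u t) (x₁ := X₁ s u) (x₁' := X₁ u t) (v := XX s u) (v' := XX u t)
        (v₁ := XX₁ s u) (v₁' := XX₁ u t) (w := ω s t ^ (1 / r)) (ξ := ω₁ s t ^ (1 / r))
        (ζ := ω₃ s t ^ (2 / r)) (d := D) (h.ctrl.rpow_le_one hr h1 has hst htb)
        (h.bounds hr has le_rfl hsu hut htb).1 (h.bounds hr has le_rfl hsu hut htb).2
        (h.bounds hr has hsu hut le_rfl htb).1 (h.bounds hr has hsu hut le_rfl htb).2
        (h₁.bounds hr has le_rfl hsu hut htb).1 (h₁.bounds hr has le_rfl hsu hut htb).2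
        ((hX s u has hsu (hut.trans htb)).trans (Real.rpow_le_rpow
          (hω₁.nonneg s u has hsu (hut.trans htb)) (hω₁.mono has le_rfl hsu hut htb)
          (by positivity)))
        ((hX u t (has.trans hsu) hut htb).trans (Real.rpow_le_rpow
          (hω₁.nonneg u t (has.trans hsu) hut htb) (hω₁.mono has hsu hut le_rfl htb)
          (by positivity)))
        ((hXX s u has hsu (hut.trans htb)).trans (Real.rpow_le_rpow
          (hω₃.nonneg s u has hsu (hut.trans htb)) (hω₃.mono has le_rfl hsu hut htb)
          (by positivity)))
        ((hXX u t (has.trans hsu) hut htb).trans (Real.rpow_le_rpow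
          (hω₃.nonneg u t (has.trans hsu) hut htb) (hω₃.mono has hsu hut le_rfl htb)
          (by positivity)))
        (hD s has (hst.trans htb))
        (by
          rw [← rpow_three_div p]
          refine (hY s u has hsu (hut.trans htb)).trans (mul_le_mul_of_nonneg_left ?_ hμ0)
          exact Real.rpow_le_rpow (h.ctrl.nonneg s u has hsu (hut.trans htb))
            (h.ctrl.mono has le_rfl hsu hut htb) (by positivity))
        (by
          rw [← rpow_three_div p]
          refine (hY₁ s u has hsu (hut.trans htb)).trans (mul_le_mul_of_nonneg_left ?_ hμ0)
          exact Real.rpow_le_rpow (h.ctrl.nonneg s u has hsu (hut.trans htb))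
            (h.ctrl.mono has le_rfl hsu hut htb) (by positivity))
      refine key.trans ?_
      rw [← e₁ s t has hst htb, ← e₂ s t has hst htb, ← e₃ s t has hst htb]
      have q₁ := C₁.nonneg s t has hst htb
      have q₂ := C₂.nonneg s t has hst htb
      have q₃ := C₃.nonneg s t has hst htb
      have l₁ : c₁ s t ^ (3 / r) ≤ (c₁ s t + c₂ s t + c₃ s t) ^ (3 / r) :=
        Real.rpow_le_rpow q₁ (by linarith) (by positivity)
      have l₂ : c₂ s t ^ (3 / r) ≤ (c₁ s t + c₂ s t + c₃ s t) ^ (3 / r) :=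
        Real.rpow_le_rpow q₂ (by linarith) (by positivity)
      have l₃ : c₃ s t ^ (3 / r) ≤ (c₁ s t + c₂ s t + c₃ s t) ^ (3 / r) :=
        Real.rpow_le_rpow q₃ (by linarith) (by positivity)
      have l₄ := h.ctrl.rpow_le (e := 1 / r) (by positivity) has hst htb
      have l₅ : ω s t ^ (1 / r) * ‖pathRem ι φ X XX Y s u - pathRem ι φ X₁ XX₁ Y₁ s u‖ ≤
        ω a b ^ (1 / r) * ‖pathRem ι φ X XX Y s u - pathRem ι φ X₁ XX₁ Y₁ s u‖ := by gcongr
      have hK : 0 ≤ 43 * μ ^ 5 := by positivity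
      have := mul_le_mul_of_nonneg_left (add_le_add (add_le_add (add_le_add l₁ l₂) l₃) l₅) hK
      refine this.trans (le_of_eq ?_)
      ring)
    hsm
    (fun s t has hst htb ε hε => h.ctrl.exists_isPart_sum_le
      (I := fun s t => pathRem ι φ X XX Y s t - pathRem ι φ X₁ XX₁ Y₁ s t) hsmall hθ (L := 2 * μ)
      (by positivity) (fun s t h1 h2 h3 => by
        refine (norm_sub_le _ _).trans ?_
        have := hY s t h1 h2 h3
        have := hY₁ s t h1 h2 h3
        linarith) has hst htb hε) has hst htb
  refine main.trans ?_
  rw [← e₁ s t has hst htb, ← e₂ s t has hst htb, ← e₃ s t has hst htb]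
  have q₁ := C₁.nonneg s t has hst htb
  have q₂ := C₂.nonneg s t has hst htb
  have q₃ := C₃.nonneg s t has hst htb
  -- The sum is at most three times the largest summand.
  have key : (c₁ s t + c₂ s t + c₃ s t) ^ (3 / r) ≤
      3 ^ (3 / r) * (c₁ s t ^ (3 / r) + c₂ s t ^ (3 / r) + c₃ s t ^ (3 / r)) := by
    obtain ⟨m, hm, hm1, hm2, hm3, hmle⟩ : ∃ m : ℝ, 0 ≤ m ∧ c₁ s t ≤ m ∧ c₂ s t ≤ m ∧ c₃ s t ≤ m ∧
        m ^ (3 / r) ≤ c₁ s t ^ (3 / r) + c₂ s t ^ (3 / r) + c₃ s t ^ (3 / r) := by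
      have r₁ := Real.rpow_nonneg q₁ (3 / r)
      have r₂ := Real.rpow_nonneg q₂ (3 / r)
      have r₃ := Real.rpow_nonneg q₃ (3 / r)
      refine ⟨max (c₁ s t) (max (c₂ s t) (c₃ s t)), le_max_of_le_left q₁, le_max_left _ _,
        (le_max_left _ _).trans (le_max_right _ _), (le_max_right _ _).trans (le_max_right _ _), ?_⟩
      rcases max_choice (c₁ s t) (max (c₂ s t) (c₃ s t)) with hc | hc
      · rw [hc]; linarith
      · rw [hc]
        rcases max_choice (c₂ s t) (c₃ s t) with hc' | hc' <;> rw [hc'] <;> linarith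
    calc (c₁ s t + c₂ s t + c₃ s t) ^ (3 / r) ≤ (3 * m) ^ (3 / r) :=
          Real.rpow_le_rpow (by positivity) (by linarith) (by positivity)
      _ = 3 ^ (3 / r) * m ^ (3 / r) := Real.mul_rpow (by norm_num) hm
      _ ≤ _ := by gcongr
  unfold stabConst
  rw [mul_assoc _ ((3 : ℝ) ^ (3 / r))]
  gcongr

end Rough

/-! ### Stability and uniqueness of paths. -/

section Rough

variable {E F V : Type*} [NormedAddCommGroup E] [NormedSpace ℝ E]
  [NormedAddCommGroup F] [NormedSpace ℝ F] [NormedAddCommGroup V] [NormedSpace ℝ V]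
  {ι : E ⊗[ℝ] E ≃ₗ[ℝ] V} {a b r : ℝ} {ω ω₁ ω₃ : ℝ → ℝ → ℝ} {X X₁ : ℝ → ℝ → E}
  {XX XX₁ : ℝ → ℝ → V} {φ : F → E →L[ℝ] F} {μ : ℝ} {Y Y₁ : ℝ → F}

lemma EulerBound.norm_tensor_sub_le (hφ : EulerBound ι φ μ) (y y₁ : F) (v v₁ : V) :
    ‖tensorApply ι (derivMul φ y) v - tensorApply ι (derivMul φ y₁) v₁‖ ≤
      μ ^ 2 * (‖y - y₁‖ * ‖v‖ + ‖v - v₁‖) := by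
  have hμ0 : 0 ≤ μ := by linarith [hφ.nice.one_le]
  have e : tensorApply ι (derivMul φ y) v - tensorApply ι (derivMul φ y₁) v₁ =
      tensorApply ι (derivMul φ y - derivMul φ y₁) v +
        tensorApply ι (derivMul φ y₁) (v - v₁) := by
    rw [sub_tensorApply, tensorApply_sub]; abel
  rw [e]
  refine (norm_add_le _ _).trans ?_
  have b1 : ‖tensorApply ι (derivMul φ y - derivMul φ y₁) v‖ ≤ μ * (μ * ‖y - y₁‖) * ‖v‖ := by
    refine (hφ.tensor _ _).trans ?_
    gcongr
    exact hφ.nice.derivMul_lip y y₁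
  have b2 : ‖tensorApply ι (derivMul φ y₁) (v - v₁)‖ ≤ μ * μ * ‖v - v₁‖ := by
    refine (hφ.tensor _ _).trans ?_
    gcongr
    exact hφ.nice.derivMul_bound y₁
  linarith

lemma EulerBound.norm_apply_sub_le (hφ : EulerBound ι φ μ) (y y₁ : F) (x x₁ : E) :
    ‖φ y x - φ y₁ x₁‖ ≤ μ * (‖y - y₁‖ * ‖x‖ + ‖x - x₁‖) := by
  have hμ0 : 0 ≤ μ := by linarith [hφ.nice.one_le]
  have e : φ y x - φ y₁ x₁ = (φ y - φ y₁) x + φ y₁ (x - x₁) := by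
    rw [_root_.sub_apply, map_sub]; abel
  rw [e]
  have b1 : ‖(φ y - φ y₁) x‖ ≤ (μ * ‖y - y₁‖) * ‖x‖ :=
    (ContinuousLinearMap.le_opNorm _ _).trans (by gcongr; exact hφ.nice.lip y y₁)
  have b2 : ‖φ y₁ (x - x₁)‖ ≤ μ * ‖x - x₁‖ :=
    (ContinuousLinearMap.le_opNorm _ _).trans (by gcongr; exact hφ.nice.bound y₁)
  refine (norm_add_le _ _).trans ?_
  linarith

lemma pathRem_eq (s t : ℝ) : Y t - Y s = φ (Y s) (X s t) +
    tensorApply ι (derivMul φ (Y s)) (XX s t) + pathRem ι φ X XX Y s t := by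
  simp only [pathRem, eulerRem]; abel

/-- The increments of a path that satisfies the Davie estimate. -/
lemma IsRoughOn.norm_incr_le (h : IsRoughOn ι a b r ω X XX) (hφ : EulerBound ι φ μ) (hr : 0 < r)
    (hY : ∀ s t, a ≤ s → s ≤ t → t ≤ b → ‖pathRem ι φ X XX Y s t‖ ≤ μ * ω s t ^ (3 / r))
    (h1 : ω a b ≤ 1) {s t : ℝ} (has : a ≤ s) (hst : s ≤ t) (htb : t ≤ b) :
    ‖Y t - Y s‖ ≤ 3 * μ ^ 2 * ω s t ^ (1 / r) := by
  have hμ := hφ.nice.one_le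
  rw [pathRem_eq (ι := ι) (φ := φ) (X := X) (XX := XX)]
  have hw1 := h.ctrl.rpow_le_one hr h1 has hst htb
  have hw0 := Real.rpow_nonneg (h.ctrl.nonneg s t has hst htb) (1 / r)
  have e1 := hφ.norm_incr_le (Y s) hw1 (h.bounds hr has le_rfl hst le_rfl htb).1
    (h.bounds hr has le_rfl hst le_rfl htb).2
  have e2 := hY s t has hst htb
  rw [rpow_three_div (h.ctrl.nonneg s t has hst htb)] at e2
  have : μ * (ω s t ^ (1 / r)) ^ 3 ≤ μ ^ 2 * ω s t ^ (1 / r) := by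
    refine mul_le_mul (by nlinarith) ?_ (by positivity) (by positivity)
    calc (ω s t ^ (1 / r)) ^ 3 ≤ (ω s t ^ (1 / r)) ^ 1 :=
          pow_le_pow_of_le_one hw0 hw1 (by norm_num)
      _ = _ := pow_one _
  refine (norm_add_le _ _).trans ?_
  linarith

/-- The constant in the stability estimate for the paths. -/
noncomputable def supConst (r μ : ℝ) : ℝ := 2 * (2 * μ ^ 2 + stabConst r μ)

lemma supConst_pos {r μ : ℝ} (hr : 0 < r) (hr3 : r < 3) (hμ : 1 ≤ μ) : 0 < supConst r μ := by
  have := stabConst_nonneg hr hr3 (by linarith : 0 ≤ μ)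
  unfold supConst; positivity

/-- Uniform stability of paths that satisfy the Davie estimate. -/
theorem IsRoughOn.norm_sub_le_of_pathRem (h : IsRoughOn ι a b r ω X XX)
    (h₁ : IsRoughOn ι a b r ω X₁ XX₁) (hφ : EulerBound ι φ μ) (hr : 0 < r) (hr3 : r < 3)
    (hsmall : IsUnifSmall a b ω) (hω₁ : IsControl a b ω₁) (hω₃ : IsControl a b ω₃)
    (hX : ∀ s t, a ≤ s → s ≤ t → t ≤ b → ‖X s t - X₁ s t‖ ≤ ω₁ s t ^ (1 / r))
    (hXX : ∀ s t, a ≤ s → s ≤ t → t ≤ b → ‖XX s t - XX₁ s t‖ ≤ ω₃ s t ^ (2 / r))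
    (hY : ∀ s t, a ≤ s → s ≤ t → t ≤ b → ‖pathRem ι φ X XX Y s t‖ ≤ μ * ω s t ^ (3 / r))
    (hY₁ : ∀ s t, a ≤ s → s ≤ t → t ≤ b → ‖pathRem ι φ X₁ XX₁ Y₁ s t‖ ≤ μ * ω s t ^ (3 / r))
    (h1 : ω a b ≤ 1) (hsm : sewConst (3 / r) * (43 * μ ^ 5 * ω a b ^ (1 / r)) ≤ 1 / 2)
    (hsm' : supConst r μ * ω a b ^ (1 / r) ≤ 1) {t : ℝ} (hat : a ≤ t) (htb : t ≤ b) :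
    ‖Y t - Y₁ t‖ ≤ 2 * ‖Y a - Y₁ a‖ +
      supConst r μ * (ω₁ a b ^ (1 / r) + ω₃ a b ^ (2 / r)) := by
  have hμ := hφ.nice.one_le
  have hμ0 : 0 ≤ μ := by linarith
  have hab := hat.trans htb
  have hst := stabConst_nonneg hr hr3 hμ0
  have hsp := supConst_pos hr hr3 hμ
  set w := ω a b ^ (1 / r) with hw
  have hw0 : 0 ≤ w := Real.rpow_nonneg (h.ctrl.nonneg a b le_rfl hab le_rfl) _
  have hw1 : w ≤ 1 := h.ctrl.rpow_le_one hr h1 le_rfl hab le_rfl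
  set x₁ := ω₁ a b ^ (1 / r) with hx₁
  set x₃ := ω₃ a b ^ (2 / r) with hx₃
  have hx₁0 : 0 ≤ x₁ := Real.rpow_nonneg (hω₁.nonneg a b le_rfl hab le_rfl) _
  have hx₃0 : 0 ≤ x₃ := Real.rpow_nonneg (hω₃.nonneg a b le_rfl hab le_rfl) _
  -- Any uniform bound `K` improves: the contributions proportional to `K` carry a factor `w`, and
  -- `hsm'` makes them at most `K / 2`.
  have step : ∀ K, 0 ≤ K → (∀ t, a ≤ t → t ≤ b → ‖Y t - Y₁ t‖ ≤ K) →
      ∀ t, a ≤ t → t ≤ b → ‖Y t - Y₁ t‖ ≤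
        (‖Y a - Y₁ a‖ + supConst r μ / 2 * (x₁ + x₃)) + K / 2 := by
    intro K hK hYK t hat htb
    have e : Y t - Y₁ t = (Y a - Y₁ a) + (φ (Y a) (X a t) - φ (Y₁ a) (X₁ a t)) +
        (tensorApply ι (derivMul φ (Y a)) (XX a t) -
          tensorApply ι (derivMul φ (Y₁ a)) (XX₁ a t)) +
        (pathRem ι φ X XX Y a t - pathRem ι φ X₁ XX₁ Y₁ a t) := by
      simp only [pathRem, eulerRem]; abel
    have b1 := hφ.norm_apply_sub_le (Y a) (Y₁ a) (X a t) (X₁ a t)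
    have b2 := hφ.norm_tensor_sub_le (Y a) (Y₁ a) (XX a t) (XX₁ a t)
    have b3 := h.norm_pathRem_sub_le h₁ hφ hr hr3 hsmall hω₁ hω₃ hX hXX hY hY₁ h1 hsm hYK
      le_rfl hat htb
    have c0 := hYK a le_rfl hab
    have c1 := (h.bounds hr le_rfl le_rfl hat htb le_rfl).1
    have c2 := (h.bounds hr le_rfl le_rfl hat htb le_rfl).2
    have c3 := (hX a t le_rfl hat htb).trans (hω₁.rpow_le (e := 1 / r) (by positivity)
      le_rfl hat htb)
    have c4 := (hXX a t le_rfl hat htb).trans (hω₃.rpow_le (e := 2 / r) (by positivity)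
      le_rfl hat htb)
    have c5 := h.ctrl.rpow_le (e := 1 / r) (by positivity) le_rfl hat htb
    have c6 := hω₁.rpow_le (e := 1 / r) (by positivity) le_rfl hat htb
    have c7 := hω₃.rpow_le (e := 2 / r) (by positivity) le_rfl hat htb
    have n5 := Real.rpow_nonneg (h.ctrl.nonneg a t le_rfl hat htb) (1 / r)
    have n6 := Real.rpow_nonneg (hω₁.nonneg a t le_rfl hat htb) (1 / r)
    have n7 := Real.rpow_nonneg (hω₃.nonneg a t le_rfl hat htb) (2 / r)
    rw [← hw] at c1 c2 c5
    rw [← hx₁] at c3 c6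
    rw [← hx₃] at c4 c7
    have w2 : w ^ 2 ≤ w := by nlinarith
    have w3 : w ^ 3 ≤ w := by
      calc w ^ 3 ≤ w ^ 1 := pow_le_pow_of_le_one hw0 hw1 (by norm_num)
        _ = w := pow_one w
    have w21 : w ^ 2 ≤ 1 := w2.trans hw1
    have d1 : ‖φ (Y a) (X a t) - φ (Y₁ a) (X₁ a t)‖ ≤ μ ^ 2 * (K * w + x₁ + x₃) := by
      refine b1.trans ?_
      calc μ * (‖Y a - Y₁ a‖ * ‖X a t‖ + ‖X a t - X₁ a t‖) ≤ μ ^ 2 * (K * w + x₁) := by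
            gcongr
            nlinarith
        _ ≤ _ := mul_le_mul_of_nonneg_left (by linarith) (by positivity)
    have d2 : ‖tensorApply ι (derivMul φ (Y a)) (XX a t) -
        tensorApply ι (derivMul φ (Y₁ a)) (XX₁ a t)‖ ≤ μ ^ 2 * (K * w + x₁ + x₃) := by
      refine b2.trans ?_
      calc μ ^ 2 * (‖Y a - Y₁ a‖ * ‖XX a t‖ + ‖XX a t - XX₁ a t‖) ≤ μ ^ 2 * (K * w ^ 2 + x₃) := by
            gcongr
        _ ≤ μ ^ 2 * (K * w + x₃) := by gcongr
        _ ≤ _ := mul_le_mul_of_nonneg_left (by linarith) (by positivity)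
    have d3 : ‖pathRem ι φ X XX Y a t - pathRem ι φ X₁ XX₁ Y₁ a t‖ ≤
        stabConst r μ * (K * w + x₁ + x₃) := by
      refine b3.trans ?_
      calc _ ≤ stabConst r μ * (K * w ^ 3 + x₁ * w ^ 2 + x₃ * w) := by gcongr
        _ ≤ stabConst r μ * (K * w + x₁ * 1 + x₃ * 1) := by gcongr
        _ = _ := by ring
    have hsK : supConst r μ / 2 * (K * w) ≤ K / 2 := by
      have := mul_le_mul_of_nonneg_left hsm' hK
      linarith
    have hdef : supConst r μ / 2 = 2 * μ ^ 2 + stabConst r μ := by unfold supConst; ring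
    rw [e]
    refine norm_add₄_le.trans ?_
    calc _ ≤ ‖Y a - Y₁ a‖ + μ ^ 2 * (K * w + x₁ + x₃) + μ ^ 2 * (K * w + x₁ + x₃) +
          stabConst r μ * (K * w + x₁ + x₃) := by gcongr
      _ = ‖Y a - Y₁ a‖ + supConst r μ / 2 * (x₁ + x₃) + supConst r μ / 2 * (K * w) := by
          rw [hdef]; ring
      _ ≤ _ := by linarith
  -- The a priori bound that starts the iteration: both paths move by at most `3 * μ ^ 2` on the
  -- interval.
  have := le_two_mul_of_forall_improve (ι := Icc a b) (fun t => ‖Y t - Y₁ t‖) (fun _ => 1)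
    (c := ‖Y a - Y₁ a‖ + supConst r μ / 2 * (x₁ + x₃))
    (K₀ := ‖Y a - Y₁ a‖ + 6 * μ ^ 2) (by positivity) (by positivity) (fun _ => zero_le_one)
    (fun t => by
      have e : Y t - Y₁ t = (Y a - Y₁ a) + (Y t - Y a) - (Y₁ t - Y₁ a) := by abel
      have b1 := h.norm_incr_le hφ hr hY h1 le_rfl t.2.1 t.2.2
      have b2 := h₁.norm_incr_le hφ hr hY₁ h1 le_rfl t.2.1 t.2.2
      have b3 := h.ctrl.rpow_le_one hr h1 le_rfl t.2.1 t.2.2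
      have b4 : 3 * μ ^ 2 * ω a t ^ (1 / r) ≤ 3 * μ ^ 2 * 1 := by gcongr
      rw [mul_one, e]
      refine (norm_sub_le _ _).trans ?_
      have := norm_add_le (Y a - Y₁ a) (Y t - Y a)
      linarith)
    (fun K hK hYK t => by
      rw [mul_one]
      exact step K hK (fun t h1 h2 => by simpa using hYK ⟨t, h1, h2⟩) t t.2.1 t.2.2)
    ⟨t, hat, htb⟩
  simp only [mul_one] at this
  refine this.trans (le_of_eq ?_)
  ring

lemma isControl_zero : IsControl a b (fun _ _ => 0) :=
  ⟨fun _ _ _ _ _ => le_rfl, fun _ _ _ _ _ _ _ => by simp⟩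

lemma IsUnifSmall.exists_rpow_le (hsmall : IsUnifSmall a b ω) (hω : IsControl a b ω) {e : ℝ}
    (he : 0 < e) {ε : ℝ} (hε : 0 < ε) :
    ∃ η > 0, ∀ s t, a ≤ s → s ≤ t → t ≤ b → t - s ≤ η → ω s t ^ e ≤ ε := by
  obtain ⟨η, hη, h⟩ := hsmall (ε ^ (1 / e)) (by positivity)
  refine ⟨η, hη, fun s t h1 h2 h3 h4 => ?_⟩
  calc ω s t ^ e ≤ (ε ^ (1 / e)) ^ e :=
        Real.rpow_le_rpow (hω.nonneg s t h1 h2 h3) (h s t h1 h2 h3 h4) he.le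
    _ = ε := by rw [← Real.rpow_mul hε.le, one_div_mul_cancel he.ne', Real.rpow_one]

lemma IsNiceField.mono {Λ ν : ℝ} (hn : IsNiceField φ Λ) (h : Λ ≤ ν) : IsNiceField φ ν :=
  ⟨hn.one_le.trans h, fun y => (hn.bound y).trans h,
    fun x y => (hn.lip x y).trans (by gcongr), fun y => (hn.deriv_bound y).trans h,
    fun x y => (hn.deriv_lip x y).trans (by gcongr), fun y => (hn.derivMul_bound y).trans h,
    fun x y => (hn.derivMul_lip x y).trans (by gcongr),
    fun a b h k => (hn.derivMul_four a b h k).trans (by gcongr),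
    fun a h => (hn.taylor a h).trans (by gcongr),
    fun a b h k => (hn.taylor_sub a b h k).trans (by gcongr)⟩

lemma EulerBound.mono (hφ : EulerBound ι φ μ) {ν : ℝ} (h : μ ≤ ν) : EulerBound ι φ ν :=
  ⟨hφ.nice.mono h, fun B v => (hφ.tensor B v).trans (by gcongr)⟩

/-- Uniqueness of solutions with a remainder of finite variation. -/
theorem IsRoughOn.eqOn_of_limit {y₀ : F} {ω' ω'' : ℝ → ℝ → ℝ}
    (h : IsRoughOn ι a b r ω X XX) (hφ : EulerBound ι φ μ) (hr : 0 < r) (hr3 : r < 3)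
    (hsmall : IsUnifSmall a b ω)
    (hsol : ∀ t ∈ Icc a b, IsPartitionLimit
      (fun u v => φ (Y u) (X u v) + tensorApply ι (derivMul φ (Y u)) (XX u v)) a t (Y t - y₀))
    (hsol₁ : ∀ t ∈ Icc a b, IsPartitionLimit
      (fun u v => φ (Y₁ u) (X u v) + tensorApply ι (derivMul φ (Y₁ u)) (XX u v)) a t (Y₁ t - y₀))
    (hω' : IsControl a b ω')
    (hY : ∀ s t, a ≤ s → s ≤ t → t ≤ b → ‖Y t - Y s - φ (Y s) (X s t)‖ ≤ ω' s t ^ (2 / r))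
    (hω'' : IsControl a b ω'')
    (hY₁ : ∀ s t, a ≤ s → s ≤ t → t ≤ b → ‖Y₁ t - Y₁ s - φ (Y₁ s) (X s t)‖ ≤ ω'' s t ^ (2 / r))
    (h0 : Y a = Y₁ a) : EqOn Y Y₁ (Icc a b) := by
  have hθ : 1 < 3 / r := by rwa [lt_div_iff₀ hr, one_mul]
  have hμ := hφ.nice.one_le
  have hS := sewConst_pos hθ
  -- One constant that serves both as a bound for the field and as the constant in Davie's estimate,
  -- as the stability theorem requires.
  set ν := max μ (2 * (sewConst (3 / r) * (8 * μ ^ 5))) with hν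
  have hφν := hφ.mono (le_max_left μ (2 * (sewConst (3 / r) * (8 * μ ^ 5))))
  rw [← hν] at hφν
  have hν1 := hφν.nice.one_le
  have hsp := supConst_pos hr hr3 hν1
  obtain ⟨ε, hε0, hε1, hε2, hε3, hε4⟩ : ∃ ε : ℝ, 0 < ε ∧ ε ≤ 1 ∧
      sewConst (3 / r) * (8 * μ ^ 5 * ε) ≤ 1 / 2 ∧ sewConst (3 / r) * (43 * ν ^ 5 * ε) ≤ 1 / 2 ∧
      supConst r ν * ε ≤ 1 := by
    set c := 2 + 2 * (sewConst (3 / r) * (8 * μ ^ 5)) + 2 * (sewConst (3 / r) * (43 * ν ^ 5)) +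
      supConst r ν with hc
    have p1 : 0 ≤ sewConst (3 / r) * (8 * μ ^ 5) := by positivity
    have p2 : 0 ≤ sewConst (3 / r) * (43 * ν ^ 5) := by positivity
    have hc0 : 0 < c := by positivity
    refine ⟨1 / c, by positivity, ?_, ?_, ?_, ?_⟩
    · rw [div_le_one hc0]; linarith
    · rw [← mul_assoc, mul_one_div, div_le_div_iff₀ hc0 two_pos]; linarith
    · rw [← mul_assoc, mul_one_div, div_le_div_iff₀ hc0 two_pos]; linarith
    · rw [mul_one_div, div_le_one hc0]; linarith
  obtain ⟨η₁, hη₁, H₁⟩ := hsmall.exists_rpow_le h.ctrl (e := 1 / r) (by positivity) hε0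
  obtain ⟨η₂, hη₂, H₂⟩ := hsmall 1 one_pos
  set η := min η₁ η₂ with hη
  have hη0 : 0 < η := lt_min hη₁ hη₂
  -- Uniqueness on a short interval is stability with both difference controls equal to zero. The
  -- limits stay based at `a`, so they need no adjustment to the smaller interval.
  have loc : ∀ c d, a ≤ c → c ≤ d → d ≤ b → d - c ≤ η → Y c = Y₁ c → Y d = Y₁ d := by
    intro c d hac hcd hdb hη' hc
    have hr' := h.restrict hac hdb
    have hw := H₁ c d hac hcd hdb (hη'.trans (min_le_left _ _))
    have hw1 := H₂ c d hac hcd hdb (hη'.trans (min_le_right _ _))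
    have hs' : IsUnifSmall c d ω := fun ε hε => by
      obtain ⟨η, hη, hh⟩ := hsmall ε hε
      exact ⟨η, hη, fun x y h1 h2 h3 => hh x y (hac.trans h1) h2 (h3.trans hdb)⟩
    have hsm : sewConst (3 / r) * (8 * μ ^ 5 * ω c d ^ (1 / r)) ≤ 1 / 2 := by
      refine le_trans ?_ hε2
      gcongr
    have D : ∀ {Y : ℝ → F} {ω' : ℝ → ℝ → ℝ} (_ : ∀ t ∈ Icc a b, IsPartitionLimit
        (fun u v => φ (Y u) (X u v) + tensorApply ι (derivMul φ (Y u)) (XX u v)) a t (Y t - y₀))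
        (_ : IsControl a b ω') (_ : ∀ s t, a ≤ s → s ≤ t → t ≤ b →
          ‖Y t - Y s - φ (Y s) (X s t)‖ ≤ ω' s t ^ (2 / r)),
        ∀ s t, c ≤ s → s ≤ t → t ≤ d → ‖pathRem ι φ X XX Y s t‖ ≤ ν * ω s t ^ (3 / r) := by
      intro Y ω' hsol hω' hY s t hcs hst htd
      refine (hr'.norm_pathRem_le_of_limit hφ hr hr3 hac
        (fun t ht => hsol t ⟨hac.trans ht.1, ht.2.trans hdb⟩) (hω'.restrict hac hdb)
        (fun s t h1 h2 h3 => hY s t (hac.trans h1) h2 (h3.trans hdb)) hw1 hsm hcs hst htd).trans ?_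
      exact mul_le_mul_of_nonneg_right (le_max_right _ _)
        (Real.rpow_nonneg (hr'.ctrl.nonneg s t hcs hst htd) _)
    have key := hr'.norm_sub_le_of_pathRem hr' hφν hr hr3 hs' (ω₁ := fun _ _ => 0)
      (ω₃ := fun _ _ => 0) isControl_zero isControl_zero
      (fun s t _ _ _ => by
        rw [sub_self, norm_zero]
        exact Real.rpow_nonneg le_rfl _)
      (fun s t _ _ _ => by
        rw [sub_self, norm_zero]
        exact Real.rpow_nonneg le_rfl _)
      (D hsol hω' hY) (D hsol₁ hω'' hY₁) hw1
      (by refine le_trans ?_ hε3; gcongr) (by refine le_trans ?_ hε4; gcongr) hcd le_rfl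
    rw [hc, sub_self, norm_zero, Real.zero_rpow (by positivity), Real.zero_rpow (by positivity)]
      at key
    simpa [sub_eq_zero] using key
  have ind : ∀ n : ℕ, ∀ t, a ≤ t → t ≤ b → t ≤ a + n * η → Y t = Y₁ t := by
    intro n
    induction n with
    | zero =>
      intro t h1 h2 h3
      have : t = a := le_antisymm (by simpa using h3) h1
      rw [this, h0]
    | succ n ih =>
      intro t h1 h2 h3
      push_cast at h3
      have hn : (0 : ℝ) ≤ n * η := by positivity
      rcases le_total t (a + n * η) with h4 | h4
      · exact ih t h1 h2 h4
      · exact loc (a + n * η) t (by linarith) h4 h2 (by linarith)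
          (ih _ (by linarith) (h4.trans h2) le_rfl)
  intro t ht
  obtain ⟨n, hn⟩ := exists_nat_gt ((t - a) / η)
  rw [div_lt_iff₀ hη0] at hn
  exact ind n t ht.1 ht.2 (by linarith)

end Rough

/-! ### Existence through Euler schemes. -/

section Existence

open Filter Topology

variable {E F V : Type*} [NormedAddCommGroup E] [NormedSpace ℝ E]
  [NormedAddCommGroup F] [NormedSpace ℝ F] [NormedAddCommGroup V] [NormedSpace ℝ V]
  {ι : E ⊗[ℝ] E ≃ₗ[ℝ] V} {a b r τ : ℝ} {ω : ℝ → ℝ → ℝ} {X : ℝ → ℝ → E}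
  {XX : ℝ → ℝ → V} {φ : F → E →L[ℝ] F} {μ : ℝ}

lemma IsRoughOn.fst_self (h : IsRoughOn ι a b r ω X XX) {s : ℝ} (h1 : a ≤ s) (h2 : s ≤ b) :
    X s s = 0 := by
  simpa using h.additive s s s h1 le_rfl le_rfl h2

lemma IsRoughOn.snd_self (h : IsRoughOn ι a b r ω X XX) {s : ℝ} (h1 : a ≤ s) (h2 : s ≤ b) :
    XX s s = 0 := by
  simpa [h.fst_self h1 h2] using h.chen s s s h1 le_rfl le_rfl h2

lemma eulerRem_self (y : F) : eulerRem ι φ y y 0 0 = 0 := by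
  simp [eulerRem, tensorApply]

lemma EulerBound.tendsto_eulerRem (hφ : EulerBound ι φ μ) {α : Type*} {l : Filter α}
    {f g : α → F} {x : α → E} {v : α → V} {y z : F} {x₀ : E} {v₀ : V} (hf : Tendsto f l (𝓝 y))
    (hg : Tendsto g l (𝓝 z)) (hx : Tendsto x l (𝓝 x₀)) (hv : Tendsto v l (𝓝 v₀)) :
    Tendsto (fun i => eulerRem ι φ (f i) (g i) (x i) (v i)) l (𝓝 (eulerRem ι φ y z x₀ v₀)) := by
  have h1 : Tendsto (fun i => φ (f i) (x i)) l (𝓝 (φ y x₀)) := by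
    rw [tendsto_iff_norm_sub_tendsto_zero]
    refine squeeze_zero (fun _ => norm_nonneg _) (fun i => hφ.norm_apply_sub_le _ _ _ _) ?_
    have := (((tendsto_iff_norm_sub_tendsto_zero.1 hf).mul hx.norm).add
      (tendsto_iff_norm_sub_tendsto_zero.1 hx)).const_mul μ
    simpa using this
  have h2 : Tendsto (fun i => tensorApply ι (derivMul φ (f i)) (v i)) l
      (𝓝 (tensorApply ι (derivMul φ y) v₀)) := by
    rw [tendsto_iff_norm_sub_tendsto_zero]
    refine squeeze_zero (fun _ => norm_nonneg _) (fun i => hφ.norm_tensor_sub_le _ _ _ _) ?_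
    have := (((tendsto_iff_norm_sub_tendsto_zero.1 hf).mul hv.norm).add
      (tendsto_iff_norm_sub_tendsto_zero.1 hv)).const_mul (μ ^ 2)
    simpa using this
  exact ((hg.sub hf).sub h1).sub h2

/-- The second order Euler scheme along the points `u`. -/
noncomputable def eulerScheme (ι : E ⊗[ℝ] E ≃ₗ[ℝ] V) (φ : F → E →L[ℝ] F) (X : ℝ → ℝ → E)
    (XX : ℝ → ℝ → V) (u : ℕ → ℝ) (y₀ : F) : ℕ → F
  | 0 => y₀
  | k + 1 => eulerScheme ι φ X XX u y₀ k + (φ (eulerScheme ι φ X XX u y₀ k) (X (u k) (u (k + 1))) +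
      tensorApply ι (derivMul φ (eulerScheme ι φ X XX u y₀ k)) (XX (u k) (u (k + 1))))

/-- The local error of the scheme vanishes over a single step, so `discrete_sewing` applies. Its
hypothesis may use the bound still to be proved: with `L * w ≤ 1` the term `w * ‖J‖` is at most `w ^
3`, the defect is at most `16 * μ ^ 5 * w ^ 3`, and this reproduces exactly the constant `L`. -/
lemma IsRoughOn.norm_eulerRem_eulerScheme_le (h : IsRoughOn ι a b r ω X XX)
    (hφ : EulerBound ι φ μ) (hr : 0 < r) (hr3 : r < 3) (h1 : ω a b ≤ 1)
    (hsm : 2 * (sewConst (3 / r) * (8 * μ ^ 5)) * ω a b ^ (1 / r) ≤ 1) {u : ℕ → ℝ}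
    (hu : Monotone u) (hub : ∀ k, u k ∈ Icc a b) (y₀ : F) (i j : ℕ) (hij : i ≤ j) :
    ‖eulerRem ι φ (eulerScheme ι φ X XX u y₀ i) (eulerScheme ι φ X XX u y₀ j) (X (u i) (u j))
      (XX (u i) (u j))‖ ≤
      2 * (sewConst (3 / r) * (8 * μ ^ 5)) * ω (u i) (u j) ^ (3 / r) := by
  have hθ : 1 < 3 / r := by rwa [lt_div_iff₀ hr, one_mul]
  have hμ0 : 0 ≤ μ := by linarith [hφ.nice.one_le]
  have hS := sewConst_pos hθ
  set y := eulerScheme ι φ X XX u y₀ with hy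
  set L := 2 * (sewConst (3 / r) * (8 * μ ^ 5)) with hL
  have hL0 : 0 ≤ L := by positivity
  refine discrete_sewing (fun i j => eulerRem ι φ (y i) (y j) (X (u i) (u j)) (XX (u i) (u j)))
    (fun i j => ω (u i) (u j)) (B := 16 * μ ^ 5) hθ hL0
    (fun i j hij => h.ctrl.nonneg _ _ (hub i).1 (hu hij) (hub j).2)
    (fun i j k hij hjk => h.ctrl.add_le _ _ _ (hub i).1 (hu hij) (hu hjk) (hub k).2)
    (fun i => ?_) (fun i => ?_) (fun i j k hij hjk hI => ?_) (le_of_eq (by rw [hL]; ring)) i j hij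
  · rw [h.fst_self (hub i).1 (hub i).2, h.snd_self (hub i).1 (hub i).2, eulerRem_self, norm_zero]
  · rw [norm_eq_zero]
    simp only [hy, eulerScheme, eulerRem]
    abel
  · have i1 := (hub i).1
    have i2 := hu hij
    have i3 := hu hjk
    have i4 := (hub k).2
    have p := h.ctrl.nonneg _ _ i1 (i2.trans i3) i4
    rw [h.additive _ _ _ i1 i2 i3 i4, h.chen _ _ _ i1 i2 i3 i4, eulerRem_defect]
    refine (hφ.norm_defect_le (y i) (y j) (h.ctrl.rpow_le_one hr h1 i1 (i2.trans i3) i4)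
      (h.bounds hr i1 le_rfl i2 i3 i4).1 (h.bounds hr i1 le_rfl i2 i3 i4).2
      (h.bounds hr i1 i2 i3 le_rfl i4).1 (h.bounds hr i1 i2 i3 le_rfl i4).2).trans ?_
    rw [rpow_three_div p]
    have q := Real.rpow_nonneg p (1 / r)
    have e1 : ω (u i) (u j) ^ (3 / r) ≤ (ω (u i) (u k) ^ (1 / r)) ^ 3 := by
      rw [← rpow_three_div p]
      exact Real.rpow_le_rpow (h.ctrl.nonneg _ _ i1 i2 (i3.trans i4))
        (h.ctrl.mono i1 le_rfl i2 i3 i4) (by positivity)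
    have e2 := h.ctrl.rpow_le (e := 1 / r) (by positivity) i1 (i2.trans i3) i4
    set w := ω (u i) (u k) ^ (1 / r)
    have e3 : w * ‖eulerRem ι φ (y i) (y j) (X (u i) (u j)) (XX (u i) (u j))‖ ≤ w ^ 3 := by
      calc _ ≤ w * (L * w ^ 3) := by gcongr; exact hI.trans (by gcongr)
        _ = (L * w) * w ^ 3 := by ring
        _ ≤ 1 * w ^ 3 := by
            gcongr
            exact (mul_le_mul_of_nonneg_left e2 hL0).trans hsm
        _ = w ^ 3 := one_mul _
    calc _ ≤ 8 * μ ^ 5 * (w ^ 3 + w ^ 3) := by gcongr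
      _ = _ := by ring

/-- Existence of a path that satisfies the Davie estimate, as a limit of Euler schemes. -/
theorem IsRoughOn.exists_pathRem_le [FiniteDimensional ℝ F] (h : IsRoughOn ι 0 τ r ω X XX)
    (hτ : 0 < τ) (hφ : EulerBound ι φ μ) (hr : 0 < r) (hr3 : r < 3) (h1 : ω 0 τ ≤ 1)
    (hsm : 2 * (sewConst (3 / r) * (8 * μ ^ 5)) * ω 0 τ ^ (1 / r) ≤ 1)
    (hsmall : IsUnifSmall 0 τ ω)
    (hX : ContinuousOn (fun z : ℝ × ℝ => X z.1 z.2) (simplex τ))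
    (hXX : ContinuousOn (fun z : ℝ × ℝ => XX z.1 z.2) (simplex τ)) (y₀ : F) :
    ∃ Y : ℝ → F, Y 0 = y₀ ∧ ContinuousOn Y (Icc 0 τ) ∧ ∀ s t, 0 ≤ s → s ≤ t → t ≤ τ →
      ‖pathRem ι φ X XX Y s t‖ ≤ 2 * (sewConst (3 / r) * (8 * μ ^ 5)) * ω s t ^ (3 / r) := by
  have hθ : 1 < 3 / r := by rwa [lt_div_iff₀ hr, one_mul]
  have hμ0 : 0 ≤ μ := by linarith [hφ.nice.one_le]
  have hS := sewConst_pos hθ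
  have hprop : ProperSpace F := FiniteDimensional.proper_real F
  set L := 2 * (sewConst (3 / r) * (8 * μ ^ 5)) with hL
  have hL0 : 0 ≤ L := by positivity
  set δ : ℕ → ℝ := fun n => τ / 2 ^ n with hδ
  have hδ0 : ∀ n, 0 < δ n := fun n => by positivity
  have hδlim : Tendsto δ atTop (𝓝 0) := by
    have := (tendsto_pow_atTop_nhds_zero_of_lt_one (r := (1 / 2 : ℝ)) (by norm_num)
      (by norm_num)).const_mul τ
    simpa [hδ, div_eq_mul_inv] using this
  set u : ℕ → ℕ → ℝ := fun n k => min (k * δ n) τ with hu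
  have humono : ∀ n, Monotone (u n) := fun n i j hij => by
    refine min_le_min_right _ ?_
    have := (hδ0 n).le
    gcongr
  have hub : ∀ n k, u n k ∈ Icc 0 τ := fun n k =>
    ⟨le_min (mul_nonneg (Nat.cast_nonneg _) (hδ0 n).le) hτ.le, min_le_right _ _⟩
  set y : ℕ → ℕ → F := fun n => eulerScheme ι φ X XX (u n) y₀ with hy
  have hrem := fun n => h.norm_eulerRem_eulerScheme_le hφ hr hr3 h1 hsm (humono n) (hub n) y₀
  set C := 2 * μ ^ 2 + L with hC
  have hC0 : 0 < C := by have := hφ.nice.one_le; positivity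
  have hincr : ∀ n i j, i ≤ j → ‖y n j - y n i‖ ≤ C * ω (u n i) (u n j) ^ (1 / r) := by
    intro n i j hij
    have i1 := (hub n i).1
    have i2 := humono n hij
    have i3 := (hub n j).2
    have hw1 := h.ctrl.rpow_le_one hr h1 i1 i2 i3
    have hw0 := Real.rpow_nonneg (h.ctrl.nonneg _ _ i1 i2 i3) (1 / r)
    have e1 := hφ.norm_incr_le (y n i) hw1 (h.bounds hr i1 le_rfl i2 le_rfl i3).1
      (h.bounds hr i1 le_rfl i2 le_rfl i3).2
    have e2 := hrem n i j hij
    rw [rpow_three_div (h.ctrl.nonneg _ _ i1 i2 i3)] at e2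
    have e3 : L * (ω (u n i) (u n j) ^ (1 / r)) ^ 3 ≤ L * ω (u n i) (u n j) ^ (1 / r) := by
      refine mul_le_mul_of_nonneg_left ?_ hL0
      calc _ ≤ (ω (u n i) (u n j) ^ (1 / r)) ^ 1 := pow_le_pow_of_le_one hw0 hw1 (by norm_num)
        _ = _ := pow_one _
    have e : y n j - y n i = (φ (y n i) (X (u n i) (u n j)) +
        tensorApply ι (derivMul φ (y n i)) (XX (u n i) (u n j))) +
        eulerRem ι φ (y n i) (y n j) (X (u n i) (u n j)) (XX (u n i) (u n j)) := by
      simp only [eulerRem]; abel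
    rw [e]
    refine (norm_add_le _ _).trans ?_
    rw [hC]
    linarith
  set fl : ℕ → ℝ → ℕ := fun n t => ⌊t / δ n⌋₊ with hfl
  have hfl1 : ∀ n t, 0 ≤ t → fl n t * δ n ≤ t := fun n t ht => by
    have := Nat.floor_le (div_nonneg ht (hδ0 n).le)
    rwa [le_div_iff₀ (hδ0 n)] at this
  have hfl2 : ∀ n t, t < fl n t * δ n + δ n := fun n t => by
    have := Nat.lt_floor_add_one (t / δ n)
    rw [div_lt_iff₀ (hδ0 n)] at this
    linarith
  have hufl : ∀ n t, 0 ≤ t → t ≤ τ → u n (fl n t) = fl n t * δ n := fun n t h0 h1 =>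
    min_eq_left ((hfl1 n t h0).trans h1)
  have hflmono : ∀ n s t, s ≤ t → fl n s ≤ fl n t := fun n s t hst =>
    Nat.floor_le_floor (div_le_div_of_nonneg_right hst (hδ0 n).le)
  -- equicontinuity
  have hequi : ∀ ε > 0, ∃ η > 0, ∀ s t, 0 ≤ s → s ≤ t → t ≤ τ → t - s ≤ η →
      ∀ᶠ n in atTop, ‖y n (fl n t) - y n (fl n s)‖ ≤ ε := by
    intro ε hε
    obtain ⟨η, hη, H⟩ := hsmall.exists_rpow_le h.ctrl (e := 1 / r) (by positivity)
      (div_pos hε hC0)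
    refine ⟨η / 2, by positivity, fun s t h0 hst htτ hη' => ?_⟩
    filter_upwards [hδlim.eventually (gt_mem_nhds (half_pos hη))] with n hn
    refine (hincr n _ _ (hflmono n s t hst)).trans ?_
    have := H (u n (fl n s)) (u n (fl n t)) (hub _ _).1 (humono n (hflmono n s t hst)) (hub _ _).2
      (by
        rw [hufl n s h0 (hst.trans htτ), hufl n t (h0.trans hst) htτ]
        have := hfl1 n t (h0.trans hst)
        have := hfl2 n s
        linarith)
    calc C * _ ≤ C * (ε / C) := by gcongr
      _ = ε := by field_simp
  -- the limit
  set U : Ultrafilter ℕ := hyperfilter ℕ with hU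
  have hUat : (U : Filter ℕ) ≤ atTop := Nat.hyperfilter_le_atTop
  have hlim : ∀ t, ∃ z, Tendsto (fun n => y n (fl n t)) U (𝓝 z) := by
    intro t
    have hmem : ∀ n, y n (fl n t) ∈ Metric.closedBall y₀ C := by
      intro n
      rw [mem_closedBall_iff_norm]
      have := hincr n 0 (fl n t) (Nat.zero_le _)
      have e : y n 0 = y₀ := rfl
      rw [e] at this
      refine this.trans ?_
      have := h.ctrl.rpow_le_one hr h1 (hub n 0).1 (humono n (Nat.zero_le (fl n t))) (hub n _).2
      calc C * _ ≤ C * 1 := by gcongr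
        _ = C := mul_one C
    obtain ⟨z, -, hz⟩ := (isCompact_closedBall y₀ C).ultrafilter_le_nhds
      (U.map fun n => y n (fl n t)) (by
        rw [le_principal_iff, Ultrafilter.coe_map, Filter.mem_map]
        exact Filter.univ_mem' hmem)
    exact ⟨z, hz⟩
  choose Y hYlim using hlim
  have hcont : ∀ ε > 0, ∃ η > 0, ∀ s t, 0 ≤ s → s ≤ t → t ≤ τ → t - s ≤ η → ‖Y t - Y s‖ ≤ ε := by
    intro ε hε
    obtain ⟨η, hη, H⟩ := hequi ε hε
    refine ⟨η, hη, fun s t h0 hst htτ hη' => ?_⟩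
    exact le_of_tendsto ((hYlim t).sub (hYlim s)).norm ((H s t h0 hst htτ hη').filter_mono hUat)
  refine ⟨Y, ?_, ?_, ?_⟩
  · refine tendsto_nhds_unique (hYlim 0) ?_
    have : (fun n => y n (fl n 0)) = fun _ => y₀ := by
      funext n; simp [hfl, hy, eulerScheme]
    rw [this]
    exact tendsto_const_nhds
  · rw [Metric.continuousOn_iff]
    intro t ht ε hε
    obtain ⟨η, hη, H⟩ := hcont (ε / 2) (half_pos hε)
    refine ⟨η, hη, fun s hs hst => ?_⟩
    rw [Real.dist_eq] at hst
    rw [dist_eq_norm]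
    have hst' := abs_lt.1 hst
    rcases le_total s t with hle | hle
    · rw [norm_sub_rev]
      linarith [H s t hs.1 hle ht.2 (by linarith)]
    · linarith [H t s ht.1 hle hs.2 (by linarith)]
  · intro s t h0 hst htτ
    rcases hst.eq_or_lt with rfl | hlt
    · rw [pathRem, h.fst_self h0 htτ, h.snd_self h0 htτ, eulerRem_self, norm_zero]
      exact mul_nonneg hL0 (Real.rpow_nonneg (h.ctrl.nonneg s s h0 le_rfl htτ) _)
    -- Rounding `s` up and `t` down keeps the grid interval inside `[s, t]`. The control over it is
    -- then at most `ω s t` by monotonicity, without any continuity of `ω`.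
    set ce : ℕ → ℕ := fun n => ⌈s / δ n⌉₊ with hce
    have hce1 : ∀ n, s ≤ ce n * δ n := fun n => by
      have := Nat.le_ceil (s / δ n)
      rwa [div_le_iff₀ (hδ0 n)] at this
    have hce2 : ∀ n, ce n * δ n < s + δ n := fun n => by
      have := Nat.ceil_lt_add_one (div_nonneg h0 (hδ0 n).le)
      have := mul_lt_mul_of_pos_right this (hδ0 n)
      rwa [add_mul, div_mul_cancel₀ _ (hδ0 n).ne', one_mul] at this
    have hflce : ∀ n, fl n s ≤ ce n := fun n => Nat.floor_le_ceil _
    have hev : ∀ᶠ n in atTop, δ n < (t - s) / 2 :=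
      hδlim.eventually (gt_mem_nhds (by linarith))
    have hcefl : ∀ᶠ n in atTop, ce n ≤ fl n t := by
      filter_upwards [hev] with n hn
      have e1 := hce2 n
      have e2 := hfl2 n t
      have : (ce n : ℝ) * δ n < fl n t * δ n := by linarith
      exact_mod_cast ((mul_lt_mul_iff_left₀ (hδ0 n)).1 this).le
    have huce : ∀ᶠ n in atTop, u n (ce n) = ce n * δ n := by
      filter_upwards [hcefl] with n hn
      refine min_eq_left ?_
      have e1 : (ce n : ℝ) * δ n ≤ fl n t * δ n := by
        have := (hδ0 n).le
        gcongr
      exact e1.trans ((hfl1 n t (h0.trans hst)).trans htτ)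
    have lim1 : Tendsto (fun n => u n (ce n)) atTop (𝓝 s) := by
      have : Tendsto (fun n => s + δ n) atTop (𝓝 (s + 0)) := hδlim.const_add s
      rw [add_zero] at this
      refine tendsto_of_tendsto_of_tendsto_of_le_of_le' tendsto_const_nhds this ?_ ?_
      · filter_upwards [huce] with n hn; rw [hn]; exact hce1 n
      · filter_upwards [huce] with n hn; rw [hn]; exact (hce2 n).le
    have lim2 : Tendsto (fun n => u n (fl n t)) atTop (𝓝 t) := by
      have : Tendsto (fun n => t - δ n) atTop (𝓝 (t - 0)) := hδlim.const_sub t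
      rw [sub_zero] at this
      refine tendsto_of_tendsto_of_tendsto_of_le_of_le this tendsto_const_nhds ?_ ?_
      · intro n
        dsimp only
        rw [hufl n t (h0.trans hst) htτ]
        linarith [hfl2 n t]
      · intro n
        dsimp only
        rw [hufl n t (h0.trans hst) htτ]
        exact hfl1 n t (h0.trans hst)
    have limp : Tendsto (fun n => (u n (ce n), u n (fl n t))) U (𝓝[simplex τ] (s, t)) := by
      refine tendsto_nhdsWithin_iff.2 ⟨(lim1.prodMk_nhds lim2).mono_left hUat, ?_⟩
      refine Eventually.filter_mono hUat ?_
      filter_upwards [hcefl] with n hn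
      exact ⟨(hub _ _).1, humono n hn, (hub _ _).2⟩
    have hmem : (s, t) ∈ simplex τ := ⟨h0, hst, htτ⟩
    have limX := (hX (s, t) hmem).tendsto.comp limp
    have limXX := (hXX (s, t) hmem).tendsto.comp limp
    -- `Y s` was defined with `s` rounded down; the two roundings differ by at most one grid step,
    -- which is harmless by `hincr`.
    have limY : Tendsto (fun n => y n (ce n)) U (𝓝 (Y s)) := by
      have hdiff : Tendsto (fun n => y n (ce n) - y n (fl n s)) atTop (𝓝 0) := by
        rw [tendsto_zero_iff_norm_tendsto_zero, Metric.tendsto_atTop']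
        intro ε hε
        obtain ⟨η, hη, H⟩ := hsmall.exists_rpow_le h.ctrl (e := 1 / r) (by positivity)
          (div_pos hε (mul_pos two_pos hC0))
        have hev2 := (hδlim.eventually (gt_mem_nhds hη)).and huce
        obtain ⟨N, hN⟩ := eventually_atTop.1 hev2
        refine ⟨N, fun n hn => ?_⟩
        obtain ⟨hn1, hn2⟩ := hN n hn.le
        rw [Real.dist_eq, sub_zero, abs_norm]
        refine (hincr n _ _ (hflce n)).trans_lt ?_
        have := H (u n (fl n s)) (u n (ce n)) (hub _ _).1 (humono n (hflce n)) (hub _ _).2 (by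
          rw [hn2, hufl n s h0 (hst.trans htτ)]
          have e2 : (ce n : ℝ) ≤ fl n s + 1 := by
            exact_mod_cast Nat.ceil_le_floor_add_one (s / δ n)
          have := mul_le_mul_of_nonneg_right e2 (hδ0 n).le
          linarith)
        calc C * _ ≤ C * (ε / (2 * C)) := by gcongr
          _ = ε / 2 := by field_simp
          _ < ε := by linarith
      have := (hdiff.mono_left hUat).add (hYlim s)
      simpa using this
    have limrem := (hφ.tendsto_eulerRem limY (hYlim t) limX limXX).norm
    refine le_of_tendsto limrem (Eventually.filter_mono hUat ?_)
    filter_upwards [hcefl, huce] with n hn hn2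
    refine (hrem n (ce n) (fl n t) hn).trans (mul_le_mul_of_nonneg_left ?_ hL0)
    refine Real.rpow_le_rpow (h.ctrl.nonneg _ _ (hub _ _).1 (humono n hn) (hub _ _).2)
      (h.ctrl.mono h0 ?_ (humono n hn) ?_ htτ) (by positivity)
    · rw [hn2]; exact hce1 n
    · rw [hufl n t (h0.trans hst) htτ]; exact hfl1 n t (h0.trans hst)

end Existence

/-! ### Besov norms of two-parameter functions -/

/-- Cauchy-Schwarz for the powers `p / 2` of `g` and `h`. Since it is applied to these powers, it
remains valid when `p / 2 < 1`. -/
theorem eLpNorm_half_le_mul {α : Type*} {m : MeasurableSpace α} {μ : Measure α} {p : ℝ≥0∞}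
    {f g h : α → ℝ≥0∞} (hp : p ≠ 0) (hg : AEMeasurable g μ) (hh : AEMeasurable h μ)
    (hfgh : ∀ᵐ x ∂μ, f x ≤ g x * h x) :
    eLpNorm f (p / 2) μ ≤ eLpNorm g p μ * eLpNorm h p μ := by
  rcases eq_or_ne p ∞ with rfl | hpt
  · rw [ENNReal.top_div_of_ne_top (by norm_num)]
    simp only [eLpNorm_exponent_top, eLpNormEssSup, enorm_eq_self]
    exact (essSup_mono_ae hfgh).trans (ENNReal.essSup_mul_le g h)
  · have hP : 0 < p.toReal := ENNReal.toReal_pos hp hpt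
    have h2 : p / 2 ≠ 0 := by simp [hp]
    have h3 : p / 2 ≠ ∞ := by
      intro h
      rcases ENNReal.div_eq_top.1 h with h | h
      · simp at h
      · exact hpt h.1
    have h4 : (p / 2).toReal = p.toReal / 2 := by simp
    rw [eLpNorm_eq_lintegral_rpow_enorm_toReal h2 h3, eLpNorm_eq_lintegral_rpow_enorm_toReal hp hpt,
      eLpNorm_eq_lintegral_rpow_enorm_toReal hp hpt]
    simp only [enorm_eq_self, h4]
    have key : ∫⁻ x, f x ^ (p.toReal / 2) ∂μ ≤
        (∫⁻ x, g x ^ p.toReal ∂μ) ^ (1 / 2 : ℝ) * (∫⁻ x, h x ^ p.toReal ∂μ) ^ (1 / 2 : ℝ) := by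
      calc ∫⁻ x, f x ^ (p.toReal / 2) ∂μ
          ≤ ∫⁻ x, g x ^ (p.toReal / 2) * h x ^ (p.toReal / 2) ∂μ := by
            refine lintegral_mono_ae (hfgh.mono fun x hx => ?_)
            rw [← ENNReal.mul_rpow_of_nonneg _ _ (by positivity)]
            exact ENNReal.rpow_le_rpow hx (by positivity)
        _ ≤ _ := by
            refine (ENNReal.lintegral_mul_le_Lp_mul_Lq μ (p := 2) (q := 2)
              Real.HolderConjugate.two_two (hg.pow_const _) (hh.pow_const _)).trans_eq ?_
            simp only [← ENNReal.rpow_mul]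
            norm_num
    calc _ ≤ ((∫⁻ x, g x ^ p.toReal ∂μ) ^ (1 / 2 : ℝ) *
            (∫⁻ x, h x ^ p.toReal ∂μ) ^ (1 / 2 : ℝ)) ^ (1 / (p.toReal / 2)) :=
          ENNReal.rpow_le_rpow key (by positivity)
      _ = _ := by
          rw [ENNReal.mul_rpow_of_nonneg _ _ (by positivity), ← ENNReal.rpow_mul,
            ← ENNReal.rpow_mul]
          congr 2 <;> field_simp

section

variable {G H K : Type*} [NormedAddCommGroup G] [NormedAddCommGroup H] [NormedAddCommGroup K]
  {T α : ℝ} {p q : ℝ≥0∞}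

/-- The slices `s ↦ A s (s + h)` are measurable on their domain. -/
def SliceMeasurable (T : ℝ) (A : ℝ → ℝ → G) : Prop :=
  ∀ h, 0 < h → h ≤ T → AEStronglyMeasurable (fun s => A s (s + h)) (volume.restrict (Ioc 0 (T - h)))

theorem SliceMeasurable.of_continuousOn {A : ℝ → ℝ → G}
    (hA : ContinuousOn (fun z : ℝ × ℝ => A z.1 z.2) (simplex T)) : SliceMeasurable T A := by
  intro h h0 _
  refine ContinuousOn.aestronglyMeasurable ?_ measurableSet_Ioc
  refine hA.comp (f := fun s : ℝ => (s, s + h)) (by fun_prop) ?_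
  intro s hs
  exact ⟨hs.1.le, by simpa using h0.le, by simpa using by linarith [hs.2]⟩

theorem SliceMeasurable.of_measurable {f : ℝ → ℝ → ℝ} (hf : Measurable (Function.uncurry f)) :
    SliceMeasurable T f := fun h _ _ =>
  (hf.comp (by fun_prop : Measurable fun s : ℝ => (s, s + h))).aestronglyMeasurable

theorem omegaMod_mono (T : ℝ) (p : ℝ≥0∞) (A : ℝ → ℝ → G) : Monotone (omegaMod T p A) :=
  fun _ _ hst => biSup_mono fun _ h => ⟨h.1, h.2.trans hst⟩

/-- The modulus is monotone in `t`, so measurability in `t` needs none of `A`. -/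
theorem measurable_omegaMod_div (T : ℝ) (p : ℝ≥0∞) (A : ℝ → ℝ → G) (α : ℝ) :
    Measurable fun t => omegaMod T p A t / ENNReal.ofReal (t ^ α) :=
  (omegaMod_mono T p A).measurable.div (by fun_prop)

theorem eLpNorm_slice_le_omegaMod {A : ℝ → ℝ → G} {h t : ℝ} (h0 : 0 < h) (ht : h ≤ t) :
    eLpNorm (fun s => A s (s + h)) p (volume.restrict (Ioc 0 (T - h))) ≤ omegaMod T p A t :=
  le_biSup (fun h => eLpNorm (fun s => A s (s + h)) p (volume.restrict (Ioc 0 (T - h))))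
    (show h ∈ Ioc 0 t from ⟨h0, ht⟩)

theorem besovNorm_mono_of_omegaMod {A : ℝ → ℝ → G} {B : ℝ → ℝ → H} (c : ℝ≥0∞)
    (h : ∀ t ∈ Ioc 0 T, omegaMod T p A t ≤ c * omegaMod T p B t) :
    besovNorm T α p q A ≤ c * besovNorm T α p q B := by
  refine eLpNorm_le_mul_eLpNorm_of_ae_le_mul'' q
    (measurable_omegaMod_div T p B α).aestronglyMeasurable ?_
  refine (withDensity_absolutelyContinuous _ _).ae_le ?_
  filter_upwards [ae_restrict_mem measurableSet_Ioc] with t ht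
  simp only [enorm_eq_self, ← mul_div_assoc]
  exact ENNReal.div_le_div_right (h t ht) _

theorem omegaMod_le_mul {A : ℝ → ℝ → G} {B : ℝ → ℝ → H} (c : ℝ≥0) (hB : SliceMeasurable T B)
    (h : ∀ s t, 0 ≤ s → s ≤ t → t ≤ T → ‖A s t‖ ≤ c * ‖B s t‖) (t : ℝ) (ht : t ≤ T) :
    omegaMod T p A t ≤ c * omegaMod T p B t := by
  refine iSup₂_le fun w hw => ?_
  refine le_trans ?_ (mul_le_mul_right (eLpNorm_slice_le_omegaMod hw.1 hw.2) _)
  refine eLpNorm_le_mul_eLpNorm_of_ae_le_mul'' p (hB w hw.1 (hw.2.trans ht)) ?_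
  filter_upwards [ae_restrict_mem measurableSet_Ioc] with s hs
  have := h s (s + w) hs.1.le (by linarith [hw.1]) (by linarith [hs.2])
  rw [← ofReal_norm, ← ofReal_norm, ← ENNReal.ofReal_coe_nnreal,
    ← ENNReal.ofReal_mul (by positivity)]
  exact ENNReal.ofReal_le_ofReal this

theorem besovNorm_le_mul {A : ℝ → ℝ → G} {B : ℝ → ℝ → H} (c : ℝ≥0) (hB : SliceMeasurable T B)
    (h : ∀ s t, 0 ≤ s → s ≤ t → t ≤ T → ‖A s t‖ ≤ c * ‖B s t‖) :
    besovNorm T α p q A ≤ c * besovNorm T α p q B :=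
  besovNorm_mono_of_omegaMod c fun t ht => omegaMod_le_mul c hB h t ht.2

/-- Minkowski's inequality on each slice, where the exponent is at least one, and the quasi-triangle
inequality in `t`, where `q < 1` is possible and costs the constant. -/
theorem besovNorm_add_le {A B : ℝ → ℝ → G} (hp : 1 ≤ p) (hA : SliceMeasurable T A)
    (hB : SliceMeasurable T B) :
    besovNorm T α p q (A + B) ≤ ENNReal.LpAddConst q * (besovNorm T α p q A + besovNorm T α p q B) := by
  refine le_trans ?_ (eLpNorm_add_le' (measurable_omegaMod_div T p A α).aestronglyMeasurable
    (measurable_omegaMod_div T p B α).aestronglyMeasurable q)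
  refine eLpNorm_mono_enorm_ae ?_
  refine (withDensity_absolutelyContinuous _ _).ae_le ?_
  filter_upwards [ae_restrict_mem measurableSet_Ioc] with t ht
  simp only [enorm_eq_self, Pi.add_apply, ← ENNReal.add_div]
  refine ENNReal.div_le_div_right (iSup₂_le fun w hw => ?_) _
  refine (eLpNorm_add_le (hA w hw.1 (hw.2.trans ht.2)) (hB w hw.1 (hw.2.trans ht.2)) hp).trans ?_
  exact add_le_add (eLpNorm_slice_le_omegaMod hw.1 hw.2) (eLpNorm_slice_le_omegaMod hw.1 hw.2)

/-- Cauchy-Schwarz twice: over `s` in each slice, and then over `t`, where the weight `t ^ (-2 * α)`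
splits evenly between the factors. -/
theorem besovNorm_mul_le {A : ℝ → ℝ → G} {B : ℝ → ℝ → H} {D : ℝ → ℝ → K} (hp : p ≠ 0) (hq : q ≠ 0)
    (hB : SliceMeasurable T B) (hD : SliceMeasurable T D)
    (h : ∀ s t, 0 ≤ s → s ≤ t → t ≤ T → ‖A s t‖ ≤ ‖B s t‖ * ‖D s t‖) :
    besovNorm T (2 * α) (p / 2) (q / 2) A ≤ besovNorm T α p q B * besovNorm T α p q D := by
  refine eLpNorm_half_le_mul hq (measurable_omegaMod_div T p B α).aemeasurable
    (measurable_omegaMod_div T p D α).aemeasurable ?_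
  refine (withDensity_absolutelyContinuous _ _).ae_le ?_
  filter_upwards [ae_restrict_mem measurableSet_Ioc] with t ht
  have hmod : omegaMod T (p / 2) A t ≤ omegaMod T p B t * omegaMod T p D t := by
    refine iSup₂_le fun w hw => ?_
    refine le_trans ?_ (mul_le_mul' (eLpNorm_slice_le_omegaMod hw.1 hw.2)
      (eLpNorm_slice_le_omegaMod hw.1 hw.2))
    rw [← eLpNorm_enorm (fun s => A s (s + w)), ← eLpNorm_enorm (fun s => B s (s + w)),
      ← eLpNorm_enorm (fun s => D s (s + w))]
    refine eLpNorm_half_le_mul hp (hB w hw.1 (hw.2.trans ht.2)).enorm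
      (hD w hw.1 (hw.2.trans ht.2)).enorm ?_
    filter_upwards [ae_restrict_mem measurableSet_Ioc] with s hs
    have := h s (s + w) hs.1.le (by linarith [hw.1]) (by linarith [hs.2])
    simp only [← ofReal_norm]
    rw [← ENNReal.ofReal_mul (by positivity)]
    exact ENNReal.ofReal_le_ofReal this
  have hpow : ENNReal.ofReal (t ^ (2 * α)) = ENNReal.ofReal (t ^ α) * ENNReal.ofReal (t ^ α) := by
    rw [← ENNReal.ofReal_mul (Real.rpow_nonneg ht.1.le _), ← Real.rpow_add ht.1, two_mul]
  have hne : ENNReal.ofReal (t ^ α) ≠ 0 := by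
    simpa using Real.rpow_pos_of_pos ht.1 α
  generalize omegaMod T (p / 2) A t = x at hmod ⊢
  rw [hpow, div_eq_mul_inv, div_eq_mul_inv, div_eq_mul_inv,
    ENNReal.mul_inv (Or.inl hne) (Or.inr hne), mul_mul_mul_comm]
  gcongr

theorem besovNorm_sq {W : ℝ → ℝ → ℝ} :
    besovNorm T (2 * α) (p / 2) (q / 2) (fun s t => W s t ^ 2) = besovNorm T α p q W ^ 2 := by
  have hpp : ∀ p : ℝ≥0∞, p / 2 * ENNReal.ofReal 2 = p := fun p => by
    rw [ENNReal.ofReal_ofNat]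
    exact ENNReal.div_mul_cancel (by norm_num) (by norm_num)
  have h2 : (0 : ℝ) < 2 := by norm_num
  have hmod : ∀ t, omegaMod T (p / 2) (fun s t => W s t ^ 2) t = omegaMod T p W t ^ (2 : ℝ) := by
    intro t
    have : ∀ (w : ℝ), eLpNorm (fun s => W s (s + w) ^ 2) (p / 2) (volume.restrict (Ioc 0 (T - w))) =
        eLpNorm (fun s => W s (s + w)) p (volume.restrict (Ioc 0 (T - w))) ^ (2 : ℝ) := by
      intro w
      have := eLpNorm_enorm_rpow (p := p / 2) (q := 2) (μ := volume.restrict (Ioc 0 (T - w)))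
        (fun s => W s (s + w)) h2
      rw [hpp] at this
      rw [← this, ← eLpNorm_enorm]
      congr 1
      ext s
      rw [enorm_pow]
      norm_cast
    have hiso := (ENNReal.orderIsoRpow 2 h2)
    simp only [omegaMod, this]
    have := fun (f : ℝ → ℝ≥0∞) => (ENNReal.orderIsoRpow 2 h2).map_iSup₂ (fun (w : ℝ) (_ : w ∈ Ioc 0 t) => f w)
    simp only [ENNReal.orderIsoRpow_apply] at this
    rw [this]
  have := eLpNorm_enorm_rpow (p := q / 2) (q := 2)
    (μ := (volume.restrict (Ioc 0 T)).withDensity fun t => ENNReal.ofReal t⁻¹)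
    (fun t => omegaMod T p W t / ENNReal.ofReal (t ^ α)) h2
  rw [hpp] at this
  rw [besovNorm, besovNorm, ← ENNReal.rpow_two, ← this]
  refine eLpNorm_congr_ae ((withDensity_absolutelyContinuous _ _).ae_le ?_)
  filter_upwards [ae_restrict_mem measurableSet_Ioc] with t ht
  rw [hmod, enorm_eq_self, ENNReal.div_rpow_of_nonneg _ _ h2.le,
    ENNReal.ofReal_rpow_of_nonneg (Real.rpow_nonneg ht.1.le _) h2.le, ← Real.rpow_mul ht.1.le,
    mul_comm α 2]

theorem besovNorm_mono_right {τ : ℝ} (hτ : τ ≤ T) (A : ℝ → ℝ → G) :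
    besovNorm τ α p q A ≤ besovNorm T α p q A := by
  have hμ : ∀ a b : ℝ, a ≤ b → (volume.restrict (Ioc 0 a)) ≤ volume.restrict (Ioc 0 b) :=
    fun a b hab => Measure.restrict_mono (Ioc_subset_Ioc_right hab) le_rfl
  have hle : (volume.restrict (Ioc 0 τ)).withDensity (fun t : ℝ => ENNReal.ofReal t⁻¹) ≤
      (volume.restrict (Ioc 0 T)).withDensity fun t : ℝ => ENNReal.ofReal t⁻¹ := by
    rw [← restrict_withDensity measurableSet_Ioc, ← restrict_withDensity measurableSet_Ioc]
    exact Measure.restrict_mono (Ioc_subset_Ioc_right hτ) le_rfl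
  refine (eLpNorm_mono_measure _ hle).trans ?_
  refine eLpNorm_mono_enorm fun t => ?_
  simp only [enorm_eq_self]
  refine ENNReal.div_le_div_right (iSup₂_mono fun w _ => ?_) _
  exact eLpNorm_mono_measure _ (hμ _ _ (by linarith))

end

/-! ### The modulus of continuity in mean -/

section

variable {G H : Type*} [NormedAddCommGroup G] [NormedAddCommGroup H]
  {τ β γ : ℝ} {P Q : ℝ≥0∞}

/-- `sup_{0 < w ≤ min(t, τ/2)} w^{-γ} Ω(w)`. -/
noncomputable def scaleSup (τ γ : ℝ) (P : ℝ≥0∞) (A : ℝ → ℝ → G) (t : ℝ) : ℝ≥0∞ :=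
  ⨆ w ∈ Ioc (0 : ℝ) (min t (τ / 2)), omegaMod τ P A w / ENNReal.ofReal (w ^ γ)

theorem scaleSup_mono (τ γ : ℝ) (P : ℝ≥0∞) (A : ℝ → ℝ → G) : Monotone (scaleSup τ γ P A) :=
  fun _ _ hst => biSup_mono fun _ h => ⟨h.1, h.2.trans (min_le_min_right _ hst)⟩

theorem omegaMod_le_scaleSup {A : ℝ → ℝ → G} {w t : ℝ} (hw : 0 < w) (hwt : w ≤ t)
    (hwτ : w ≤ τ / 2) : omegaMod τ P A w ≤ ENNReal.ofReal (w ^ γ) * scaleSup τ γ P A t := by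
  have h1 : omegaMod τ P A w / ENNReal.ofReal (w ^ γ) ≤ scaleSup τ γ P A t :=
    le_biSup (fun w => omegaMod τ P A w / ENNReal.ofReal (w ^ γ))
      (show w ∈ Ioc 0 (min t (τ / 2)) from ⟨hw, le_min hwt hwτ⟩)
  have h2 : ENNReal.ofReal (w ^ γ) ≠ 0 := by simpa using Real.rpow_pos_of_pos hw γ
  rwa [ENNReal.div_le_iff_le_mul (Or.inl h2) (Or.inl ENNReal.ofReal_ne_top), mul_comm] at h1

/-- The modulus is at least `omegaMod τ P A w` on all of `(w, 2w]`. The mass of this interval under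
`dt / t` is at least one half, and it lies in `(0, τ]` because `w ≤ τ / 2`. -/
theorem omegaMod_le_besovNorm (hβ : 0 ≤ β) (hQ : Q ≠ 0) {A : ℝ → ℝ → G} {w : ℝ} (hw : 0 < w)
    (hwτ : w ≤ τ / 2) :
    omegaMod τ P A w ≤ ENNReal.ofReal (2 ^ (β + 1 / Q.toReal)) *
      (ENNReal.ofReal (w ^ β) * besovNorm τ β P Q A) := by
  set μ := (volume.restrict (Ioc 0 τ)).withDensity fun t : ℝ => ENNReal.ofReal t⁻¹ with hμ
  set c := omegaMod τ P A w / ENNReal.ofReal ((2 * w) ^ β) with hc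
  have hsub : Ioc w (2 * w) ⊆ Ioc 0 τ := fun t ht => ⟨hw.trans ht.1, by linarith [ht.2]⟩
  have hμw : (2 : ℝ≥0∞)⁻¹ ≤ μ (Ioc w (2 * w)) := by
    rw [hμ, withDensity_apply _ measurableSet_Ioc, Measure.restrict_restrict measurableSet_Ioc,
      inter_eq_left.2 hsub]
    calc (2 : ℝ≥0∞)⁻¹ = ∫⁻ t in Ioc w (2 * w), ENNReal.ofReal (2 * w)⁻¹ := by
          rw [setLIntegral_const, Real.volume_Ioc, ← ENNReal.ofReal_mul (by positivity),
            ← ENNReal.ofReal_ofNat 2, ← ENNReal.ofReal_inv_of_pos (by norm_num)]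
          congr 1; field_simp; ring
      _ ≤ _ := setLIntegral_mono' measurableSet_Ioc fun t ht =>
          ENNReal.ofReal_le_ofReal (inv_anti₀ (hw.trans ht.1) ht.2)
  -- For `Q = ∞` the exponent `1 / Q.toReal` is `1 / 0 = 0`, so the formula also covers the
  -- essential supremum.
  have h1 : c * (2 : ℝ≥0∞)⁻¹ ^ (1 / Q.toReal) ≤ besovNorm τ β P Q A := by
    calc c * (2 : ℝ≥0∞)⁻¹ ^ (1 / Q.toReal) ≤
          eLpNorm (fun _ : ℝ => c) Q (μ.restrict (Ioc w (2 * w))) := by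
          have hne : μ.restrict (Ioc w (2 * w)) ≠ 0 := by
            intro h
            rw [Measure.restrict_eq_zero] at h
            rw [h] at hμw
            simp at hμw
          rw [eLpNorm_const c hQ hne, Measure.restrict_apply_univ, enorm_eq_self]
          gcongr
      _ ≤ eLpNorm (fun t => omegaMod τ P A t / ENNReal.ofReal (t ^ β)) Q
            (μ.restrict (Ioc w (2 * w))) := by
          refine eLpNorm_mono_enorm_ae ?_
          filter_upwards [ae_restrict_mem measurableSet_Ioc] with t ht
          simp only [enorm_eq_self, hc]
          have hwt := hw.trans ht.1
          exact ENNReal.div_le_div (omegaMod_mono τ P A ht.1.le)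
            (ENNReal.ofReal_le_ofReal (Real.rpow_le_rpow hwt.le ht.2 hβ))
      _ ≤ _ := eLpNorm_mono_measure _ Measure.restrict_le_self
  have hpos : ENNReal.ofReal ((2 * w) ^ β) ≠ 0 := by
    simpa using Real.rpow_pos_of_pos (by linarith) β
  have h2 : (2 : ℝ≥0∞)⁻¹ ^ (1 / Q.toReal) * ENNReal.ofReal (2 ^ (1 / Q.toReal)) = 1 := by
    rw [← ENNReal.ofReal_rpow_of_pos (by norm_num), ENNReal.ofReal_ofNat, ENNReal.inv_rpow]
    exact ENNReal.inv_mul_cancel (by simp) (by simp)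
  calc omegaMod τ P A w = c * ENNReal.ofReal ((2 * w) ^ β) :=
        (ENNReal.div_mul_cancel hpos ENNReal.ofReal_ne_top).symm
    _ = c * (2 : ℝ≥0∞)⁻¹ ^ (1 / Q.toReal) * (ENNReal.ofReal (2 ^ (1 / Q.toReal)) *
          ENNReal.ofReal ((2 * w) ^ β)) := by
        rw [mul_assoc, ← mul_assoc _ _ (ENNReal.ofReal ((2 * w) ^ β)), h2, one_mul]
    _ ≤ besovNorm τ β P Q A * (ENNReal.ofReal (2 ^ (1 / Q.toReal)) *
          ENNReal.ofReal ((2 * w) ^ β)) := by gcongr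
    _ = _ := by
        rw [Real.mul_rpow (by norm_num) hw.le, Real.rpow_add (by norm_num),
          ENNReal.ofReal_mul (by positivity), ENNReal.ofReal_mul (by positivity)]
        ring

theorem scaleSup_le_besovNorm (hβ : 0 ≤ β) (hγ : γ ≤ β) (hQ : Q ≠ 0) (A : ℝ → ℝ → G) (t : ℝ) :
    scaleSup τ γ P A t ≤ ENNReal.ofReal (2 ^ (β + 1 / Q.toReal)) *
      (ENNReal.ofReal (t ^ (β - γ)) * besovNorm τ β P Q A) := by
  refine iSup₂_le fun w hw => ?_
  have hwt := hw.2.trans (min_le_left _ _)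
  have hpos : 0 < w ^ γ := Real.rpow_pos_of_pos hw.1 γ
  refine ENNReal.div_le_of_le_mul ((omegaMod_le_besovNorm hβ hQ hw.1
    (hw.2.trans (min_le_right _ _))).trans ?_)
  rw [mul_assoc]
  refine mul_le_mul_right ?_ _
  rw [mul_right_comm]
  refine mul_le_mul_left ?_ _
  rw [← ENNReal.ofReal_mul (Real.rpow_nonneg (hw.1.le.trans hwt) _)]
  refine ENNReal.ofReal_le_ofReal ?_
  calc w ^ β = w ^ (β - γ) * w ^ γ := by rw [← Real.rpow_add hw.1]; ring_nf
    _ ≤ t ^ (β - γ) * w ^ γ := by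
      gcongr
      exact hw.1.le

/-- The measure `dt / t` is invariant under dilations, and a contraction maps `(0, τ]` into itself.
-/
theorem lintegral_dilation_le {f : ℝ → ℝ≥0∞} (hf : Measurable f) {a : ℝ} (ha : 0 < a)
    (ha1 : a ≤ 1) :
    ∫⁻ t, f (a * t) ∂((volume.restrict (Ioc 0 τ)).withDensity fun t : ℝ => ENNReal.ofReal t⁻¹) ≤
      ∫⁻ t, f t ∂((volume.restrict (Ioc 0 τ)).withDensity fun t : ℝ => ENNReal.ofReal t⁻¹) := by
  have hm : Measurable fun t : ℝ => ENNReal.ofReal t⁻¹ := by fun_prop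
  rw [lintegral_withDensity_eq_lintegral_mul _ hm
      (show Measurable fun t => f (a * t) from hf.comp (measurable_const_mul a)),
    lintegral_withDensity_eq_lintegral_mul _ hm hf, ← lintegral_indicator measurableSet_Ioc,
    ← lintegral_indicator measurableSet_Ioc]
  set g : ℝ → ℝ≥0∞ := (Ioc 0 τ).indicator ((fun t : ℝ => ENNReal.ofReal t⁻¹) * f) with hg
  have hgm : Measurable g := (hm.mul hf).indicator measurableSet_Ioc
  have hmap : ∫⁻ t, g (a * t) = ENNReal.ofReal a⁻¹ * ∫⁻ t, g t := by
    rw [← lintegral_map hgm (measurable_const_mul a), Real.map_volume_mul_left ha.ne',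
      lintegral_smul_measure, abs_of_pos (inv_pos.2 ha), smul_eq_mul]
  have ha' : ENNReal.ofReal a * ENNReal.ofReal a⁻¹ = 1 := by
    rw [← ENNReal.ofReal_mul ha.le, mul_inv_cancel₀ ha.ne', ENNReal.ofReal_one]
  calc _ ≤ ∫⁻ t, ENNReal.ofReal a * g (a * t) := by
        refine lintegral_mono fun t => ?_
        by_cases ht : t ∈ Ioc 0 τ
        · have h2 : a * t ∈ Ioc 0 τ := ⟨mul_pos ha ht.1, by nlinarith [ht.1, ht.2]⟩
          simp only [hg, indicator_of_mem ht, indicator_of_mem h2, Pi.mul_apply, ← mul_assoc]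
          rw [← ENNReal.ofReal_mul ha.le, mul_inv, mul_inv_cancel_left₀ ha.ne']
        · simp [indicator_of_notMem ht]
    _ = ∫⁻ t, g t := by
        rw [lintegral_const_mul _
          (show Measurable fun t => g (a * t) from hgm.comp (measurable_const_mul a)), hmap, ← mul_assoc, ha',
          one_mul]

/-- Each scale `w ≤ t` lies within a factor two below some `2 ^ (-n) * t`, and the modulus is
monotone; the rounding costs `2 ^ γ` and leaves the decaying weight `2 ^ (-n * (β - γ))`. -/
theorem mul_scaleSup_le {A : ℝ → ℝ → G} (hγ : 0 ≤ γ) {t : ℝ} (ht : 0 < t) :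
    ENNReal.ofReal (t ^ (γ - β)) * scaleSup τ γ P A t ≤
      ⨆ n : ℕ, ENNReal.ofReal (2 ^ γ * ((1 / 2 : ℝ) ^ n) ^ (β - γ)) *
        (omegaMod τ P A ((1 / 2) ^ n * t) / ENNReal.ofReal (((1 / 2) ^ n * t) ^ β)) := by
  simp only [scaleSup, ENNReal.mul_iSup]
  refine iSup₂_le fun w hw => ?_
  have hw0 := hw.1
  have hwt : w ≤ t := hw.2.trans (min_le_left _ _)
  obtain ⟨n, hn1, hn2⟩ := exists_nat_pow_near_of_lt_one (div_pos hw0 ht) ((div_le_one ht).2 hwt)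
    (by norm_num : (0 : ℝ) < 1 / 2) (by norm_num)
  refine le_trans ?_ (le_iSup _ n)
  rw [lt_div_iff₀ ht, pow_succ] at hn1
  rw [div_le_iff₀ ht] at hn2
  have hx0 : (0 : ℝ) < (1 / 2) ^ n := by positivity
  set x : ℝ := (1 / 2) ^ n with hx
  rw [div_eq_mul_inv, div_eq_mul_inv, ← ENNReal.ofReal_inv_of_pos (Real.rpow_pos_of_pos hw0 γ),
    ← ENNReal.ofReal_inv_of_pos (Real.rpow_pos_of_pos (by positivity) β), mul_left_comm,
    mul_left_comm (ENNReal.ofReal (2 ^ γ * x ^ (β - γ))), ← ENNReal.ofReal_mul (by positivity),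
    ← ENNReal.ofReal_mul (by positivity)]
  refine mul_le_mul' (omegaMod_mono τ P A hn2) (ENNReal.ofReal_le_ofReal ?_)
  have h1 : (w ^ γ)⁻¹ ≤ ((x * (1 / 2) * t) ^ γ)⁻¹ :=
    inv_anti₀ (by positivity) (Real.rpow_le_rpow (by positivity) hn1.le hγ)
  refine (mul_le_mul_of_nonneg_left h1 (by positivity)).trans_eq ?_
  rw [Real.mul_rpow (by positivity) ht.le, Real.mul_rpow hx0.le (by norm_num),
    Real.mul_rpow hx0.le ht.le, Real.rpow_sub ht, Real.rpow_sub hx0, Real.div_rpow (by norm_num)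
    (by norm_num), Real.one_rpow]
  have := (Real.rpow_pos_of_pos ht γ).ne'
  have := (Real.rpow_pos_of_pos ht β).ne'
  have := (Real.rpow_pos_of_pos hx0 γ).ne'
  have := (Real.rpow_pos_of_pos hx0 β).ne'
  field_simp

/-- A Hardy type inequality. The supremum over dyadic scales is bounded by the sum of the `Q`-th
powers, which is legitimate also for `Q < 1`. Every scale contributes at most the norm itself by
dilation invariance, and the weights are summable since `γ < β`. -/
theorem exists_eLpNorm_scaleSup_le (G : Type*) [NormedAddCommGroup G] (hγ : 0 ≤ γ) (hγβ : γ < β)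
    (P : ℝ≥0∞) (hQ : Q ≠ 0) :
    ∃ C : ℝ≥0, ∀ (τ : ℝ) (A : ℝ → ℝ → G),
      eLpNorm (fun t => ENNReal.ofReal (t ^ (γ - β)) * scaleSup τ γ P A t) Q
        ((volume.restrict (Ioc 0 τ)).withDensity fun t : ℝ => ENNReal.ofReal t⁻¹) ≤
      C * besovNorm τ β P Q A := by
  rcases eq_or_ne Q ∞ with rfl | hQt
  · refine ⟨(2 ^ (β + 1 / (∞ : ℝ≥0∞).toReal) : ℝ).toNNReal, fun τ A => ?_⟩
    rw [eLpNorm_exponent_top]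
    refine eLpNormEssSup_le_of_ae_enorm_bound ((withDensity_absolutelyContinuous _ _).ae_le ?_)
    filter_upwards [ae_restrict_mem measurableSet_Ioc] with t ht
    rw [enorm_eq_self]
    refine (mul_le_mul_right (scaleSup_le_besovNorm (hγ.trans hγβ.le) hγβ.le hQ A t) _).trans_eq ?_
    rw [mul_left_comm, ← mul_assoc (ENNReal.ofReal (t ^ (γ - β))),
      ← ENNReal.ofReal_mul (Real.rpow_nonneg ht.1.le _), ← Real.rpow_add ht.1]
    simp [ENNReal.ofReal]
  · have hQ' : 0 < Q.toReal := ENNReal.toReal_pos hQ hQt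
    set a : ℕ → ℝ≥0∞ := fun n => ENNReal.ofReal (2 ^ γ * ((1 / 2 : ℝ) ^ n) ^ (β - γ)) ^ Q.toReal
      with ha
    have hsum : ∑' n, a n ≠ ∞ := by
      have : ∀ n, a n = ENNReal.ofReal ((2 ^ γ) ^ Q.toReal) *
          ENNReal.ofReal (((1 / 2) ^ (β - γ)) ^ Q.toReal) ^ n := by
        intro n
        simp only [ha]
        rw [ENNReal.ofReal_rpow_of_nonneg (by positivity) hQ'.le,
          ← ENNReal.ofReal_pow (by positivity), ← ENNReal.ofReal_mul (by positivity),
          Real.mul_rpow (by positivity) (by positivity)]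
        congr 2
        simp only [← Real.rpow_natCast, ← Real.rpow_mul (by norm_num : (0 : ℝ) ≤ 1 / 2)]
        congr 1; ring
      simp only [this]
      rw [ENNReal.tsum_mul_left, ENNReal.tsum_geometric]
      refine ENNReal.mul_ne_top ENNReal.ofReal_ne_top (ENNReal.inv_ne_top.2 ?_)
      rw [ne_eq, tsub_eq_zero_iff_le, not_le, ENNReal.ofReal_lt_one]
      exact Real.rpow_lt_one (by positivity)
        (Real.rpow_lt_one (by norm_num) (by norm_num) (by linarith)) hQ'
    refine ⟨((∑' n, a n) ^ (1 / Q.toReal)).toNNReal, fun τ A => ?_⟩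
    rw [ENNReal.coe_toNNReal (ENNReal.rpow_ne_top_of_nonneg (by positivity) hsum), besovNorm,
      eLpNorm_eq_lintegral_rpow_enorm_toReal hQ hQt, eLpNorm_eq_lintegral_rpow_enorm_toReal hQ hQt,
      ← ENNReal.mul_rpow_of_nonneg _ _ (by positivity)]
    refine ENNReal.rpow_le_rpow ?_ (by positivity)
    set f : ℝ → ℝ≥0∞ := fun t => (omegaMod τ P A t / ENNReal.ofReal (t ^ β)) ^ Q.toReal with hf
    have hfm : Measurable f := (measurable_omegaMod_div τ P A β).pow_const _
    simp only [enorm_eq_self]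
    calc _ ≤ ∫⁻ t, ∑' n, a n * f ((1 / 2) ^ n * t)
          ∂((volume.restrict (Ioc 0 τ)).withDensity fun t : ℝ => ENNReal.ofReal t⁻¹) := by
          refine lintegral_mono_ae ((withDensity_absolutelyContinuous _ _).ae_le ?_)
          filter_upwards [ae_restrict_mem measurableSet_Ioc] with t ht
          refine (ENNReal.rpow_le_rpow (mul_scaleSup_le hγ ht.1) hQ'.le).trans ?_
          have := (ENNReal.orderIsoRpow Q.toReal hQ').map_iSup (fun n : ℕ =>
            ENNReal.ofReal (2 ^ γ * ((1 / 2 : ℝ) ^ n) ^ (β - γ)) *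
            (omegaMod τ P A ((1 / 2) ^ n * t) / ENNReal.ofReal (((1 / 2) ^ n * t) ^ β)))
          simp only [ENNReal.orderIsoRpow_apply] at this
          rw [this]
          refine iSup_le fun n => ?_
          rw [ENNReal.mul_rpow_of_nonneg _ _ hQ'.le]
          exact ENNReal.le_tsum (f := fun n => a n * f ((1 / 2) ^ n * t)) n
      _ = ∑' n, a n * ∫⁻ t, f ((1 / 2) ^ n * t)
          ∂((volume.restrict (Ioc 0 τ)).withDensity fun t : ℝ => ENNReal.ofReal t⁻¹) := by
          have hm : ∀ n : ℕ, Measurable fun t => a n * f ((1 / 2) ^ n * t) := fun n =>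
            (hfm.comp (measurable_const_mul _)).const_mul (a n)
          rw [lintegral_tsum fun n => (hm n).aemeasurable]
          refine tsum_congr fun n => ?_
          exact lintegral_const_mul _ (hfm.comp (measurable_const_mul _))
      _ ≤ ∑' n, a n * ∫⁻ t, f t
          ∂((volume.restrict (Ioc 0 τ)).withDensity fun t : ℝ => ENNReal.ofReal t⁻¹) := by
          refine ENNReal.tsum_le_tsum fun n => mul_le_mul_right ?_ _
          exact lintegral_dilation_le hfm (by positivity) (pow_le_one₀ (by norm_num) (by norm_num))
      _ = _ := by rw [ENNReal.tsum_mul_right]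

theorem besovNorm_le_of_scaleSup {A : ℝ → ℝ → G} {B : ℝ → ℝ → H} {c C : ℝ≥0}
    (hC : eLpNorm (fun t => ENNReal.ofReal (t ^ (γ - β)) * scaleSup τ γ P A t) Q
        ((volume.restrict (Ioc 0 τ)).withDensity fun t : ℝ => ENNReal.ofReal t⁻¹) ≤
      C * besovNorm τ β P Q A)
    (h : ∀ t ∈ Ioc 0 τ, omegaMod τ P B t ≤ c * (ENNReal.ofReal (t ^ γ) * scaleSup τ γ P A t)) :
    besovNorm τ β P Q B ≤ ↑(c * C) * besovNorm τ β P Q A := by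
  rw [ENNReal.coe_mul, mul_assoc]
  refine le_trans ?_ (mul_le_mul_right hC _)
  refine eLpNorm_le_mul_eLpNorm_of_ae_le_mul'' Q ?_ ?_
  · exact Measurable.aestronglyMeasurable
      ((by fun_prop : Measurable fun t : ℝ => ENNReal.ofReal (t ^ (γ - β))).mul
        (scaleSup_mono τ γ P A).measurable)
  refine (withDensity_absolutelyContinuous _ _).ae_le ?_
  filter_upwards [ae_restrict_mem measurableSet_Ioc] with t ht
  simp only [enorm_eq_self]
  rw [Real.rpow_sub ht.1, div_eq_mul_inv (t ^ γ), ENNReal.ofReal_mul (Real.rpow_nonneg ht.1.le _),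
    ENNReal.ofReal_inv_of_pos (Real.rpow_pos_of_pos ht.1 β), div_eq_mul_inv]
  calc _ ≤ c * (ENNReal.ofReal (t ^ γ) * scaleSup τ γ P A t) * (ENNReal.ofReal (t ^ β))⁻¹ :=
        mul_le_mul_left (h t ht) _
    _ = _ := by ring

end

/-! ### Regular controls and a chaining estimate -/

/-- A control `ω` on `[0, τ]` with `ω(s', t') ≤ ((t' - s') / (t - s)) ^ κ ω(s, t)` for
`[s', t'] ⊆ [s, t]`. -/
structure IsRegControl (τ κ : ℝ) (ω : ℝ → ℝ → ℝ) : Prop where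
  ctrl : IsControl 0 τ ω
  reg : ∀ s s' t' t, 0 ≤ s → s ≤ s' → s' ≤ t' → t' ≤ t → t ≤ τ →
    ω s' t' * (t - s) ^ κ ≤ (t' - s') ^ κ * ω s t

namespace IsRegControl

variable {τ κ : ℝ} {ω ω₁ ω₂ : ℝ → ℝ → ℝ}

theorem add (h₁ : IsRegControl τ κ ω₁) (h₂ : IsRegControl τ κ ω₂) :
    IsRegControl τ κ (fun s t => ω₁ s t + ω₂ s t) where
  ctrl := h₁.ctrl.add h₂.ctrl
  reg s s' t' t a b c d e := by
    rw [add_mul, mul_add]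
    exact add_le_add (h₁.reg s s' t' t a b c d e) (h₂.reg s s' t' t a b c d e)

theorem const_mul (h : IsRegControl τ κ ω) {c : ℝ} (hc : 0 ≤ c) :
    IsRegControl τ κ (fun s t => c * ω s t) where
  ctrl := h.ctrl.const_mul hc
  reg s s' t' t a b c' d e := by
    rw [mul_assoc, mul_left_comm ((t' - s') ^ κ)]
    exact mul_le_mul_of_nonneg_left (h.reg s s' t' t a b c' d e) hc

theorem rpow_half_mul (h₁ : IsRegControl τ κ ω₁) (h₂ : IsRegControl τ κ ω₂) :
    IsRegControl τ κ (fun s t => ω₁ s t ^ (1 / 2 : ℝ) * ω₂ s t ^ (1 / 2 : ℝ)) where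
  ctrl := h₁.ctrl.rpow_mul_rpow h₂.ctrl (by norm_num) (by norm_num) (by norm_num)
  reg s s' t' t a b c d e := by
    have hω : ∀ {ω}, IsRegControl τ κ ω → 0 ≤ ω s t ∧ 0 ≤ ω s' t' := fun h =>
      ⟨h.ctrl.nonneg _ _ a (by linarith) e, h.ctrl.nonneg _ _ (by linarith) c (by linarith)⟩
    have hx : 0 ≤ (t - s) ^ κ := Real.rpow_nonneg (by linarith) _
    have hy : 0 ≤ (t' - s') ^ κ := Real.rpow_nonneg (by linarith) _
    have key : ∀ z : ℝ, 0 ≤ z → z = z ^ (1 / 2 : ℝ) * z ^ (1 / 2 : ℝ) := fun z hz => by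
      rw [← Real.sqrt_eq_rpow, Real.mul_self_sqrt hz]
    have h1 := Real.rpow_le_rpow (mul_nonneg (hω h₁).2 hx) (h₁.reg s s' t' t a b c d e)
      (by norm_num : (0 : ℝ) ≤ 1 / 2)
    have h2 := Real.rpow_le_rpow (mul_nonneg (hω h₂).2 hx) (h₂.reg s s' t' t a b c d e)
      (by norm_num : (0 : ℝ) ≤ 1 / 2)
    rw [Real.mul_rpow (hω h₁).2 hx, Real.mul_rpow hy (hω h₁).1] at h1
    rw [Real.mul_rpow (hω h₂).2 hx, Real.mul_rpow hy (hω h₂).1] at h2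
    rw [key _ hx, key _ hy, mul_mul_mul_comm, mul_mul_mul_comm (((t' - s') ^ κ) ^ (1 / 2 : ℝ))]
    exact mul_le_mul h1 h2
      (mul_nonneg (Real.rpow_nonneg (hω h₂).2 _) (Real.rpow_nonneg hx _))
      (mul_nonneg (Real.rpow_nonneg hy _) (Real.rpow_nonneg (hω h₁).1 _))

theorem rpow_le (h : IsRegControl τ κ ω) {δ : ℝ} (hδ : 0 ≤ δ) {s s' t' t : ℝ} (h1 : 0 ≤ s)
    (h2 : s ≤ s') (h3 : s' ≤ t') (h4 : t' ≤ t) (h5 : t ≤ τ) (hst : s < t) {x : ℝ} (hx : 0 ≤ x)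
    (hκ : 0 ≤ κ) (h6 : t' - s' ≤ x * (t - s)) :
    ω s' t' ^ δ ≤ (x ^ (κ * δ)) * ω s t ^ δ := by
  have hω := h.ctrl.nonneg s t h1 hst.le h5
  have hω' := h.ctrl.nonneg s' t' (h1.trans h2) h3 (h4.trans h5)
  have hpos : 0 < t - s := sub_pos.2 hst
  have hpow : 0 < (t - s) ^ κ := Real.rpow_pos_of_pos hpos κ
  have hle : ω s' t' ≤ x ^ κ * ω s t := by
    refine le_of_mul_le_mul_right ?_ hpow
    calc ω s' t' * (t - s) ^ κ ≤ (t' - s') ^ κ * ω s t := h.reg s s' t' t h1 h2 h3 h4 h5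
      _ ≤ (x * (t - s)) ^ κ * ω s t := by
          exact mul_le_mul_of_nonneg_right (Real.rpow_le_rpow (by linarith) h6 hκ) hω
      _ = x ^ κ * ω s t * (t - s) ^ κ := by rw [Real.mul_rpow hx hpos.le]; ring
  calc ω s' t' ^ δ ≤ (x ^ κ * ω s t) ^ δ := Real.rpow_le_rpow hω' hle hδ
    _ = _ := by rw [Real.mul_rpow (Real.rpow_nonneg hx _) hω, ← Real.rpow_mul hx]

/-- Comparison of a short interval with `[0, τ]`: the regularity yields the factor `((t - s) / τ) ^
κ`. -/
theorem isUnifSmall (h : IsRegControl τ κ ω) (hτ : 0 < τ) (hκ : 0 < κ) : IsUnifSmall 0 τ ω := by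
  intro ε hε
  have hω := h.ctrl.nonneg 0 τ le_rfl hτ.le le_rfl
  have hc : Filter.Tendsto (fun x : ℝ => x ^ κ * ω 0 τ) (nhdsWithin 0 (Ioi 0)) (nhds 0) := by
    have : Continuous fun x : ℝ => x ^ κ * ω 0 τ :=
      (Real.continuous_rpow_const hκ.le).mul_const _
    have h0 := (this.tendsto 0).mono_left (nhdsWithin_le_nhds (s := Ioi 0))
    rwa [Real.zero_rpow hκ.ne', zero_mul] at h0
  obtain ⟨x, hx, hx0⟩ := ((hc.eventually (ge_mem_nhds hε)).and self_mem_nhdsWithin).exists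
  have hx0' : (0 : ℝ) < x := hx0
  refine ⟨x * τ, by positivity, fun s t h1 h2 h3 h4 => ?_⟩
  have := h.rpow_le (δ := 1) zero_le_one le_rfl h1 h2 h3 le_rfl hτ hx0'.le hκ.le (by simpa using h4)
  rw [Real.rpow_one, Real.rpow_one, mul_one] at this
  exact this.trans hx

end IsRegControl

theorem ENNReal.le_tsum_of_le_add_succ {x c : ℕ → ℝ≥0∞} (h : ∀ n, x n ≤ x (n + 1) + c n)
    (hx : Filter.Tendsto x Filter.atTop (nhds 0)) : x 0 ≤ ∑' n, c n := by
  have h1 : ∀ n, x 0 ≤ x n + ∑ k ∈ Finset.range n, c k := by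
    intro n
    induction n with
    | zero => simp
    | succ n ih =>
      rw [Finset.sum_range_succ, add_comm _ (c n), ← add_assoc]
      exact ih.trans (by gcongr; exact h n)
  have h2 : Filter.Tendsto (fun n => x n + ∑' k, c k) Filter.atTop (nhds (0 + ∑' k, c k)) :=
    hx.add tendsto_const_nhds
  rw [zero_add] at h2
  exact ge_of_tendsto' h2 fun n => (h1 n).trans (by gcongr; exact ENNReal.sum_le_tsum _)

/-- The uniform probability measure on `(k, m]`. -/
noncomputable def unifIoc (k m : ℝ) : Measure ℝ :=
  (ENNReal.ofReal (m - k))⁻¹ • volume.restrict (Ioc k m)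

theorem isProbabilityMeasure_unifIoc {k m : ℝ} (h : k < m) : IsProbabilityMeasure (unifIoc k m) :=
  ⟨by
    rw [unifIoc, Measure.smul_apply, Measure.restrict_apply_univ, Real.volume_Ioc, smul_eq_mul]
    exact ENNReal.inv_mul_cancel (by simpa using h) ENNReal.ofReal_ne_top⟩

theorem ae_mem_unifIoc (k m : ℝ) : ∀ᵐ x ∂unifIoc k m, x ∈ Ioc k m :=
  Measure.ae_smul_measure (ae_restrict_mem measurableSet_Ioc) _

/-- Averaging a triangle inequality with intermediate points over two probability measures; terms
that depend on one variable keep only their own average. -/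
theorem lintegral_lintegral_le_add {μ ν : Measure ℝ} [IsProbabilityMeasure μ]
    [IsProbabilityMeasure ν] {f g : ℝ → ℝ≥0∞} {a F : ℝ → ℝ → ℝ≥0∞} {ε : ℝ≥0∞}
    (hf : Measurable f) (hg : Measurable g)
    (h : ∀ᵐ x ∂ν, ∀ᵐ y ∂μ, F x y ≤ f x + g y + a x y + ε) :
    ∫⁻ x, ∫⁻ y, F x y ∂μ ∂ν ≤ ∫⁻ x, f x ∂ν + ∫⁻ y, g y ∂μ + ∫⁻ x, ∫⁻ y, a x y ∂μ ∂ν + ε := by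
  calc ∫⁻ x, ∫⁻ y, F x y ∂μ ∂ν ≤ ∫⁻ x, (f x + ∫⁻ y, g y ∂μ) + ∫⁻ y, a x y ∂μ + ε ∂ν := by
        refine lintegral_mono_ae (h.mono fun x hx => ?_)
        refine (lintegral_mono_ae hx).trans_eq ?_
        rw [lintegral_add_right _ measurable_const, lintegral_add_left (hg.const_add (f x)),
          lintegral_add_left measurable_const]
        simp
    _ = _ := by
        rw [lintegral_add_right _ measurable_const, lintegral_add_left (hf.add_const _),
          lintegral_add_right _ measurable_const]
        simp

theorem tendsto_lintegral_unifIoc {f : ℝ → ℝ≥0∞} {l : Filter ℝ}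
    (hf : Filter.Tendsto f l (nhds 0)) {k m : ℕ → ℝ} (hkm : ∀ n, k n < m n)
    (h : ∀ S ∈ l, ∀ᶠ n in Filter.atTop, Ioc (k n) (m n) ⊆ S) :
    Filter.Tendsto (fun n => ∫⁻ x, f x ∂unifIoc (k n) (m n)) Filter.atTop (nhds 0) := by
  rw [ENNReal.tendsto_nhds_zero] at hf ⊢
  intro ε hε
  filter_upwards [h _ (hf ε hε)] with n hn
  have := isProbabilityMeasure_unifIoc (hkm n)
  calc _ ≤ ∫⁻ x, ε ∂unifIoc (k n) (m n) :=
        lintegral_mono_ae ((ae_mem_unifIoc _ _).mono fun x hx => hn hx)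
    _ = ε := by simp

section Chaining

variable {τ κ δ c : ℝ} {ω e : ℝ → ℝ → ℝ} {a : ℝ → ℝ → ℝ≥0∞}

/-- The data of the chaining estimate: an almost subadditive function whose averages over adjacent
squares are bounded by a regular control. -/
structure ChainBound (τ κ δ c : ℝ) (ω e : ℝ → ℝ → ℝ) (a : ℝ → ℝ → ℝ≥0∞) : Prop where
  kappa_pos : 0 < κ
  delta_pos : 0 < δ
  const_nonneg : 0 ≤ c
  ctrl : IsRegControl τ κ ω
  ctrl_defect : IsRegControl τ κ e
  measurable : Measurable (Function.uncurry a)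
  triangle : ∀ s u t, 0 ≤ s → s ≤ u → u ≤ t → t ≤ τ →
    a s t ≤ a s u + a u t + ENNReal.ofReal (e s t ^ δ)
  tendsto_left : ∀ s, 0 ≤ s → s < τ → Filter.Tendsto (a s) (nhdsWithin s (Ioi s)) (nhds 0)
  tendsto_right : ∀ t, 0 < t → t ≤ τ →
    Filter.Tendsto (fun x => a x t) (nhdsWithin t (Iio t)) (nhds 0)
  average : ∀ k m l, 0 ≤ k → k < m → m < l → l ≤ τ → l - k ≤ τ / 2 → l - k ≤ 3 * (m - k) →
    l - k ≤ 3 * (l - m) →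
    ∫⁻ x, ∫⁻ y, a x y ∂unifIoc m l ∂unifIoc k m ≤ ENNReal.ofReal (c * ω k l ^ δ)

namespace ChainBound

theorem measurable_left (h : ChainBound τ κ δ c ω e a) (s : ℝ) : Measurable (a s) :=
  h.measurable.comp (by fun_prop : Measurable fun y : ℝ => (s, y))

theorem measurable_right (h : ChainBound τ κ δ c ω e a) (t : ℝ) : Measurable fun x => a x t :=
  h.measurable.comp (by fun_prop : Measurable fun x : ℝ => (x, t))

theorem tsum_eq (h : ChainBound τ κ δ c ω e a) (b : ℝ) (hb : 0 ≤ b) :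
    ∑' n : ℕ, ENNReal.ofReal (((1 / 2 : ℝ) ^ n) ^ (κ * δ) * b) =
      ENNReal.ofReal (b / (1 - (1 / 2) ^ (κ * δ))) := by
  have hκδ : 0 < κ * δ := mul_pos h.kappa_pos h.delta_pos
  have hθ : (1 / 2 : ℝ) ^ (κ * δ) < 1 := Real.rpow_lt_one (by norm_num) (by norm_num) hκδ
  have hs : HasSum (fun n : ℕ => ((1 / 2 : ℝ) ^ n) ^ (κ * δ) * b) (b / (1 - (1 / 2) ^ (κ * δ))) := by
    have := (hasSum_geometric_of_lt_one (by positivity) hθ).mul_right b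
    rw [inv_mul_eq_div] at this
    refine this.congr_fun fun n => ?_
    rw [← Real.rpow_natCast, ← Real.rpow_natCast, ← Real.rpow_mul (by norm_num),
      ← Real.rpow_mul (by norm_num), mul_comm (n : ℝ)]
  rw [← hs.tsum_eq, ENNReal.ofReal_tsum_of_nonneg (fun n => by positivity) hs.summable]

/-- One link of the chain: by regularity, both the average over a pair of adjacent intervals and the
defect at scale `2 ^ (-n) * (t - s)` shrink geometrically in `n`. -/
theorem step_le (h : ChainBound τ κ δ c ω e a) {s t : ℝ} (hs : 0 ≤ s) (hst : s < t) (ht : t ≤ τ)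
    {n : ℕ} {k m l u v : ℝ} (hk : s ≤ k) (hkm : k < m) (hml : m < l) (hl : l ≤ t)
    (hkl : l - k ≤ (1 / 2) * ((1 / 2) ^ n * (t - s))) (h1 : l - k ≤ 3 * (m - k))
    (h2 : l - k ≤ 3 * (l - m)) (hu : s ≤ u) (huv : u ≤ v) (hv : v ≤ t)
    (h3 : v - u ≤ (1 / 2) ^ n * (t - s)) :
    ∫⁻ x, ∫⁻ y, a x y ∂unifIoc m l ∂unifIoc k m + ENNReal.ofReal (e u v ^ δ) ≤
      ENNReal.ofReal (((1 / 2 : ℝ) ^ n) ^ (κ * δ) * (c * ω s t ^ δ + e s t ^ δ)) := by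
  have hx : (0 : ℝ) ≤ (1 / 2) ^ n := by positivity
  have hx1 : ((1 / 2 : ℝ)) ^ n ≤ 1 := pow_le_one₀ (by norm_num) (by norm_num)
  have hts : 0 < t - s := sub_pos.2 hst
  have h5 : (1 / 2 : ℝ) ^ n * (t - s) ≤ t - s := by nlinarith
  have he := h.ctrl_defect.rpow_le h.delta_pos.le hs hu huv hv ht hst hx h.kappa_pos.le h3
  have hω := h.ctrl.rpow_le h.delta_pos.le hs hk (hkm.trans hml).le hl ht hst hx h.kappa_pos.le
    (by nlinarith : l - k ≤ (1 / 2) ^ n * (t - s))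
  have hω0 := h.ctrl.ctrl.nonneg k l (by linarith) (by linarith) (by linarith)
  have he0 := h.ctrl_defect.ctrl.nonneg u v (by linarith) huv (by linarith)
  have hc := h.const_nonneg
  refine (add_le_add (h.average k m l (by linarith) hkm hml (by linarith) (by linarith) h1 h2)
    le_rfl).trans ?_
  rw [← ENNReal.ofReal_add (by positivity) (by positivity), mul_add]
  refine ENNReal.ofReal_le_ofReal (add_le_add ?_ he)
  rw [mul_left_comm]
  exact mul_le_mul_of_nonneg_left hω hc

/-- The averages of `a s` over dyadic intervals shrinking to `s` tend to zero by continuity at the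
diagonal. Two consecutive averages differ by an average over adjacent intervals and a defect, so the
first one is bounded by a geometric series. -/
theorem left_le (h : ChainBound τ κ δ c ω e a) {s t : ℝ} (hs : 0 ≤ s) (hst : s < t) (ht : t ≤ τ) :
    ∫⁻ x, a s x ∂unifIoc (s + (t - s) * (1 / 2) ^ 2) (s + (t - s) * (1 / 2) ^ 1) ≤
      ENNReal.ofReal ((c * ω s t ^ δ + e s t ^ δ) / (1 - (1 / 2) ^ (κ * δ))) := by
  have hω := h.ctrl.ctrl.nonneg s t hs hst.le ht
  have he := h.ctrl_defect.ctrl.nonneg s t hs hst.le ht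
  have hc := h.const_nonneg
  have hts : 0 < t - s := sub_pos.2 hst
  rw [← h.tsum_eq _ (by positivity)]
  set P : ℕ → ℝ := fun n => s + (t - s) * (1 / 2) ^ (n + 1) with hP
  have hPlt : ∀ n, P (n + 1) < P n := fun n => by
    have : (0 : ℝ) < (1 / 2) ^ n := by positivity
    simp only [hP, pow_succ]; nlinarith
  have hPs : ∀ n, s < P n := fun n => by
    have : (0 : ℝ) < (1 / 2) ^ n := by positivity
    simp only [hP, pow_succ]; nlinarith
  have hPt : ∀ n, P n ≤ t := fun n => by
    have : ((1 / 2 : ℝ)) ^ (n + 1) ≤ 1 := pow_le_one₀ (by norm_num) (by norm_num)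
    simp only [hP]; nlinarith
  refine ENNReal.le_tsum_of_le_add_succ (x := fun n => ∫⁻ x, a s x ∂unifIoc (P (n + 1)) (P n))
    (fun n => ?_) ?_
  · have := isProbabilityMeasure_unifIoc (hPlt n)
    have := isProbabilityMeasure_unifIoc (hPlt (n + 1))
    have key := lintegral_lintegral_le_add (μ := unifIoc (P (n + 1)) (P n))
      (ν := unifIoc (P (n + 1 + 1)) (P (n + 1))) (f := a s) (g := fun _ => 0) (a := a)
      (F := fun x y => a s y) (ε := ENNReal.ofReal (e s (P n) ^ δ)) (h.measurable_left s)
      measurable_const ?_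
    · simp only [lintegral_const, measure_univ, mul_one, add_zero] at key
      refine key.trans ?_
      rw [add_assoc]
      gcongr
      have h0 : (0 : ℝ) < (1 / 2) ^ n := by positivity
      have hpos : 0 < (t - s) * (1 / 2) ^ n := by positivity
      -- In units of `2 ^ (-n) * (t - s)` the lengths are `l - k = 3/8`, `m - k = 1/8`, `l - m =
      -- 1/4`: the ratio three in `average` is attained.
      refine h.step_le hs hst ht (hPs _).le (hPlt _) (hPlt _) (hPt _) ?_ ?_ ?_ le_rfl (hPs n).le
        (hPt n) ?_ <;> simp only [hP, pow_succ] <;> linarith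
    · filter_upwards [ae_mem_unifIoc (P (n + 1 + 1)) (P (n + 1))] with x hx
      filter_upwards [ae_mem_unifIoc (P (n + 1)) (P n)] with y hy
      have hsx : s < x := (hPs _).trans hx.1
      have hxy : x < y := hx.2.trans_lt hy.1
      rw [add_zero]
      refine (h.triangle s x y hs hsx.le hxy.le (hy.2.trans ((hPt n).trans ht))).trans ?_
      gcongr
      · exact h.ctrl_defect.ctrl.nonneg _ _ hs (hsx.trans hxy).le (hy.2.trans ((hPt n).trans ht))
      · exact h.delta_pos.le
      · exact h.ctrl_defect.ctrl.mono hs le_rfl (hsx.trans hxy).le hy.2 ((hPt n).trans ht)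
  · refine tendsto_lintegral_unifIoc (h.tendsto_left s hs (hst.trans_le ht)) hPlt fun S hS => ?_
    have hlim : Filter.Tendsto P Filter.atTop (nhds s) := by
      have := ((tendsto_pow_atTop_nhds_zero_of_lt_one (by norm_num : (0 : ℝ) ≤ 1 / 2)
        (by norm_num)).comp (Filter.tendsto_add_atTop_nat 1)).const_mul (t - s) |>.const_add s
      simpa [hP] using this
    obtain ⟨b, hb, hbS⟩ := mem_nhdsGT_iff_exists_Ioo_subset.1 hS
    filter_upwards [hlim.eventually_lt_const hb] with n hn x hx
    exact hbS ⟨(hPs _).trans hx.1, hx.2.trans_lt hn⟩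

theorem right_le (h : ChainBound τ κ δ c ω e a) {s t : ℝ} (hs : 0 ≤ s) (hst : s < t) (ht : t ≤ τ) :
    ∫⁻ x, a x t ∂unifIoc (t - (t - s) * (1 / 2) ^ 1) (t - (t - s) * (1 / 2) ^ 2) ≤
      ENNReal.ofReal ((c * ω s t ^ δ + e s t ^ δ) / (1 - (1 / 2) ^ (κ * δ))) := by
  have hω := h.ctrl.ctrl.nonneg s t hs hst.le ht
  have he := h.ctrl_defect.ctrl.nonneg s t hs hst.le ht
  have hc := h.const_nonneg
  have hts : 0 < t - s := sub_pos.2 hst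
  rw [← h.tsum_eq _ (by positivity)]
  set P : ℕ → ℝ := fun n => t - (t - s) * (1 / 2) ^ (n + 1) with hP
  have hPlt : ∀ n, P n < P (n + 1) := fun n => by
    have : (0 : ℝ) < (1 / 2) ^ n := by positivity
    simp only [hP, pow_succ]; nlinarith
  have hPt : ∀ n, P n < t := fun n => by
    have : (0 : ℝ) < (1 / 2) ^ n := by positivity
    simp only [hP, pow_succ]; nlinarith
  have hPs : ∀ n, s ≤ P n := fun n => by
    have : ((1 / 2 : ℝ)) ^ (n + 1) ≤ 1 := pow_le_one₀ (by norm_num) (by norm_num)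
    simp only [hP]; nlinarith
  refine ENNReal.le_tsum_of_le_add_succ (x := fun n => ∫⁻ x, a x t ∂unifIoc (P n) (P (n + 1)))
    (fun n => ?_) ?_
  · have := isProbabilityMeasure_unifIoc (hPlt n)
    have := isProbabilityMeasure_unifIoc (hPlt (n + 1))
    have key := lintegral_lintegral_le_add (ν := unifIoc (P n) (P (n + 1)))
      (μ := unifIoc (P (n + 1)) (P (n + 1 + 1))) (g := fun y => a y t) (f := fun _ => 0) (a := a)
      (F := fun x y => a x t) (ε := ENNReal.ofReal (e (P n) t ^ δ)) measurable_const
      (h.measurable_right t) ?_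
    · simp only [lintegral_const, measure_univ, mul_one, zero_add] at key
      refine key.trans ?_
      rw [add_assoc]
      gcongr
      have h0 : (0 : ℝ) < (1 / 2) ^ n := by positivity
      have hpos : 0 < (t - s) * (1 / 2) ^ n := by positivity
      refine h.step_le hs hst ht (hPs _) (hPlt _) (hPlt _) (hPt _).le ?_ ?_ ?_ (hPs n) (hPt n).le
        le_rfl ?_ <;> simp only [hP, pow_succ] <;> linarith
    · filter_upwards [ae_mem_unifIoc (P n) (P (n + 1))] with x hx
      filter_upwards [ae_mem_unifIoc (P (n + 1)) (P (n + 1 + 1))] with y hy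
      have hyt : y < t := hy.2.trans_lt (hPt _)
      have hxy : x < y := hx.2.trans_lt hy.1
      have hsx : 0 ≤ x := hs.trans ((hPs n).trans hx.1.le)
      rw [zero_add, add_comm (a y t)]
      refine (h.triangle x y t hsx hxy.le hyt.le ht).trans ?_
      gcongr
      · exact h.ctrl_defect.ctrl.nonneg _ _ hsx (hxy.trans hyt).le ht
      · exact h.delta_pos.le
      · exact h.ctrl_defect.ctrl.mono (hs.trans (hPs n)) hx.1.le (hxy.trans hyt).le le_rfl ht
  · refine tendsto_lintegral_unifIoc (h.tendsto_right t (hs.trans_lt hst) ht) hPlt fun S hS => ?_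
    have hlim : Filter.Tendsto P Filter.atTop (nhds t) := by
      have := ((tendsto_pow_atTop_nhds_zero_of_lt_one (by norm_num : (0 : ℝ) ≤ 1 / 2)
        (by norm_num)).comp (Filter.tendsto_add_atTop_nat 1)).const_mul (t - s) |>.const_sub t
      simpa [hP] using this
    obtain ⟨b, hb, hbS⟩ := mem_nhdsLT_iff_exists_Ioo_subset.1 hS
    filter_upwards [hlim.eventually_const_lt hb] with n hn x hx
    exact hbS ⟨hn.trans hx.1, hx.2.trans_lt (hPt _)⟩

/-- Intermediate points `x` and `y` are averaged over the second and the third quarter of `[s, t]`.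
The outer terms are the two chains, and the middle one is an average over an interval of length `(t
- s) / 2`, within the range `τ / 2` allowed in `average`. -/
theorem le (h : ChainBound τ κ δ c ω e a) {s t : ℝ} (hs : 0 ≤ s) (hst : s < t) (ht : t ≤ τ) :
    a s t ≤ ENNReal.ofReal
      ((2 / (1 - (1 / 2) ^ (κ * δ)) + 2) * (c * ω s t ^ δ + e s t ^ δ)) := by
  have hω := h.ctrl.ctrl.nonneg s t hs hst.le ht
  have he := h.ctrl_defect.ctrl.nonneg s t hs hst.le ht
  have hc := h.const_nonneg
  have hts : 0 < t - s := sub_pos.2 hst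
  have hθ : (1 / 2 : ℝ) ^ (κ * δ) < 1 :=
    Real.rpow_lt_one (by norm_num) (by norm_num) (mul_pos h.kappa_pos h.delta_pos)
  set b := c * ω s t ^ δ + e s t ^ δ with hb
  have hb0 : 0 ≤ b := by positivity
  have hk : s + (t - s) * (1 / 2) ^ 2 < s + (t - s) * (1 / 2) ^ 1 := by nlinarith
  have hl : t - (t - s) * (1 / 2) ^ 1 < t - (t - s) * (1 / 2) ^ 2 := by nlinarith
  have hmid : t - (t - s) * (1 / 2) ^ 1 = s + (t - s) * (1 / 2) ^ 1 := by ring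
  have h1 := h.left_le hs hst ht
  have h2 := h.right_le hs hst ht
  rw [hmid] at h2 hl
  have := isProbabilityMeasure_unifIoc hk
  have := isProbabilityMeasure_unifIoc hl
  have h3 := h.step_le (n := 0) (u := s) (v := t) hs hst ht (by nlinarith) hk hl (by nlinarith)
    (by linarith) (by linarith) (by linarith) le_rfl hst.le le_rfl (by simp)
  have key := lintegral_lintegral_le_add
    (ν := unifIoc (s + (t - s) * (1 / 2) ^ 2) (s + (t - s) * (1 / 2) ^ 1))
    (μ := unifIoc (s + (t - s) * (1 / 2) ^ 1) (t - (t - s) * (1 / 2) ^ 2)) (g := fun y => a y t)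
    (f := a s) (a := a) (F := fun _ _ => a s t) (ε := ENNReal.ofReal (2 * e s t ^ δ))
    (h.measurable_left s) (h.measurable_right t) ?_
  · simp only [lintegral_const, measure_univ, mul_one] at key
    rw [pow_zero, Real.one_rpow, one_mul] at h3
    have hav : ∫⁻ x, ∫⁻ y, a x y ∂unifIoc (s + (t - s) * (1 / 2) ^ 1) (t - (t - s) * (1 / 2) ^ 2)
        ∂unifIoc (s + (t - s) * (1 / 2) ^ 2) (s + (t - s) * (1 / 2) ^ 1) +
        ENNReal.ofReal (2 * e s t ^ δ) ≤ ENNReal.ofReal (2 * b) := by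
      rw [two_mul, two_mul, ENNReal.ofReal_add (by positivity) (by positivity),
        ENNReal.ofReal_add hb0 hb0, ← add_assoc]
      refine add_le_add h3 (ENNReal.ofReal_le_ofReal ?_)
      rw [hb]
      have : 0 ≤ c * ω s t ^ δ := by positivity
      linarith
    refine key.trans ?_
    rw [add_assoc]
    refine (add_le_add (add_le_add h1 h2) hav).trans_eq ?_
    have hθ' : 0 < 1 - (1 / 2 : ℝ) ^ (κ * δ) := by linarith
    rw [← ENNReal.ofReal_add (by positivity) (by positivity),
      ← ENNReal.ofReal_add (by positivity) (by positivity)]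
    congr 1
    ring
  · filter_upwards [ae_mem_unifIoc (s + (t - s) * (1 / 2) ^ 2) (s + (t - s) * (1 / 2) ^ 1)] with x hx
    filter_upwards [ae_mem_unifIoc (s + (t - s) * (1 / 2) ^ 1) (t - (t - s) * (1 / 2) ^ 2)]
      with y hy
    have hsx : s ≤ x := by nlinarith [hx.1]
    have hxy : x ≤ y := hx.2.trans hy.1.le
    have hyt : y ≤ t := by nlinarith [hy.2]
    have e1 := h.triangle s x t hs hsx (hxy.trans hyt) ht
    have e2 := h.triangle x y t (hs.trans hsx) hxy hyt ht
    have e3 : e x t ^ δ ≤ e s t ^ δ := Real.rpow_le_rpow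
      (h.ctrl_defect.ctrl.nonneg _ _ (hs.trans hsx) (hxy.trans hyt) ht)
      (h.ctrl_defect.ctrl.mono hs hsx (hxy.trans hyt) le_rfl ht) h.delta_pos.le
    rw [two_mul, ENNReal.ofReal_add (by positivity) (by positivity)]
    calc a s t ≤ a s x + (a x y + a y t + ENNReal.ofReal (e x t ^ δ)) +
          ENNReal.ofReal (e s t ^ δ) := e1.trans (by gcongr)
      _ ≤ a s x + (a x y + a y t + ENNReal.ofReal (e s t ^ δ)) +
          ENNReal.ofReal (e s t ^ δ) := by
        have := ENNReal.ofReal_le_ofReal e3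
        gcongr
      _ = _ := by ring

end ChainBound

end Chaining

/-! ### The control of a function of finite Besov norm -/

section

variable {G : Type*} [NormedAddCommGroup G] {τ : ℝ} {P : ℝ≥0∞} {A : ℝ → ℝ → G}

theorem measurableSet_simplex (τ : ℝ) : MeasurableSet (simplex τ) := by
  have : IsClosed (simplex τ) := by
    refine (isClosed_le continuous_const continuous_fst).inter
      ((isClosed_le continuous_fst continuous_snd).inter
        (isClosed_le continuous_snd continuous_const))
  exact this.measurableSet

/-- `‖A(s, t)‖`, extended by zero from the simplex. -/
noncomputable def simplexNorm (τ : ℝ) (A : ℝ → ℝ → G) (s t : ℝ) : ℝ≥0∞ :=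
  (simplex τ).indicator (fun z => ‖A z.1 z.2‖ₑ) (s, t)

theorem simplexNorm_of_mem {s t : ℝ} (h1 : 0 ≤ s) (h2 : s ≤ t) (h3 : t ≤ τ) :
    simplexNorm τ A s t = ‖A s t‖ₑ :=
  indicator_of_mem (show (s, t) ∈ simplex τ from ⟨h1, h2, h3⟩) _

theorem simplexNorm_of_notMem {s t : ℝ} (h : (s, t) ∉ simplex τ) :
    simplexNorm τ A s t = 0 :=
  indicator_of_notMem h _

theorem measurable_simplexNorm (hA : ContinuousOn (fun z : ℝ × ℝ => A z.1 z.2) (simplex τ)) :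
    Measurable (Function.uncurry (simplexNorm τ A)) := by
  classical
  have := ContinuousOn.measurable_piecewise (f := fun z : ℝ × ℝ => ‖A z.1 z.2‖ₑ)
    (g := fun _ => (0 : ℝ≥0∞)) (s := simplex τ)
    (continuous_enorm.comp_continuousOn hA) continuousOn_const (measurableSet_simplex τ)
  rwa [show (fun _ => (0 : ℝ≥0∞)) = (0 : ℝ × ℝ → ℝ≥0∞) from rfl, piecewise_eq_indicator] at this

/-- The shear `y = x + w` turns an average over a rectangle into an integral over base points and
step lengths, the variables in which Besov moduli are expressed. -/
theorem lintegral_unifIoc_unifIoc {g : ℝ → ℝ → ℝ≥0∞} (hg : Measurable (Function.uncurry g))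
    (k m l : ℝ) :
    ∫⁻ x, ∫⁻ y, g x y ∂unifIoc m l ∂unifIoc k m =
      (ENNReal.ofReal (m - k))⁻¹ * ((ENNReal.ofReal (l - m))⁻¹ *
        ∫⁻ z : ℝ × ℝ, {z : ℝ × ℝ | z.1 ∈ Ioc k m ∧ z.1 + z.2 ∈ Ioc m l}.indicator
          (fun z => g z.1 (z.1 + z.2)) z) := by
  have hS : MeasurableSet {z : ℝ × ℝ | z.1 ∈ Ioc k m ∧ z.1 + z.2 ∈ Ioc m l} :=
    (measurable_fst measurableSet_Ioc).inter ((measurable_fst.add measurable_snd) measurableSet_Ioc)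
  have hgm : Measurable fun z : ℝ × ℝ => g z.1 (z.1 + z.2) :=
    hg.comp (measurable_fst.prodMk (measurable_fst.add measurable_snd))
  rw [Measure.volume_eq_prod, lintegral_prod _ (hgm.indicator hS).aemeasurable]
  simp only [unifIoc, lintegral_smul_measure, smul_eq_mul]
  rw [lintegral_const_mul]
  swap
  · have := hg.lintegral_prod_right' (ν := volume.restrict (Ioc m l))
    exact this
  congr 2
  rw [← lintegral_indicator measurableSet_Ioc]
  refine lintegral_congr fun x => ?_
  by_cases hx : x ∈ Ioc k m
  · rw [indicator_of_mem hx, ← lintegral_indicator measurableSet_Ioc,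
      ← lintegral_add_left_eq_self _ x]
    refine lintegral_congr fun w => ?_
    by_cases hw : x + w ∈ Ioc m l
    · rw [indicator_of_mem hw, indicator_of_mem
        (show (x, w) ∈ {z : ℝ × ℝ | z.1 ∈ Ioc k m ∧ z.1 + z.2 ∈ Ioc m l} from ⟨hx, hw⟩)]
    · rw [indicator_of_notMem hw, indicator_of_notMem fun h => hw h.2]
  · rw [indicator_of_notMem hx]
    have : ∀ w, {z : ℝ × ℝ | z.1 ∈ Ioc k m ∧ z.1 + z.2 ∈ Ioc m l}.indicator
        (fun z => g z.1 (z.1 + z.2)) (x, w) = 0 := fun w => indicator_of_notMem (fun h => hx h.1) _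
    simp only [this, lintegral_zero]

/-- The comparison is given for each fixed step `w` and almost every base point; Fubini with the
step as outer variable transfers it to the rectangle. -/
theorem lintegral_unifIoc_mono {g g' : ℝ → ℝ → ℝ≥0∞} (hg : Measurable (Function.uncurry g))
    (hg' : Measurable (Function.uncurry g')) {k m l : ℝ} (hk : 0 ≤ k) (hl : l ≤ τ)
    (h : ∀ w ∈ Ioc 0 (l - k), ∀ᵐ x ∂volume.restrict (Ioc 0 (τ - w)), g x (x + w) ≤ g' x (x + w)) :
    ∫⁻ x, ∫⁻ y, g x y ∂unifIoc m l ∂unifIoc k m ≤ ∫⁻ x, ∫⁻ y, g' x y ∂unifIoc m l ∂unifIoc k m := by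
  rw [lintegral_unifIoc_unifIoc hg, lintegral_unifIoc_unifIoc hg']
  have hS : MeasurableSet {z : ℝ × ℝ | z.1 ∈ Ioc k m ∧ z.1 + z.2 ∈ Ioc m l} :=
    (measurable_fst measurableSet_Ioc).inter ((measurable_fst.add measurable_snd) measurableSet_Ioc)
  have hm : Measurable fun z : ℝ × ℝ => (z.1, z.1 + z.2) :=
    measurable_fst.prodMk (measurable_fst.add measurable_snd)
  gcongr _ * (_ * ?_)
  have h1 : Measurable fun z : ℝ × ℝ => g z.1 (z.1 + z.2) := hg.comp hm
  have h2 : Measurable fun z : ℝ × ℝ => g' z.1 (z.1 + z.2) := hg'.comp hm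
  rw [Measure.volume_eq_prod, lintegral_prod_symm _ (h1.indicator hS).aemeasurable,
    lintegral_prod_symm _ (h2.indicator hS).aemeasurable]
  refine lintegral_mono fun w => lintegral_mono_ae ?_
  by_cases hw : w ∈ Ioc 0 (l - k)
  · filter_upwards [(ae_restrict_iff' measurableSet_Ioc).1 (h w hw)] with x hx
    by_cases hz : (x, w) ∈ {z : ℝ × ℝ | z.1 ∈ Ioc k m ∧ z.1 + z.2 ∈ Ioc m l}
    · rw [indicator_of_mem hz, indicator_of_mem hz]
      exact hx ⟨hk.trans_lt hz.1.1, by linarith [hz.2.2]⟩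
    · rw [indicator_of_notMem hz, indicator_of_notMem hz]
  · refine Filter.Eventually.of_forall fun x => ?_
    have hz : (x, w) ∉ {z : ℝ × ℝ | z.1 ∈ Ioc k m ∧ z.1 + z.2 ∈ Ioc m l} := fun hz =>
      hw ⟨by linarith [hz.1.2, hz.2.1], by linarith [hz.1.1, hz.2.2]⟩
    rw [indicator_of_notMem hz, indicator_of_notMem hz]

/-- The conclusion of the construction of a control `ω` such that `ω ^ δ` has the same Besov
regularity as `A`. -/
structure IsBesovControl (τ κ δ γ : ℝ) (P : ℝ≥0∞) (c : ℝ≥0) (A : ℝ → ℝ → G) (ω : ℝ → ℝ → ℝ) :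
    Prop where
  ctrl : IsRegControl τ κ ω
  measurable : Measurable (Function.uncurry ω)
  omegaMod_le : ∀ t ∈ Ioc 0 τ, omegaMod τ P (fun s t => ω s t ^ δ) t ≤
    c * (ENNReal.ofReal (t ^ γ) * scaleSup τ γ P A t)
  total_le : ENNReal.ofReal (ω 0 τ ^ δ) ≤
    c * (ENNReal.ofReal (τ ^ (γ - 1 / P.toReal)) * scaleSup τ γ P A τ)
  average : ∀ k m l, 0 ≤ k → k < m → m < l → l ≤ τ → l - k ≤ τ / 2 → l - k ≤ 3 * (m - k) →
    l - k ≤ 3 * (l - m) →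
    ∫⁻ x, ∫⁻ y, simplexNorm τ A x y ∂unifIoc m l ∂unifIoc k m ≤ ENNReal.ofReal (9 * ω k l ^ δ)

theorem ae_le_omegaMod_top {w : ℝ} (hw : 0 < w) :
    ∀ᵐ x ∂volume.restrict (Ioc 0 (τ - w)), simplexNorm τ A x (x + w) ≤ omegaMod τ ∞ A w := by
  have h1 := eLpNorm_slice_le_omegaMod (T := τ) (p := ∞) (A := A) hw le_rfl
  rw [eLpNorm_exponent_top] at h1
  filter_upwards [ae_restrict_mem measurableSet_Ioc,
    enorm_ae_le_eLpNormEssSup (fun s => A s (s + w)) (volume.restrict (Ioc 0 (τ - w)))] with x hx h2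
  rw [simplexNorm_of_mem hx.1.le (by linarith) (by linarith [hx.2])]
  exact h2.trans h1

/-- For `P = ∞` the control depends on `t - s` only: it is `h ^ (γ * ρ) * S h ^ ρ` with `S`
monotone. Since `γ * ρ > 1`, this is superadditive and vanishes at least linearly, whence the
regularity exponent one. -/
theorem exists_isBesovControl_top {ρ γ : ℝ} (hτ : 0 < τ) (hρ : 0 < ρ) (hγ : 1 / ρ < γ)
    (hA : ContinuousOn (fun z : ℝ × ℝ => A z.1 z.2) (simplex τ))
    (hfin : scaleSup τ γ ∞ A τ ≠ ∞) :
    ∃ ω, IsBesovControl τ 1 (1 / ρ) γ ∞ 1 A ω := by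
  have hγ0 : 0 < γ := (by positivity : 0 < 1 / ρ).trans hγ
  have hγρ : 1 < γ * ρ := by rwa [div_lt_iff₀ hρ] at hγ
  -- The truncation at `τ` makes `S` finite and monotone on the whole line, in particular
  -- measurable.
  set S : ℝ → ℝ := fun h => (scaleSup τ γ ∞ A (min h τ)).toReal with hS
  have hSfin : ∀ h, scaleSup τ γ ∞ A (min h τ) ≠ ∞ := fun h =>
    ne_top_of_le_ne_top hfin (scaleSup_mono τ γ ∞ A (min_le_right _ _))
  have hSm : Monotone S := fun x y hxy =>
    ENNReal.toReal_mono (hSfin y) (scaleSup_mono τ γ ∞ A (min_le_min_right _ hxy))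
  have hS0 : ∀ h, 0 ≤ S h := fun h => ENNReal.toReal_nonneg
  set g : ℝ → ℝ := fun h => h ^ (γ * ρ) * S h ^ ρ with hg
  have hgρ : ∀ h, 0 ≤ h → g h ^ (1 / ρ) = h ^ γ * S h := fun h hh => by
    rw [hg, Real.mul_rpow (by positivity) (Real.rpow_nonneg (hS0 h) _), ← Real.rpow_mul hh,
      ← Real.rpow_mul (hS0 h)]
    field_simp
    simp
  have hgE : ∀ h, 0 < h → h ≤ τ → ENNReal.ofReal (g h ^ (1 / ρ)) =
      ENNReal.ofReal (h ^ γ) * scaleSup τ γ ∞ A h := fun h h0 hh => by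
    rw [hgρ h h0.le, ENNReal.ofReal_mul (by positivity)]
    simp only [hS]
    rw [ENNReal.ofReal_toReal (hSfin h), min_eq_left hh]
  have hctrl : IsControl 0 τ fun s t => g (t - s) := by
    refine ⟨fun s t _ hst _ => ?_, fun s u t _ hsu hut _ => ?_⟩
    · exact mul_nonneg (Real.rpow_nonneg (by linarith) _) (Real.rpow_nonneg (hS0 _) _)
    · have hx : 0 ≤ u - s := by linarith
      have hy : 0 ≤ t - u := by linarith
      have h1 : S (u - s) ^ ρ ≤ S (t - s) ^ ρ :=
        Real.rpow_le_rpow (hS0 _) (hSm (by linarith)) hρ.le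
      have h2 : S (t - u) ^ ρ ≤ S (t - s) ^ ρ :=
        Real.rpow_le_rpow (hS0 _) (hSm (by linarith)) hρ.le
      have h3 : (u - s) ^ (γ * ρ) + (t - u) ^ (γ * ρ) ≤ (t - s) ^ (γ * ρ) := by
        have := Real.add_rpow_le_rpow_add hx hy hγρ.le
        rwa [show u - s + (t - u) = t - s by ring] at this
      calc g (u - s) + g (t - u) ≤ (u - s) ^ (γ * ρ) * S (t - s) ^ ρ +
            (t - u) ^ (γ * ρ) * S (t - s) ^ ρ := by simp only [hg]; gcongr
        _ = ((u - s) ^ (γ * ρ) + (t - u) ^ (γ * ρ)) * S (t - s) ^ ρ := by ring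
        _ ≤ g (t - s) := mul_le_mul_of_nonneg_right h3 (Real.rpow_nonneg (hS0 _) _)
  have hgm : Measurable g := by
    have := hSm.measurable
    simp only [hg]
    fun_prop
  refine ⟨fun s t => g (t - s), ⟨hctrl, ?_⟩, ?_, ?_, ?_, ?_⟩
  · intro s s' t' t h1 h2 h3 h4 h5
    simp only [Real.rpow_one]
    have hx : 0 ≤ t' - s' := by linarith
    have hy : 0 ≤ t - s := by linarith
    have hsplit : ∀ x : ℝ, 0 ≤ x → x ^ (γ * ρ) = x * x ^ (γ * ρ - 1) := fun x hx => by
      rw [← Real.rpow_one_add' hx (by linarith)]; ring_nf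
    simp only [hg]
    rw [hsplit _ hx, hsplit _ hy]
    have h6 : (t' - s') ^ (γ * ρ - 1) ≤ (t - s) ^ (γ * ρ - 1) :=
      Real.rpow_le_rpow hx (by linarith) (by linarith)
    have h7 : S (t' - s') ^ ρ ≤ S (t - s) ^ ρ :=
      Real.rpow_le_rpow (hS0 _) (hSm (by linarith)) hρ.le
    have h8 : 0 ≤ S (t' - s') ^ ρ := Real.rpow_nonneg (hS0 _) _
    calc _ = ((t' - s') * (t - s)) * ((t' - s') ^ (γ * ρ - 1) * S (t' - s') ^ ρ) := by ring
      _ ≤ ((t' - s') * (t - s)) * ((t - s) ^ (γ * ρ - 1) * S (t - s) ^ ρ) := by gcongr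
      _ = _ := by ring
  · exact hgm.comp (measurable_snd.sub measurable_fst)
  · intro t ht
    refine iSup₂_le fun w hw => ?_
    simp only [add_sub_cancel_left, ENNReal.coe_one, one_mul]
    rw [eLpNorm_exponent_top]
    refine eLpNormEssSup_le_of_ae_enorm_bound (Filter.Eventually.of_forall fun x => ?_)
    have h0 : 0 ≤ g w ^ (1 / ρ) := by
      rw [hgρ w hw.1.le]; exact mul_nonneg (Real.rpow_nonneg hw.1.le _) (hS0 _)
    rw [Real.enorm_eq_ofReal h0, hgE w hw.1 (hw.2.trans ht.2)]
    refine mul_le_mul' (ENNReal.ofReal_le_ofReal (Real.rpow_le_rpow hw.1.le hw.2 hγ0.le))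
      (scaleSup_mono τ γ ∞ A hw.2)
  · simp only [sub_zero, ENNReal.coe_one, one_mul]
    rw [hgE τ hτ le_rfl]
    simp
  · intro k m l hk hkm hml hl hlk _ _
    have := isProbabilityMeasure_unifIoc hkm
    have := isProbabilityMeasure_unifIoc hml
    have hlk0 : 0 < l - k := by linarith
    calc _ ≤ ∫⁻ x, ∫⁻ y, omegaMod τ ∞ A (l - k) ∂unifIoc m l ∂unifIoc k m := by
          refine lintegral_unifIoc_mono (measurable_simplexNorm hA)
            (measurable_const (a := omegaMod τ ∞ A (l - k))) hk hl fun w hw => ?_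
          filter_upwards [ae_le_omegaMod_top (A := A) hw.1] with x hx
          exact hx.trans (omegaMod_mono τ ∞ A hw.2)
      _ = omegaMod τ ∞ A (l - k) := by simp
      _ ≤ ENNReal.ofReal ((l - k) ^ γ) * scaleSup τ γ ∞ A (l - k) :=
          omegaMod_le_scaleSup hlk0 le_rfl hlk
      _ = ENNReal.ofReal (g (l - k) ^ (1 / ρ)) := (hgE _ hlk0 (by linarith)).symm
      _ ≤ _ := by
          refine ENNReal.ofReal_le_ofReal ?_
          have h0 : 0 ≤ g (l - k) ^ (1 / ρ) := by
            rw [hgρ _ hlk0.le]; exact mul_nonneg (Real.rpow_nonneg hlk0.le _) (hS0 _)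
          linarith

end

/-! ### The kernel construction of the control for finite integrability. -/

section

variable {G : Type*} [NormedAddCommGroup G] {τ δ γ : ℝ} {P : ℝ≥0∞} {A : ℝ → ℝ → G}

/-- The density `‖A(u, u + w)‖^P w^{-1 - δ P}`. -/
noncomputable def kernelDensity (τ δ P : ℝ) (A : ℝ → ℝ → G) (z : ℝ × ℝ) : ℝ≥0∞ :=
  (Ioc 0 (τ / 2)).indicator (fun w : ℝ => ENNReal.ofReal (w ^ (-1 - δ * P))) z.2 *
    simplexNorm τ A z.1 (z.1 + z.2) ^ P

/-- The integral of `‖A(u, v)‖^P (v - u)^{-1 - δ P}` over `s < u ≤ v ≤ t`. -/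
noncomputable def kernelMass (τ δ P : ℝ) (A : ℝ → ℝ → G) (s t : ℝ) : ℝ≥0∞ :=
  ∫⁻ z, {z : ℝ × ℝ | s < z.1 ∧ z.1 + z.2 ≤ t}.indicator (kernelDensity τ δ P A) z

theorem measurable_kernelDensity {R : ℝ}
    (hA : ContinuousOn (fun z : ℝ × ℝ => A z.1 z.2) (simplex τ)) :
    Measurable (kernelDensity τ δ R A) := by
  have h1 : Measurable ((Ioc 0 (τ / 2)).indicator fun w : ℝ => ENNReal.ofReal (w ^ (-1 - δ * R))) :=
    Measurable.indicator (by fun_prop) measurableSet_Ioc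
  have h2 : Measurable fun z : ℝ × ℝ => simplexNorm τ A z.1 (z.1 + z.2) :=
    (measurable_simplexNorm hA).comp (measurable_fst.prodMk (measurable_fst.add measurable_snd))
  exact (h1.comp measurable_snd).mul (h2.pow_const _)

theorem kernelDensity_eq_zero {R : ℝ} {z : ℝ × ℝ} (h : z.2 ∉ Ioc 0 (τ / 2)) :
    kernelDensity τ δ R A z = 0 := by
  rw [kernelDensity, indicator_of_notMem h, zero_mul]

theorem measurableSet_kernel (s t : ℝ) : MeasurableSet {z : ℝ × ℝ | s < z.1 ∧ z.1 + z.2 ≤ t} :=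
  (measurableSet_lt measurable_const measurable_fst).inter
    (measurableSet_le (measurable_fst.add measurable_snd) measurable_const)

theorem measurable_kernelMass {R : ℝ}
    (hA : ContinuousOn (fun z : ℝ × ℝ => A z.1 z.2) (simplex τ)) :
    Measurable (Function.uncurry (kernelMass τ δ R A)) := by
  have hS : MeasurableSet {x : (ℝ × ℝ) × (ℝ × ℝ) | x.1.1 < x.2.1 ∧ x.2.1 + x.2.2 ≤ x.1.2} :=
    (measurableSet_lt measurable_fst.fst measurable_snd.fst).inter
      (measurableSet_le (measurable_snd.fst.add measurable_snd.snd) measurable_fst.snd)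
  have := (((measurable_kernelDensity (δ := δ) (R := R) hA).comp
    (measurable_snd (α := ℝ × ℝ))).indicator hS).lintegral_prod_right' (ν := volume)
  exact this

/-- The pairs contained in `(s, u]` and those contained in `(u, t]` are disjoint, since the density
is supported on positive steps. -/
theorem kernelMass_add_le {R : ℝ} (hA : ContinuousOn (fun z : ℝ × ℝ => A z.1 z.2) (simplex τ))
    {s u t : ℝ} (hsu : s ≤ u) (hut : u ≤ t) :
    kernelMass τ δ R A s u + kernelMass τ δ R A u t ≤ kernelMass τ δ R A s t := by
  rw [kernelMass, kernelMass, kernelMass, ← lintegral_add_left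
    ((measurable_kernelDensity hA).indicator (measurableSet_kernel s u))]
  refine lintegral_mono fun z => ?_
  by_cases hz : z.2 ∈ Ioc 0 (τ / 2)
  · simp only [indicator_apply, mem_ofPred_eq]
    have := hz.1
    by_cases h1 : s < z.1 ∧ z.1 + z.2 ≤ u
    · rw [if_pos h1, if_neg (by intro h; linarith [h.1]), if_pos ⟨h1.1, h1.2.trans hut⟩, add_zero]
    · rw [if_neg h1, zero_add]
      by_cases h2 : u < z.1 ∧ z.1 + z.2 ≤ t
      · rw [if_pos h2, if_pos ⟨hsu.trans_lt h2.1, h2.2⟩]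
      · rw [if_neg h2]; exact zero_le
  · simp [indicator_apply, kernelDensity_eq_zero hz]

theorem lintegral_slice_le (hP : P ≠ 0) (hPt : P ≠ ∞) {w : ℝ} (hw : 0 < w) :
    ∫⁻ x, simplexNorm τ A x (x + w) ^ P.toReal ≤ omegaMod τ P A w ^ P.toReal := by
  have hR : 0 < P.toReal := ENNReal.toReal_pos hP hPt
  have h1 := eLpNorm_slice_le_omegaMod (T := τ) (p := P) (A := A) hw le_rfl
  rw [eLpNorm_eq_lintegral_rpow_enorm_toReal hP hPt] at h1
  have h2 := ENNReal.rpow_le_rpow h1 hR.le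
  rw [← ENNReal.rpow_mul, one_div_mul_cancel hR.ne', ENNReal.rpow_one] at h2
  refine le_trans (le_of_eq ?_) h2
  rw [Measure.restrict_congr_set Ioc_ae_eq_Icc, ← lintegral_indicator measurableSet_Icc]
  refine lintegral_congr fun x => ?_
  by_cases hx : x ∈ Icc 0 (τ - w)
  · rw [indicator_of_mem hx, simplexNorm_of_mem hx.1 (by linarith) (by linarith [hx.2])]
  · rw [indicator_of_notMem hx, simplexNorm_of_notMem, ENNReal.zero_rpow_of_pos hR]
    exact fun h => hx ⟨h.1, by linarith [h.2.2]⟩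

theorem lintegral_rpow_Ioc {a h : ℝ} (ha : 0 < a) (hh : 0 ≤ h) :
    ∫⁻ w in Ioc 0 h, ENNReal.ofReal (w ^ (a - 1)) = ENNReal.ofReal (h ^ a / a) := by
  have hi : IntervalIntegrable (fun w : ℝ => w ^ (a - 1)) volume 0 h :=
    intervalIntegral.intervalIntegrable_rpow' (by linarith)
  rw [intervalIntegrable_iff_integrableOn_Ioc_of_le hh] at hi
  rw [← ofReal_integral_eq_lintegral_ofReal hi, ← intervalIntegral.integral_of_le hh,
    integral_rpow (Or.inl (by linarith))]
  · rw [sub_add_cancel, Real.zero_rpow ha.ne', sub_zero]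
  · filter_upwards [ae_restrict_mem measurableSet_Ioc] with w hw
    exact Real.rpow_nonneg hw.1.le _

/-- For a fixed step `w` the integral over base points is at most `omegaMod τ P A w ^ P`, hence at
most `w ^ (γ * P)` times a power of `scaleSup`. The remaining power of `w` is integrable at zero
because `δ < γ`. -/
theorem lintegral_kernelDensity_le (hP : P ≠ 0) (hPt : P ≠ ∞) (hδγ : δ < γ)
    (hA : ContinuousOn (fun z : ℝ × ℝ => A z.1 z.2) (simplex τ)) {h : ℝ} (hh : 0 ≤ h) :
    ∫⁻ z, {z : ℝ × ℝ | z.2 ≤ h}.indicator (kernelDensity τ δ P.toReal A) z ≤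
      scaleSup τ γ P A h ^ P.toReal *
        ENNReal.ofReal (h ^ ((γ - δ) * P.toReal) / ((γ - δ) * P.toReal)) := by
  have hR : 0 < P.toReal := ENNReal.toReal_pos hP hPt
  set R := P.toReal with hRdef
  have hS : MeasurableSet {z : ℝ × ℝ | z.2 ≤ h} := measurableSet_le measurable_snd measurable_const
  rw [← lintegral_rpow_Ioc (mul_pos (sub_pos.2 hδγ) hR) hh, Measure.volume_eq_prod,
    lintegral_prod_symm _ ((measurable_kernelDensity hA).indicator hS).aemeasurable,
    ← lintegral_const_mul _ (by fun_prop), ← lintegral_indicator measurableSet_Ioc]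
  refine lintegral_mono fun w => ?_
  by_cases hw : w ∈ Ioc 0 (min h (τ / 2))
  · have hw1 : w ≤ h := hw.2.trans (min_le_left _ _)
    have hw2 : w ≤ τ / 2 := hw.2.trans (min_le_right _ _)
    rw [indicator_of_mem (show w ∈ Ioc 0 h from ⟨hw.1, hw1⟩)]
    have h1 : ∀ x, {z : ℝ × ℝ | z.2 ≤ h}.indicator (kernelDensity τ δ R A) (x, w) =
        ENNReal.ofReal (w ^ (-1 - δ * R)) * simplexNorm τ A x (x + w) ^ R := fun x => by
      rw [indicator_of_mem (show (x, w) ∈ {z : ℝ × ℝ | z.2 ≤ h} from hw1), kernelDensity,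
        indicator_of_mem (show w ∈ Ioc 0 (τ / 2) from ⟨hw.1, hw2⟩)]
    simp only [h1]
    have hm : Measurable fun x => simplexNorm τ A x (x + w) ^ R :=
      ((measurable_simplexNorm hA).comp
        (by fun_prop : Measurable fun x : ℝ => (x, x + w))).pow_const _
    rw [lintegral_const_mul _ hm]
    calc _ ≤ ENNReal.ofReal (w ^ (-1 - δ * R)) *
          (ENNReal.ofReal (w ^ γ) * scaleSup τ γ P A h) ^ R := by
          gcongr
          exact (lintegral_slice_le hP hPt hw.1).trans
            (ENNReal.rpow_le_rpow (omegaMod_le_scaleSup hw.1 hw1 hw2) hR.le)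
      _ = _ := by
          rw [ENNReal.mul_rpow_of_nonneg _ _ hR.le, ← mul_assoc, mul_comm (scaleSup τ γ P A h ^ R),
            ENNReal.ofReal_rpow_of_nonneg (Real.rpow_nonneg hw.1.le _) hR.le,
            ← ENNReal.ofReal_mul (Real.rpow_nonneg hw.1.le _), ← Real.rpow_mul hw.1.le,
            ← Real.rpow_add hw.1]
          ring_nf
  · refine le_trans (le_of_eq ?_) (zero_le)
    have h1 : ∀ x, {z : ℝ × ℝ | z.2 ≤ h}.indicator (kernelDensity τ δ R A) (x, w) = 0 := by
      intro x
      by_cases hwh : w ≤ h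
      · refine (indicator_of_mem (show (x, w) ∈ {z : ℝ × ℝ | z.2 ≤ h} from hwh) _).trans
          (kernelDensity_eq_zero fun h => hw ⟨h.1, le_min hwh h.2⟩)
      · exact indicator_of_notMem (show (x, w) ∉ {z : ℝ × ℝ | z.2 ≤ h} from hwh) _
    simp only [h1, lintegral_zero]

theorem kernelMass_le {R : ℝ} {s t h : ℝ} (hst : t - s ≤ h) :
    kernelMass τ δ R A s t ≤
      ∫⁻ z, {z : ℝ × ℝ | z.2 ≤ h}.indicator (kernelDensity τ δ R A) z := by
  refine lintegral_mono fun z => ?_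
  simp only [indicator_apply, mem_ofPred_eq]
  split_ifs with h1 h2
  · exact le_rfl
  · exact absurd (by linarith [h1.1, h1.2]) h2
  · exact zero_le
  · exact zero_le

/-- By Fubini, a pair with step `w ≤ h` is seen from the windows `[s, s + h]` with `s` in an
interval of length `h - w ≤ h`. -/
theorem lintegral_kernelMass_le {R : ℝ}
    (hA : ContinuousOn (fun z : ℝ × ℝ => A z.1 z.2) (simplex τ)) {h : ℝ} :
    ∫⁻ s, kernelMass τ δ R A s (s + h) ≤ ENNReal.ofReal h *
      ∫⁻ z, {z : ℝ × ℝ | z.2 ≤ h}.indicator (kernelDensity τ δ R A) z := by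
  have hS : MeasurableSet {z : ℝ × ℝ | z.2 ≤ h} := measurableSet_le measurable_snd measurable_const
  have hS' : MeasurableSet {x : ℝ × (ℝ × ℝ) | x.1 < x.2.1 ∧ x.2.1 + x.2.2 ≤ x.1 + h} :=
    (measurableSet_lt measurable_fst measurable_snd.fst).inter
      (measurableSet_le (measurable_snd.fst.add measurable_snd.snd) (measurable_fst.add_const h))
  have hm := ((measurable_kernelDensity (δ := δ) (R := R) hA).comp
    (measurable_snd (α := ℝ))).indicator hS'
  have hsw := lintegral_lintegral_swap (μ := (volume : Measure ℝ)) (ν := (volume : Measure (ℝ × ℝ)))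
    (f := fun s z => {z : ℝ × ℝ | s < z.1 ∧ z.1 + z.2 ≤ s + h}.indicator (kernelDensity τ δ R A) z)
    (show AEMeasurable _ _ from Measurable.aemeasurable hm)
  refine hsw.trans_le ?_
  rw [← lintegral_const_mul _ ((measurable_kernelDensity hA).indicator hS)]
  refine lintegral_mono fun z => ?_
  have h1 : ∀ s, {z : ℝ × ℝ | s < z.1 ∧ z.1 + z.2 ≤ s + h}.indicator (kernelDensity τ δ R A) z =
      (Ico (z.1 + z.2 - h) z.1).indicator (fun _ => kernelDensity τ δ R A z) s := by
    intro s
    simp only [indicator_apply, mem_ofPred_eq, mem_Ico]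
    refine if_congr ⟨fun h => ⟨by linarith [h.2], h.1⟩, fun h => ⟨h.2, by linarith [h.1]⟩⟩ rfl rfl
  simp only [h1]
  rw [lintegral_indicator measurableSet_Ico, setLIntegral_const, Real.volume_Ico, mul_comm]
  by_cases hz : z.2 ≤ h
  · rw [indicator_of_mem (show z ∈ {z : ℝ × ℝ | z.2 ≤ h} from hz)]
    by_cases hz' : z.2 ∈ Ioc 0 (τ / 2)
    · gcongr
      linarith [hz'.1]
    · simp [kernelDensity_eq_zero hz']
  · have : ENNReal.ofReal (z.1 - (z.1 + z.2 - h)) = 0 := ENNReal.ofReal_of_nonpos (by linarith)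
    rw [this, zero_mul]
    exact zero_le

/-- Jensen's inequality on the product of two probability spaces. -/
theorem lintegral_lintegral_rpow_le {μ ν : Measure ℝ} [IsProbabilityMeasure μ]
    [IsProbabilityMeasure ν] {a : ℝ → ℝ → ℝ≥0∞} (ha : Measurable (Function.uncurry a)) {R : ℝ}
    (hR : 1 ≤ R) :
    ∫⁻ x, ∫⁻ y, a x y ∂μ ∂ν ≤ (∫⁻ x, ∫⁻ y, a x y ^ R ∂μ ∂ν) ^ (1 / R) := by
  have h := eLpNorm_le_eLpNorm_of_exponent_le (μ := ν.prod μ) (f := Function.uncurry a)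
    (p := 1) (q := ENNReal.ofReal R) (by simpa using ENNReal.ofReal_le_ofReal hR)
    ha.aestronglyMeasurable
  rw [eLpNorm_one_eq_lintegral_enorm, eLpNorm_eq_lintegral_rpow_enorm_toReal
    (by simp; linarith) ENNReal.ofReal_ne_top, ENNReal.toReal_ofReal (by linarith)] at h
  simp only [enorm_eq_self] at h
  rwa [lintegral_prod _ ha.aemeasurable, lintegral_prod _ (ha.pow_const R).aemeasurable] at h

/-- On the rectangle all steps are at most `l - k`, so the kernel is bounded below by `(l - k) ^ (-1
- δ * R)`. Both sides are at least a third of `l - k`, which gives the factor nine. -/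
theorem lintegral_unifIoc_simplexNorm_rpow_le {R : ℝ} (hR : 0 ≤ R) (hδ : 0 ≤ δ)
    (hA : ContinuousOn (fun z : ℝ × ℝ => A z.1 z.2) (simplex τ)) {k m l : ℝ} (hlk : l - k ≤ τ / 2)
    (hkm : k < m) (hml : m < l) (h1 : l - k ≤ 3 * (m - k)) (h2 : l - k ≤ 3 * (l - m)) :
    ∫⁻ x, ∫⁻ y, simplexNorm τ A x y ^ R ∂unifIoc m l ∂unifIoc k m ≤
      ENNReal.ofReal (9 * (l - k) ^ (δ * R - 1)) * kernelMass τ δ R A k l := by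
  have hd : 0 < l - k := by linarith
  rw [lintegral_unifIoc_unifIoc (g := fun x y => simplexNorm τ A x y ^ R)
    ((measurable_simplexNorm hA).pow_const R)]
  have h3 : ∫⁻ z : ℝ × ℝ, {z : ℝ × ℝ | z.1 ∈ Ioc k m ∧ z.1 + z.2 ∈ Ioc m l}.indicator
      (fun z => simplexNorm τ A z.1 (z.1 + z.2) ^ R) z ≤
      ENNReal.ofReal ((l - k) ^ (1 + δ * R)) * kernelMass τ δ R A k l := by
    rw [kernelMass, ← lintegral_const_mul _
      ((measurable_kernelDensity hA).indicator (measurableSet_kernel k l))]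
    refine lintegral_mono_ae ?_
    have hne : ∀ᵐ z : ℝ × ℝ, z.2 ≠ 0 := by
      have : ∀ᵐ w : ℝ, w ≠ 0 := by simp [ae_iff]
      exact Measure.quasiMeasurePreserving_snd.ae this
    filter_upwards [hne] with z hz0
    by_cases hz : z.1 ∈ Ioc k m ∧ z.1 + z.2 ∈ Ioc m l
    · rw [indicator_of_mem (show z ∈ {z : ℝ × ℝ | z.1 ∈ Ioc k m ∧ z.1 + z.2 ∈ Ioc m l} from hz),
        indicator_of_mem (show z ∈ {z : ℝ × ℝ | k < z.1 ∧ z.1 + z.2 ≤ l} from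
          ⟨hz.1.1, hz.2.2⟩), kernelDensity]
      have hw : 0 < z.2 := lt_of_le_of_ne (by linarith [hz.1.2, hz.2.1]) (Ne.symm hz0)
      have hw2 : z.2 ≤ l - k := by linarith [hz.1.1, hz.2.2]
      rw [indicator_of_mem (show z.2 ∈ Ioc 0 (τ / 2) from ⟨hw, hw2.trans hlk⟩), ← mul_assoc,
        ← ENNReal.ofReal_mul (Real.rpow_nonneg hd.le _)]
      refine le_mul_of_one_le_left (zero_le) ?_
      rw [ENNReal.one_le_ofReal]
      calc (1 : ℝ) = z.2 ^ (1 + δ * R) * z.2 ^ (-1 - δ * R) := by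
            rw [← Real.rpow_add hw]; ring_nf; simp
        _ ≤ _ := by gcongr
    · rw [indicator_of_notMem (show z ∉ {z : ℝ × ℝ | z.1 ∈ Ioc k m ∧ z.1 + z.2 ∈ Ioc m l} from hz)]
      exact zero_le
  refine (mul_le_mul_right (mul_le_mul_right h3 _) _).trans ?_
  rw [← ENNReal.ofReal_inv_of_pos (by linarith), ← ENNReal.ofReal_inv_of_pos (by linarith),
    ← mul_assoc, ← mul_assoc, mul_assoc (ENNReal.ofReal (m - k)⁻¹),
    ← ENNReal.ofReal_mul (by simp; linarith), ← ENNReal.ofReal_mul (by simp; linarith)]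
  refine mul_le_mul_left (ENNReal.ofReal_le_ofReal ?_) _
  have e1 : (m - k)⁻¹ ≤ 3 * (l - k)⁻¹ := by
    rw [inv_le_comm₀ (by linarith) (by positivity), mul_inv, inv_inv]; linarith
  have e2 : (l - m)⁻¹ ≤ 3 * (l - k)⁻¹ := by
    rw [inv_le_comm₀ (by linarith) (by positivity), mul_inv, inv_inv]; linarith
  have e3 : (l - k) ^ (1 + δ * R) = (l - k) ^ (δ * R - 1) * (l - k) * (l - k) := by
    rw [← Real.rpow_add_one hd.ne', ← Real.rpow_add_one hd.ne']; ring_nf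
  calc _ ≤ 3 * (l - k)⁻¹ * (3 * (l - k)⁻¹ * (l - k) ^ (1 + δ * R)) := by
        gcongr
    _ = _ := by rw [e3]; field_simp; ring

end

section

variable {G : Type*} [NormedAddCommGroup G] {τ δ γ : ℝ} {P : ℝ≥0∞} {A : ℝ → ℝ → G}

theorem kernelMass_total_le (hP : P ≠ 0) (hPt : P ≠ ∞) (hδγ : δ < γ)
    (hA : ContinuousOn (fun z : ℝ × ℝ => A z.1 z.2) (simplex τ)) {h s t : ℝ} (hh : 0 ≤ h)
    (hst : t - s ≤ h) :
    kernelMass τ δ P.toReal A s t ^ (1 / P.toReal) ≤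
      ENNReal.ofReal (((γ - δ) * P.toReal)⁻¹ ^ (1 / P.toReal)) *
        (ENNReal.ofReal (h ^ (γ - δ)) * scaleSup τ γ P A h) := by
  have hR : 0 < P.toReal := ENNReal.toReal_pos hP hPt
  have hη : 0 < (γ - δ) * P.toReal := mul_pos (sub_pos.2 hδγ) hR
  refine (ENNReal.rpow_le_rpow ((kernelMass_le hst).trans
    (lintegral_kernelDensity_le hP hPt hδγ hA hh)) (by positivity)).trans_eq ?_
  rw [ENNReal.mul_rpow_of_nonneg _ _ (by positivity), ← ENNReal.rpow_mul,
    mul_one_div_cancel hR.ne', ENNReal.rpow_one, ENNReal.ofReal_rpow_of_nonneg (by positivity)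
    (by positivity), div_eq_mul_inv, Real.mul_rpow (by positivity) (by positivity),
    ← Real.rpow_mul hh, mul_assoc (γ - δ), mul_one_div_cancel hR.ne', mul_one,
    ENNReal.ofReal_mul (by positivity)]
  ring

/-- The control is a geometric mean of the length and the kernel mass. The length factor gives the
regularity with `κ = 1 - ρ / P`. The power `1 / ρ` contains the kernel mass to the power `1 / P`, so
its `L^P` norm in the base point reduces to an integral of the mass, computed by Fubini; the powers
of `h` add up to `h ^ γ`. -/
theorem exists_isBesovControl_of_ne_top {ρ : ℝ} (hτ : 0 < τ) (hρ : 0 < ρ) (hγ : 1 / ρ < γ)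
    (hP : 1 ≤ P) (hPt : P ≠ ∞) (hρP : ρ < P.toReal)
    (hA : ContinuousOn (fun z : ℝ × ℝ => A z.1 z.2) (simplex τ))
    (hfin : scaleSup τ γ P A τ ≠ ∞) :
    ∃ ω, IsBesovControl τ (1 - ρ / P.toReal) (1 / ρ) γ P
      (((γ - 1 / ρ) * P.toReal)⁻¹ ^ (1 / P.toReal) : ℝ).toNNReal A ω := by
  have hP0 : P ≠ 0 := (zero_lt_one.trans_le hP).ne'
  have hR : 0 < P.toReal := ENNReal.toReal_pos hP0 hPt
  have hR1 : 1 ≤ P.toReal := by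
    simpa using (ENNReal.toReal_le_toReal ENNReal.one_ne_top hPt).2 hP
  set R := P.toReal with hRdef
  set c : ℝ := ((γ - 1 / ρ) * R)⁻¹ ^ (1 / R) with hc
  have hγ0 : 0 < γ - 1 / ρ := sub_pos.2 hγ
  have hκ : 0 < 1 - ρ / R := by rw [sub_pos, div_lt_one hR]; exact hρP
  have hI1 : ∀ {s t h : ℝ}, 0 ≤ h → t - s ≤ h → kernelMass τ (1 / ρ) R A s t ^ (1 / R) ≤
      ENNReal.ofReal c * (ENNReal.ofReal (h ^ (γ - 1 / ρ)) * scaleSup τ γ P A h) :=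
    fun hh hst => kernelMass_total_le hP0 hPt hγ hA hh hst
  have hIfin : ∀ s t, t - s ≤ τ → kernelMass τ (1 / ρ) R A s t ≠ ∞ := by
    intro s t hst h
    have := hI1 hτ.le hst
    rw [h, ENNReal.top_rpow_of_pos (by positivity), top_le_iff] at this
    exact ENNReal.mul_ne_top ENNReal.ofReal_ne_top (ENNReal.mul_ne_top ENNReal.ofReal_ne_top hfin)
      this
  set I : ℝ → ℝ → ℝ := fun s t => (kernelMass τ (1 / ρ) R A s t).toReal with hI
  have hI0 : ∀ s t, 0 ≤ I s t := fun _ _ => ENNReal.toReal_nonneg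
  have hIctrl : IsControl 0 τ I := by
    refine ⟨fun s t _ _ _ => hI0 s t, fun s u t hs hsu hut ht => ?_⟩
    simp only [hI]
    rw [← ENNReal.toReal_add (hIfin _ _ (by linarith)) (hIfin _ _ (by linarith))]
    exact ENNReal.toReal_mono (hIfin _ _ (by linarith)) (kernelMass_add_le hA hsu hut)
  have hlen : IsControl 0 τ fun s t : ℝ => t - s :=
    ⟨fun s t _ h _ => sub_nonneg.2 h, fun s u t _ _ _ _ => by linarith⟩
  set ω : ℝ → ℝ → ℝ := fun s t => (t - s) ^ (1 - ρ / R) * I s t ^ (ρ / R) with hω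
  have hωδ : ∀ s t, s ≤ t → ω s t ^ (1 / ρ) = (t - s) ^ (1 / ρ - 1 / R) * I s t ^ (1 / R) := by
    intro s t hst
    have h0 : 0 ≤ t - s := sub_nonneg.2 hst
    simp only [hω]
    rw [Real.mul_rpow (by positivity) (Real.rpow_nonneg (hI0 _ _) _), ← Real.rpow_mul h0,
      ← Real.rpow_mul (hI0 _ _)]
    congr 2 <;> field_simp
  have hωE : ∀ s t, s ≤ t → t - s ≤ τ → ENNReal.ofReal (ω s t ^ (1 / ρ)) =
      ENNReal.ofReal ((t - s) ^ (1 / ρ - 1 / R)) * kernelMass τ (1 / ρ) R A s t ^ (1 / R) := by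
    intro s t hst hτ'
    rw [hωδ s t hst, ENNReal.ofReal_mul (Real.rpow_nonneg (sub_nonneg.2 hst) _),
      ← ENNReal.ofReal_rpow_of_nonneg (hI0 _ _) (by positivity)]
    simp only [hI]
    rw [ENNReal.ofReal_toReal (hIfin s t hτ')]
  have hcc : ((c.toNNReal : ℝ≥0) : ℝ≥0∞) = ENNReal.ofReal c := rfl
  have hIm : Measurable (Function.uncurry I) := (measurable_kernelMass hA).ennreal_toReal
  refine ⟨ω, ⟨hlen.rpow_mul_rpow hIctrl hκ.le (by positivity) (by ring), ?_⟩, ?_, ?_, ?_, ?_⟩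
  · intro s s' t' t h1 h2 h3 h4 h5
    have h6 : I s' t' ^ (ρ / R) ≤ I s t ^ (ρ / R) :=
      Real.rpow_le_rpow (hI0 _ _) (hIctrl.mono h1 h2 h3 h4 h5) (by positivity)
    have hx : 0 ≤ t' - s' := by linarith
    have hy : 0 ≤ t - s := by linarith
    simp only [hω]
    calc _ = ((t' - s') ^ (1 - ρ / R) * (t - s) ^ (1 - ρ / R)) * I s' t' ^ (ρ / R) := by ring
      _ ≤ ((t' - s') ^ (1 - ρ / R) * (t - s) ^ (1 - ρ / R)) * I s t ^ (ρ / R) := by gcongr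
      _ = _ := by ring
  · have : Measurable fun z : ℝ × ℝ => (z.2 - z.1) ^ (1 - ρ / R) * I z.1 z.2 ^ (ρ / R) :=
      ((measurable_snd.sub measurable_fst).pow_const _).mul (hIm.pow_const _)
    exact this
  · intro t ht
    refine iSup₂_le fun h hh => ?_
    have hh0 := hh.1
    have hhτ : h ≤ τ := hh.2.trans ht.2
    rw [hcc, eLpNorm_eq_lintegral_rpow_enorm_toReal hP0 hPt, ← hRdef]
    have h1 : ∀ s, ‖ω s (s + h) ^ (1 / ρ)‖ₑ ^ R =
        ENNReal.ofReal (h ^ ((1 / ρ - 1 / R) * R)) * kernelMass τ (1 / ρ) R A s (s + h) := by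
      intro s
      have hle : s ≤ s + h := by linarith
      have h0 : 0 ≤ ω s (s + h) ^ (1 / ρ) := by
        rw [hωδ _ _ hle]
        exact mul_nonneg (Real.rpow_nonneg (by linarith) _) (Real.rpow_nonneg (hI0 _ _) _)
      rw [Real.enorm_eq_ofReal h0, hωE _ _ hle (by linarith),
        ENNReal.mul_rpow_of_nonneg _ _ hR.le, ← ENNReal.rpow_mul, one_div_mul_cancel hR.ne',
        ENNReal.rpow_one, add_sub_cancel_left,
        ENNReal.ofReal_rpow_of_nonneg (Real.rpow_nonneg hh0.le _) hR.le, ← Real.rpow_mul hh0.le]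
    have hms : Measurable fun s => kernelMass τ (1 / ρ) R A s (s + h) :=
      (measurable_kernelMass hA).comp (by fun_prop : Measurable fun s : ℝ => (s, s + h))
    simp only [h1]
    rw [lintegral_const_mul _ hms]
    calc _ ≤ (ENNReal.ofReal (h ^ ((1 / ρ - 1 / R) * R)) * (ENNReal.ofReal h *
          (scaleSup τ γ P A h ^ R *
            ENNReal.ofReal (h ^ ((γ - 1 / ρ) * R) / ((γ - 1 / ρ) * R))))) ^ (1 / R) := by
          refine ENNReal.rpow_le_rpow (mul_le_mul_right ?_ _) (by positivity)
          exact (setLIntegral_le_lintegral _ _).trans ((lintegral_kernelMass_le hA).trans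
            (mul_le_mul_right (lintegral_kernelDensity_le hP0 hPt hγ hA hh0.le) _))
      _ = (ENNReal.ofReal (h ^ (γ * R) * ((γ - 1 / ρ) * R)⁻¹) *
            scaleSup τ γ P A h ^ R) ^ (1 / R) := by
          rw [mul_comm (scaleSup τ γ P A h ^ R), ← mul_assoc, ← mul_assoc,
            ← ENNReal.ofReal_mul (by positivity), ← ENNReal.ofReal_mul (by positivity)]
          congr 3
          rw [div_eq_mul_inv (h ^ ((γ - 1 / ρ) * R)), ← mul_assoc, ← Real.rpow_add_one hh0.ne',
            ← Real.rpow_add hh0]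
          congr 2
          field_simp
          ring
      _ = ENNReal.ofReal c * (ENNReal.ofReal (h ^ γ) * scaleSup τ γ P A h) := by
          rw [ENNReal.mul_rpow_of_nonneg _ _ (by positivity), ← ENNReal.rpow_mul,
            mul_one_div_cancel hR.ne', ENNReal.rpow_one,
            ENNReal.ofReal_rpow_of_nonneg (by positivity) (by positivity),
            Real.mul_rpow (by positivity) (by positivity), ← Real.rpow_mul hh0.le,
            mul_assoc γ, mul_one_div_cancel hR.ne', mul_one, ENNReal.ofReal_mul (by positivity)]
          ring
      _ ≤ _ := by
          have hγ1 : 0 ≤ γ := by have : 0 < 1 / ρ := by positivity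
                                 linarith
          exact mul_le_mul_right (mul_le_mul' (ENNReal.ofReal_le_ofReal
            (Real.rpow_le_rpow hh0.le hh.2 hγ1)) (scaleSup_mono τ γ P A hh.2)) _
  · rw [hωE 0 τ hτ.le (by linarith), hcc, sub_zero]
    refine (mul_le_mul_right (hI1 hτ.le (by linarith)) _).trans_eq ?_
    rw [mul_left_comm, ← mul_assoc (ENNReal.ofReal (τ ^ (1 / ρ - 1 / R))),
      ← ENNReal.ofReal_mul (by positivity), ← Real.rpow_add hτ]
    congr 4
    ring
  · intro k m l hk hkm hml hl hlk h1 h2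
    have := isProbabilityMeasure_unifIoc hkm
    have := isProbabilityMeasure_unifIoc hml
    have hd : 0 < l - k := by linarith
    refine (lintegral_lintegral_rpow_le (measurable_simplexNorm hA) hR1).trans ?_
    refine (ENNReal.rpow_le_rpow (lintegral_unifIoc_simplexNorm_rpow_le (δ := 1 / ρ) hR.le
      (by positivity) hA hlk hkm hml h1 h2) (by positivity)).trans ?_
    rw [ENNReal.ofReal_mul (p := 9) (q := ω k l ^ (1 / ρ)) (by norm_num), hωE k l (by linarith) (by linarith),
      ENNReal.mul_rpow_of_nonneg _ _ (by positivity),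
      ENNReal.ofReal_rpow_of_nonneg (by positivity) (by positivity),
      Real.mul_rpow (by norm_num) (by positivity), ENNReal.ofReal_mul (by positivity),
      ← Real.rpow_mul hd.le, mul_assoc]
    refine mul_le_mul' (ENNReal.ofReal_le_ofReal ?_) (le_of_eq ?_)
    · calc (9 : ℝ) ^ (1 / R) ≤ 9 ^ (1 : ℝ) :=
            Real.rpow_le_rpow_of_exponent_le (by norm_num) ((div_le_one hR).2 hR1)
        _ = 9 := Real.rpow_one _
    · congr 3
      field_simp

theorem ChainBound.of_isBesovControl {κ : ℝ} {c : ℝ≥0} {ω e : ℝ → ℝ → ℝ} (hκ : 0 < κ) (hδ : 0 < δ)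
    (hω : IsBesovControl τ κ δ γ P c A ω) (he : IsRegControl τ κ e)
    (hA : ContinuousOn (fun z : ℝ × ℝ => A z.1 z.2) (simplex τ))
    (hdiag : ∀ s, 0 ≤ s → s ≤ τ → A s s = 0)
    (htri : ∀ s u t, 0 ≤ s → s ≤ u → u ≤ t → t ≤ τ →
      ‖A s t‖ ≤ ‖A s u‖ + ‖A u t‖ + e s t ^ δ) :
    ChainBound τ κ δ 9 ω e (simplexNorm τ A) where
  kappa_pos := hκ
  delta_pos := hδ
  const_nonneg := by norm_num
  ctrl := hω.ctrl
  ctrl_defect := he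
  measurable := measurable_simplexNorm hA
  triangle s u t hs hsu hut ht := by
    rw [simplexNorm_of_mem hs (hsu.trans hut) ht, simplexNorm_of_mem hs hsu (hut.trans ht),
      simplexNorm_of_mem (hs.trans hsu) hut ht, ← ofReal_norm, ← ofReal_norm, ← ofReal_norm,
      ← ENNReal.ofReal_add (norm_nonneg _) (norm_nonneg _), ← ENNReal.ofReal_add (by positivity)
      (Real.rpow_nonneg (he.ctrl.nonneg s t hs (hsu.trans hut) ht) _)]
    exact ENNReal.ofReal_le_ofReal (htri s u t hs hsu hut ht)
  tendsto_left s hs hsτ := by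
    have hc := hA (s, s) ⟨hs, le_rfl, hsτ.le⟩
    have h1 : Filter.Tendsto (fun x => (s, x)) (nhdsWithin s (Ioi s))
        (nhdsWithin (s, s) (simplex τ)) := by
      refine tendsto_nhdsWithin_iff.2 ⟨?_, ?_⟩
      · exact ((Continuous.prodMk_right s).tendsto s).mono_left nhdsWithin_le_nhds
      · filter_upwards [Ioo_mem_nhdsGT hsτ] with x hx
        exact ⟨hs, hx.1.le, hx.2.le⟩
    have h2 := (continuous_enorm.tendsto _).comp (hc.tendsto.comp h1)
    simp only [hdiag s hs hsτ.le, enorm_zero] at h2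
    refine h2.congr' ?_
    filter_upwards [Ioo_mem_nhdsGT hsτ] with x hx
    exact (simplexNorm_of_mem hs hx.1.le hx.2.le).symm
  tendsto_right t ht htτ := by
    have hc := hA (t, t) ⟨ht.le, le_rfl, htτ⟩
    have h1 : Filter.Tendsto (fun x => (x, t)) (nhdsWithin t (Iio t))
        (nhdsWithin (t, t) (simplex τ)) := by
      refine tendsto_nhdsWithin_iff.2 ⟨?_, ?_⟩
      · exact ((Continuous.prodMk_left t).tendsto t).mono_left nhdsWithin_le_nhds
      · filter_upwards [Ioo_mem_nhdsLT ht] with x hx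
        exact ⟨hx.1.le, hx.2.le, htτ⟩
    have h2 := (continuous_enorm.tendsto _).comp (hc.tendsto.comp h1)
    simp only [hdiag t ht.le htτ, enorm_zero] at h2
    refine h2.congr' ?_
    filter_upwards [Ioo_mem_nhdsLT ht] with x hx
    exact (simplexNorm_of_mem hx.1.le hx.2.le htτ).symm
  average := hω.average

/-- Besov functions are controlled: a function of finite `B^β_{P,Q}`-norm with `1 / ρ < β` that is
additive up to a controlled defect is bounded by the power `1 / ρ` of a control, the Besov norm of
which is bounded by the one of the function. -/
theorem exists_control_of_besovNorm (G : Type*) [NormedAddCommGroup G] {β ρ : ℝ} {P Q : ℝ≥0∞}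
    (hρ : 0 < ρ) (hβ : 1 / ρ < β) (hP : 1 ≤ P) (hρP : ENNReal.ofReal ρ < P) (hQ : Q ≠ 0) :
    ∃ C : ℝ≥0, ∀ (τ : ℝ) (A : ℝ → ℝ → G), 0 < τ →
      ContinuousOn (fun z : ℝ × ℝ => A z.1 z.2) (simplex τ) → besovNorm τ β P Q A < ∞ →
      ∃ ω : ℝ → ℝ → ℝ, IsRegControl τ (1 - ρ / P.toReal) ω ∧ Measurable (Function.uncurry ω) ∧
        besovNorm τ β P Q (fun s t => ω s t ^ (1 / ρ)) ≤ C * besovNorm τ β P Q A ∧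
        ENNReal.ofReal (ω 0 τ ^ (1 / ρ)) ≤
          C * (ENNReal.ofReal (τ ^ (β - 1 / P.toReal)) * besovNorm τ β P Q A) ∧
        ∀ e : ℝ → ℝ → ℝ, IsRegControl τ (1 - ρ / P.toReal) e →
          (∀ s, 0 ≤ s → s ≤ τ → A s s = 0) →
          (∀ s u t, 0 ≤ s → s ≤ u → u ≤ t → t ≤ τ →
            ‖A s t‖ ≤ ‖A s u‖ + ‖A u t‖ + e s t ^ (1 / ρ)) →
          ∀ s t, 0 ≤ s → s ≤ t → t ≤ τ →
            ‖A s t‖ ≤ C * (ω s t ^ (1 / ρ) + e s t ^ (1 / ρ)) := by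
  -- The lower gap makes the kernel integrable at zero and the control regular enough; the upper gap
  -- makes the Hardy inequality converge.
  obtain ⟨γ, hγ1, hγ2⟩ := exists_between hβ
  have hδ0 : 0 < 1 / ρ := by positivity
  obtain ⟨C₁, hC₁⟩ := exists_eLpNorm_scaleSup_le G (hδ0.trans hγ1).le hγ2 P hQ
  have hκ : 0 < 1 - ρ / P.toReal := by
    rcases eq_or_ne P ∞ with rfl | hPt
    · simp
    · have h1 : ρ < P.toReal := (ENNReal.ofReal_lt_iff_lt_toReal hρ.le hPt).1 hρP
      rw [sub_pos, div_lt_one (hρ.trans h1)]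
      exact h1
  obtain ⟨c, hc⟩ : ∃ c : ℝ≥0, ∀ (τ : ℝ) (A : ℝ → ℝ → G), 0 < τ →
      ContinuousOn (fun z : ℝ × ℝ => A z.1 z.2) (simplex τ) → scaleSup τ γ P A τ ≠ ∞ →
      ∃ ω, IsBesovControl τ (1 - ρ / P.toReal) (1 / ρ) γ P c A ω := by
    rcases eq_or_ne P ∞ with rfl | hPt
    · refine ⟨1, fun τ A hτ hA hfin => ?_⟩
      -- Since `∞.toReal = 0` and division by zero gives zero, the exponent `1 - ρ / P.toReal` is
      -- one here.
      simpa using exists_isBesovControl_top hτ hρ hγ1 hA hfin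
    · exact ⟨_, fun τ A hτ hA hfin => exists_isBesovControl_of_ne_top hτ hρ hγ1 hP hPt
        ((ENNReal.ofReal_lt_iff_lt_toReal hρ.le hPt).1 hρP) hA hfin⟩
  set C₂ : ℝ≥0 := (2 ^ (β + 1 / Q.toReal) : ℝ).toNNReal with hC₂
  set C₃ : ℝ := (2 / (1 - (1 / 2) ^ ((1 - ρ / P.toReal) * (1 / ρ))) + 2) * 9 with hC₃
  have hθ : (1 / 2 : ℝ) ^ ((1 - ρ / P.toReal) * (1 / ρ)) < 1 :=
    Real.rpow_lt_one (by norm_num) (by norm_num) (mul_pos hκ hδ0)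
  have hD : 0 ≤ 2 / (1 - (1 / 2 : ℝ) ^ ((1 - ρ / P.toReal) * (1 / ρ))) + 2 := by
    have : 0 < 1 - (1 / 2 : ℝ) ^ ((1 - ρ / P.toReal) * (1 / ρ)) := by linarith
    positivity
  refine ⟨c * C₁ + c * C₂ + C₃.toNNReal, fun τ A hτ hA hfin => ?_⟩
  have hscale := scaleSup_le_besovNorm (τ := τ) (P := P) (hδ0.trans hβ).le hγ2.le hQ A τ
  have hfin' : scaleSup τ γ P A τ ≠ ∞ := ne_top_of_le_ne_top
    (ENNReal.mul_ne_top ENNReal.ofReal_ne_top (ENNReal.mul_ne_top ENNReal.ofReal_ne_top hfin.ne))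
    hscale
  obtain ⟨ω, hω⟩ := hc τ A hτ hA hfin'
  refine ⟨ω, hω.ctrl, hω.measurable, ?_, ?_, ?_⟩
  · refine (besovNorm_le_of_scaleSup (hC₁ τ A) hω.omegaMod_le).trans ?_
    gcongr
    rw [add_assoc]
    exact le_self_add
  · refine hω.total_le.trans ?_
    calc _ ≤ (c : ℝ≥0∞) * (ENNReal.ofReal (τ ^ (γ - 1 / P.toReal)) *
          (C₂ * (ENNReal.ofReal (τ ^ (β - γ)) * besovNorm τ β P Q A))) := by
          gcongr
          exact hscale
      _ = ↑(c * C₂) * (ENNReal.ofReal (τ ^ (β - 1 / P.toReal)) * besovNorm τ β P Q A) := by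
          have : τ ^ (β - 1 / P.toReal) = τ ^ (γ - 1 / P.toReal) * τ ^ (β - γ) := by
            rw [← Real.rpow_add hτ]; ring_nf
          rw [this, ENNReal.ofReal_mul (by positivity), ENNReal.coe_mul]
          ring
      _ ≤ _ := by
          gcongr
          rw [add_right_comm]
          exact le_add_self
  · intro e he hdiag htri s t hs hst ht
    have hω0 := hω.ctrl.ctrl.nonneg s t hs hst ht
    have he0 := he.ctrl.nonneg s t hs hst ht
    have hb : 0 ≤ ω s t ^ (1 / ρ) + e s t ^ (1 / ρ) := by positivity
    rcases hst.eq_or_lt with rfl | hlt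
    · rw [hdiag s hs ht, norm_zero]
      positivity
    have key := (ChainBound.of_isBesovControl hκ hδ0 hω he hA hdiag htri).le hs hlt ht
    rw [simplexNorm_of_mem hs hst ht, ← ofReal_norm, ENNReal.ofReal_le_ofReal_iff
      (mul_nonneg hD (by positivity))] at key
    calc ‖A s t‖ ≤ _ := key
      _ ≤ C₃ * (ω s t ^ (1 / ρ) + e s t ^ (1 / ρ)) := by
          rw [hC₃, mul_assoc]
          refine mul_le_mul_of_nonneg_left ?_ hD
          have : 0 ≤ e s t ^ (1 / ρ) := by positivity
          linarith
      _ ≤ _ := by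
          refine mul_le_mul_of_nonneg_right ?_ hb
          push_cast
          have := Real.le_coe_toNNReal C₃
          have h1 : (0 : ℝ) ≤ c * C₁ := by positivity
          have h2 : (0 : ℝ) ≤ c * C₂ := by positivity
          linarith

end

/-! ### Controls of given Besov size -/

/-- `ω` is a regular control on `[0, τ]` such that `ω ^ δ` has Besov norm at most `N`, and such that
its total mass is bounded accordingly. -/
structure HasBesovSize (τ κ β : ℝ) (P Q : ℝ≥0∞) (δ : ℝ) (N : ℝ≥0∞) (ω : ℝ → ℝ → ℝ) : Prop where
  reg : IsRegControl τ κ ω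
  measurable : Measurable (Function.uncurry ω)
  norm_le : besovNorm τ β P Q (fun s t => ω s t ^ δ) ≤ N
  total_le : ENNReal.ofReal (ω 0 τ ^ δ) ≤ ENNReal.ofReal (τ ^ (β - 1 / P.toReal)) * N

namespace HasBesovSize

variable {τ κ β δ : ℝ} {P Q N N₁ N₂ : ℝ≥0∞} {ω ω₁ ω₂ : ℝ → ℝ → ℝ}

theorem sliceMeasurable (h : HasBesovSize τ κ β P Q δ N ω) (a : ℝ) :
    SliceMeasurable τ fun s t => ω s t ^ a :=
  SliceMeasurable.of_measurable
    (show Measurable (Function.uncurry fun s t => ω s t ^ a) from h.measurable.pow_const a)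

theorem mono (h : HasBesovSize τ κ β P Q δ N ω) (hN : N ≤ N₁) : HasBesovSize τ κ β P Q δ N₁ ω :=
  ⟨h.reg, h.measurable, h.norm_le.trans hN, h.total_le.trans (by gcongr)⟩

theorem const_mul (h : HasBesovSize τ κ β P Q δ N ω) (hτ : 0 ≤ τ) (c : ℝ≥0) :
    HasBesovSize τ κ β P Q δ (ENNReal.ofReal (c ^ δ) * N) (fun s t => c * ω s t) where
  reg := h.reg.const_mul c.coe_nonneg
  measurable := by
    have := h.measurable.const_mul (c : ℝ)
    exact this
  norm_le := by
    have hc : 0 ≤ (c : ℝ) ^ δ := Real.rpow_nonneg c.coe_nonneg _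
    refine (besovNorm_le_mul ((c : ℝ) ^ δ).toNNReal (h.sliceMeasurable δ) ?_).trans
      (mul_le_mul_right h.norm_le _)
    intro s t hs hst ht
    rw [Real.mul_rpow c.coe_nonneg (h.reg.ctrl.nonneg s t hs hst ht), norm_mul, Real.norm_of_nonneg hc,
      Real.coe_toNNReal _ hc]
  total_le := by
    have hc : 0 ≤ (c : ℝ) ^ δ := Real.rpow_nonneg c.coe_nonneg _
    rw [Real.mul_rpow c.coe_nonneg (h.reg.ctrl.nonneg 0 τ le_rfl hτ le_rfl), ENNReal.ofReal_mul hc,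
      mul_left_comm]
    exact mul_le_mul_right h.total_le _

/-- A sum is at most twice the larger summand, so its power `δ` is at most `2 ^ δ` times the sum of
the powers; then the quasi-triangle inequality applies. -/
theorem add (h₁ : HasBesovSize τ κ β P Q δ N₁ ω₁) (h₂ : HasBesovSize τ κ β P Q δ N₂ ω₂)
    (hτ : 0 ≤ τ) (hP : 1 ≤ P) (hδ : 0 ≤ δ) :
    HasBesovSize τ κ β P Q δ (ENNReal.ofReal (2 ^ δ) * ((1 + ENNReal.LpAddConst Q) * (N₁ + N₂)))
      (fun s t => ω₁ s t + ω₂ s t) := by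
  have key : ∀ s t, 0 ≤ s → s ≤ t → t ≤ τ →
      (ω₁ s t + ω₂ s t) ^ δ ≤ 2 ^ δ * (ω₁ s t ^ δ + ω₂ s t ^ δ) := by
    intro s t hs hst ht
    have a0 := h₁.reg.ctrl.nonneg s t hs hst ht
    have b0 := h₂.reg.ctrl.nonneg s t hs hst ht
    have a1 : 0 ≤ ω₁ s t ^ δ := Real.rpow_nonneg a0 _
    have b1 : 0 ≤ ω₂ s t ^ δ := Real.rpow_nonneg b0 _
    have h2 : 0 ≤ (2 : ℝ) ^ δ := by positivity
    rcases le_total (ω₁ s t) (ω₂ s t) with h | h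
    · calc _ ≤ (2 * ω₂ s t) ^ δ := Real.rpow_le_rpow (by positivity) (by linarith) hδ
        _ = 2 ^ δ * ω₂ s t ^ δ := Real.mul_rpow (by norm_num) b0
        _ ≤ _ := mul_le_mul_of_nonneg_left (by linarith) h2
    · calc _ ≤ (2 * ω₁ s t) ^ δ := Real.rpow_le_rpow (by positivity) (by linarith) hδ
        _ = 2 ^ δ * ω₁ s t ^ δ := Real.mul_rpow (by norm_num) a0
        _ ≤ _ := mul_le_mul_of_nonneg_left (by linarith) h2
  refine ⟨h₁.reg.add h₂.reg, ?_, ?_, ?_⟩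
  · have := h₁.measurable.add h₂.measurable
    exact this
  · have hs : SliceMeasurable τ ((fun s t => ω₁ s t ^ δ) + fun s t => ω₂ s t ^ δ) :=
      fun h a b => (h₁.sliceMeasurable δ h a b).add (h₂.sliceMeasurable δ h a b)
    refine (besovNorm_le_mul ((2 : ℝ) ^ δ).toNNReal hs ?_).trans (mul_le_mul_right
      ((besovNorm_add_le hP (h₁.sliceMeasurable δ) (h₂.sliceMeasurable δ)).trans
        (mul_le_mul' le_add_self (add_le_add h₁.norm_le h₂.norm_le))) _)
    intro s t hs hst ht
    have a0 := h₁.reg.ctrl.nonneg s t hs hst ht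
    have b0 := h₂.reg.ctrl.nonneg s t hs hst ht
    simp only [Pi.add_apply]
    rw [Real.norm_of_nonneg (by positivity), Real.norm_of_nonneg (by positivity),
      Real.coe_toNNReal _ (by positivity)]
    exact key s t hs hst ht
  · have a0 := h₁.reg.ctrl.nonneg 0 τ le_rfl hτ le_rfl
    have b0 := h₂.reg.ctrl.nonneg 0 τ le_rfl hτ le_rfl
    calc _ ≤ ENNReal.ofReal (2 ^ δ * (ω₁ 0 τ ^ δ + ω₂ 0 τ ^ δ)) :=
          ENNReal.ofReal_le_ofReal (key 0 τ le_rfl hτ le_rfl)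
      _ = ENNReal.ofReal (2 ^ δ) * (ENNReal.ofReal (ω₁ 0 τ ^ δ) + ENNReal.ofReal (ω₂ 0 τ ^ δ)) := by
          rw [ENNReal.ofReal_mul (by positivity), ENNReal.ofReal_add (by positivity)
            (by positivity)]
      _ ≤ ENNReal.ofReal (2 ^ δ) * (ENNReal.ofReal (τ ^ (β - 1 / P.toReal)) * N₁ +
            ENNReal.ofReal (τ ^ (β - 1 / P.toReal)) * N₂) :=
          mul_le_mul_right (add_le_add h₁.total_le h₂.total_le) _
      _ = ENNReal.ofReal (2 ^ δ) * (ENNReal.ofReal (τ ^ (β - 1 / P.toReal)) * (1 * (N₁ + N₂))) := by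
          rw [one_mul]; ring
      _ ≤ ENNReal.ofReal (2 ^ δ) * (ENNReal.ofReal (τ ^ (β - 1 / P.toReal)) *
            ((1 + ENNReal.LpAddConst Q) * (N₁ + N₂))) := by
          gcongr
          exact le_self_add
      _ = _ := by ring

end HasBesovSize

section

variable {τ κ α r : ℝ} {p q N N₁ N₂ : ℝ≥0∞} {ω ω₁ ω₂ : ℝ → ℝ → ℝ}

theorem ENNReal.toReal_div_two (p : ℝ≥0∞) : (p / 2).toReal = p.toReal / 2 := by simp

theorem exponent_double (α : ℝ) (p : ℝ≥0∞) :
    2 * α - 1 / (p / 2).toReal = 2 * (α - 1 / p.toReal) := by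
  rw [ENNReal.toReal_div_two, one_div_div]; ring

/-- The power `2 / r` of the geometric mean is the product of the two powers `1 / r`, whose size in
the doubled parameters is given by Cauchy-Schwarz. This is how mixed products of first level terms
are dominated at the second level. -/
theorem HasBesovSize.rpow_half_mul
    (h₁ : HasBesovSize τ κ α p q (1 / r) N₁ ω₁) (h₂ : HasBesovSize τ κ α p q (1 / r) N₂ ω₂)
    (hτ : 0 < τ) (hp : p ≠ 0) (hq : q ≠ 0) :
    HasBesovSize τ κ (2 * α) (p / 2) (q / 2) (2 / r) (N₁ * N₂)
      (fun s t => ω₁ s t ^ (1 / 2 : ℝ) * ω₂ s t ^ (1 / 2 : ℝ)) := by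
  have key : ∀ s t, 0 ≤ s → s ≤ t → t ≤ τ →
      (ω₁ s t ^ (1 / 2 : ℝ) * ω₂ s t ^ (1 / 2 : ℝ)) ^ (2 / r) =
        ω₁ s t ^ (1 / r) * ω₂ s t ^ (1 / r) := by
    intro s t hs hst ht
    have a0 := h₁.reg.ctrl.nonneg s t hs hst ht
    have b0 := h₂.reg.ctrl.nonneg s t hs hst ht
    rw [Real.mul_rpow (by positivity) (by positivity), ← Real.rpow_mul a0, ← Real.rpow_mul b0]
    congr 2 <;> ring
  refine ⟨h₁.reg.rpow_half_mul h₂.reg, ?_, ?_, ?_⟩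
  · have := (h₁.measurable.pow_const (1 / 2 : ℝ)).mul (h₂.measurable.pow_const (1 / 2 : ℝ))
    exact this
  · refine (besovNorm_mul_le hp hq (h₁.sliceMeasurable _) (h₂.sliceMeasurable _) ?_).trans
      (mul_le_mul' h₁.norm_le h₂.norm_le)
    intro s t hs hst ht
    rw [key s t hs hst ht, norm_mul]
  · rw [key 0 τ le_rfl hτ.le le_rfl, exponent_double, two_mul, Real.rpow_add hτ,
      ENNReal.ofReal_mul (Real.rpow_nonneg (h₁.reg.ctrl.nonneg 0 τ le_rfl hτ.le le_rfl) _),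
      ENNReal.ofReal_mul (by positivity), mul_mul_mul_comm]
    exact mul_le_mul' h₁.total_le h₂.total_le

/-- Squaring identifies the two scales of norms by `besovNorm_sq`; hence the square root of the
size, in accordance with the homogeneous norm. -/
theorem HasBesovSize.of_double (h : HasBesovSize τ κ (2 * α) (p / 2) (q / 2) (2 / r) N ω)
    (hτ : 0 < τ) : HasBesovSize τ κ α p q (1 / r) (N ^ (1 / 2 : ℝ)) ω := by
  have hle : ∀ {x y : ℝ≥0∞}, x ^ 2 ≤ y → x ≤ y ^ (1 / 2 : ℝ) := fun {x y} hxy => by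
    have := ENNReal.rpow_le_rpow hxy (by norm_num : (0 : ℝ) ≤ 1 / 2)
    rwa [← ENNReal.rpow_two, ← ENNReal.rpow_mul, mul_one_div_cancel (by norm_num),
      ENNReal.rpow_one] at this
  refine ⟨h.reg, h.measurable, hle ?_, ?_⟩
  · rw [← besovNorm_sq]
    refine le_trans ?_ h.norm_le
    have := besovNorm_le_mul (α := 2 * α) (p := p / 2) (q := q / 2) 1 (h.sliceMeasurable (2 / r))
      (A := fun s t => (ω s t ^ (1 / r)) ^ 2) ?_
    · simpa using this
    · intro s t hs hst ht
      rw [rpow_two_div (h.reg.ctrl.nonneg s t hs hst ht)]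
      simp
  · have h1 := hle (x := ENNReal.ofReal (ω 0 τ ^ (1 / r)))
      (y := ENNReal.ofReal (τ ^ (2 * α - 1 / (p / 2).toReal)) * N) (by
      rw [← ENNReal.ofReal_pow (Real.rpow_nonneg (h.reg.ctrl.nonneg 0 τ le_rfl hτ.le le_rfl) _),
        ← rpow_two_div (h.reg.ctrl.nonneg 0 τ le_rfl hτ.le le_rfl)]
      exact h.total_le)
    refine h1.trans_eq ?_
    rw [ENNReal.mul_rpow_of_nonneg _ _ (by norm_num), exponent_double,
      ENNReal.ofReal_rpow_of_nonneg (by positivity) (by norm_num), ← Real.rpow_mul hτ.le]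
    congr 3
    ring

theorem HasBesovSize.besovNorm_sq_le (h : HasBesovSize τ κ α p q (1 / r) N ω) :
    besovNorm τ (2 * α) (p / 2) (q / 2) (fun s t => (ω s t ^ (1 / r)) ^ 2) ≤ N ^ 2 := by
  rw [besovNorm_sq]
  exact pow_le_pow_left' h.norm_le 2

/-- One of the two factors is bounded by its value on `[0, τ]`, which is where the gain `τ ^ (α - 1
/ p)` comes from; the other keeps the first level norm. -/
theorem HasBesovSize.besovNorm_sq_le' (h : HasBesovSize τ κ α p q (1 / r) N ω) (hτ : 0 ≤ τ)
    (hr : 0 < r) :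
    besovNorm τ α p q (fun s t => (ω s t ^ (1 / r)) ^ 2) ≤
      ENNReal.ofReal (τ ^ (α - 1 / p.toReal)) * N ^ 2 := by
  have h0 := h.reg.ctrl.nonneg 0 τ le_rfl hτ le_rfl
  refine (besovNorm_le_mul (ω 0 τ ^ (1 / r)).toNNReal (h.sliceMeasurable (1 / r)) ?_).trans ?_
  · intro s t hs hst ht
    have h1 := h.reg.ctrl.nonneg s t hs hst ht
    rw [Real.coe_toNNReal _ (by positivity), norm_pow, sq]
    refine mul_le_mul_of_nonneg_right ?_ (norm_nonneg _)
    rw [Real.norm_of_nonneg (by positivity)]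
    exact h.reg.ctrl.rpow_le (by positivity) hs hst ht
  · calc _ ≤ (ENNReal.ofReal (τ ^ (α - 1 / p.toReal)) * N) * N :=
          mul_le_mul' h.total_le h.norm_le
      _ = _ := by ring

end

/-- A function of finite Besov norm that is additive up to a controlled defect is bounded by a
power of a control of comparable size. -/
theorem exists_hasBesovSize (G : Type*) [NormedAddCommGroup G] {β ρ : ℝ} {P Q : ℝ≥0∞}
    (hρ : 0 < ρ) (hβ : 1 / ρ < β) (hP : 1 ≤ P) (hρP : ENNReal.ofReal ρ < P) (hQ : Q ≠ 0) :
    ∃ C : ℝ≥0, ∀ (τ : ℝ) (A : ℝ → ℝ → G), 0 < τ →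
      ContinuousOn (fun z : ℝ × ℝ => A z.1 z.2) (simplex τ) → besovNorm τ β P Q A < ∞ →
      ∃ ω : ℝ → ℝ → ℝ,
        HasBesovSize τ (1 - ρ / P.toReal) β P Q (1 / ρ) (C * besovNorm τ β P Q A) ω ∧
        ∀ e : ℝ → ℝ → ℝ, IsRegControl τ (1 - ρ / P.toReal) e →
          (∀ s, 0 ≤ s → s ≤ τ → A s s = 0) →
          (∀ s u t, 0 ≤ s → s ≤ u → u ≤ t → t ≤ τ →
            ‖A s t‖ ≤ ‖A s u‖ + ‖A u t‖ + e s t ^ (1 / ρ)) →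
          ∀ s t, 0 ≤ s → s ≤ t → t ≤ τ → ‖A s t‖ ≤ (ω s t + C * e s t) ^ (1 / ρ) := by
  obtain ⟨C, hC⟩ := exists_control_of_besovNorm G hρ hβ hP hρP hQ
  -- Chosen with `K ^ (1 / ρ) = 2 * C`, so that the multiplicative constant moves inside the power
  -- and becomes part of the control.
  set K : ℝ≥0 := (2 * C) ^ ρ with hK
  have hKρ : (K : ℝ) ^ (1 / ρ) = 2 * C := by
    rw [hK, NNReal.coe_rpow, ← Real.rpow_mul (by positivity), mul_one_div_cancel hρ.ne',
      Real.rpow_one]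
    simp
  refine ⟨2 * C * C + K, fun τ A hτ hA hfin => ?_⟩
  obtain ⟨ω, hreg, hm, hnorm, htot, hle⟩ := hC τ A hτ hA hfin
  have hsize : HasBesovSize τ (1 - ρ / P.toReal) β P Q (1 / ρ) (C * besovNorm τ β P Q A) ω :=
    ⟨hreg, hm, hnorm, htot.trans_eq (by ring)⟩
  refine ⟨fun s t => K * ω s t, (hsize.const_mul hτ.le K).mono ?_, ?_⟩
  · rw [hKρ, ← mul_assoc]
    gcongr
    rw [ENNReal.ofReal_mul (by norm_num), ENNReal.ofReal_coe_nnreal, ENNReal.ofReal_ofNat]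
    push_cast
    exact le_self_add
  · intro e he hdiag htri s t hs hst ht
    have a0 := hreg.ctrl.nonneg s t hs hst ht
    have b0 := he.ctrl.nonneg s t hs hst ht
    have h1 : ω s t ^ (1 / ρ) ≤ (ω s t + e s t) ^ (1 / ρ) :=
      Real.rpow_le_rpow a0 (by linarith) (by positivity)
    have h2 : e s t ^ (1 / ρ) ≤ (ω s t + e s t) ^ (1 / ρ) :=
      Real.rpow_le_rpow b0 (by linarith) (by positivity)
    have hC0 : (0 : ℝ) ≤ C := C.coe_nonneg
    calc ‖A s t‖ ≤ C * (ω s t ^ (1 / ρ) + e s t ^ (1 / ρ)) := hle e he hdiag htri s t hs hst ht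
      _ ≤ 2 * C * (ω s t + e s t) ^ (1 / ρ) := by nlinarith
      _ = (K * (ω s t + e s t)) ^ (1 / ρ) := by
          rw [Real.mul_rpow K.coe_nonneg (by positivity), hKρ]
      _ ≤ _ := by
          refine Real.rpow_le_rpow (by positivity) ?_ (by positivity)
          push_cast
          rw [mul_add]
          have : (0 : ℝ) ≤ 2 * C * C * e s t := by positivity
          linarith [mul_nonneg K.coe_nonneg b0]

/-! ### Controls of Besov rough paths and of controlled paths -/

/-- The conditions on the exponents: `1/α < r < p`. -/
structure IsBesovExponent (α : ℝ) (p q : ℝ≥0∞) (r : ℝ) : Prop where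
  pos : 0 < r
  one_div_lt : 1 / r < α
  lt : ENNReal.ofReal r < p
  two_le : 2 ≤ p
  ne_zero : q ≠ 0

namespace IsBesovExponent

variable {α r : ℝ} {p q : ℝ≥0∞}

theorem one_le (h : IsBesovExponent α p q r) : 1 ≤ p := le_trans (by norm_num) h.two_le

theorem p_ne_zero (h : IsBesovExponent α p q r) : p ≠ 0 := (zero_lt_one.trans_le h.one_le).ne'

theorem one_le_half (h : IsBesovExponent α p q r) : 1 ≤ p / 2 := by
  rw [ENNReal.le_div_iff_mul_le (by simp) (by simp), one_mul]
  exact h.two_le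

theorem half_lt (h : IsBesovExponent α p q r) : ENNReal.ofReal (r / 2) < p / 2 := by
  rw [ENNReal.ofReal_div_of_pos (by norm_num), ENNReal.ofReal_ofNat]
  exact ENNReal.div_lt_div_right (by simp) (by simp) h.lt

theorem half_ne_zero (h : IsBesovExponent α p q r) : q / 2 ≠ 0 := by
  simp [h.ne_zero]

theorem one_div_half_lt (h : IsBesovExponent α p q r) : 1 / (r / 2) < 2 * α := by
  have := h.one_div_lt
  rw [one_div_div]
  calc 2 / r = 2 * (1 / r) := by ring
    _ < 2 * α := by linarith

/-- The second level uses half the variation exponent and half the integrability, so the ratio is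
unchanged. Controls of both levels therefore have the same regularity and can be added. -/
theorem kappa_half (r : ℝ) (p : ℝ≥0∞) : 1 - r / 2 / (p / 2).toReal = 1 - r / p.toReal := by
  rw [ENNReal.toReal_div_two, div_div_div_cancel_right₀ (by norm_num)]

theorem kappa_pos (h : IsBesovExponent α p q r) : 0 < 1 - r / p.toReal := by
  rcases eq_or_ne p ∞ with rfl | hpt
  · simp
  · have h1 : r < p.toReal := (ENNReal.ofReal_lt_iff_lt_toReal h.pos.le hpt).1 h.lt
    rw [sub_pos, div_lt_one (h.pos.trans h1)]
    exact h1

/-- This exponent is the rate at which total masses vanish for short times. For `p = ∞` the term `1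
/ p.toReal` is zero by convention. -/
theorem rate_pos (h : IsBesovExponent α p q r) : 0 < α - 1 / p.toReal := by
  have hα : 0 < α := lt_trans (by have := h.pos; positivity) h.one_div_lt
  rcases eq_or_ne p ∞ with rfl | hpt
  · simpa using hα
  · have h1 : r < p.toReal := (ENNReal.ofReal_lt_iff_lt_toReal h.pos.le hpt).1 h.lt
    have := one_div_lt_one_div_of_lt h.pos h1
    linarith [h.one_div_lt]

end IsBesovExponent

theorem isRegControl_zero (τ κ : ℝ) : IsRegControl τ κ fun _ _ => 0 :=
  ⟨isControl_zero, fun _ _ _ _ _ _ _ _ _ => by simp⟩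

section

variable {α r : ℝ} {p q : ℝ≥0∞}

theorem exists_control_of_additive (h : IsBesovExponent α p q r) (G : Type*)
    [NormedAddCommGroup G] : ∃ C : ℝ≥0, ∀ (τ : ℝ) (A : ℝ → ℝ → G), 0 < τ →
      ContinuousOn (fun z : ℝ × ℝ => A z.1 z.2) (simplex τ) → besovNorm τ α p q A < ∞ →
      (∀ s u t, 0 ≤ s → s ≤ u → u ≤ t → t ≤ τ → A s t = A s u + A u t) →
      ∃ ω : ℝ → ℝ → ℝ, HasBesovSize τ (1 - r / p.toReal) α p q (1 / r) (C * besovNorm τ α p q A) ω ∧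
        ∀ s t, 0 ≤ s → s ≤ t → t ≤ τ → ‖A s t‖ ≤ ω s t ^ (1 / r) := by
  obtain ⟨C, hC⟩ := exists_hasBesovSize G h.pos h.one_div_lt h.one_le h.lt h.ne_zero
  refine ⟨C, fun τ A hτ hA hfin hadd => ?_⟩
  obtain ⟨ω, hω, hle⟩ := hC τ A hτ hA hfin
  refine ⟨ω, hω, fun s t hs hst ht => ?_⟩
  have := hle _ (isRegControl_zero τ _)
    (fun s hs hst => by simpa using hadd s s s hs le_rfl le_rfl hst)
    (fun s u t hs hsu hut ht => by
      rw [hadd s u t hs hsu hut ht, Real.zero_rpow (by have := h.pos; positivity), add_zero]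
      exact norm_add_le _ _) s t hs hst ht
  simpa using this

theorem exists_control_of_defect (h : IsBesovExponent α p q r) (G : Type*)
    [NormedAddCommGroup G] : ∃ C : ℝ≥0, ∀ (τ : ℝ) (A : ℝ → ℝ → G), 0 < τ →
      ContinuousOn (fun z : ℝ × ℝ => A z.1 z.2) (simplex τ) →
      besovNorm τ (2 * α) (p / 2) (q / 2) A < ∞ →
      ∃ ω : ℝ → ℝ → ℝ, HasBesovSize τ (1 - r / p.toReal) (2 * α) (p / 2) (q / 2) (2 / r)
          (C * besovNorm τ (2 * α) (p / 2) (q / 2) A) ω ∧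
        ∀ e : ℝ → ℝ → ℝ, IsRegControl τ (1 - r / p.toReal) e →
          (∀ s, 0 ≤ s → s ≤ τ → A s s = 0) →
          (∀ s u t, 0 ≤ s → s ≤ u → u ≤ t → t ≤ τ →
            ‖A s t - A s u - A u t‖ ≤ e s t ^ (2 / r)) →
        ∀ s t, 0 ≤ s → s ≤ t → t ≤ τ → ‖A s t‖ ≤ (ω s t + C * e s t) ^ (2 / r) := by
  obtain ⟨C, hC⟩ := exists_hasBesovSize G (half_pos h.pos) h.one_div_half_lt h.one_le_half h.half_lt
    h.half_ne_zero
  rw [IsBesovExponent.kappa_half, one_div_div] at hC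
  refine ⟨C, fun τ A hτ hA hfin => ?_⟩
  obtain ⟨ω, hω, hle⟩ := hC τ A hτ hA hfin
  refine ⟨ω, hω, fun e he hdiag hdef => hle e he hdiag fun s u t hs hsu hut ht => ?_⟩
  have h1 := hdef s u t hs hsu hut ht
  calc ‖A s t‖ = ‖A s u + A u t + (A s t - A s u - A u t)‖ := by congr 1; abel
    _ ≤ _ := (norm_add_le _ _).trans (add_le_add (norm_add_le _ _) h1)

theorem roughBesovNorm_mono_right {E V : Type*} [NormedAddCommGroup E] [NormedAddCommGroup V]
    {T τ : ℝ} (hτ : τ ≤ T) (X : ℝ → ℝ → E) (XX : ℝ → ℝ → V) :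
    roughBesovNorm τ α p q X XX ≤ roughBesovNorm T α p q X XX :=
  add_le_add (besovNorm_mono_right hτ _)
    (ENNReal.rpow_le_rpow (besovNorm_mono_right hτ _) (by norm_num))

variable {E F V : Type*} [NormedAddCommGroup E] [NormedSpace ℝ E]
  [NormedAddCommGroup F] [NormedSpace ℝ F] [NormedAddCommGroup V] [NormedSpace ℝ V]
  {ι : E ⊗[ℝ] E ≃ₗ[ℝ] V}

theorem IsBesovRoughPath.restrict {T τ : ℝ} {X : ℝ → ℝ → E} {XX : ℝ → ℝ → V}
    (h : IsBesovRoughPath ι T α p q X XX) (hτ : τ ≤ T) : IsBesovRoughPath ι τ α p q X XX := by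
  have hs : simplex τ ⊆ simplex T := fun z hz => ⟨hz.1, hz.2.1, hz.2.2.trans hτ⟩
  exact ⟨fun s u t h1 h2 h3 h4 => h.additive s u t h1 h2 h3 (h4.trans hτ),
    fun s u t h1 h2 h3 h4 => h.chen s u t h1 h2 h3 (h4.trans hτ), h.continuousOn_fst.mono hs,
    h.continuousOn_snd.mono hs, (besovNorm_mono_right hτ _).trans_lt h.besov_fst,
    (besovNorm_mono_right hτ _).trans_lt h.besov_snd⟩

theorem IsBesovRoughPath.fst_self {τ s : ℝ} {X : ℝ → ℝ → E} {XX : ℝ → ℝ → V}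
    (h : IsBesovRoughPath ι τ α p q X XX) (hs : 0 ≤ s) (ht : s ≤ τ) : X s s = 0 := by
  simpa using h.additive s s s hs le_rfl le_rfl ht

theorem IsBesovRoughPath.snd_self {τ s : ℝ} {X : ℝ → ℝ → E} {XX : ℝ → ℝ → V}
    (h : IsBesovRoughPath ι τ α p q X XX) (hs : 0 ≤ s) (ht : s ≤ τ) : XX s s = 0 := by
  simpa [h.fst_self hs ht] using h.chen s s s hs le_rfl le_rfl ht

theorem IsRoughOn.mono {a b : ℝ} {ω ω' : ℝ → ℝ → ℝ} {X : ℝ → ℝ → E} {XX : ℝ → ℝ → V}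
    (h : IsRoughOn ι a b r ω X XX) (hr : 0 < r) (hω' : IsControl a b ω')
    (hle : ∀ s t, a ≤ s → s ≤ t → t ≤ b → ω s t ≤ ω' s t) : IsRoughOn ι a b r ω' X XX :=
  ⟨hω', h.additive, h.chen,
    fun s t h1 h2 h3 => (h.fst s t h1 h2 h3).trans (Real.rpow_le_rpow
      (h.ctrl.nonneg s t h1 h2 h3) (hle s t h1 h2 h3) (by positivity)),
    fun s t h1 h2 h3 => (h.snd s t h1 h2 h3).trans (Real.rpow_le_rpow
      (h.ctrl.nonneg s t h1 h2 h3) (hle s t h1 h2 h3) (by positivity))⟩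

theorem ENNReal.exists_nnreal_mul_le {a : ℝ≥0∞} (ha : a ≠ ∞) : ∃ c : ℝ≥0, a = c :=
  ⟨a.toNNReal, (ENNReal.coe_toNNReal ha).symm⟩

theorem IsBesovExponent.exists_add (h : IsBesovExponent α p q r) :
    ∃ K : ℝ≥0, ∀ {τ κ : ℝ} {N₁ N₂ : ℝ≥0∞} {ω₁ ω₂ : ℝ → ℝ → ℝ}, 0 ≤ τ →
      HasBesovSize τ κ α p q (1 / r) N₁ ω₁ → HasBesovSize τ κ α p q (1 / r) N₂ ω₂ →
      HasBesovSize τ κ α p q (1 / r) (K * (N₁ + N₂)) (fun s t => ω₁ s t + ω₂ s t) := by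
  obtain ⟨K, hK⟩ := ENNReal.exists_nnreal_mul_le (a := ENNReal.ofReal (2 ^ (1 / r)) *
    (1 + ENNReal.LpAddConst q)) (ENNReal.mul_ne_top ENNReal.ofReal_ne_top
      (ENNReal.add_ne_top.2 ⟨ENNReal.one_ne_top, (ENNReal.LpAddConst_lt_top q).ne⟩))
  refine ⟨K, fun hτ h₁ h₂ => (h₁.add h₂ hτ h.one_le (by have := h.pos; positivity)).mono ?_⟩
  rw [← hK, mul_assoc]

theorem IsBesovExponent.exists_add_double (h : IsBesovExponent α p q r) :
    ∃ K : ℝ≥0, ∀ {τ κ : ℝ} {N₁ N₂ : ℝ≥0∞} {ω₁ ω₂ : ℝ → ℝ → ℝ}, 0 ≤ τ →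
      HasBesovSize τ κ (2 * α) (p / 2) (q / 2) (2 / r) N₁ ω₁ →
      HasBesovSize τ κ (2 * α) (p / 2) (q / 2) (2 / r) N₂ ω₂ →
      HasBesovSize τ κ (2 * α) (p / 2) (q / 2) (2 / r) (K * (N₁ + N₂))
        (fun s t => ω₁ s t + ω₂ s t) := by
  obtain ⟨K, hK⟩ := ENNReal.exists_nnreal_mul_le (a := ENNReal.ofReal (2 ^ (2 / r)) *
    (1 + ENNReal.LpAddConst (q / 2))) (ENNReal.mul_ne_top ENNReal.ofReal_ne_top
      (ENNReal.add_ne_top.2 ⟨ENNReal.one_ne_top, (ENNReal.LpAddConst_lt_top _).ne⟩))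
  refine ⟨K, fun hτ h₁ h₂ => (h₁.add h₂ hτ h.one_le_half (by have := h.pos; positivity)).mono ?_⟩
  rw [← hK, mul_assoc]

/-- A Besov rough path is controlled by a control of comparable Besov size. -/
theorem exists_control_of_isBesovRoughPath (ι : E ⊗[ℝ] E ≃ₗ[ℝ] V)
    (hι : ∀ x y : E, ‖ι (x ⊗ₜ[ℝ] y)‖ = ‖x‖ * ‖y‖) (h : IsBesovExponent α p q r) :
    ∃ C : ℝ≥0, ∀ (τ : ℝ) (X : ℝ → ℝ → E) (XX : ℝ → ℝ → V), 0 < τ →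
      IsBesovRoughPath ι τ α p q X XX →
      ∃ ω : ℝ → ℝ → ℝ, HasBesovSize τ (1 - r / p.toReal) α p q (1 / r)
          (C * roughBesovNorm τ α p q X XX) ω ∧ IsRoughOn ι 0 τ r ω X XX := by
  obtain ⟨C₁, h₁⟩ := exists_control_of_additive h E
  obtain ⟨C₂, h₂⟩ := exists_control_of_defect h V
  obtain ⟨K, hK⟩ := h.exists_add
  have hr := h.pos
  obtain ⟨D, hDr⟩ : ∃ D : ℝ≥0, ENNReal.ofReal (((C₂ + 1 : ℝ≥0) : ℝ) ^ (1 / r)) = D := ⟨_, rfl⟩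
  obtain ⟨D₂, hD₂⟩ : ∃ D₂ : ℝ≥0, (C₂ : ℝ≥0∞) ^ (1 / 2 : ℝ) = D₂ :=
    ⟨_, (ENNReal.coe_rpow_of_nonneg _ (by norm_num)).symm⟩
  refine ⟨K * (D₂ + D * C₁), fun τ X XX hτ hX => ?_⟩
  obtain ⟨ω₁, hω₁, hX1⟩ := h₁ τ X hτ hX.continuousOn_fst hX.besov_fst hX.additive
  obtain ⟨ω₂, hω₂, hX2⟩ := h₂ τ XX hτ hX.continuousOn_snd hX.besov_snd
  -- The defect of the second level is the tensor product of two first level increments, hence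
  -- bounded by the power `2 / r` of their control.
  have hX2' := hX2 ω₁ hω₁.reg (fun s hs ht => hX.snd_self hs ht) (fun s u t hs hsu hut ht => by
    have hd : XX s t - XX s u - XX u t = ι (X s u ⊗ₜ[ℝ] X u t) := by
      rw [hX.chen s u t hs hsu hut ht]; abel
    have b := hω₁.reg.ctrl.nonneg s t hs (hsu.trans hut) ht
    rw [hd, hι, rpow_two_div b, sq]
    refine mul_le_mul ((hX1 s u hs hsu (hut.trans ht)).trans ?_)
      ((hX1 u t (hs.trans hsu) hut ht).trans ?_) (norm_nonneg _) (Real.rpow_nonneg b _)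
    · exact Real.rpow_le_rpow (hω₁.reg.ctrl.nonneg _ _ hs hsu (hut.trans ht))
        (hω₁.reg.ctrl.mono hs le_rfl hsu hut ht) (by positivity)
    · exact Real.rpow_le_rpow (hω₁.reg.ctrl.nonneg _ _ (hs.trans hsu) hut ht)
        (hω₁.reg.ctrl.mono hs hsu hut le_rfl ht) (by positivity))
  -- The weight `C₂ + 1` lets the sum dominate both the first level and the defect contribution `C₂
  -- * ω₁` at the second level.
  have hsz := hK hτ.le (hω₂.of_double hτ) (hω₁.const_mul hτ.le (C₂ + 1))
  refine ⟨_, hsz.mono ?_, hsz.reg.ctrl, hX.additive, hX.chen, fun s t hs hst ht => ?_,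
    fun s t hs hst ht => ?_⟩
  · rw [hDr, ENNReal.mul_rpow_of_nonneg _ _ (by norm_num : (0 : ℝ) ≤ 1 / 2), hD₂, roughBesovNorm]
    push_cast
    rw [mul_assoc, add_mul, ← mul_assoc (D : ℝ≥0∞)]
    gcongr
    · exact le_add_self
    · exact le_self_add
  · have a := hω₁.reg.ctrl.nonneg s t hs hst ht
    have b := hω₂.reg.ctrl.nonneg s t hs hst ht
    refine (hX1 s t hs hst ht).trans (Real.rpow_le_rpow a ?_ (by positivity))
    push_cast
    have : 0 ≤ (C₂ : ℝ) * ω₁ s t := by positivity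
    linarith
  · have a := hω₁.reg.ctrl.nonneg s t hs hst ht
    have b := hω₂.reg.ctrl.nonneg s t hs hst ht
    refine (hX2' s t hs hst ht).trans (Real.rpow_le_rpow (by positivity) ?_ (by positivity))
    push_cast
    linarith

theorem besovNorm_sub_lt_top {G : Type*} [NormedAddCommGroup G] {τ β : ℝ} {P Q : ℝ≥0∞}
    (hP : 1 ≤ P) {A B : ℝ → ℝ → G} (hA : SliceMeasurable τ A) (hB : SliceMeasurable τ B)
    (hA' : besovNorm τ β P Q A < ∞) (hB' : besovNorm τ β P Q B < ∞) :
    besovNorm τ β P Q (A - B) < ∞ := by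
  have hneg : besovNorm τ β P Q (-B) < ∞ := by
    refine (besovNorm_le_mul 1 hB (A := -B) fun s t _ _ _ => ?_).trans_lt
      (ENNReal.mul_lt_top ENNReal.one_lt_top hB')
    simp
  rw [sub_eq_add_neg]
  refine (besovNorm_add_le hP hA (B := -B) fun h a b => (hB h a b).neg).trans_lt ?_
  exact ENNReal.mul_lt_top (ENNReal.LpAddConst_lt_top Q) (ENNReal.add_lt_top.2 ⟨hA', hneg⟩)

/-- The differences of two Besov rough paths are controlled by controls of comparable size. -/
theorem exists_control_of_sub (ι : E ⊗[ℝ] E ≃ₗ[ℝ] V)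
    (hι : ∀ x y : E, ‖ι (x ⊗ₜ[ℝ] y)‖ = ‖x‖ * ‖y‖) (h : IsBesovExponent α p q r) :
    ∃ C : ℝ≥0, ∀ (τ : ℝ) (X X₁ : ℝ → ℝ → E) (XX XX₁ : ℝ → ℝ → V), 0 < τ →
      IsBesovRoughPath ι τ α p q X XX → IsBesovRoughPath ι τ α p q X₁ XX₁ →
      ∀ (ω : ℝ → ℝ → ℝ) (N : ℝ≥0∞), HasBesovSize τ (1 - r / p.toReal) α p q (1 / r) N ω →
      IsRoughOn ι 0 τ r ω X XX → IsRoughOn ι 0 τ r ω X₁ XX₁ →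
      ∃ ω₁ ω₃ : ℝ → ℝ → ℝ, HasBesovSize τ (1 - r / p.toReal) α p q (1 / r)
          (C * besovNorm τ α p q (X - X₁)) ω₁ ∧
        HasBesovSize τ (1 - r / p.toReal) (2 * α) (p / 2) (q / 2) (2 / r)
          (C * (besovNorm τ (2 * α) (p / 2) (q / 2) (XX - XX₁) +
            besovNorm τ α p q (X - X₁) * N)) ω₃ ∧
        (∀ s t, 0 ≤ s → s ≤ t → t ≤ τ → ‖X s t - X₁ s t‖ ≤ ω₁ s t ^ (1 / r)) ∧
        ∀ s t, 0 ≤ s → s ≤ t → t ≤ τ → ‖XX s t - XX₁ s t‖ ≤ ω₃ s t ^ (2 / r) := by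
  obtain ⟨C₁, h₁⟩ := exists_control_of_additive h E
  obtain ⟨C₂, h₂⟩ := exists_control_of_defect h V
  obtain ⟨K, hK⟩ := h.exists_add_double
  have hr := h.pos
  -- The difference of the two Chen relations has two products, each of size `ω₁ ^ (1 / r) * ω ^ (1
  -- / r)`; the power `2 / r` of `B` is exactly two.
  set B : ℝ≥0 := 2 ^ (r / 2) with hB
  have hBr : (B : ℝ) ^ (2 / r) = 2 := by
    rw [hB, NNReal.coe_rpow, ← Real.rpow_mul (by simp), div_mul_div_cancel₀ (by norm_num),
      div_self hr.ne', Real.rpow_one]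
    simp
  obtain ⟨D, hDr⟩ : ∃ D : ℝ≥0, ENNReal.ofReal ((C₂ : ℝ) ^ (2 / r)) = D := ⟨_, rfl⟩
  refine ⟨C₁ + K * (C₂ + D * 2 * C₁), fun τ X X₁ XX XX₁ hτ hX hX₁ ω N hω hR hR₁ => ?_⟩
  have hfin1 : besovNorm τ α p q (X - X₁) < ∞ := besovNorm_sub_lt_top h.one_le
    (.of_continuousOn hX.continuousOn_fst) (.of_continuousOn hX₁.continuousOn_fst) hX.besov_fst
    hX₁.besov_fst
  have hfin2 : besovNorm τ (2 * α) (p / 2) (q / 2) (XX - XX₁) < ∞ :=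
    besovNorm_sub_lt_top h.one_le_half (.of_continuousOn hX.continuousOn_snd)
      (.of_continuousOn hX₁.continuousOn_snd) hX.besov_snd hX₁.besov_snd
  obtain ⟨ω₁, hω₁, hX1⟩ := h₁ τ (X - X₁) hτ (hX.continuousOn_fst.sub hX₁.continuousOn_fst) hfin1
    (fun s u t a b c d => by
      simp only [Pi.sub_apply]
      rw [hX.additive s u t a b c d, hX₁.additive s u t a b c d]; abel)
  obtain ⟨ω₂, hω₂, hX2⟩ := h₂ τ (XX - XX₁) hτ (hX.continuousOn_snd.sub hX₁.continuousOn_snd) hfin2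
  have hgm := (hω₁.rpow_half_mul hω hτ h.p_ne_zero h.ne_zero).const_mul hτ.le B
  rw [hBr] at hgm
  have hX2' := hX2 _ hgm.reg (fun s hs ht => by
      simp [hX.snd_self hs ht, hX₁.snd_self hs ht]) (fun s u t hs hsu hut ht => by
    have hd : (XX - XX₁) s t - (XX - XX₁) s u - (XX - XX₁) u t =
        ι ((X s u - X₁ s u) ⊗ₜ[ℝ] X u t) + ι (X₁ s u ⊗ₜ[ℝ] (X u t - X₁ u t)) := by
      simp only [Pi.sub_apply]
      rw [hX.chen s u t hs hsu hut ht, hX₁.chen s u t hs hsu hut ht, TensorProduct.sub_tmul,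
        TensorProduct.tmul_sub, map_sub, map_sub]
      abel
    have hst := hsu.trans hut
    have a := hω₁.reg.ctrl.nonneg s t hs hst ht
    have b := hω.reg.ctrl.nonneg s t hs hst ht
    have hx1 : ‖X s u - X₁ s u‖ ≤ ω₁ s t ^ (1 / r) := (hX1 s u hs hsu (hut.trans ht)).trans
      (Real.rpow_le_rpow (hω₁.reg.ctrl.nonneg _ _ hs hsu (hut.trans ht))
        (hω₁.reg.ctrl.mono hs le_rfl hsu hut ht) (by positivity))
    have hx2 : ‖X u t - X₁ u t‖ ≤ ω₁ s t ^ (1 / r) := (hX1 u t (hs.trans hsu) hut ht).trans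
      (Real.rpow_le_rpow (hω₁.reg.ctrl.nonneg _ _ (hs.trans hsu) hut ht)
        (hω₁.reg.ctrl.mono hs hsu hut le_rfl ht) (by positivity))
    have hx3 := (hR.bounds hr hs hsu hut le_rfl ht).1
    have hx4 := (hR₁.bounds hr hs le_rfl hsu hut ht).1
    rw [hd, Real.mul_rpow B.coe_nonneg (by positivity), hBr,
      Real.mul_rpow (by positivity) (by positivity), ← Real.rpow_mul a, ← Real.rpow_mul b,
      show (1 / 2 : ℝ) * (2 / r) = 1 / r by field_simp]
    refine (norm_add_le _ _).trans ?_
    rw [hι, hι]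
    calc _ ≤ ω₁ s t ^ (1 / r) * ω s t ^ (1 / r) + ω s t ^ (1 / r) * ω₁ s t ^ (1 / r) := by
          gcongr
      _ = _ := by ring)
  have hsz := hK hτ.le hω₂ (hgm.const_mul hτ.le C₂)
  refine ⟨ω₁, _, hω₁.mono ?_, hsz.mono ?_, hX1, fun s t hs hst ht => ?_⟩
  · gcongr
    exact le_self_add
  · rw [hDr, ENNReal.ofReal_ofNat]
    push_cast
    set x := besovNorm τ (2 * α) (p / 2) (q / 2) (XX - XX₁)
    set y := besovNorm τ α p q (X - X₁)
    calc _ = (K : ℝ≥0∞) * (C₂ * x + D * 2 * C₁ * (y * N)) := by ring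
      _ ≤ K * ((C₂ + D * 2 * C₁) * (x + y * N)) := by
          rw [add_mul, mul_add (C₂ : ℝ≥0∞), mul_add ((D : ℝ≥0∞) * 2 * C₁)]
          gcongr
          · exact le_self_add
          · exact le_add_self
      _ ≤ _ := by
          rw [← mul_assoc]
          gcongr
          exact le_add_self
  · exact hX2' s t hs hst ht

end

/-! ### Variation and controls -/

section

variable {G : Type*} [NormedAddCommGroup G] {τ r : ℝ} {A : ℝ → ℝ → G}

/-- The power `r / ρ ≥ 1` of a control is a control, and the variation sums are bounded by its value
on the whole interval. -/
theorem rVariation_lt_top {ρ : ℝ} {ω : ℝ → ℝ → ℝ} (hω : IsControl 0 τ ω) (hρ : 0 < ρ)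
    (hρr : ρ ≤ r) (hA : ∀ s t, 0 ≤ s → s ≤ t → t ≤ τ → ‖A s t‖ ≤ ω s t ^ (1 / ρ)) :
    rVariation τ r A < ∞ := by
  have hr : 0 < r := hρ.trans_le hρr
  have hω' : IsControl 0 τ fun s t => ω s t ^ (r / ρ) := hω.rpow ((one_le_div hρ).2 hρr)
  refine ENNReal.rpow_lt_top_of_nonneg (by positivity) (ne_top_of_le_ne_top
    (ENNReal.ofReal_ne_top (r := ω 0 τ ^ (r / ρ))) ?_)
  refine iSup₂_le fun n u => iSup₂_le fun hu hmem => ?_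
  have hpart := finExtend_isPart hu
  have h0 := (hmem 0).1
  have h1 := (hmem (Fin.last n)).2
  have h2 := hu.monotone (Fin.zero_le (Fin.last n))
  calc ∑ i : Fin n, ‖A (u i.castSucc) (u i.succ)‖ₑ ^ r
      ≤ ∑ i : Fin n, ENNReal.ofReal (ω (u i.castSucc) (u i.succ) ^ (r / ρ)) := by
        refine Finset.sum_le_sum fun i _ => ?_
        have a1 := (hmem i.castSucc).1
        have a2 := (hu i.castSucc_lt_succ).le
        have a3 := (hmem i.succ).2
        have hω0 := hω.nonneg _ _ a1 a2 a3
        rw [← ofReal_norm, ENNReal.ofReal_rpow_of_nonneg (norm_nonneg _) hr.le]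
        refine ENNReal.ofReal_le_ofReal ((Real.rpow_le_rpow (norm_nonneg _) (hA _ _ a1 a2 a3)
          hr.le).trans_eq ?_)
        rw [← Real.rpow_mul hω0, one_div_mul_eq_div]
    _ = ENNReal.ofReal (∑ i : Fin n, ω (u i.castSucc) (u i.succ) ^ (r / ρ)) := by
        rw [ENNReal.ofReal_sum_of_nonneg]
        intro i _
        exact hω'.nonneg _ _ (hmem i.castSucc).1 (hu i.castSucc_lt_succ).le (hmem i.succ).2
    _ ≤ ENNReal.ofReal (ω 0 τ ^ (r / ρ)) := by
        refine ENNReal.ofReal_le_ofReal ?_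
        rw [← sum_finExtend fun x y => ω x y ^ (r / ρ)]
        exact (hω'.sum_le h0 h1 hpart).trans (hω'.mono le_rfl h0 h2 h1 le_rfl)

/-- The `r`-th power of the `r`-variation on `[0, t]`. -/
noncomputable def variationSum (r : ℝ) (A : ℝ → ℝ → G) (t : ℝ) : ℝ≥0∞ :=
  ⨆ (n : ℕ) (u : Fin (n + 1) → ℝ) (_ : StrictMono u) (_ : ∀ i, u i ∈ Icc 0 t),
    ∑ i : Fin n, ‖A (u i.castSucc) (u i.succ)‖ₑ ^ r

theorem le_variationSum {t : ℝ} {n : ℕ} {u : Fin (n + 1) → ℝ} (hu : StrictMono u)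
    (hmem : ∀ i, u i ∈ Icc 0 t) :
    ∑ i : Fin n, ‖A (u i.castSucc) (u i.succ)‖ₑ ^ r ≤ variationSum r A t :=
  le_iSup₂_of_le n u (le_iSup₂_of_le hu hmem le_rfl)

theorem sum_snoc (f : ℝ → ℝ → ℝ≥0∞) {n : ℕ} (u : Fin (n + 1) → ℝ) (x : ℝ) :
    ∑ i : Fin (n + 1), f ((Fin.snoc u x : Fin (n + 2) → ℝ) i.castSucc)
      ((Fin.snoc u x : Fin (n + 2) → ℝ) i.succ) =
      ∑ i : Fin n, f (u i.castSucc) (u i.succ) + f (u (Fin.last n)) x := by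
  rw [Fin.sum_univ_castSucc]
  congr 1
  · refine Finset.sum_congr rfl fun i _ => ?_
    rw [Fin.snoc_castSucc, Fin.succ_castSucc, Fin.snoc_castSucc]
  · rw [Fin.snoc_castSucc, Fin.succ_last, Fin.snoc_last]

theorem strictMono_snoc {n : ℕ} {u : Fin (n + 1) → ℝ} (hu : StrictMono u) {x : ℝ}
    (hx : u (Fin.last n) < x) : StrictMono (Fin.snoc u x : Fin (n + 2) → ℝ) := by
  rw [Fin.strictMono_iff_lt_succ]
  intro i
  refine Fin.lastCases ?_ (fun j => ?_) i
  · rw [Fin.snoc_castSucc, Fin.succ_last, Fin.snoc_last]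
    exact hx
  · rw [Fin.snoc_castSucc, Fin.succ_castSucc, Fin.snoc_castSucc]
    exact hu j.castSucc_lt_succ

/-- Append `t` to a partition of `[0, s]`, after first appending `s` if the partition does not end
there. -/
theorem variationSum_add_le {s t : ℝ} (hs : 0 ≤ s) (hst : s < t) :
    variationSum r A s + ‖A s t‖ₑ ^ r ≤ variationSum r A t := by
  have hmem' : ∀ {n : ℕ} {u : Fin (n + 1) → ℝ} {x : ℝ}, (∀ i, u i ∈ Icc 0 s) → 0 ≤ x → x ≤ t →
      ∀ i, (Fin.snoc u x : Fin (n + 2) → ℝ) i ∈ Icc 0 t := by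
    intro n u x hu hx hxt i
    refine Fin.lastCases ?_ (fun j => ?_) i
    · rw [Fin.snoc_last]; exact ⟨hx, hxt⟩
    · rw [Fin.snoc_castSucc]; exact ⟨(hu j).1, (hu j).2.trans hst.le⟩
  have hmem'' : ∀ {n : ℕ} {u : Fin (n + 1) → ℝ}, (∀ i, u i ∈ Icc 0 s) →
      ∀ i, (Fin.snoc u s : Fin (n + 2) → ℝ) i ∈ Icc 0 s := by
    intro n u hu i
    refine Fin.lastCases ?_ (fun j => ?_) i
    · rw [Fin.snoc_last]; exact ⟨hs, le_rfl⟩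
    · rw [Fin.snoc_castSucc]; exact hu j
  have key : ∀ {n : ℕ} {u : Fin (n + 1) → ℝ}, StrictMono u → (∀ i, u i ∈ Icc 0 s) →
      u (Fin.last n) = s →
      ∑ i : Fin n, ‖A (u i.castSucc) (u i.succ)‖ₑ ^ r + ‖A s t‖ₑ ^ r ≤ variationSum r A t := by
    intro n u hu hmem hlast
    have := le_variationSum (A := A) (r := r) (strictMono_snoc hu (hlast.trans_lt hst))
      (hmem' hmem (hs.trans hst.le) le_rfl)
    rwa [sum_snoc (fun x y => ‖A x y‖ₑ ^ r), hlast] at this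
  rw [variationSum]
  simp only [ENNReal.iSup_add]
  refine iSup_le fun n => ?_
  refine iSup_le fun u => ?_
  by_cases hu : StrictMono u
  -- A sequence that is not admissible contributes an empty supremum, namely zero; the two-point
  -- partition `s, t` bounds what remains.
  swap
  · have := le_variationSum (A := A) (r := r) (t := t)
      (strictMono_snoc (u := fun _ : Fin 1 => s) (fun i j h => absurd h (by omega)) hst)
      (hmem' (fun _ => ⟨hs, le_rfl⟩) (hs.trans hst.le) le_rfl)
    rw [sum_snoc (fun x y => ‖A x y‖ₑ ^ r)] at this
    simpa [hu] using this
  by_cases hmem : ∀ i, u i ∈ Icc 0 s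
  swap
  · have := le_variationSum (A := A) (r := r) (t := t)
      (strictMono_snoc (u := fun _ : Fin 1 => s) (fun i j h => absurd h (by omega)) hst)
      (hmem' (fun _ => ⟨hs, le_rfl⟩) (hs.trans hst.le) le_rfl)
    rw [sum_snoc (fun x y => ‖A x y‖ₑ ^ r)] at this
    rw [iSup_pos hu, iSup_neg hmem]
    simpa using this
  rw [iSup_pos hu, iSup_pos hmem]
  rcases (hmem (Fin.last n)).2.eq_or_lt with hl | hl
  · exact key hu hmem hl
  · have := key (strictMono_snoc hu hl) (hmem'' hmem) (Fin.snoc_last _ _)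
    rw [sum_snoc (fun x y => ‖A x y‖ₑ ^ r)] at this
    exact (add_le_add le_self_add le_rfl).trans this

/-- The increments of the variation on `[0, t]` as a function of `t` form an additive control. They
dominate `‖A s t‖ ^ r` by superadditivity; no continuity is claimed for them. -/
theorem exists_control_of_rVariation (hr : 0 < r) (h : rVariation τ r A < ∞)
    (hdiag : ∀ s, 0 ≤ s → s ≤ τ → A s s = 0) :
    ∃ ω, IsControl 0 τ ω ∧ ∀ s t, 0 ≤ s → s ≤ t → t ≤ τ → ‖A s t‖ ≤ ω s t ^ (1 / r) := by
  have hfin : variationSum r A τ ≠ ∞ := by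
    intro htop
    have : rVariation τ r A = variationSum r A τ ^ (1 / r) := rfl
    rw [this, htop, ENNReal.top_rpow_of_pos (by positivity)] at h
    exact lt_irrefl _ h
  have hmono : ∀ {s t}, 0 ≤ s → s ≤ t → variationSum r A s ≤ variationSum r A t := by
    intro s t hs hst
    rcases hst.eq_or_lt with rfl | hst
    · exact le_rfl
    · exact le_self_add.trans (variationSum_add_le hs hst)
  have hfin' : ∀ {t}, 0 ≤ t → t ≤ τ → variationSum r A t ≠ ∞ := fun h0 ht =>
    ne_top_of_le_ne_top hfin (hmono h0 ht)
  refine ⟨fun s t => (variationSum r A t).toReal - (variationSum r A s).toReal,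
    ⟨fun s t hs hst ht => ?_, fun s u t _ _ _ _ => by ring_nf; exact le_rfl⟩,
    fun s t hs hst ht => ?_⟩
  · exact sub_nonneg.2 (ENNReal.toReal_mono (hfin' (hs.trans hst) ht) (hmono hs hst))
  · rcases hst.eq_or_lt with rfl | hlt
    · simp only [hdiag s hs ht, norm_zero, sub_self]
      rw [Real.zero_rpow (by positivity)]
    have h1 := ENNReal.toReal_mono (hfin' (hs.trans hst) ht) (variationSum_add_le (A := A) (r := r)
      hs hlt)
    have h2 : ‖A s t‖ₑ ^ r = ENNReal.ofReal (‖A s t‖ ^ r) := by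
      rw [← ofReal_norm, ENNReal.ofReal_rpow_of_nonneg (norm_nonneg _) hr.le]
    rw [h2, ENNReal.toReal_add (hfin' hs (hst.trans ht)) ENNReal.ofReal_ne_top,
      ENNReal.toReal_ofReal (by positivity)] at h1
    calc ‖A s t‖ = (‖A s t‖ ^ r) ^ (1 / r) := by
          rw [← Real.rpow_mul (norm_nonneg _), mul_one_div_cancel hr.ne', Real.rpow_one]
      _ ≤ _ := Real.rpow_le_rpow (by positivity) (by linarith) (by positivity)

end

theorem IsPartitionLimit.congr {F : Type*} [NormedAddCommGroup F] {A B : ℝ → ℝ → F} {s t : ℝ}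
    {z : F} (h : IsPartitionLimit A s t z)
    (hAB : ∀ u v, s ≤ u → u ≤ v → v ≤ t → A u v = B u v) : IsPartitionLimit B s t z := by
  intro ε hε
  obtain ⟨P₀, hP, h⟩ := h ε hε
  refine ⟨P₀, hP, fun n u hu h0 hn hsub => ?_⟩
  rw [← Finset.sum_congr rfl fun i _ => hAB (u i.castSucc) (u i.succ)
    (h0 ▸ hu.monotone (Fin.zero_le _)) (hu i.castSucc_lt_succ).le
    (hn ▸ hu.monotone (Fin.le_last _))]
  exact h n u hu h0 hn hsub

/-- The one-point partition has an empty sum. This is the source of the initial condition `Y 0 =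
y₀`. -/
theorem IsPartitionLimit.eq_zero {F : Type*} [NormedAddCommGroup F] {A : ℝ → ℝ → F} {s : ℝ}
    {z : F} (h : IsPartitionLimit A s s z) : z = 0 := by
  refine norm_le_zero_iff.1 (le_of_forall_pos_le_add fun ε hε => ?_)
  obtain ⟨P₀, hP, h⟩ := h ε hε
  have := h 0 (fun _ => s) (fun i j h => absurd h (by omega)) rfl rfl (fun x hx => by
    have := hP hx
    exact ⟨0, le_antisymm this.1 this.2⟩)
  rw [Finset.univ_eq_empty, Finset.sum_empty, zero_sub, norm_neg] at this
  linarith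

section

variable {E F V : Type*} [NormedAddCommGroup E] [NormedSpace ℝ E]
  [NormedAddCommGroup F] [NormedSpace ℝ F] [NormedAddCommGroup V] [NormedSpace ℝ V]
  {ι : E ⊗[ℝ] E ≃ₗ[ℝ] V} {α r τ : ℝ} {p q : ℝ≥0∞} {X : ℝ → ℝ → E} {XX : ℝ → ℝ → V}
  {Y : ℝ → F} {Y' : ℝ → E →L[ℝ] F} {φ : F → E →L[ℝ] F} {y₀ : F}

theorem SolvesRDE.eq_zero (h : SolvesRDE ι φ τ X XX y₀ Y Y') (hτ : 0 ≤ τ) : Y 0 = y₀ :=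
  sub_eq_zero.1 (IsPartitionLimit.eq_zero (h 0 ⟨le_rfl, hτ⟩).2)

theorem SolvesRDE.deriv_eq (h : SolvesRDE ι φ τ X XX y₀ Y Y') {t : ℝ} (ht : 0 ≤ t) (htτ : t ≤ τ) :
    Y' t = φ (Y t) := (h t ⟨ht, htτ⟩).1

theorem SolvesRDE.remainder_eq (h : SolvesRDE ι φ τ X XX y₀ Y Y') {s t : ℝ} (hs : 0 ≤ s)
    (hst : s ≤ τ) : remainder X Y Y' s t = Y t - Y s - φ (Y s) (X s t) := by
  rw [remainder, h.deriv_eq hs hst]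

theorem SolvesRDE.isPartitionLimit (h : SolvesRDE ι φ τ X XX y₀ Y Y') :
    ∀ t ∈ Icc 0 τ, IsPartitionLimit
      (fun u v => φ (Y u) (X u v) + tensorApply ι (derivMul φ (Y u)) (XX u v)) 0 t (Y t - y₀) := by
  intro t ht
  refine IsPartitionLimit.congr (h t ht).2 fun u v hu huv hv => ?_
  simp only [h.deriv_eq hu (huv.trans (hv.trans ht.2)), derivMul]

/-- The defect of the remainder is `(Y' u - Y' s) (X u t)`, a product of two first level increments.
The geometric mean of their controls dominates it, so the embedding with defect applies to the
remainder. -/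
theorem IsBesovControlled.exists_control (hY : IsBesovControlled τ α p q X Y Y')
    (h : IsBesovExponent α p q r) (hτ : 0 < τ) (hX : IsBesovRoughPath ι τ α p q X XX) :
    ∃ ω₁ ω₂ : ℝ → ℝ → ℝ, IsControl 0 τ ω₁ ∧ IsControl 0 τ ω₂ ∧
      (∀ s t, 0 ≤ s → s ≤ t → t ≤ τ → ‖incr Y' s t‖ ≤ ω₁ s t ^ (1 / r)) ∧
      ∀ s t, 0 ≤ s → s ≤ t → t ≤ τ → ‖remainder X Y Y' s t‖ ≤ ω₂ s t ^ (2 / r) := by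
  obtain ⟨C₁, h₁⟩ := exists_control_of_additive h E
  obtain ⟨C₂, h₂⟩ := exists_control_of_additive h (E →L[ℝ] F)
  obtain ⟨C₃, h₃⟩ := exists_control_of_defect h F
  have hr := h.pos
  have hfst : MapsTo (fun z : ℝ × ℝ => z.1) (simplex τ) (Icc 0 τ) := fun z hz =>
    ⟨hz.1, hz.2.1.trans hz.2.2⟩
  have hsnd : MapsTo (fun z : ℝ × ℝ => z.2) (simplex τ) (Icc 0 τ) := fun z hz =>
    ⟨hz.1.trans hz.2.1, hz.2.2⟩
  have hY1 := hY.continuousOn.comp continuous_fst.continuousOn hfst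
  have hY2 := hY.continuousOn.comp continuous_snd.continuousOn hsnd
  have hY1' := hY.continuousOn_deriv.comp continuous_fst.continuousOn hfst
  have hY2' := hY.continuousOn_deriv.comp continuous_snd.continuousOn hsnd
  obtain ⟨ω, hω, hX1⟩ := h₁ τ X hτ hX.continuousOn_fst hX.besov_fst hX.additive
  obtain ⟨ω₁, hω₁, hd⟩ := h₂ τ (incr Y') hτ (hY2'.sub hY1') hY.besov_deriv
    (fun s u t _ _ _ _ => by simp only [incr]; abel)
  obtain ⟨ω₂, hω₂, hR⟩ := h₃ τ (remainder X Y Y') hτ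
    ((hY2.sub hY1).sub (hY1'.clm_apply hX.continuousOn_fst)) hY.besov_remainder
  have hgm := hω₁.rpow_half_mul hω hτ h.p_ne_zero h.ne_zero
  have hR' := hR _ hgm.reg (fun s hs ht => by simp [remainder, hX.fst_self hs ht])
    (fun s u t hs hsu hut ht => by
      have hdef : remainder X Y Y' s t - remainder X Y Y' s u - remainder X Y Y' u t =
          (Y' u - Y' s) (X u t) := by
        simp only [remainder]
        rw [hX.additive s u t hs hsu hut ht, map_add, _root_.sub_apply]
        abel
      have hst := hsu.trans hut
      have a := hω₁.reg.ctrl.nonneg s t hs hst ht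
      have b := hω.reg.ctrl.nonneg s t hs hst ht
      rw [hdef, Real.mul_rpow (by positivity) (by positivity), ← Real.rpow_mul a,
        ← Real.rpow_mul b, show (1 / 2 : ℝ) * (2 / r) = 1 / r by field_simp]
      refine (ContinuousLinearMap.le_opNorm _ _).trans ?_
      gcongr
      · exact (hd s u hs hsu (hut.trans ht)).trans
          (Real.rpow_le_rpow (hω₁.reg.ctrl.nonneg _ _ hs hsu (hut.trans ht))
          (hω₁.reg.ctrl.mono hs le_rfl hsu hut ht) (by positivity))
      · exact (hX1 u t (hs.trans hsu) hut ht).trans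
          (Real.rpow_le_rpow (hω.reg.ctrl.nonneg _ _ (hs.trans hsu) hut ht)
          (hω.reg.ctrl.mono hs hsu hut le_rfl ht) (by positivity)))
  exact ⟨ω₁, _, hω₁.reg.ctrl, hω₂.reg.ctrl.add (hgm.reg.ctrl.const_mul C₃.coe_nonneg), hd, hR'⟩

theorem IsBesovControlled.isControlled (hY : IsBesovControlled τ α p q X Y Y') {ρ : ℝ}
    (h : IsBesovExponent α p q r) (hτ : 0 < τ) (hX : IsBesovRoughPath ι τ α p q X XX)
    (hρ : r ≤ ρ) : IsControlled τ ρ X Y Y' := by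
  obtain ⟨ω₁, ω₂, hω₁, hω₂, h1, h2⟩ := hY.exists_control h hτ hX
  refine ⟨rVariation_lt_top hω₁ h.pos hρ h1, rVariation_lt_top hω₂ (half_pos h.pos)
    (by linarith) fun s t hs hst ht => ?_⟩
  rw [one_div_div]
  exact h2 s t hs hst ht

theorem IsControlled.exists_control (hr : 0 < r) (hY : IsControlled τ r X Y Y')
    (hX : ∀ s, 0 ≤ s → s ≤ τ → X s s = 0) :
    ∃ ω : ℝ → ℝ → ℝ, IsControl 0 τ ω ∧
      ∀ s t, 0 ≤ s → s ≤ t → t ≤ τ → ‖remainder X Y Y' s t‖ ≤ ω s t ^ (2 / r) := by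
  have := exists_control_of_rVariation (half_pos hr) hY.2
    (fun s hs ht => by simp [remainder, hX s hs ht])
  rwa [one_div_div] at this

end

/-! ### Existence and uniqueness -/

/-- If `p < 3`, the exponent `p` itself qualifies; otherwise any exponent close enough to three
does. -/
theorem exists_variation_exponent {α : ℝ} {p : ℝ≥0∞} (hα : 1 / 3 < α)
    (hαp : ENNReal.ofReal (1 / α) < p) (hp : 2 ≤ p) :
    ∃ ρ : ℝ, 2 ≤ ρ ∧ ρ < 3 ∧ 1 / α < ρ ∧ ENNReal.ofReal ρ ≤ p := by
  have h3 : 1 / α < 3 := by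
    rw [div_lt_comm₀ (by linarith) (by norm_num)]
    exact hα
  by_cases hp3 : p < 3
  · have hpt : p ≠ ∞ := (hp3.trans (by norm_num)).ne
    have e : ENNReal.ofReal p.toReal = p := ENNReal.ofReal_toReal hpt
    refine ⟨p.toReal, ?_, ?_, ?_, e.le⟩
    · simpa using ENNReal.toReal_mono hpt hp
    · simpa using ENNReal.toReal_strict_mono (by norm_num) hp3
    · rw [← e] at hαp
      exact (ENNReal.ofReal_lt_ofReal_iff_of_nonneg (by positivity)).1 hαp
  · obtain ⟨m, h1, h2⟩ := exists_between h3
    refine ⟨max 2 m, le_max_left _ _, max_lt (by norm_num) h2, lt_max_of_lt_right h1, ?_⟩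
    refine le_trans ?_ (not_lt.1 hp3)
    rw [ENNReal.ofReal_le_iff_le_toReal (by norm_num)]
    simp only [ENNReal.toReal_ofNat]
    exact max_le (by norm_num) h2.le

/-- Variation exponents equal to `p` are admitted, whereas the construction of controls needs an
exponent strictly below `p`; a slightly smaller one provides it. -/
theorem exists_isBesovExponent {α ρ : ℝ} {p q : ℝ≥0∞} (hα : 0 < α) (hp : 2 ≤ p) (hq : q ≠ 0)
    (hρ : 1 / α < ρ) (hρp : ENNReal.ofReal ρ ≤ p) : ∃ r < ρ, IsBesovExponent α p q r := by
  obtain ⟨r, h1, h2⟩ := exists_between hρ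
  have h0 : 0 < 1 / α := by positivity
  have hr : 0 < r := h0.trans h1
  exact ⟨r, h2, hr, (one_div_lt hr hα).2 h1,
    ((ENNReal.ofReal_lt_ofReal_iff (hr.trans h2)).2 h2).trans_le hρp, hp, hq⟩

section

variable {E F V : Type*} [NormedAddCommGroup E] [NormedSpace ℝ E]
  [NormedAddCommGroup F] [NormedSpace ℝ F] [NormedAddCommGroup V] [NormedSpace ℝ V]
  {ι : E ⊗[ℝ] E ≃ₗ[ℝ] V} {α r τ μ : ℝ} {p q N : ℝ≥0∞} {X : ℝ → ℝ → E} {XX : ℝ → ℝ → V}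
  {ω : ℝ → ℝ → ℝ} {Y Z : ℝ → F} {Y' Z' : ℝ → E →L[ℝ] F} {φ : F → E →L[ℝ] F} {y₀ : F}

theorem IsRoughOn.rpow {a b ρ : ℝ} (h : IsRoughOn ι a b r ω X XX) (hr : 0 < r) (hρ : r ≤ ρ) :
    IsRoughOn ι a b ρ (fun s t => ω s t ^ (ρ / r)) X XX := by
  have hρ0 := hr.trans_le hρ
  refine ⟨h.ctrl.rpow ((one_le_div hr).2 hρ), h.additive, h.chen, fun s t hs hst ht => ?_,
    fun s t hs hst ht => ?_⟩
  · rw [← Real.rpow_mul (h.ctrl.nonneg s t hs hst ht),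
      show ρ / r * (1 / ρ) = 1 / r by field_simp]
    exact h.fst s t hs hst ht
  · rw [← Real.rpow_mul (h.ctrl.nonneg s t hs hst ht),
      show ρ / r * (2 / ρ) = 2 / r by field_simp]
    exact h.snd s t hs hst ht

/-- The rough path is controlled with the smaller exponent `r`, the remainders only with `ρ`.
Passing to the power `ρ / r` of the control puts all data at the exponent `ρ < 3`, where pathwise
uniqueness applies. -/
theorem SolvesRDE.eqOn_of_isControlled (hι : ∀ x y : E, ‖ι (x ⊗ₜ[ℝ] y)‖ = ‖x‖ * ‖y‖)
    (h : IsBesovExponent α p q r) {ρ : ℝ} (hr : r ≤ ρ) (hρ : ρ < 3) (hτ : 0 < τ)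
    (hX : IsBesovRoughPath ι τ α p q X XX) (hφ : EulerBound ι φ μ)
    (hYc : IsControlled τ ρ X Y Y') (hY : SolvesRDE ι φ τ X XX y₀ Y Y')
    (hZc : IsControlled τ ρ X Z Z') (hZ : SolvesRDE ι φ τ X XX y₀ Z Z') :
    EqOn Z Y (Icc 0 τ) ∧ EqOn Z' Y' (Icc 0 τ) := by
  obtain ⟨C, hC⟩ := exists_control_of_isBesovRoughPath ι hι h
  obtain ⟨ω, hω, hR⟩ := hC τ X XX hτ hX
  have hr0 := h.pos
  have hρ0 := hr0.trans_le hr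
  have hX0 : ∀ s, 0 ≤ s → s ≤ τ → X s s = 0 := fun s hs ht => hX.fst_self hs ht
  obtain ⟨ω₁, hω₁, h₁⟩ := hZc.exists_control hρ0 hX0
  obtain ⟨ω₂, hω₂, h₂⟩ := hYc.exists_control hρ0 hX0
  have hsmall : IsUnifSmall 0 τ fun s t => ω s t ^ (ρ / r) := fun ε hε =>
    (hω.reg.isUnifSmall hτ h.kappa_pos).exists_rpow_le hω.reg.ctrl (div_pos hρ0 hr0) hε
  have hZY : EqOn Z Y (Icc 0 τ) := by
    refine (hR.rpow hr0 hr).eqOn_of_limit hφ hρ0 hρ hsmall hZ.isPartitionLimit hY.isPartitionLimit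
      hω₁ (fun s t hs hst ht => ?_) hω₂ (fun s t hs hst ht => ?_)
      ((hZ.eq_zero hτ.le).trans (hY.eq_zero hτ.le).symm)
    · rw [← hZ.remainder_eq hs (hst.trans ht)]
      exact h₁ s t hs hst ht
    · rw [← hY.remainder_eq hs (hst.trans ht)]
      exact h₂ s t hs hst ht
  refine ⟨hZY, fun t ht => ?_⟩
  rw [hZ.deriv_eq ht.1 ht.2, hY.deriv_eq ht.1 ht.2, hZY ht]

/-- Davie's estimate says that the increments of `Y` differ from the germ of the rough integral by a
power greater than one of a control that is small on short intervals. The Riemann sums then converge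
to the increments. -/
theorem SolvesRDE.of_pathRem_le (hR : IsRoughOn ι 0 τ r ω X XX) (hr : 0 < r) (hr3 : r < 3)
    (hsmall : IsUnifSmall 0 τ ω) (hμ : 0 ≤ μ)
    (hY : ∀ s t, 0 ≤ s → s ≤ t → t ≤ τ → ‖pathRem ι φ X XX Y s t‖ ≤ μ * ω s t ^ (3 / r)) :
    SolvesRDE ι φ τ X XX (Y 0) Y (fun t => φ (Y t)) := by
  refine fun t ht => ⟨rfl, ?_⟩
  refine isPartitionLimit_of_le ht.1 (hR.ctrl.restrict le_rfl ht.2)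
    (fun ε hε => ?_) ((one_lt_div hr).2 hr3) hμ fun x y hx hxy hy => ?_
  · obtain ⟨η, hη, h⟩ := hsmall ε hε
    exact ⟨η, hη, fun s u h1 h2 h3 => h s u h1 h2 (h3.trans ht.2)⟩
  · refine le_trans (le_of_eq ?_) (hY x y hx hxy (hy.trans ht.2))
    rw [pathRem_eq (ι := ι) (φ := φ) (X := X) (XX := XX) (Y := Y) x y, derivMul]
    congr 1
    abel

theorem EulerBound.norm_remainder_le (hφ : EulerBound ι φ μ) (hR : IsRoughOn ι 0 τ r ω X XX)
    (hr : 0 < r) (h1 : ω 0 τ ≤ 1)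
    (hY : ∀ s t, 0 ≤ s → s ≤ t → t ≤ τ → ‖pathRem ι φ X XX Y s t‖ ≤ μ * ω s t ^ (3 / r))
    {s t : ℝ} (hs : 0 ≤ s) (hst : s ≤ t) (ht : t ≤ τ) :
    ‖Y t - Y s - φ (Y s) (X s t)‖ ≤ 2 * μ ^ 2 * (ω s t ^ (1 / r)) ^ 2 := by
  have hμ := hφ.nice.one_le
  have hω := hR.ctrl.nonneg s t hs hst ht
  have hw := Real.rpow_nonneg hω (1 / r)
  have hw1 := hR.ctrl.rpow_le_one hr h1 hs hst ht
  have hXX := (hR.bounds hr hs le_rfl hst le_rfl ht).2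
  have hP := hY s t hs hst ht
  rw [rpow_three_div hω] at hP
  have hT := (hφ.tensor (derivMul φ (Y s)) (XX s t)).trans
    (mul_le_mul (mul_le_mul_of_nonneg_left (hφ.nice.derivMul_bound (Y s)) (by linarith)) hXX
      (norm_nonneg _) (by positivity))
  rw [show Y t - Y s - φ (Y s) (X s t) = tensorApply ι (derivMul φ (Y s)) (XX s t) +
    pathRem ι φ X XX Y s t by
      rw [pathRem_eq (ι := ι) (φ := φ) (X := X) (XX := XX) (Y := Y) s t]; abel]
  refine (norm_add_le _ _).trans ((add_le_add hT hP).trans ?_)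
  generalize ω s t ^ (1 / r) = w at *
  have h3 : μ * w ^ 3 ≤ μ ^ 2 * w ^ 2 := by
    calc μ * w ^ 3 = μ * (w ^ 2 * w) := by ring
      _ ≤ (μ * μ) * (w ^ 2 * 1) := by gcongr; exact le_mul_of_one_le_left (by linarith) hμ
      _ = _ := by ring
  calc μ * μ * w ^ 2 + μ * w ^ 3 ≤ μ * μ * w ^ 2 + μ ^ 2 * w ^ 2 := by gcongr
    _ = _ := by ring

/-- Increments of `Y` and of `φ(Y)` are dominated by `ω ^ (1 / r)` and the remainder by `ω ^ (2 /
r)`, and the Besov norms of these powers are finite by the choice of `ω`. -/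
theorem IsBesovControlled.of_pathRem_le (h : IsBesovExponent α p q r)
    (hω : HasBesovSize τ (1 - r / p.toReal) α p q (1 / r) N ω) (hN : N < ∞)
    (hR : IsRoughOn ι 0 τ r ω X XX) (h1 : ω 0 τ ≤ 1) (hφ : EulerBound ι φ μ)
    (hYc : ContinuousOn Y (Icc 0 τ))
    (hY : ∀ s t, 0 ≤ s → s ≤ t → t ≤ τ → ‖pathRem ι φ X XX Y s t‖ ≤ μ * ω s t ^ (3 / r)) :
    IsBesovControlled τ α p q X Y (fun t => φ (Y t)) := by
  have hμ := hφ.nice.one_le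
  have hμ0 : 0 ≤ μ := by linarith
  have hr := h.pos
  have hφc : Continuous φ :=
    (LipschitzWith.of_dist_le_mul (K := ⟨μ, hμ0⟩) fun x y => by
      rw [dist_eq_norm, dist_eq_norm]; exact hφ.nice.lip x y).continuous
  have hw : ∀ s t, 0 ≤ s → s ≤ t → t ≤ τ → 0 ≤ ω s t ^ (1 / r) := fun s t hs hst ht =>
    Real.rpow_nonneg (hR.ctrl.nonneg s t hs hst ht) _
  have hW : besovNorm τ α p q (fun s t => ω s t ^ (1 / r)) < ∞ := hω.norm_le.trans_lt hN
  have hW2 : besovNorm τ (2 * α) (p / 2) (q / 2) (fun s t => (ω s t ^ (1 / r)) ^ 2) < ∞ :=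
    hω.besovNorm_sq_le.trans_lt (ENNReal.pow_lt_top hN)
  have hsl := hω.sliceMeasurable (1 / r)
  have hsl2 : SliceMeasurable τ fun s t => (ω s t ^ (1 / r)) ^ 2 := fun x h0 hx =>
    (hsl x h0 hx).pow 2
  have hincr : ∀ s t, 0 ≤ s → s ≤ t → t ≤ τ → ‖Y t - Y s‖ ≤ 3 * μ ^ 2 * ω s t ^ (1 / r) :=
    fun s t hs hst ht => hR.norm_incr_le hφ hr hY h1 hs hst ht
  refine ⟨hYc, hφc.comp_continuousOn hYc, ?_, ?_, ?_⟩
  · refine (besovNorm_le_mul (NNReal.mk (3 * μ ^ 2) (by positivity)) hsl fun s t hs hst ht => ?_).trans_lt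
      (ENNReal.mul_lt_top ENNReal.coe_lt_top hW)
    rw [Real.norm_of_nonneg (hw s t hs hst ht)]
    exact hincr s t hs hst ht
  · refine (besovNorm_le_mul (NNReal.mk (μ * (3 * μ ^ 2)) (by positivity)) hsl
      fun s t hs hst ht => ?_).trans_lt (ENNReal.mul_lt_top ENNReal.coe_lt_top hW)
    rw [Real.norm_of_nonneg (hw s t hs hst ht), NNReal.coe_mk, mul_assoc]
    exact (hφ.nice.lip _ _).trans (mul_le_mul_of_nonneg_left (hincr s t hs hst ht) hμ0)
  · refine (besovNorm_le_mul (NNReal.mk (2 * μ ^ 2) (by positivity)) hsl2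
      fun s t hs hst ht => ?_).trans_lt (ENNReal.mul_lt_top ENNReal.coe_lt_top hW2)
    rw [Real.norm_of_nonneg (pow_nonneg (hw s t hs hst ht) 2)]
    exact hφ.norm_remainder_le hR hr h1 hY hs hst ht

theorem exists_solvesRDE [FiniteDimensional ℝ F] (h : IsBesovExponent α p q r) (hr3 : r < 3)
    (hτ : 0 < τ) (hX : IsBesovRoughPath ι τ α p q X XX)
    (hω : HasBesovSize τ (1 - r / p.toReal) α p q (1 / r) N ω) (hN : N < ∞)
    (hR : IsRoughOn ι 0 τ r ω X XX) (h1 : ω 0 τ ≤ 1) (hφ : EulerBound ι φ μ)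
    (hsm : 2 * (sewConst (3 / r) * (8 * μ ^ 5)) * ω 0 τ ^ (1 / r) ≤ 1) (y₀ : F) :
    ∃ Y : ℝ → F, IsBesovControlled τ α p q X Y (fun t => φ (Y t)) ∧
      SolvesRDE ι φ τ X XX y₀ Y (fun t => φ (Y t)) := by
  have hsmall := hω.reg.isUnifSmall hτ h.kappa_pos
  obtain ⟨Y, hY0, hYc, hY⟩ := hR.exists_pathRem_le hτ hφ h.pos hr3 h1 hsm hsmall
    hX.continuousOn_fst hX.continuousOn_snd y₀
  have hS := sewConst_pos ((one_lt_div h.pos).2 hr3)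
  have hμ := hφ.nice.one_le
  refine ⟨Y, ?_, hY0 ▸ SolvesRDE.of_pathRem_le hR h.pos hr3 hsmall (by positivity) hY⟩
  refine IsBesovControlled.of_pathRem_le (μ := max μ (2 * (sewConst (3 / r) * (8 * μ ^ 5)))) h hω hN
    hR h1 (hφ.mono (le_max_left _ _)) hYc fun s t hs hst ht => (hY s t hs hst ht).trans ?_
  exact mul_le_mul_of_nonneg_right (le_max_right _ _)
    (Real.rpow_nonneg (hR.ctrl.nonneg s t hs hst ht) _)

end

/-! ### Lipschitz dependence on the data -/

theorem exists_besovNorm_le_add (q : ℝ≥0∞) : ∃ K : ℝ≥0, ∀ {G : Type*} [NormedAddCommGroup G]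
    {τ β : ℝ} {P : ℝ≥0∞} {A : ℝ → ℝ → G} {B₁ B₂ B₃ : ℝ → ℝ → ℝ} (c : ℝ≥0), 1 ≤ P →
    SliceMeasurable τ B₁ → SliceMeasurable τ B₂ → SliceMeasurable τ B₃ →
    (∀ s t, 0 ≤ s → s ≤ t → t ≤ τ → ‖A s t‖ ≤ c * (B₁ s t + B₂ s t + B₃ s t)) →
    besovNorm τ β P q A ≤ c * (K * (besovNorm τ β P q B₁ + besovNorm τ β P q B₂ +
      besovNorm τ β P q B₃)) := by
  obtain ⟨L, hL⟩ := ENNReal.exists_nnreal_mul_le (ENNReal.LpAddConst_lt_top q).ne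
  refine ⟨L * (L + 1), fun {G} _ {τ β P A B₁ B₂ B₃} c hP h₁ h₂ h₃ h => ?_⟩
  have h₁₂ : SliceMeasurable τ (B₁ + B₂) := fun x h0 hx => (h₁ x h0 hx).add (h₂ x h0 hx)
  have hs : SliceMeasurable τ (B₁ + B₂ + B₃) := fun x h0 hx => (h₁₂ x h0 hx).add (h₃ x h0 hx)
  refine (besovNorm_le_mul c hs fun s t h0 hst ht => (h s t h0 hst ht).trans
    (mul_le_mul_of_nonneg_left (Real.le_norm_self _) c.coe_nonneg)).trans ?_
  refine mul_le_mul_right ?_ _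
  have e₁ := besovNorm_add_le (α := β) (q := q) hP h₁ h₂
  have e₂ := besovNorm_add_le (α := β) (q := q) hP h₁₂ h₃
  rw [hL] at e₁ e₂
  generalize besovNorm τ β P q (B₁ + B₂) = y at *
  generalize besovNorm τ β P q B₁ = x₁ at *
  generalize besovNorm τ β P q B₂ = x₂ at *
  generalize besovNorm τ β P q B₃ = x₃ at *
  refine e₂.trans ?_
  calc (L : ℝ≥0∞) * (y + x₃) ≤ L * (L * (x₁ + x₂) + x₃) := by gcongr
    _ ≤ L * ((L + 1) * (x₁ + x₂) + (L + 1) * x₃) := by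
        gcongr
        · exact le_self_add
        · exact le_mul_of_one_le_left (zero_le) le_add_self
    _ = _ := by push_cast; ring

theorem ENNReal.two_mul_add_le (x y z S : ℝ≥0∞) :
    2 * x + y + z + S * (y + z) ≤ (2 + S) * (x + y + z) := by
  calc 2 * x + y + z + S * (y + z) ≤ 2 * x + y + z + S * (y + z) + (y + z + S * x) := le_self_add
    _ = _ := by ring

theorem besovNorm_const_mul_le {τ β : ℝ} {P Q : ℝ≥0∞} {B : ℝ → ℝ → ℝ} {c : ℝ} (hc : 0 ≤ c)
    (hB : SliceMeasurable τ B) :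
    besovNorm τ β P Q (fun s t => c * B s t) ≤ ENNReal.ofReal c * besovNorm τ β P Q B :=
  besovNorm_le_mul c.toNNReal hB fun s t _ _ _ => by
    rw [norm_mul, Real.norm_of_nonneg hc, Real.coe_toNNReal c hc]

section

variable {E F V : Type*} [NormedAddCommGroup E] [NormedSpace ℝ E]
  [NormedAddCommGroup F] [NormedSpace ℝ F] [NormedAddCommGroup V] [NormedSpace ℝ V]
  {ι : E ⊗[ℝ] E ≃ₗ[ℝ] V} {α r τ μ : ℝ} {p q N N₁ N₃ : ℝ≥0∞} {X X₁ : ℝ → ℝ → E}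
  {XX XX₁ : ℝ → ℝ → V} {ω ω₁ ω₃ : ℝ → ℝ → ℝ} {Y Y₁ : ℝ → F} {φ : F → E →L[ℝ] F}

/-- A bound of the increments and of the remainders of `Y - Y₁` at one pair of times. -/
theorem EulerBound.norm_sub_remainder_le (hφ : EulerBound ι φ μ) {s t w w₁ v₃ D S : ℝ}
    (hw : 0 ≤ w) (hw1 : w ≤ 1) (hw₁ : 0 ≤ w₁) (hv₃ : 0 ≤ v₃) (hS : 0 ≤ S)
    (hX : ‖X s t‖ ≤ w) (hXX : ‖XX s t‖ ≤ w ^ 2)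
    (hdX : ‖X s t - X₁ s t‖ ≤ w₁) (hdXX : ‖XX s t - XX₁ s t‖ ≤ v₃) (hD : ‖Y s - Y₁ s‖ ≤ D)
    (hP : ‖pathRem ι φ X XX Y s t - pathRem ι φ X₁ XX₁ Y₁ s t‖ ≤
      S * (D * w ^ 3 + w₁ * w ^ 2 + v₃ * w)) :
    ‖(Y t - Y s - φ (Y s) (X s t)) - (Y₁ t - Y₁ s - φ (Y₁ s) (X₁ s t))‖ ≤
        (μ + μ ^ 2 + S) * (D * w ^ 2 + w₁ * w + v₃) ∧
      ‖(Y t - Y s) - (Y₁ t - Y₁ s)‖ ≤ (μ + μ ^ 2 + S) * (D * w + w₁ + v₃) := by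
  have hμ := hφ.nice.one_le
  have hD0 : 0 ≤ D := (norm_nonneg _).trans hD
  have hT : ‖tensorApply ι (derivMul φ (Y s)) (XX s t) -
      tensorApply ι (derivMul φ (Y₁ s)) (XX₁ s t)‖ ≤ μ ^ 2 * (D * w ^ 2 + v₃) :=
    (hφ.norm_tensor_sub_le _ _ _ _).trans (by gcongr)
  have hA : ‖φ (Y s) (X s t) - φ (Y₁ s) (X₁ s t)‖ ≤ μ * (D * w + w₁) :=
    (hφ.norm_apply_sub_le _ _ _ _).trans (by gcongr)
  have hw2 : w ^ 2 ≤ w := by rw [sq]; exact mul_le_of_le_one_left hw hw1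
  have hw3 : w ^ 3 ≤ w ^ 2 := by
    rw [pow_succ]; exact mul_le_of_le_one_right (sq_nonneg w) hw1
  have hP' : ‖pathRem ι φ X XX Y s t - pathRem ι φ X₁ XX₁ Y₁ s t‖ ≤
      S * (D * w ^ 2 + w₁ * w + v₃) := by
    refine hP.trans (mul_le_mul_of_nonneg_left ?_ hS)
    have := mul_le_of_le_one_right hv₃ hw1
    gcongr
  have e : (Y t - Y s - φ (Y s) (X s t)) - (Y₁ t - Y₁ s - φ (Y₁ s) (X₁ s t)) =
      (tensorApply ι (derivMul φ (Y s)) (XX s t) -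
        tensorApply ι (derivMul φ (Y₁ s)) (XX₁ s t)) +
      (pathRem ι φ X XX Y s t - pathRem ι φ X₁ XX₁ Y₁ s t) := by
    rw [pathRem_eq (ι := ι) (φ := φ) (X := X) (XX := XX) (Y := Y) s t,
      pathRem_eq (ι := ι) (φ := φ) (X := X₁) (XX := XX₁) (Y := Y₁) s t]
    abel
  have hR : ‖(Y t - Y s - φ (Y s) (X s t)) - (Y₁ t - Y₁ s - φ (Y₁ s) (X₁ s t))‖ ≤
      (μ ^ 2 + S) * (D * w ^ 2 + w₁ * w + v₃) := by
    rw [e]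
    refine (norm_add_le _ _).trans ((add_le_add hT hP').trans ?_)
    rw [add_mul]
    gcongr
    exact le_add_of_nonneg_right (by positivity)
  refine ⟨hR.trans (by gcongr; linarith), ?_⟩
  have e' : (Y t - Y s) - (Y₁ t - Y₁ s) = (φ (Y s) (X s t) - φ (Y₁ s) (X₁ s t)) +
      ((Y t - Y s - φ (Y s) (X s t)) - (Y₁ t - Y₁ s - φ (Y₁ s) (X₁ s t))) := by abel
  rw [e']
  refine (norm_add_le _ _).trans ((add_le_add hA hR).trans ?_)
  have h1 : D * w ^ 2 + w₁ * w + v₃ ≤ D * w + w₁ + v₃ := by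
    have := mul_le_of_le_one_right hw₁ hw1
    gcongr
  calc μ * (D * w + w₁) + (μ ^ 2 + S) * (D * w ^ 2 + w₁ * w + v₃)
      ≤ μ * (D * w + w₁ + v₃) + (μ ^ 2 + S) * (D * w + w₁ + v₃) := by
        exact add_le_add (mul_le_mul_of_nonneg_left (le_add_of_nonneg_right hv₃) (by linarith))
          (mul_le_mul_of_nonneg_left h1 (by positivity))
    _ = _ := by ring

/-- A second level control also has a first level size, with the gain `τ ^ (α - 1 / p)`. This is
needed where second level differences enter the estimate of the path. -/
theorem HasBesovSize.besovNorm_le_of_double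
    (h : HasBesovSize τ (1 - r / p.toReal) (2 * α) (p / 2) (q / 2) (2 / r) N₃ ω₃) (hτ : 0 < τ)
    (hr : 0 < r) :
    besovNorm τ α p q (fun s t => (ω₃ s t ^ (1 / r)) ^ 2) ≤
      ENNReal.ofReal (τ ^ (α - 1 / p.toReal)) * N₃ := by
  have := (h.of_double hτ).besovNorm_sq_le' hτ.le hr
  rwa [← ENNReal.rpow_natCast, ← ENNReal.rpow_mul, show (1 / 2 : ℝ) * (2 : ℕ) = 1 by norm_num,
    ENNReal.rpow_one] at this

/-- The pointwise bounds for increments and remainders are integrated term by term: powers of `ω`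
give `N`, those of `ω₁` give `N₁`, those of `ω₃` give `N₃`, and their products follow from
Cauchy-Schwarz. The distance `D` of the paths is replaced by its bound through the initial values
and the total masses, and `t * N ≤ 1` removes the extra factors. -/
theorem exists_besovNorm_sub_le (h : IsBesovExponent α p q r) (hr3 : r < 3) (hμ : 1 ≤ μ) :
    ∃ c : ℝ≥0, ∀ {τ : ℝ} {N N₁ N₃ : ℝ≥0∞} {X X₁ : ℝ → ℝ → E} {XX XX₁ : ℝ → ℝ → V}
      {ω ω₁ ω₃ : ℝ → ℝ → ℝ} {Y Y₁ : ℝ → F} {Y' Y₁' : ℝ → E →L[ℝ] F} {φ : F → E →L[ℝ] F}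
      {ι : E ⊗[ℝ] E ≃ₗ[ℝ] V},
      0 < τ → EulerBound ι φ μ →
      IsRoughOn ι 0 τ r ω X XX → IsRoughOn ι 0 τ r ω X₁ XX₁ →
      HasBesovSize τ (1 - r / p.toReal) α p q (1 / r) N ω →
      HasBesovSize τ (1 - r / p.toReal) α p q (1 / r) N₁ ω₁ →
      HasBesovSize τ (1 - r / p.toReal) (2 * α) (p / 2) (q / 2) (2 / r) N₃ ω₃ →
      (∀ s t, 0 ≤ s → s ≤ t → t ≤ τ → ‖X s t - X₁ s t‖ ≤ ω₁ s t ^ (1 / r)) →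
      (∀ s t, 0 ≤ s → s ≤ t → t ≤ τ → ‖XX s t - XX₁ s t‖ ≤ ω₃ s t ^ (2 / r)) →
      (∀ s t, 0 ≤ s → s ≤ t → t ≤ τ → ‖pathRem ι φ X XX Y s t‖ ≤ μ * ω s t ^ (3 / r)) →
      (∀ s t, 0 ≤ s → s ≤ t → t ≤ τ → ‖pathRem ι φ X₁ XX₁ Y₁ s t‖ ≤ μ * ω s t ^ (3 / r)) →
      (∀ t, 0 ≤ t → t ≤ τ → Y' t = φ (Y t)) → (∀ t, 0 ≤ t → t ≤ τ → Y₁' t = φ (Y₁ t)) →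
      ω 0 τ ≤ 1 → sewConst (3 / r) * (43 * μ ^ 5 * ω 0 τ ^ (1 / r)) ≤ 1 / 2 →
      supConst r μ * ω 0 τ ^ (1 / r) ≤ 1 → ENNReal.ofReal (τ ^ (α - 1 / p.toReal)) ≤ 1 →
      ENNReal.ofReal (τ ^ (α - 1 / p.toReal)) * N ≤ 1 →
      besovNorm τ α p q (incr (Y - Y₁)) ≤ c * (N * ‖Y 0 - Y₁ 0‖ₑ + N₁ +
          ENNReal.ofReal (τ ^ (α - 1 / p.toReal)) * N₃) ∧
        besovNorm τ (2 * α) (p / 2) (q / 2) (remainder X Y Y' - remainder X₁ Y₁ Y₁') ≤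
          c * (N ^ 2 * ‖Y 0 - Y₁ 0‖ₑ + N * N₁ + N₃) := by
  obtain ⟨K, hK⟩ := exists_besovNorm_le_add q
  obtain ⟨K', hK'⟩ := exists_besovNorm_le_add (q / 2)
  have hr := h.pos
  have hst0 := stabConst_nonneg hr hr3 (zero_le_one.trans hμ)
  have hsp0 := (supConst_pos hr hr3 hμ).le
  obtain ⟨S, hS⟩ : ∃ S : ℝ≥0, (S : ℝ) = supConst r μ := ⟨NNReal.mk _ hsp0, rfl⟩
  obtain ⟨c₀, hc₀⟩ : ∃ c₀ : ℝ≥0, (c₀ : ℝ) = μ + μ ^ 2 + stabConst r μ :=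
    ⟨NNReal.mk _ (by positivity), rfl⟩
  refine ⟨c₀ * ((K + K') * (2 + S)), ?_⟩
  intro τ N N₁ N₃ X X₁ XX XX₁ ω ω₁ ω₃ Y Y₁ Y' Y₁' φ ι hτ hφ hR hR₁ hω hω₁ hω₃ hX hXX hY hY₁ hY' hY₁'
    h1 hsm hsm' hT hTN
  have hsmall := hω.reg.isUnifSmall hτ h.kappa_pos
  have hw₁0 := hω₁.reg.ctrl.nonneg 0 τ le_rfl hτ.le le_rfl
  have hw₃0 := hω₃.reg.ctrl.nonneg 0 τ le_rfl hτ.le le_rfl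
  obtain ⟨D, hDdef⟩ : ∃ D, D = 2 * ‖Y 0 - Y₁ 0‖ +
    supConst r μ * (ω₁ 0 τ ^ (1 / r) + ω₃ 0 τ ^ (2 / r)) := ⟨_, rfl⟩
  have hD : ∀ t, 0 ≤ t → t ≤ τ → ‖Y t - Y₁ t‖ ≤ D := fun t h0 ht =>
    hDdef ▸ hR.norm_sub_le_of_pathRem hR₁ hφ hr hr3 hsmall hω₁.reg.ctrl hω₃.reg.ctrl hX hXX hY hY₁
      h1 hsm hsm' h0 ht
  have hD0 : 0 ≤ D := (norm_nonneg _).trans (hD 0 le_rfl hτ.le)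
  have hpt : ∀ s t, 0 ≤ s → s ≤ t → t ≤ τ → _ := fun s t h0 hst ht =>
    hφ.norm_sub_remainder_le (X := X) (X₁ := X₁) (XX := XX) (XX₁ := XX₁) (Y := Y) (Y₁ := Y₁)
      (s := s) (t := t)
      (Real.rpow_nonneg (hR.ctrl.nonneg s t h0 hst ht) (1 / r))
      (hR.ctrl.rpow_le_one hr h1 h0 hst ht)
      (Real.rpow_nonneg (hω₁.reg.ctrl.nonneg s t h0 hst ht) (1 / r))
      (Real.rpow_nonneg (hω₃.reg.ctrl.nonneg s t h0 hst ht) (2 / r)) hst0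
      (hR.bounds hr h0 le_rfl hst le_rfl ht).1 (hR.bounds hr h0 le_rfl hst le_rfl ht).2
      (hX s t h0 hst ht) (hXX s t h0 hst ht) (hD s h0 (hst.trans ht))
      (hR.norm_pathRem_sub_le hR₁ hφ hr hr3 hsmall hω₁.reg.ctrl hω₃.reg.ctrl hX hXX hY hY₁ h1 hsm
        hD h0 hst ht)
  rw [← hc₀] at hpt
  obtain ⟨t, htdef⟩ : ∃ t, t = ENNReal.ofReal (τ ^ (α - 1 / p.toReal)) := ⟨_, rfl⟩
  -- The square of `t` at `N₃` reflects that the small time exponent doubles at the second level.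
  have hDE : ENNReal.ofReal D ≤ 2 * ‖Y 0 - Y₁ 0‖ₑ + S * (t * N₁ + t ^ 2 * N₃) := by
    have a₁ := hω₁.total_le
    have a₃ := hω₃.total_le
    rw [exponent_double, mul_comm (2 : ℝ), Real.rpow_mul hτ.le, Real.rpow_two,
      ENNReal.ofReal_pow (by positivity), ← htdef] at a₃
    rw [← htdef] at a₁
    rw [hDdef, ENNReal.ofReal_add (by positivity) (by positivity),
      ENNReal.ofReal_mul (by norm_num), ENNReal.ofReal_mul hsp0,
      ENNReal.ofReal_add (by positivity) (by positivity), ofReal_norm, ← hS,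
      ENNReal.ofReal_coe_nnreal, ENNReal.ofReal_ofNat]
    gcongr
  rw [← htdef] at hT hTN ⊢
  have m₀ := hω.sliceMeasurable (1 / r)
  have m₁ := hω₁.sliceMeasurable (1 / r)
  have m₃ := hω₃.sliceMeasurable (2 / r)
  have mD : SliceMeasurable τ fun s t => D * ω s t ^ (1 / r) := fun x h0 hx =>
    (m₀ x h0 hx).const_mul D
  have m₂ : SliceMeasurable τ fun s t => (ω s t ^ (1 / r)) ^ 2 := fun x h0 hx => (m₀ x h0 hx).pow 2
  have mD₂ : SliceMeasurable τ fun s t => D * (ω s t ^ (1 / r)) ^ 2 := fun x h0 hx =>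
    (m₂ x h0 hx).const_mul D
  have m₀₁ : SliceMeasurable τ fun s t => ω₁ s t ^ (1 / r) * ω s t ^ (1 / r) := fun x h0 hx =>
    (m₁ x h0 hx).mul (m₀ x h0 hx)
  have n₀ := (besovNorm_const_mul_le (β := α) (P := p) (Q := q) hD0 m₀).trans
    (mul_le_mul' hDE hω.norm_le)
  have n₂ := (besovNorm_const_mul_le (β := 2 * α) (P := p / 2) (Q := q / 2) hD0 m₂).trans
    (mul_le_mul' hDE hω.besovNorm_sq_le)
  have n₃ : besovNorm τ α p q (fun s t => ω₃ s t ^ (2 / r)) ≤ t * N₃ := by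
    have m₃' : SliceMeasurable τ fun s t => (ω₃ s t ^ (1 / r)) ^ 2 := fun x h0 hx =>
      (hω₃.sliceMeasurable (1 / r) x h0 hx).pow 2
    refine (besovNorm_le_mul 1 m₃' fun s t h0 hst ht => ?_).trans ?_
    · rw [rpow_two_div (hω₃.reg.ctrl.nonneg s t h0 hst ht), NNReal.coe_one, one_mul]
    · rw [ENNReal.coe_one, one_mul, htdef]
      exact hω₃.besovNorm_le_of_double hτ hr
  have n₀₁ : besovNorm τ (2 * α) (p / 2) (q / 2)
      (fun s t => ω₁ s t ^ (1 / r) * ω s t ^ (1 / r)) ≤ N₁ * N :=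
    (besovNorm_mul_le h.p_ne_zero h.ne_zero m₁ m₀ fun s t _ _ _ => (norm_mul _ _).le).trans
      (mul_le_mul' hω₁.norm_le hω.norm_le)
  constructor
  · refine (hK c₀ h.one_le mD m₁ m₃ fun s t h0 hst ht => ?_).trans ?_
    · refine le_trans (le_of_eq ?_) (hpt s t h0 hst ht).2
      simp only [incr, Pi.sub_apply]
      congr 1
      abel
    · refine (mul_le_mul_right (mul_le_mul_right (add_le_add (add_le_add n₀ hω₁.norm_le) n₃) _)
        _).trans ?_
      push_cast
      rw [mul_assoc]
      refine mul_le_mul_right ?_ _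
      -- The terms with `S` stem from `D` and carry a factor `t * N ≤ 1` on top of terms already
      -- present.
      have e : (2 * ‖Y 0 - Y₁ 0‖ₑ + S * (t * N₁ + t ^ 2 * N₃)) * N + N₁ + t * N₃ ≤
          (2 + S) * (N * ‖Y 0 - Y₁ 0‖ₑ + N₁ + t * N₃) := by
        calc (2 * ‖Y 0 - Y₁ 0‖ₑ + S * (t * N₁ + t ^ 2 * N₃)) * N + N₁ + t * N₃
            = 2 * (N * ‖Y 0 - Y₁ 0‖ₑ) + N₁ + t * N₃ + S * ((t * N) * (N₁ + t * N₃)) := by ring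
          _ ≤ 2 * (N * ‖Y 0 - Y₁ 0‖ₑ) + N₁ + t * N₃ + S * (1 * (N₁ + t * N₃)) := by gcongr
          _ ≤ _ := by
              rw [one_mul]
              exact ENNReal.two_mul_add_le _ _ _ _
      calc (K : ℝ≥0∞) * _ ≤ K * ((2 + S) * (N * ‖Y 0 - Y₁ 0‖ₑ + N₁ + t * N₃)) :=
            mul_le_mul_right e _
        _ ≤ (K + K') * ((2 + S) * (N * ‖Y 0 - Y₁ 0‖ₑ + N₁ + t * N₃)) :=
            mul_le_mul_left le_self_add _
        _ = _ := by ring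
  · refine (hK' c₀ h.one_le_half mD₂ m₀₁ m₃ fun s t h0 hst ht => ?_).trans ?_
    · simp only [Pi.sub_apply, remainder, hY' s h0 (hst.trans ht), hY₁' s h0 (hst.trans ht)]
      exact (hpt s t h0 hst ht).1
    refine (mul_le_mul_right (mul_le_mul_right (add_le_add (add_le_add n₂ n₀₁) hω₃.norm_le) _)
        _).trans ?_
    push_cast
    rw [mul_assoc]
    refine mul_le_mul_right ?_ _
    have e : (2 * ‖Y 0 - Y₁ 0‖ₑ + S * (t * N₁ + t ^ 2 * N₃)) * N ^ 2 + N₁ * N + N₃ ≤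
        (2 + S) * (N ^ 2 * ‖Y 0 - Y₁ 0‖ₑ + N * N₁ + N₃) := by
      calc (2 * ‖Y 0 - Y₁ 0‖ₑ + S * (t * N₁ + t ^ 2 * N₃)) * N ^ 2 + N₁ * N + N₃
          = 2 * (N ^ 2 * ‖Y 0 - Y₁ 0‖ₑ) + N * N₁ + N₃ +
            S * ((t * N) * (N * N₁) + (t * N) ^ 2 * N₃) := by ring
        _ ≤ 2 * (N ^ 2 * ‖Y 0 - Y₁ 0‖ₑ) + N * N₁ + N₃ +
            S * (1 * (N * N₁) + 1 ^ 2 * N₃) := by gcongr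
        _ ≤ _ := by
            rw [one_mul, one_pow, one_mul]
            exact ENNReal.two_mul_add_le _ _ _ _
    calc (K' : ℝ≥0∞) * _ ≤ K' * ((2 + S) * (N ^ 2 * ‖Y 0 - Y₁ 0‖ₑ + N * N₁ + N₃)) :=
          mul_le_mul_right e _
      _ ≤ (K + K') * ((2 + S) * (N ^ 2 * ‖Y 0 - Y₁ 0‖ₑ + N * N₁ + N₃)) :=
          mul_le_mul_left le_add_self _
      _ = _ := by ring

end

/-! ### Small times and constants -/

theorem exists_time_le {a ε T : ℝ} (ha : 0 < a) (hε : 0 < ε) (hT : 0 < T) (B : ℝ≥0) :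
    ∃ T₀, 0 < T₀ ∧ T₀ ≤ T ∧ ∀ τ, 0 < τ → τ ≤ T₀ → τ ^ a ≤ 1 ∧ τ ^ a * B ≤ ε := by
  have hB := B.coe_nonneg
  refine ⟨min T (min 1 ((ε / (B + 1)) ^ (1 / a))), by positivity, min_le_left _ _,
    fun τ h0 hτ => ?_⟩
  have h1 : τ ≤ 1 := hτ.trans ((min_le_right _ _).trans (min_le_left _ _))
  have h2 : τ ≤ (ε / (B + 1)) ^ (1 / a) := hτ.trans ((min_le_right _ _).trans (min_le_right _ _))
  refine ⟨Real.rpow_le_one h0.le h1 ha.le, ?_⟩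
  have h3 := Real.rpow_le_rpow h0.le h2 ha.le
  rw [← Real.rpow_mul (by positivity), one_div_mul_cancel ha.ne', Real.rpow_one,
    le_div_iff₀ (by positivity)] at h3
  refine le_trans ?_ h3
  gcongr
  linarith

theorem exists_small {r ν : ℝ} (hr : 0 < r) (hr3 : r < 3) (hν : 1 ≤ ν) : ∃ ε : ℝ, 0 < ε ∧ ε ≤ 1 ∧
    sewConst (3 / r) * (43 * ν ^ 5 * ε) ≤ 1 / 2 ∧ supConst r ν * ε ≤ 1 := by
  have hS := sewConst_pos ((one_lt_div hr).2 hr3)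
  have hs := supConst_pos hr hr3 hν
  have h1 : 0 < 1 + 86 * (sewConst (3 / r) * ν ^ 5) + supConst r ν := by positivity
  have h2 : 0 < sewConst (3 / r) * ν ^ 5 := by positivity
  refine ⟨(1 + 86 * (sewConst (3 / r) * ν ^ 5) + supConst r ν)⁻¹, inv_pos.2 h1, ?_, ?_, ?_⟩
  · exact inv_le_one_of_one_le₀ (by linarith)
  · rw [show sewConst (3 / r) * (43 * ν ^ 5 * (1 + 86 * (sewConst (3 / r) * ν ^ 5) +
      supConst r ν)⁻¹) = (43 * (sewConst (3 / r) * ν ^ 5)) / (1 + 86 * (sewConst (3 / r) * ν ^ 5) +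
      supConst r ν) by ring, div_le_iff₀ h1]
    linarith
  · rw [← div_eq_mul_inv, div_le_one h1]
    linarith

/-- For a short time the total mass is below every threshold that the pathwise theorems impose. -/
theorem HasBesovSize.total_le_of_le {τ κ β δ ε : ℝ} {P Q N : ℝ≥0∞} {B : ℝ≥0} {ω : ℝ → ℝ → ℝ}
    (h : HasBesovSize τ κ β P Q δ N ω) (hτ : 0 ≤ τ) (hδ : 0 < δ) (hN : N ≤ B) (hε : 0 ≤ ε)
    (hε1 : ε ≤ 1) (hB : τ ^ (β - 1 / P.toReal) * B ≤ ε) : ω 0 τ ^ δ ≤ ε ∧ ω 0 τ ≤ 1 := by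
  have h1 : ω 0 τ ^ δ ≤ ε := by
    rw [← ENNReal.ofReal_le_ofReal_iff hε]
    calc ENNReal.ofReal (ω 0 τ ^ δ) ≤ ENNReal.ofReal (τ ^ (β - 1 / P.toReal)) * B :=
          h.total_le.trans (mul_le_mul_right hN _)
      _ = ENNReal.ofReal (τ ^ (β - 1 / P.toReal) * B) := by
          rw [ENNReal.ofReal_mul (by positivity), ENNReal.ofReal_coe_nnreal]
      _ ≤ ENNReal.ofReal ε := ENNReal.ofReal_le_ofReal hB
  refine ⟨h1, ?_⟩
  by_contra! hlt
  exact absurd (Real.one_lt_rpow hlt hδ) (not_lt.2 (h1.trans hε1))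

theorem ENNReal.add_sq_le_four_mul (a b : ℝ≥0∞) : (a + b) ^ 2 ≤ 4 * (a ^ 2 + b ^ 2) := by
  rcases le_total a b with h | h
  · calc (a + b) ^ 2 ≤ (b + b) ^ 2 := by gcongr
      _ = 4 * b ^ 2 := by ring
      _ ≤ _ := by gcongr; exact le_add_self
  · calc (a + b) ^ 2 ≤ (a + a) ^ 2 := by gcongr
      _ = 4 * a ^ 2 := by ring
      _ ≤ _ := by gcongr; exact le_self_add

theorem ENNReal.mul_add_mul_add_mul_le {a b c g : ℝ≥0∞} (ha : a ≤ g) (hb : b ≤ g) (hc : c ≤ g)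
    (x y z : ℝ≥0∞) : a * x + b * y + c * z ≤ g * (x + y + z) := by
  rw [mul_add, mul_add]
  gcongr

section

variable {E F V : Type*} [NormedAddCommGroup E] [NormedSpace ℝ E]
  [NormedAddCommGroup F] [NormedSpace ℝ F] [NormedAddCommGroup V] [NormedSpace ℝ V]

theorem exists_eulerBound [FiniteDimensional ℝ E] (ι : E ⊗[ℝ] E ≃ₗ[ℝ] V)
    (Φ₀ Φ₀₁ Φ₁ Φ₁₁ Φ₂ Φ₂₁ ΦDD : ℝ≥0) : ∃ μ : ℝ, 1 ≤ μ ∧ ∀ φ : F → E →L[ℝ] F,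
      BoundedC21 φ Φ₀ Φ₀₁ Φ₁ Φ₁₁ Φ₂ Φ₂₁ ΦDD → EulerBound ι φ μ := by
  obtain ⟨κ, hκ, hκ'⟩ := exists_norm_tensorApply_le ι F
  obtain ⟨Λ, hΛ⟩ : ∃ Λ : ℝ, Λ = 1 + Φ₀ + Φ₀₁ + Φ₁ + Φ₁₁ + Φ₂₁ + ΦDD + 2 * (Φ₁₁ * Φ₀ + Φ₁ * Φ₀₁)
      + Φ₂₁ * Φ₀ + 2 * Φ₁₁ * Φ₀₁ + Φ₁ * Φ₁₁ := ⟨_, rfl⟩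
  refine ⟨max 1 (max Λ κ), le_max_left _ _, fun φ hφ => ⟨?_, fun B v => (hκ' B v).trans ?_⟩⟩
  · exact (hΛ ▸ hφ.isNiceField : IsNiceField φ Λ).mono ((le_max_left _ _).trans (le_max_right _ _))
  · gcongr
    exact (le_max_right _ _).trans (le_max_right _ _)

variable {ι : E ⊗[ℝ] E ≃ₗ[ℝ] V} {α r τ μ : ℝ} {p q : ℝ≥0∞} {X X₁ : ℝ → ℝ → E}
  {XX XX₁ : ℝ → ℝ → V} {ω : ℝ → ℝ → ℝ} {Y Y₁ : ℝ → F} {Y' Y₁' : ℝ → E →L[ℝ] F}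
  {φ : F → E →L[ℝ] F} {y₀ : F}

/-- The variation control of the remainder, obtained from its Besov regularity, is needed only
qualitatively; the resulting bound is in terms of `ω`. -/
theorem SolvesRDE.norm_pathRem_le (h : IsBesovExponent α p q r) (hr3 : r < 3) (hτ : 0 < τ)
    (hX : IsBesovRoughPath ι τ α p q X XX) (hR : IsRoughOn ι 0 τ r ω X XX)
    (hφ : EulerBound ι φ μ) (hYc : IsBesovControlled τ α p q X Y Y')
    (hY : SolvesRDE ι φ τ X XX y₀ Y Y') (h1 : ω 0 τ ≤ 1)
    (hsm : sewConst (3 / r) * (8 * μ ^ 5 * ω 0 τ ^ (1 / r)) ≤ 1 / 2) {s t : ℝ} (hs : 0 ≤ s)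
    (hst : s ≤ t) (ht : t ≤ τ) :
    ‖pathRem ι φ X XX Y s t‖ ≤ 2 * (sewConst (3 / r) * (8 * μ ^ 5)) * ω s t ^ (3 / r) := by
  obtain ⟨_, ω', _, hω', _, hrem⟩ := hYc.exists_control h hτ hX
  refine hR.norm_pathRem_le_of_limit hφ h.pos hr3 le_rfl hY.isPartitionLimit hω'
    (fun s t hs hst ht => ?_) h1 hsm hs hst ht
  rw [← hY.remainder_eq hs (hst.trans ht)]
  exact hrem s t hs hst ht

/-- Both rough paths are dominated by the sum of their controls, of size `N` proportional to the sum
of the two norms. Inserting the sizes of the difference controls into `exists_besovNorm_sub_le`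
leaves algebra, in which `θ ≤ 1` and `θ * N ≤ 1` keep the constant independent of `M`. -/
theorem exists_lipschitz_estimate (ι : E ⊗[ℝ] E ≃ₗ[ℝ] V)
    (hι : ∀ x y : E, ‖ι (x ⊗ₜ[ℝ] y)‖ = ‖x‖ * ‖y‖) (h : IsBesovExponent α p q r) (hr3 : r < 3)
    (hμ : 1 ≤ μ) :
    ∃ C B : ℝ≥0, ∃ ε : ℝ, 0 < ε ∧ ∀ {τ : ℝ} {M : ℝ≥0} {X X₁ : ℝ → ℝ → E} {XX XX₁ : ℝ → ℝ → V}
      {Y Y₁ : ℝ → F} {Y' Y₁' : ℝ → E →L[ℝ] F} {φ : F → E →L[ℝ] F} {y₀ y₁ : F}, 0 < τ →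
      EulerBound ι φ μ →
      IsBesovRoughPath ι τ α p q X XX → IsBesovRoughPath ι τ α p q X₁ XX₁ →
      roughBesovNorm τ α p q X XX ≤ M → roughBesovNorm τ α p q X₁ XX₁ ≤ M →
      IsBesovControlled τ α p q X Y Y' → SolvesRDE ι φ τ X XX y₀ Y Y' →
      IsBesovControlled τ α p q X₁ Y₁ Y₁' → SolvesRDE ι φ τ X₁ XX₁ y₁ Y₁ Y₁' →
      τ ^ (α - 1 / p.toReal) ≤ 1 → τ ^ (α - 1 / p.toReal) * (B * M : ℝ≥0) ≤ ε →
      besovNorm τ α p q (incr (Y - Y₁)) ≤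
          C * ((roughBesovNorm τ α p q X XX + roughBesovNorm τ α p q X₁ XX₁) * ‖y₀ - y₁‖ₑ
            + (1 + besovNorm τ α p q X + besovNorm τ α p q X₁) * besovNorm τ α p q (X - X₁)
            + besovNorm τ (2 * α) (p / 2) (q / 2) (XX - XX₁)) ∧
        besovNorm τ (2 * α) (p / 2) (q / 2) (remainder X Y Y' - remainder X₁ Y₁ Y₁') ≤
          C * ((roughBesovNorm τ α p q X XX ^ 2 + roughBesovNorm τ α p q X₁ XX₁ ^ 2
                + besovNorm τ α p q X * besovNorm τ α p q X₁) * ‖y₀ - y₁‖ₑ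
            + (roughBesovNorm τ α p q X XX + roughBesovNorm τ α p q X₁ XX₁)
                * besovNorm τ α p q (X - X₁)
            + besovNorm τ (2 * α) (p / 2) (q / 2) (XX - XX₁)) := by
  have hr := h.pos
  have hS := sewConst_pos ((one_lt_div hr).2 hr3)
  obtain ⟨ν, hν⟩ : ∃ ν, ν = max μ (2 * (sewConst (3 / r) * (8 * μ ^ 5))) := ⟨_, rfl⟩
  have hμν : μ ≤ ν := hν ▸ le_max_left _ _
  have hν' : 2 * (sewConst (3 / r) * (8 * μ ^ 5)) ≤ ν := hν ▸ le_max_right _ _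
  obtain ⟨ε, hε0, hε1, hε2, hε3⟩ := exists_small hr hr3 (hμ.trans hμν)
  obtain ⟨C₁, hC₁⟩ := exists_control_of_isBesovRoughPath ι hι h
  obtain ⟨C₂, hC₂⟩ := exists_control_of_sub ι hι h
  obtain ⟨K, hK⟩ := h.exists_add
  obtain ⟨c, hc⟩ := exists_besovNorm_sub_le (E := E) (F := F) (V := V) h hr3 (hμ.trans hμν)
  obtain ⟨L, hL⟩ : ∃ L, L = K * C₁ := ⟨_, rfl⟩
  -- Each summand bounds one of the coefficients `hg₁` to `hg₄` below; the second constant is `2 *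
  -- L` because `N ≤ 2 * L * M`.
  refine ⟨c * (L + 4 * L ^ 2 + 2 * C₂ + 2 * L * C₂), 2 * L, ε, hε0, ?_⟩
  intro τ M X X₁ XX XX₁ Y Y₁ Y' Y₁' φ y₀ y₁ hτ hφ hX hX₁ hM hM₁ hYc hY hYc₁ hY₁ ht1 htB
  obtain ⟨a, ha, haR⟩ := hC₁ τ X XX hτ hX
  obtain ⟨b, hb, hbR⟩ := hC₁ τ X₁ XX₁ hτ hX₁
  have hω := hK hτ.le ha hb
  obtain ⟨ω, hωdef⟩ : ∃ ω : ℝ → ℝ → ℝ, ω = fun s t => a s t + b s t := ⟨_, rfl⟩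
  rw [← hωdef] at hω
  obtain ⟨N, hN⟩ : ∃ N : ℝ≥0∞,
      N = L * (roughBesovNorm τ α p q X XX + roughBesovNorm τ α p q X₁ XX₁) := ⟨_, rfl⟩
  rw [← mul_add, ← mul_assoc, ← ENNReal.coe_mul, ← hL, ← hN] at hω
  have hR : IsRoughOn ι 0 τ r ω X XX := haR.mono hr hω.reg.ctrl fun s t hs hst ht => by
    rw [hωdef]
    exact le_add_of_nonneg_right (hbR.ctrl.nonneg s t hs hst ht)
  have hR₁ : IsRoughOn ι 0 τ r ω X₁ XX₁ := hbR.mono hr hω.reg.ctrl fun s t hs hst ht => by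
    rw [hωdef]
    exact le_add_of_nonneg_left (haR.ctrl.nonneg s t hs hst ht)
  have hNB : N ≤ (2 * L * M : ℝ≥0) := by
    rw [hN]
    push_cast
    calc (L : ℝ≥0∞) * _ ≤ L * (M + M) := mul_le_mul_right (add_le_add hM hM₁) _
      _ = _ := by ring
  obtain ⟨hωε, hω1⟩ := hω.total_le_of_le hτ.le (by positivity) hNB hε0.le hε1 htB
  have hω0 := Real.rpow_nonneg (hR.ctrl.nonneg 0 τ le_rfl hτ.le le_rfl) (1 / r)
  have hs43 : sewConst (3 / r) * (43 * ν ^ 5 * ω 0 τ ^ (1 / r)) ≤ 1 / 2 :=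
    le_trans (by have : 0 ≤ ν := by linarith
                 gcongr) hε2
  have hs8 : sewConst (3 / r) * (8 * μ ^ 5 * ω 0 τ ^ (1 / r)) ≤ 1 / 2 :=
    le_trans (by gcongr; norm_num) hs43
  have hssup : supConst r ν * ω 0 τ ^ (1 / r) ≤ 1 :=
    le_trans (mul_le_mul_of_nonneg_left hωε (supConst_pos hr hr3 (hμ.trans hμν)).le) hε3
  obtain ⟨ω₁, ω₃, hω₁, hω₃, hd, hdd⟩ := hC₂ τ X X₁ XX XX₁ hτ hX hX₁ ω N hω hR hR₁
  have ht1' : ENNReal.ofReal (τ ^ (α - 1 / p.toReal)) ≤ 1 := ENNReal.ofReal_le_one.2 ht1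
  have htN : ENNReal.ofReal (τ ^ (α - 1 / p.toReal)) * N ≤ 1 := by
    refine (mul_le_mul_right hNB _).trans ?_
    rw [← ENNReal.ofReal_coe_nnreal, ← ENNReal.ofReal_mul (by positivity)]
    exact ENNReal.ofReal_le_one.2 (htB.trans hε1)
  have key := hc hτ (hφ.mono hμν) hR hR₁ hω hω₁ hω₃ hd hdd
    (fun s t hs hst ht => (SolvesRDE.norm_pathRem_le h hr3 hτ hX hR hφ hYc hY hω1 hs8 hs hst
      ht).trans (mul_le_mul_of_nonneg_right hν' (Real.rpow_nonneg
        (hR.ctrl.nonneg s t hs hst ht) _)))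
    (fun s t hs hst ht => (SolvesRDE.norm_pathRem_le h hr3 hτ hX₁ hR₁ hφ hYc₁ hY₁ hω1 hs8 hs hst
      ht).trans (mul_le_mul_of_nonneg_right hν' (Real.rpow_nonneg
        (hR.ctrl.nonneg s t hs hst ht) _)))
    (fun t h0 ht => hY.deriv_eq h0 ht) (fun t h0 ht => hY₁.deriv_eq h0 ht)
    hω1 hs43 hssup ht1' htN
  rw [hY.eq_zero hτ.le, hY₁.eq_zero hτ.le] at key
  generalize ENNReal.ofReal (τ ^ (α - 1 / p.toReal)) = θ at *
  generalize roughBesovNorm τ α p q X XX = x at *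
  generalize roughBesovNorm τ α p q X₁ XX₁ = x₁ at *
  generalize besovNorm τ α p q (X - X₁) = δ at *
  generalize besovNorm τ (2 * α) (p / 2) (q / 2) (XX - XX₁) = η at *
  generalize besovNorm τ α p q X = z at *
  generalize besovNorm τ α p q X₁ = z₁ at *
  generalize ‖y₀ - y₁‖ₑ = d at *
  obtain ⟨g, hg⟩ : ∃ g : ℝ≥0∞, g = L + 4 * L ^ 2 + 2 * C₂ + 2 * L * C₂ := ⟨_, rfl⟩
  have hg₁ : (L : ℝ≥0∞) ≤ g := hg ▸ by
    rw [add_assoc, add_assoc]; exact le_self_add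
  have hg₂ : (4 * L ^ 2 : ℝ≥0∞) ≤ g := hg ▸ by
    rw [add_assoc]; exact le_add_self.trans le_self_add
  have hg₃ : (2 * C₂ : ℝ≥0∞) ≤ g := hg ▸ le_add_self.trans le_self_add
  have hg₄ : (2 * L * C₂ : ℝ≥0∞) ≤ g := hg ▸ le_add_self
  have hg₅ : (C₂ : ℝ≥0∞) ≤ g := le_trans (by rw [two_mul]; exact le_self_add) hg₃
  push_cast
  rw [← hg, mul_assoc, mul_assoc]
  refine ⟨key.1.trans (mul_le_mul_right ?_ _), key.2.trans (mul_le_mul_right ?_ _)⟩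
  -- The cross term `δ * N` comes from the second level difference control. It arrives with the
  -- factor `θ`, so `θ * N ≤ 1` reduces it to `δ`, and the summand one in the factor `1 + z + z₁`
  -- suffices.
  · calc N * d + C₂ * δ + θ * (C₂ * (η + δ * N))
        = L * ((x + x₁) * d) + C₂ * δ + (C₂ * (θ * η) + C₂ * (δ * (θ * N))) := by rw [hN]; ring
      _ ≤ L * ((x + x₁) * d) + C₂ * δ + (C₂ * (1 * η) + C₂ * (δ * 1)) := by gcongr
      _ = L * ((x + x₁) * d) + (2 * C₂) * δ + C₂ * η := by ring
      _ ≤ g * ((x + x₁) * d + δ + η) := ENNReal.mul_add_mul_add_mul_le hg₁ hg₃ hg₅ _ _ _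
      _ ≤ _ := by
        gcongr
        refine le_mul_of_one_le_left zero_le ?_
        rw [add_assoc]
        exact le_self_add
  -- No factor `θ` is present here, so the cross term `δ * N` keeps the rough path norms as its
  -- coefficient.
  · calc N ^ 2 * d + N * (C₂ * δ) + C₂ * (η + δ * N)
        = L ^ 2 * ((x + x₁) ^ 2 * d) + (2 * L * C₂) * ((x + x₁) * δ) + C₂ * η := by rw [hN]; ring
      _ ≤ L ^ 2 * (4 * (x ^ 2 + x₁ ^ 2) * d) + (2 * L * C₂) * ((x + x₁) * δ) + C₂ * η := by
        gcongr
        exact ENNReal.add_sq_le_four_mul x x₁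
      _ = (4 * L ^ 2) * ((x ^ 2 + x₁ ^ 2) * d) + (2 * L * C₂) * ((x + x₁) * δ) + C₂ * η := by ring
      _ ≤ g * ((x ^ 2 + x₁ ^ 2) * d + (x + x₁) * δ + η) :=
        ENNReal.mul_add_mul_add_mul_le hg₂ hg₄ hg₅ _ _ _
      _ ≤ _ := mul_le_mul_right
        (add_le_add (add_le_add (mul_le_mul_left le_self_add _) le_rfl) le_rfl) _

/-- The smallness chosen for the stability estimate, with the constant 43, is more than the
convergence of the Euler schemes requires. -/
theorem exists_existence_estimate [FiniteDimensional ℝ F] (ι : E ⊗[ℝ] E ≃ₗ[ℝ] V)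
    (hι : ∀ x y : E, ‖ι (x ⊗ₜ[ℝ] y)‖ = ‖x‖ * ‖y‖) (h : IsBesovExponent α p q r) (hr3 : r < 3)
    (hμ : 1 ≤ μ) :
    ∃ B : ℝ≥0, ∃ ε : ℝ, 0 < ε ∧ ∀ {τ : ℝ} {M : ℝ≥0} {X : ℝ → ℝ → E} {XX : ℝ → ℝ → V}
      {φ : F → E →L[ℝ] F}, 0 < τ → EulerBound ι φ μ → IsBesovRoughPath ι τ α p q X XX →
      roughBesovNorm τ α p q X XX ≤ M → τ ^ (α - 1 / p.toReal) * (B * M : ℝ≥0) ≤ ε → ∀ y₀ : F,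
      ∃ Y : ℝ → F, IsBesovControlled τ α p q X Y (fun t => φ (Y t)) ∧
        SolvesRDE ι φ τ X XX y₀ Y (fun t => φ (Y t)) := by
  have hr := h.pos
  have hS := sewConst_pos ((one_lt_div hr).2 hr3)
  obtain ⟨ε, hε0, hε1, hε2, -⟩ := exists_small hr hr3 hμ
  obtain ⟨C₁, hC₁⟩ := exists_control_of_isBesovRoughPath ι hι h
  refine ⟨C₁, ε, hε0, ?_⟩
  intro τ M X XX φ hτ hφ hX hM htB y₀
  obtain ⟨ω, hω, hR⟩ := hC₁ τ X XX hτ hX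
  have hNB : (C₁ : ℝ≥0∞) * roughBesovNorm τ α p q X XX ≤ (C₁ * M : ℝ≥0) := by
    rw [ENNReal.coe_mul]
    exact mul_le_mul_right hM _
  obtain ⟨hωε, hω1⟩ := hω.total_le_of_le hτ.le (by positivity) hNB hε0.le hε1 htB
  have hω0 := Real.rpow_nonneg (hR.ctrl.nonneg 0 τ le_rfl hτ.le le_rfl) (1 / r)
  refine exists_solvesRDE h hr3 hτ hX hω (hNB.trans_lt ENNReal.coe_lt_top) hR hω1 hφ ?_ y₀
  have h43 : sewConst (3 / r) * (43 * μ ^ 5 * ω 0 τ ^ (1 / r)) ≤ 1 / 2 :=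
    le_trans (by gcongr) hε2
  have : 0 ≤ sewConst (3 / r) * μ ^ 5 * ω 0 τ ^ (1 / r) := by positivity
  linarith

end

/-! ### Choice of exponents and times, and the conclusion. -/

theorem mainTheorem7
    {E F V : Type*}
    [NormedAddCommGroup E] [NormedSpace ℝ E] [FiniteDimensional ℝ E]
    [NormedAddCommGroup F] [NormedSpace ℝ F] [FiniteDimensional ℝ F]
    [NormedAddCommGroup V] [NormedSpace ℝ V]
    (ι : E ⊗[ℝ] E ≃ₗ[ℝ] V) (hι : ∀ x y : E, ‖ι (x ⊗ₜ[ℝ] y)‖ = ‖x‖ * ‖y‖)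
    (α : ℝ) (p q : ℝ≥0∞) (hα : 1 / 3 < α) (hαp : ENNReal.ofReal (1 / α) < p)
    (hp : 2 ≤ p) (hq : 1 / 2 ≤ q)
    (Φ₀ Φ₀₁ Φ₁ Φ₁₁ Φ₂ Φ₂₁ ΦDD : ℝ≥0) :
    ∃ C : ℝ≥0, ∀ T : ℝ, 0 < T → ∀ M : ℝ≥0, ∃ T₀ : ℝ, 0 < T₀ ∧ T₀ ≤ T ∧
      ∀ φ : F → E →L[ℝ] F, BoundedC21 φ Φ₀ Φ₀₁ Φ₁ Φ₁₁ Φ₂ Φ₂₁ ΦDD →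
      ∀ τ : ℝ, 0 < τ → τ ≤ T₀ →
      -- existence and uniqueness on `[0, τ]`
      (∀ (X : ℝ → ℝ → E) (XX : ℝ → ℝ → V), IsBesovRoughPath ι T α p q X XX →
        roughBesovNorm T α p q X XX ≤ M → ∀ y₀ : F,
        ∃ (Y : ℝ → F) (Y' : ℝ → E →L[ℝ] F),
          IsBesovControlled τ α p q X Y Y' ∧
          (∀ r : ℝ, 2 ≤ r → r < 3 → 1 / α < r → ENNReal.ofReal r ≤ p →
            IsControlled τ r X Y Y') ∧
          SolvesRDE ι φ τ X XX y₀ Y Y' ∧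
          ∀ (Z : ℝ → F) (Z' : ℝ → E →L[ℝ] F),
            (IsBesovControlled τ α p q X Z Z' ∨
              ∃ r : ℝ, 2 ≤ r ∧ r < 3 ∧ 1 / α < r ∧ ENNReal.ofReal r ≤ p ∧
                IsControlled τ r X Z Z') →
            SolvesRDE ι φ τ X XX y₀ Z Z' →
            EqOn Z Y (Icc 0 τ) ∧ EqOn Z' Y' (Icc 0 τ)) ∧
      -- Lipschitz dependence on the data on `[0, τ]`
      (∀ (X Xt : ℝ → ℝ → E) (XX XXt : ℝ → ℝ → V),
        IsBesovRoughPath ι T α p q X XX → IsBesovRoughPath ι T α p q Xt XXt →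
        roughBesovNorm T α p q X XX ≤ M → roughBesovNorm T α p q Xt XXt ≤ M →
        ∀ (y₀ yt₀ : F) (Y Yt : ℝ → F) (Y' Yt' : ℝ → E →L[ℝ] F),
        IsBesovControlled τ α p q X Y Y' → SolvesRDE ι φ τ X XX y₀ Y Y' →
        IsBesovControlled τ α p q Xt Yt Yt' → SolvesRDE ι φ τ Xt XXt yt₀ Yt Yt' →
        besovNorm τ α p q (incr (Y - Yt)) ≤
          C * ((roughBesovNorm τ α p q X XX + roughBesovNorm τ α p q Xt XXt) * ‖y₀ - yt₀‖ₑ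
            + (1 + besovNorm τ α p q X + besovNorm τ α p q Xt) * besovNorm τ α p q (X - Xt)
            + besovNorm τ (2 * α) (p / 2) (q / 2) (XX - XXt)) ∧
        besovNorm τ (2 * α) (p / 2) (q / 2) (remainder X Y Y' - remainder Xt Yt Yt') ≤
          C * ((roughBesovNorm τ α p q X XX ^ 2 + roughBesovNorm τ α p q Xt XXt ^ 2
                + besovNorm τ α p q X * besovNorm τ α p q Xt) * ‖y₀ - yt₀‖ₑ
            + (roughBesovNorm τ α p q X XX + roughBesovNorm τ α p q Xt XXt)
                * besovNorm τ α p q (X - Xt)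
            + besovNorm τ (2 * α) (p / 2) (q / 2) (XX - XXt))) := by
  have hα0 : 0 < α := by linarith
  have hq0 : q ≠ 0 := ne_of_gt (lt_of_lt_of_le (by simp) hq)
  -- `ρ` is an admissible variation exponent in the sense of the statement; `r < ρ` is the exponent
  -- with which the controls are built, strictly below `p`.
  obtain ⟨ρ, hρ2, hρ3, hαρ, hρp⟩ := exists_variation_exponent hα hαp hp
  obtain ⟨r, hrρ, h⟩ := exists_isBesovExponent hα0 hp hq0 hαρ hρp
  have hr3 := hrρ.trans hρ3
  obtain ⟨μ, hμ, hφμ⟩ := exists_eulerBound (F := F) ι Φ₀ Φ₀₁ Φ₁ Φ₁₁ Φ₂ Φ₂₁ ΦDD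
  obtain ⟨B₁, ε₁, hε₁, hex⟩ := exists_existence_estimate (F := F) ι hι h hr3 hμ
  obtain ⟨C, B₂, ε₂, hε₂, hlip⟩ := exists_lipschitz_estimate (F := F) ι hι h hr3 hμ
  -- `C` is fixed before `T` and `M`; these enter only the choice of the time.
  refine ⟨C, fun T hT M => ?_⟩
  obtain ⟨T₁, hT₁, hT₁T, h₁⟩ := exists_time_le h.rate_pos hε₁ hT (B₁ * M)
  obtain ⟨T₂, hT₂, -, h₂⟩ := exists_time_le h.rate_pos hε₂ hT (B₂ * M)
  refine ⟨min T₁ T₂, lt_min hT₁ hT₂, (min_le_left _ _).trans hT₁T, fun φ hφ τ hτ hτT => ?_⟩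
  have hτ₁ := hτT.trans (min_le_left _ _)
  have hτ₂ := hτT.trans (min_le_right _ _)
  have hτT := hτ₁.trans hT₁T
  have hφ := hφμ φ hφ
  have hM' : ∀ (X : ℝ → ℝ → E) (XX : ℝ → ℝ → V), roughBesovNorm T α p q X XX ≤ M →
      roughBesovNorm τ α p q X XX ≤ M := fun X XX => (roughBesovNorm_mono_right hτT X XX).trans
  refine ⟨fun X XX hX hM y₀ => ?_, fun X Xt XX XXt hX hXt hM hMt y₀ yt₀ Y Yt Y' Yt' hYc hY hYtc
    hYt => hlip hτ hφ (hX.restrict hτT) (hXt.restrict hτT) (hM' _ _ hM) (hM' _ _ hMt) hYc hY hYtc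
      hYt (h₂ τ hτ hτ₂).1 (h₂ τ hτ hτ₂).2⟩
  have hX := hX.restrict hτT
  have hctrl : ∀ (Z : ℝ → F) (Z' : ℝ → E →L[ℝ] F), IsBesovControlled τ α p q X Z Z' →
      ∀ σ : ℝ, 1 / α < σ → ENNReal.ofReal σ ≤ p → IsControlled τ σ X Z Z' := by
    intro Z Z' hZ σ hασ hσp
    obtain ⟨r', hr', h'⟩ := exists_isBesovExponent hα0 hp hq0 hασ hσp
    exact hZ.isControlled h' hτ hX hr'.le
  obtain ⟨Y, hYc, hY⟩ := hex hτ hφ hX (hM' _ _ hM) (h₁ τ hτ hτ₁).2 y₀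
  refine ⟨Y, _, hYc, fun σ _ _ h1 h2 => hctrl _ _ hYc σ h1 h2, hY, fun Z Z' hZc hZ => ?_⟩
  -- Besov-controlled competitors are also controlled in the sense of variation, with exponent `ρ`;
  -- it remains to treat a competitor with some exponent `σ < 3`, for which a new exponent `r' < σ`
  -- is taken.
  obtain ⟨σ, hσ3, hασ, hσp, hZσ⟩ : ∃ σ < 3, 1 / α < σ ∧ ENNReal.ofReal σ ≤ p ∧
      IsControlled τ σ X Z Z' := by
    rcases hZc with hZc | ⟨σ, -, h3, hασ, hσp, hZσ⟩
    · exact ⟨ρ, hρ3, hαρ, hρp, hctrl _ _ hZc ρ hαρ hρp⟩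
    · exact ⟨σ, h3, hασ, hσp, hZσ⟩
  obtain ⟨r', hr', h'⟩ := exists_isBesovExponent hα0 hp hq0 hασ hσp
  exact SolvesRDE.eqOn_of_isControlled hι h' hr'.le hσ3 hτ hX hφ (hctrl _ _ hYc σ hασ hσp) hY hZσ hZ
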